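/- **Setting.** Let $1\le k<n\le N$, let $\Omega\subset\mathbb R^N$ be open and let $\Sigma_n\subset\Omega$ be a relatively closed smooth embedded $n$-dimensional submanifold with the induced metric. Let $\Sigma_k\subset\Sigma_{k+1}\subset\dots\subset\Sigma_n$ be relatively closed subsets of $\Omega$. The regular set $\mathcal R_j$ consists of the points of $\Sigma_j$ near which each $\Sigma_i$, $j\le i\le n$, is a smooth embedded $i$-dimensional submanifold of $\mathbb R^N$. On $\mathcal R_j$, $g_j$ is the induced metric, $\nabla_j$ its gradient and $R_j$ its scalar curvature; $\mu_j$ is $j$-dimensional Hausdorff measure. Let $\nu_j$ ($k\le j<n$) be a smooth unit normal field on $\mathcal R_j$ of $\Sigma_j$ in $\Sigma_{j+1}$. Let $u_n=1$, let $u_j$ ($k\le j<n$) be functions on $\Sigma_j$, smooth and positive on $\mathcal R_j$, let $\lambda_j\ge 0$ be real numbers, and put $\rho_j=u_ju_{j+1}\cdots u_n$. With $S^1$ the circle of length $1$, let $$\hat g_j=g_j+\sum_{p=j}^{n-1}u_p^2\,dt_p^2\quad\text{on }\mathcal R_j\times (S^1)^{n-j},$$ with scalar curvature $\hat R_j$,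 and let $\tilde A_j$ be the second fundamental form of $\Sigma_j\times(S^1)^{n-j-1}$ in $(\Sigma_{j+1}\times (S^1)^{n-j-1},\hat g_{j+1})$ for $j<n$, its length being taken in the metric induced by $\hat g_{j+1}$; put $\tilde A_n=0$. These data form a *minimal $k$-slicing* if for each $j=k,\dots,n-1$: 1. $\Sigma_j$ minimizes the weighted volume $V_{\rho_{j+1}}(\Sigma)=\int_\Sigma\rho_{j+1}\,d\mu_j$ in $\Sigma_{j+1}$, at least against its deformations: the weighted volume is not decreased by any smooth isotopy of diffeomorphisms of $\mathbb R^N$ starting at the identity that preserves $\Sigma_{j+1}$ and is supported in a compact set $K\subset\Omega$ with $K\cap\Sigma_{j+1}\subset\mathcal R_{j+1}$ (volumes being compared inside $K$). 2. $u_j$ is a lowest eigenfunction, with eigenvalue $\lambda_j$, of the quadratic form $$Q_j(\varphi,\varphi)=S_j(\varphi,\varphi)+\frac38\int_{\Sigma_j}\Big(|\tilde A_j|^2+\frac1{3n}\sum_{p=j+1}^n\big(|\nabla_j\log u_p|^2+|\tilde A_p|^2\big)\Big)\varphi^2\rho_{j+1}\,d\mu_j,$$ where $S_j(\varphi,\varphi)$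 is the second variation of $V_{\rho_{j+1}}$ at $\Sigma_j$ in the direction $\varphi\nu_j$. That is, $Q_j(u_j,\varphi)=\lambda_j\int_{\Sigma_j} u_j\varphi\,\rho_{j+1}\,d\mu_j$ and $Q_j(\varphi,\varphi)\ge\lambda_j\int_{\Sigma_j}\varphi^2\rho_{j+1}\,d\mu_j$ for all smooth $\varphi$ with compact support in $\mathcal R_j$. **Theorem 2.6.** Suppose that $R_n\ge\kappa$ on $\Sigma_n$ for a constant $\kappa$. For every minimal $k$-slicing, at every point of $\mathcal R_k$, $$\hat R_k=R_n+2\sum_{p=k}^{n-1}\lambda_p+\frac14\sum_{p=k}^{n-1}\Big(|\tilde A_p|^2-\frac1n\sum_{q=p+1}^n\big(|\nabla_p\log u_q|^2+|\tilde A_q|^2\big)\Big),$$ and for every smooth function $\varphi$ with compact support in $\mathcal R_k$, both of the following integrals converge and $$\int_{\Sigma_k}\Big(\kappa+\frac34\sum_{j=k+1}^n|\nabla_k\log u_j|^2-R_k\Big)\varphi^2\,d\mu_k\le 4\int_{\Sigma_k}|\nabla_k\varphi|^2\,d\mu_k .$$ -/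

import Mathlib

open MeasureTheory
open scoped ContDiff

noncomputable section

/-! ## Riemannian metrics in coordinates

A metric on an open set of `ι → ℝ` is given by its matrix of components `g_{ab}`. -/

/-- The partial derivative `∂_i f` at `y`. -/
def partialD {ι : Type} [Fintype ι] [DecidableEq ι]
    (i : ι) (f : (ι → ℝ) → ℝ) (y : ι → ℝ) : ℝ :=
  fderiv ℝ f y (Pi.single i 1)

/-- The Christoffel symbol `Γ^c_{ab}` of the Levi-Civita connection of `g`. -/
def christoffel {ι : Type} [Fintype ι] [DecidableEq ι]
    (g : (ι → ℝ) → Matrix ι ι ℝ) (c a b : ι) (y : ι → ℝ) : ℝ :=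
  (1 / 2) * ∑ l, (g y)⁻¹ c l *
    (partialD a (fun z => g z b l) y + partialD b (fun z => g z a l) y
      - partialD l (fun z => g z a b) y)

/-- The Ricci curvature `R_{ab}`, with the sign for which round spheres are positive. -/
def ricciCurvature {ι : Type} [Fintype ι] [DecidableEq ι]
    (g : (ι → ℝ) → Matrix ι ι ℝ) (a b : ι) (y : ι → ℝ) : ℝ :=
  ∑ c, (partialD c (christoffel g c a b) y - partialD b (christoffel g c a c) y
    + ∑ l, (christoffel g c c l y * christoffel g l a b y
      - christoffel g c b l y * christoffel g l a c y))

/-- The scalar curvature `g^{ab} R_{ab}`. -/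
def scalarCurvature {ι : Type} [Fintype ι] [DecidableEq ι]
    (g : (ι → ℝ) → Matrix ι ι ℝ) (y : ι → ℝ) : ℝ :=
  ∑ a, ∑ b, (g y)⁻¹ a b * ricciCurvature g a b y

/-- The component `A(∂_a, ∂_b) = g(∇_{∂_a} ∂_b, ν)` of the second fundamental form of a coordinate
hypersurface. The map `emb` lists the coordinates of the ambient space that are coordinates
of the hypersurface (the remaining one vanishes on it), and `ν` is a unit normal vector. -/
def secondFund {α β : Type} [Fintype β] [DecidableEq β]
    (g : (β → ℝ) → Matrix β β ℝ) (emb : α → β) (ν : β → ℝ) (z : β → ℝ) (a b : α) : ℝ :=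
  ∑ c, ∑ l, christoffel g c (emb a) (emb b) z * g z c l * ν l

/-- The square length `|A|² = h^{aa'} h^{bb'} A_{ab} A_{a'b'}` of the second fundamental form,
`h` being the induced metric. -/
def secondFundNormSq {α β : Type} [Fintype α] [DecidableEq α] [Fintype β] [DecidableEq β]
    (g : (β → ℝ) → Matrix β β ℝ) (emb : α → β) (ν : β → ℝ) (z : β → ℝ) : ℝ :=
  let h : Matrix α α ℝ := (g z).submatrix emb emb
  ∑ a, ∑ b, ∑ a', ∑ b', h⁻¹ a a' * h⁻¹ b b' * secondFund g emb ν z a b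
    * secondFund g emb ν z a' b'

/-! ## Submanifolds of Euclidean space -/

/-- The Euclidean space `ℝ^N`. -/
abbrev Amb (N : ℕ) : Type := EuclideanSpace ℝ (Fin N)

/-- `e` is a smooth coordinate system of `ℝ^N` in whose domain each of the sets `S j`, `j ∈ I`, is
the coordinate plane of dimension `j` on which all coordinates but the first `j` vanish. -/
structure Flattens {N : ℕ} (S : ℕ → Set (Amb N)) (I : Set ℕ)
    (e : OpenPartialHomeomorph (Amb N) (Amb N)) : Prop where
  smooth : ContDiffOn ℝ ∞ e e.source
  smooth_symm : ContDiffOn ℝ ∞ e.symm e.target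
  flat : ∀ j ∈ I, ∀ y ∈ e.source, y ∈ S j ↔ ∀ i : Fin N, j ≤ i.1 → e y i = 0

/-- Near `x`, the set `S` is a smooth embedded submanifold (without boundary) of dimension `d`. -/
def IsSubmanifoldAt {N : ℕ} (d : ℕ) (S : Set (Amb N)) (x : Amb N) : Prop :=
  ∃ e : OpenPartialHomeomorph (Amb N) (Amb N), x ∈ e.source ∧ Flattens (fun _ => S) {d} e

/-- The tangent space of `S` at `x`. -/
def tangentSpan {N : ℕ} (S : Set (Amb N)) (x : Amb N) : Submodule ℝ (Amb N) :=
  Submodule.span ℝ (tangentConeAt ℝ S x)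

/-- `|∇_S f|²` at `x`: the square of the length of the differential of `f|_S` on the tangent
space of `S` at `x`, with the metric induced from `ℝ^N`. -/
def gradSq {N : ℕ} (S : Set (Amb N)) (f : Amb N → ℝ) (x : Amb N) : ℝ :=
  ‖(fderivWithin ℝ f S x).comp (tangentSpan S x).subtypeL‖ ^ 2

/-- The first `j` coordinates of a vector. -/
def headCoords {N : ℕ} (j : ℕ) (v : Amb N) : Fin j → ℝ :=
  fun i => if h : i.1 < N then v ⟨i.1, h⟩ else 0

/-- The vector whose first `j` coordinates are given and whose other coordinates vanish. -/
def padCoords {N : ℕ} (j : ℕ) (y : Fin j → ℝ) : Amb N :=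
  WithLp.toLp 2 (fun i : Fin N => if h : i.1 < j then y ⟨i.1, h⟩ else 0)

/-- The parametrization of the `j`-dimensional submanifold flattened by `e`. -/
def planeParam {N : ℕ} (e : OpenPartialHomeomorph (Amb N) (Amb N)) (j : ℕ) :
    (Fin j → ℝ) → Amb N :=
  fun y => e.symm (padCoords j y)

/-- The metric induced from `ℝ^N` by a parametrization. -/
def inducedMetric {N j : ℕ} (ψ : (Fin j → ℝ) → Amb N) (y : Fin j → ℝ) :
    Matrix (Fin j) (Fin j) ℝ :=
  Matrix.of fun a b =>
    inner ℝ (fderiv ℝ ψ y (Pi.single a 1)) (fderiv ℝ ψ y (Pi.single b 1))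

/-! ## Slicings -/

/-- The data of a slicing of an `n`-dimensional submanifold of `ℝ^N`: the leaves `Σ_j`, the
functions `u_j` on `Σ_j`, the numbers `λ_j`, and the normals `ν_j` of `Σ_j` in `Σ_{j+1}`.
Only the values of `u_j` and `ν_j` on the regular set of `Σ_j` matter. -/
structure Slicing (N n : ℕ) where
  leaf : ℕ → Set (Amb N)
  u : ℕ → Amb N → ℝ
  lam : ℕ → ℝ
  nu : ℕ → Amb N → Amb N

namespace Slicing

/-- The regular set `R_j`: the points of `Σ_j` near which all of `Σ_j, …, Σ_n` are smooth embedded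
submanifolds, of their respective dimensions. -/
def reg {N n : ℕ} (S : Slicing N n) (j : ℕ) : Set (Amb N) :=
  {x | x ∈ S.leaf j ∧ ∀ i ∈ Set.Icc j n, IsSubmanifoldAt i (S.leaf i) x}

/-- The weight `ρ_j = u_j u_{j+1} ⋯ u_n`. -/
def rho {N n : ℕ} (S : Slicing N n) (j : ℕ) (x : Amb N) : ℝ :=
  ∏ p ∈ Finset.Icc j n, S.u p x

open Classical in
/-- Coordinates near `x` that flatten all of `Σ_j, …, Σ_n` (they exist near the points of `R_j`). -/
def chart {N n : ℕ} (S : Slicing N n) (j : ℕ) (x : Amb N) :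
    OpenPartialHomeomorph (Amb N) (Amb N) :=
  if h : ∃ e : OpenPartialHomeomorph (Amb N) (Amb N),
      x ∈ e.source ∧ Flattens S.leaf (Set.Icc j n) e
  then h.choose else OpenPartialHomeomorph.refl _

/-- The metric `g_j + ∑_{p=m}^{n-1} u_p² dt_p²` on `Σ_j × (S¹)^{n-m}`, in the coordinates `(y, t)`
where `y` are the coordinates of `Σ_j` given by `e`. Its components do not depend on `t`. -/
def warpedMetric {N n : ℕ} (S : Slicing N n) (e : OpenPartialHomeomorph (Amb N) (Amb N))
    (j m : ℕ) (z : (Fin j ⊕ Finset.Ico m n) → ℝ) :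
    Matrix (Fin j ⊕ Finset.Ico m n) (Fin j ⊕ Finset.Ico m n) ℝ :=
  let y : Fin j → ℝ := fun i => z (Sum.inl i)
  Matrix.fromBlocks (inducedMetric (planeParam e j) y) 0 0
    (Matrix.diagonal fun p => S.u p.1 (planeParam e j y) ^ 2)

/-- The scalar curvature `R_j` of the induced metric `g_j` of `Σ_j`. -/
def scal {N n : ℕ} (S : Slicing N n) (j : ℕ) (x : Amb N) : ℝ :=
  let e := S.chart j x
  scalarCurvature (inducedMetric (planeParam e j)) (headCoords j (e x))

/-- The scalar curvature of `ĝ_j = g_j + ∑_{p=j}^{n-1} u_p² dt_p²` on `Σ_j × (S¹)^{n-j}`; it does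
not depend on the point of the torus, which is taken to be `0`. -/
def scalHat {N n : ℕ} (S : Slicing N n) (j : ℕ) (x : Amb N) : ℝ :=
  let e := S.chart j x
  scalarCurvature (S.warpedMetric e j j) (Sum.elim (headCoords j (e x)) 0)

/-- `|Ã_p|²`, the square length of the second fundamental form of `Σ_p × (S¹)^{n-p-1}` in
`Σ_{p+1} × (S¹)^{n-p-1}` with the metric `ĝ_{p+1}`, for `p < n`; by convention `Ã_n = 0`. -/
def tildeASq {N n : ℕ} (S : Slicing N n) (p : ℕ) (x : Amb N) : ℝ :=
  if p < n then
    let e := S.chart p x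
    secondFundNormSq (S.warpedMetric e (p + 1) (p + 1))
      (Sum.map Fin.castSucc id : (Fin p ⊕ Finset.Ico (p + 1) n) → _)
      (Sum.elim (headCoords (p + 1) (fderiv ℝ e x (S.nu p x))) 0)
      (Sum.elim (headCoords (p + 1) (e x)) 0)
  else 0

/-- `|∇_p log u_q|²` on `Σ_p`. -/
def gradLogSq {N n : ℕ} (S : Slicing N n) (p q : ℕ) (x : Amb N) : ℝ :=
  gradSq (S.leaf p) (fun y => Real.log (S.u q y)) x

/-- Smooth functions with compact support in the regular set `R_j`. -/
def IsTest {N n : ℕ} (S : Slicing N n) (j : ℕ) (φ : Amb N → ℝ) : Prop :=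
  ContDiffOn ℝ ∞ φ (S.reg j) ∧
    ∃ K : Set (Amb N), IsCompact K ∧ K ⊆ S.reg j ∧ ∀ x ∈ S.leaf j \ K, φ x = 0

/-- `F` is a smooth isotopy of diffeomorphisms, starting at the identity and supported in the
compact set `K ⊆ Ω`, that maps the ambient leaf `Σ_{j+1}` onto itself; near the support, `Σ_{j+1}`
is regular. -/
structure IsDeformation {N n : ℕ} (S : Slicing N n) (Ω : Set (Amb N)) (j : ℕ)
    (F : ℝ → Amb N → Amb N) (K : Set (Amb N)) : Prop where
  compact : IsCompact K
  subset : K ⊆ Ω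
  regular : K ∩ S.leaf (j + 1) ⊆ S.reg (j + 1)
  smooth : ContDiff ℝ ∞ (fun p : ℝ × Amb N => F p.1 p.2)
  zero : ∀ x, F 0 x = x
  bij : ∀ s, Function.Bijective (F s)
  bij_fderiv : ∀ s x, Function.Bijective (fderiv ℝ (F s) x)
  preserves : ∀ s, F s '' S.leaf (j + 1) = S.leaf (j + 1)
  off : ∀ s, ∀ x ∉ K, F s x = x

/-- `Σ_j` minimizes the `ρ_{j+1}`-weighted volume in `Σ_{j+1}`: compactly supported deformations
do not decrease it. (Inside `K` only, because the total volume may be infinite.) -/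
def MinimizesVolume {N n : ℕ} (S : Slicing N n) (Ω : Set (Amb N)) (j : ℕ) : Prop :=
  ∀ F K, S.IsDeformation Ω j F K →
    ∫⁻ x in S.leaf j ∩ K, ENNReal.ofReal (S.rho (j + 1) x) ∂μHE[j] ≤
      ∫⁻ x in F 1 '' S.leaf j ∩ K, ENNReal.ofReal (S.rho (j + 1) x) ∂μHE[j]

/-- `F` is a deformation, supported near regular points of `Σ_j`, with initial velocity `φ ν_j`
along `Σ_j`. -/
def IsNormalVariation {N n : ℕ} (S : Slicing N n) (Ω : Set (Amb N)) (j : ℕ) (φ : Amb N → ℝ)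
    (F : ℝ → Amb N → Amb N) (K : Set (Amb N)) : Prop :=
  S.IsDeformation Ω j F K ∧ K ∩ S.leaf j ⊆ S.reg j ∧
    ∀ x ∈ S.reg j, deriv (fun s => F s x) 0 = φ x • S.nu j x

/-- The `ρ_{j+1}`-weighted volume of `F_s(Σ_j ∩ K)`. -/
def volumeAlong {N n : ℕ} (S : Slicing N n) (j : ℕ)
    (F : ℝ → Amb N → Amb N) (K : Set (Amb N)) (s : ℝ) : ℝ :=
  ∫ x in F s '' (S.leaf j ∩ K), S.rho (j + 1) x ∂μHE[j]

open Classical in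
/-- The second variation `S_j(φ, φ)` of the `ρ_{j+1}`-weighted volume at `Σ_j`: the second
derivative of the weighted volume along a deformation with initial velocity `φ ν_j`. (At a
minimizer it does not depend on the deformation.) -/
def secondVariation {N n : ℕ} (S : Slicing N n) (Ω : Set (Amb N)) (j : ℕ)
    (φ : Amb N → ℝ) : ℝ :=
  if h : ∃ d : (ℝ → Amb N → Amb N) × Set (Amb N), S.IsNormalVariation Ω j φ d.1 d.2
  then iteratedDeriv 2 (S.volumeAlong j h.choose.1 h.choose.2) 0 else 0

/-- The quadratic form `Q_j(φ, φ)`, for `φ` supported in the regular set. -/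
def Q {N n : ℕ} (S : Slicing N n) (Ω : Set (Amb N)) (j : ℕ) (φ : Amb N → ℝ) : ℝ :=
  S.secondVariation Ω j φ + (3 / 8) * ∫ x in S.reg j,
    (S.tildeASq j x + 1 / (3 * (n : ℝ)) *
      ∑ p ∈ Finset.Ioc j n, (S.gradLogSq j p x + S.tildeASq p x))
      * φ x ^ 2 * S.rho (j + 1) x ∂μHE[j]

/-- The bilinear form `Q_j(φ, ψ)`. -/
def Qbil {N n : ℕ} (S : Slicing N n) (Ω : Set (Amb N)) (j : ℕ) (φ ψ : Amb N → ℝ) : ℝ :=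
  (S.Q Ω j (φ + ψ) - S.Q Ω j (φ - ψ)) / 4

/-- The inner product of `L²(Σ_j, ρ_{j+1} μ_j)`. -/
def innerL2 {N n : ℕ} (S : Slicing N n) (j : ℕ) (φ ψ : Amb N → ℝ) : ℝ :=
  ∫ x in S.reg j, φ x * ψ x * S.rho (j + 1) x ∂μHE[j]

/-- `u_j` is a positive lowest eigenfunction of `Q_j` with eigenvalue `λ_j ≥ 0`. The equation
`Q_j(u_j, φ) = λ_j ⟨u_j, φ⟩` is tested against `φ` with compact support `K` in the regular set; as
`Q_j` is local, `Q_j(u_j, φ)` means `Q_j(ψ, φ)` for any test function `ψ` equal to `u_j`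
near `K`. -/
structure IsLowestEigenfunction {N n : ℕ} (S : Slicing N n) (Ω : Set (Amb N)) (j : ℕ) :
    Prop where
  smooth : ContDiffOn ℝ ∞ (S.u j) (S.reg j)
  pos : ∀ x ∈ S.reg j, 0 < S.u j x
  lam_nonneg : 0 ≤ S.lam j
  lowest : ∀ φ, S.IsTest j φ → S.lam j * S.innerL2 j φ φ ≤ S.Q Ω j φ
  equation : ∀ (φ ψ : Amb N → ℝ) (K U : Set (Amb N)), S.IsTest j φ → S.IsTest j ψ →
    IsCompact K → K ⊆ S.reg j → (∀ x ∈ S.leaf j \ K, φ x = 0) →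
    IsOpen U → K ⊆ U → (∀ x ∈ S.reg j ∩ U, ψ x = S.u j x) →
    S.Qbil Ω j ψ φ = S.lam j * S.innerL2 j (S.u j) φ

/-- `S` is a minimal `k`-slicing `Σ_k ⊆ Σ_{k+1} ⊆ ⋯ ⊆ Σ_n` in the open set `Ω ⊆ ℝ^N`. -/
structure IsMinimal {N n : ℕ} (S : Slicing N n) (Ω : Set (Amb N)) (k : ℕ) : Prop where
  isOpen : IsOpen Ω
  dim_le : n ≤ N
  /-- every leaf is a relatively closed subset of `Ω` -/
  leaf_closed : ∀ j ∈ Set.Icc k n, ∃ C, IsClosed C ∧ S.leaf j = Ω ∩ C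
  /-- the top leaf is a smooth submanifold -/
  top_smooth : ∀ x ∈ S.leaf n, IsSubmanifoldAt n (S.leaf n) x
  u_top : ∀ x ∈ S.leaf n, S.u n x = 1
  nested : ∀ j ∈ Set.Ico k n, S.leaf j ⊆ S.leaf (j + 1)
  nu_smooth : ∀ j ∈ Set.Ico k n, ContDiffOn ℝ ∞ (S.nu j) (S.reg j)
  nu_unit : ∀ j ∈ Set.Ico k n, ∀ x ∈ S.reg j, ‖S.nu j x‖ = 1
  nu_tangent : ∀ j ∈ Set.Ico k n, ∀ x ∈ S.reg j, S.nu j x ∈ tangentSpan (S.leaf (j + 1)) x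
  nu_normal : ∀ j ∈ Set.Ico k n, ∀ x ∈ S.reg j, S.nu j x ∈ (tangentSpan (S.leaf j) x)ᗮ
  minimizes : ∀ j ∈ Set.Ico k n, S.MinimizesVolume Ω j
  eigenfunction : ∀ j ∈ Set.Ico k n, S.IsLowestEigenfunction Ω j

end Slicing

end

noncomputable section

set_option linter.unusedSectionVars false
open Set Filter Topology
open Finset (sum_congr sum_comm mul_sum sum_mul sum_add_distrib sum_sub_distrib sum_neg_distrib sum_const_zero sum_ite_eq' sum_ite_eq univ_sum_single sum_nonneg sum_eq_zero sum_insert sum_eq_sum_Ico_succ_bot)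
open Sum (inl inr)
open Real (exp log)
open Function (Injective Bijective)
open Pi (single)
open Fin (castSucc last)
open Matrix (of_apply of mul_nonsing_inv nonsing_inv_mul fromBlocks diagonal diagonal_apply transpose_apply diag_apply trace trace_mul_comm submatrix_apply fromBlocks_apply₂₂ fromBlocks_apply₁₁)

/-! The weighted volume of `Σ_j` with weight `ρ_{j+1} = u_{j+1} ⋯ u_n` is the ordinary volume of
`Σ_j × (S¹)^{n-j-1}` in the warped product `ĝ_{j+1}`. So all variation formulas are derived for
unweighted hypersurfaces and then applied to the warped metrics; `sqrt_det_pullGram_liftVar` is the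
bridge.

Curvature formula. A minimal hypersurface satisfies `Ric(ν,ν) + |A|² = ½ (R - R_Σ + |A|²)`. Let
`R̃_j` be the scalar curvature of `g_j + ∑_{p>j} u_p² dt_p²` (this is `scalMid`). Then `S_j(φ,φ)` is
the integral of `(|∇φ|² - ½ (R̂_{j+1} - R̃_j + |Ã_j|²) φ²) ρ_{j+1}`, which is `secondVariation_eq`.
Write `w_q = log u_q` and let `P_j` be the zeroth order coefficient of `Q_j`. The eigenfunction
equation becomes `Δw_j + ∑_{q≥j} ⟨∇w_q, ∇w_j⟩ = P_j - λ_j` (`laplace_logU_eq`). By the scalar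
curvature formula for warped products (`scalarCurvature_warpOf`), adding the circle of length `u_j`
changes the scalar curvature by `-2` times the left side. Hence `R̃_j` cancels, the coefficient of
`|Ã_j|²` becomes `1 - 3/4 = 1/4`, and `R̂_j` is expressed through `R̂_{j+1}` (`scalHat_eq_succ`).
Summing down from `R̂_n = R_n` gives the first claim.

Integral inequality. The principal curvatures of `Σ_r × torus` along the fibres are, up to sign, the
normal derivatives of `log u_q`. Therefore `|Ã_r|²` bounds `∑_q (|∇_{r+1} log u_q|² - |∇_r log
u_q|²)` (`sum_gradLogSq_sub_le`). Telescoping this, and using that there are `n - k ≤ n` summands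
with the factor `1/n`, shows that the error term in the curvature formula is at least `-¼ ∑_q |∇_k
log u_q|²` (`sum_sub_sum_div_ge`). Since `λ_p ≥ 0`, `R̂_k ≥ κ - ¼ ∑ |∇_k log u_q|²`. With `W =
∑_{p≥k} log u_p`, the warped product formula for `R̂_k` gives `κ + ¾ ∑ |∇_k log u_q|² - R_k ≤ -2ΔW -
|∇W|²` (`scal_bound`). Multiplying by `φ²`, completing the square `|2∇φ - φ∇W|² ≥ 0` and discarding
the divergence of `φ²∇W` finishes the proof.

Much of the work makes this precise for the given definitions. Curvatures are defined in chosen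
charts, so they must be shown invariant under coordinate changes. Charts flattening all leaves at
once must be built, and among them Fermi charts, in which `ν_j` is a coordinate field whose lines
have acceleration normal to `Σ_{j+1}` at points of `Σ_j`. The second variation is defined through a
chosen deformation, so enough deformations must be constructed, and the formula must be shown not to
depend on their acceleration: the normal part of the acceleration meets the mean curvature, which is
zero, and the tangential part gives a divergence. Integrals over leaves are taken with Hausdorff
measure and are brought into charts by the area formula and partitions of unity. -/

theorem ContDiffAt.diffAt {V W : Type*} [NormedAddCommGroup V] [NormedSpace ℝ V] [NormedAddCommGroup W]
    [NormedSpace ℝ W] {f : V → W} {x : V} {n : WithTop ℕ∞} (h : ContDiffAt ℝ n f x) (hn : n ≠ 0 := by simp) :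
    DifferentiableAt ℝ f x := h.differentiableAt hn

theorem ContDiffAt.smooth_fderiv {V W : Type*} [NormedAddCommGroup V] [NormedSpace ℝ V] [NormedAddCommGroup W]
    [NormedSpace ℝ W] {f : V → W} {x : V} (h : ContDiffAt ℝ ∞ f x) : ContDiffAt ℝ ∞ (fderiv ℝ f) x :=
  h.fderiv_right (by simp)

/-- Coordinate systems of open subsets of `ℝ^N`. -/
abbrev Chart (N : ℕ) : Type := OpenPartialHomeomorph (Amb N) (Amb N)

/-! ## The area formula for smooth parametrizations -/

notation:max "D" => fderiv ℝ
notation:max "SmoothAt" => ContDiffAt ℝ ∞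
notation:max "DiffAt" => DifferentiableAt ℝ

section AreaFormula

open scoped NNReal ENNReal

/-- A map that expands distances at most `K` times as much as `T` does expands Hausdorff measure at
most `K ^ d` times as much. -/
theorem euclideanHausdorffMeasure_image_le_of_edist_le {X Y Z : Type*} [EMetricSpace Y]
    [MeasurableSpace Y] [BorelSpace Y] [EMetricSpace Z] [MeasurableSpace Z] [BorelSpace Z]
    (d : ℕ) {f : X → Y} {T : X → Z} {S : Set X} {K : ℝ≥0}
    (h : ∀ x ∈ S, ∀ y ∈ S, edist (f x) (f y) ≤ K * edist (T x) (T y)) :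
    (μHE[d] : Measure Y) (f '' S) ≤ (K : ℝ≥0∞) ^ d * (μHE[d] : Measure Z) (T '' S) := by
  rcases S.eq_empty_or_nonempty with rfl | ⟨x0, hx0⟩
  · simp
  have : Nonempty X := ⟨x0⟩
  have hinv : ∀ z ∈ T '' S, Function.invFunOn T S z ∈ S ∧ T (Function.invFunOn T S z) = z :=
    fun z hz => ⟨Function.invFunOn_mem hz, Function.invFunOn_eq hz⟩
  -- `T` need not be injective on `S`, but the hypothesis makes equal values of `T` give equal
  -- values of `f`. So on `S` the map `f` factors through `T`, and the factor is Lipschitz with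
  -- constant `K`.
  have hlip : LipschitzOnWith K (f ∘ Function.invFunOn T S) (T '' S) := by
    intro a ha b hb
    have := h _ (hinv a ha).1 _ (hinv b hb).1
    rwa [(hinv a ha).2, (hinv b hb).2] at this
  have himg : f '' S = (f ∘ Function.invFunOn T S) '' (T '' S) := by
    rw [image_image]
    refine image_congr fun x hx => ?_
    have h1 := hinv (T x) (mem_image_of_mem _ hx)
    have h2 := h x hx _ h1.1
    rw [h1.2, edist_self, mul_zero, nonpos_iff_eq_zero, edist_eq_zero] at h2
    exact h2
  have := hlip.hausdorffMeasure_image_le (d := (d : ℝ)) (by positivity)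
  rw [himg, Measure.euclideanHausdorffMeasure_def, Measure.euclideanHausdorffMeasure_def,
    Measure.smul_apply, Measure.smul_apply, mul_smul_comm]
  rw [ENNReal.rpow_natCast] at this
  gcongr

variable {m : ℕ} {F : Type*} [NormedAddCommGroup F] [InnerProductSpace ℝ F]

/-- The Gram matrix of a linear map with respect to the coordinate basis. -/
def gramOf (A : (Fin m → ℝ) →L[ℝ] F) : Matrix (Fin m) (Fin m) ℝ :=
  of fun a b => inner ℝ (A (single a 1)) (A (single b 1))

/-- An injective linear map from `ℝ^m` agrees up to an isometry with an automorphism of `ℝ^m`. -/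
theorem exists_linear_isometric_model (A : (Fin m → ℝ) →L[ℝ] F) (hA : Injective A) :
    ∃ T : (Fin m → ℝ) →L[ℝ] EuclideanSpace ℝ (Fin m), (∀ v, ‖T v‖ = ‖A v‖) ∧
      ∀ S : Set (Fin m → ℝ), (μHE[m] : Measure (EuclideanSpace ℝ (Fin m))) (T '' S) =
        ENNReal.ofReal (√(gramOf A).det) * volume S := by
  have hfr : Module.finrank ℝ (LinearMap.range (A : (Fin m → ℝ) →ₗ[ℝ] F)) = m := by
    rw [LinearMap.finrank_range_of_inj hA]; simp
  -- The model `T0` is `A` followed by the coordinates of an orthonormal basis of its range, so it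
  -- has the same inner products as `A`.
  let b := (stdOrthonormalBasis ℝ (LinearMap.range (A : (Fin m → ℝ) →ₗ[ℝ] F))).reindex (finCongr hfr)
  let T0 : (Fin m → ℝ) →ₗ[ℝ] EuclideanSpace ℝ (Fin m) :=
    b.repr.toLinearEquiv.toLinearMap ∘ₗ (A : (Fin m → ℝ) →ₗ[ℝ] F).rangeRestrict
  have hinner : ∀ v w, inner ℝ (T0 v) (T0 w) = inner ℝ (A v) (A w) := by
    intro v w
    change inner ℝ (b.repr _) (b.repr _) = _
    rw [b.repr.inner_map_map]
    rfl
  refine ⟨LinearMap.toContinuousLinearMap T0, ?_, ?_⟩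
  · intro v
    rw [@norm_eq_sqrt_real_inner _ _ _ (A v), @norm_eq_sqrt_real_inner _ _ _ _]
    exact congrArg _ (hinner v v)
  intro S
  let L : (Fin m → ℝ) →ₗ[ℝ] (Fin m → ℝ) :=
    (WithLp.linearEquiv 2 ℝ (Fin m → ℝ)).toLinearMap ∘ₗ T0
  have hvol : (μHE[m] : Measure (EuclideanSpace ℝ (Fin m))) (T0 '' S) = volume (L '' S) := by
    rw [EuclideanSpace.euclideanHausdorffMeasure_eq_volume]
    have := (EuclideanSpace.volume_preserving_symm_measurableEquiv_toLp (Fin m)).measure_preimage_equiv (L '' S)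
    rw [← this]
    congr 1
    ext x
    constructor
    · rintro ⟨v, hv, rfl⟩
      exact ⟨v, hv, rfl⟩
    · rintro ⟨v, hv, h⟩
      refine ⟨v, hv, ?_⟩
      exact (WithLp.linearEquiv 2 ℝ (Fin m → ℝ)).injective h
  -- The Gram matrix factors as `Lᵀ L`, so its determinant is `(det L)²`.
  have hdet : |LinearMap.det L| = √(gramOf A).det := by
    rw [← LinearMap.det_toMatrix']
    have : gramOf A = (LinearMap.toMatrix' L).transpose * LinearMap.toMatrix' L := by
      ext i k
      rw [gramOf, of_apply, ← hinner, Matrix.mul_apply, PiLp.inner_apply]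
      refine sum_congr rfl fun l _ => ?_
      simp only [transpose_apply, LinearMap.toMatrix'_apply, RCLike.inner_apply, conj_trivial]
      rw [mul_comm]
      rfl
    rw [this, Matrix.det_mul, Matrix.det_transpose, Real.sqrt_mul_self_eq_abs]
  change (μHE[m] : Measure (EuclideanSpace ℝ (Fin m))) (T0 '' S) = _
  rw [hvol, Measure.addHaar_image_linearMap, hdet]

theorem gramOf_posDef (A : (Fin m → ℝ) →L[ℝ] F) (hA : Injective A) : (gramOf A).PosDef := by
  apply Matrix.posDef_gram_of_linearIndependent (𝕜 := ℝ) (v := fun a => A (single a 1))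
  have h := (Pi.basisFun ℝ (Fin m)).linearIndependent.map' (A : (Fin m → ℝ) →ₗ[ℝ] F) (LinearMap.ker_eq_bot.2 hA)
  have h2 : ⇑(A : (Fin m → ℝ) →ₗ[ℝ] F) ∘ ⇑(Pi.basisFun ℝ (Fin m)) = fun a => A (single a 1) := by
    ext a
    simp
  rwa [h2] at h

/-- The derivative of any map is measurable, so the Jacobian is a measurable density on the whole
space and not only where `ψ` is smooth. -/
theorem measurable_gramOf_fderiv [CompleteSpace F] (ψ : (Fin m → ℝ) → F) :
    Measurable fun z => √(gramOf (D ψ z)).det := by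
  have h2 : Continuous fun A : (Fin m → ℝ) →L[ℝ] F => √(gramOf A).det := by
    refine Real.continuous_sqrt.comp (Continuous.matrix_det ?_)
    refine continuous_matrix fun a b => ?_
    simp only [gramOf, of_apply]
    fun_prop
  exact h2.measurable.comp (measurable_fderiv ℝ ψ)

variable [MeasurableSpace F] [BorelSpace F]

/-- Locally, a smooth parametrization is close to a linear map. -/
theorem exists_nhds_area_bounds {ψ : (Fin m → ℝ) → F} {U : Set (Fin m → ℝ)} (hU : IsOpen U)
    (hψ : ContDiffOn ℝ 1 ψ U) {y : Fin m → ℝ} (hy : y ∈ U)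
    (hinj : Injective (D ψ y)) {K : ℝ≥0} (hK : 1 < K) :
    ∃ V ∈ 𝓝 y, ∃ J₀ : ℝ≥0∞, ∀ S ⊆ V,
      (μHE[m] : Measure F) (ψ '' S) ≤ K ^ m * (J₀ * volume S) ∧
      J₀ * volume S ≤ K ^ m * (μHE[m] : Measure F) (ψ '' S) ∧
      ∀ z ∈ V, J₀ ≤ K * ENNReal.ofReal (√(gramOf (D ψ z)).det) ∧ ENNReal.ofReal (√(gramOf (D ψ z)).det) ≤ K * J₀ := by
  set A := D ψ y
  obtain ⟨T, hT, hTvol⟩ := exists_linear_isometric_model A hinj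
  have hTinj : Injective T := by
    refine (injective_iff_map_eq_zero T).2 fun v hv => ?_
    have := hT v
    rw [hv, norm_zero] at this
    exact (injective_iff_map_eq_zero A).1 hinj v (norm_eq_zero.1 this.symm)
  obtain ⟨C, hC0, hC⟩ := (T : (Fin m → ℝ) →ₗ[ℝ] EuclideanSpace ℝ (Fin m)).exists_antilipschitzWith
    (LinearMap.ker_eq_bot.2 hTinj)
  have hK0 : (0 : ℝ) < K := by positivity
  have hK1 : (1 : ℝ) < K := by exact_mod_cast hK
  -- With `C` the antilipschitz constant of `T`, this makes an error `ε ‖v‖` at most `(1 - 1/K) ‖T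
  -- v‖`.
  set ε : ℝ := (1 - (K : ℝ)⁻¹) / C with hε
  have hinvK : (K : ℝ)⁻¹ < 1 := inv_lt_one_of_one_lt₀ hK1
  have hε0 : 0 < ε := div_pos (by linarith) (by exact_mod_cast hC0)
  -- Strict differentiability compares `ψ` with its linear part at arbitrary pairs of nearby points,
  -- as distance estimates need.
  have hstrict : HasStrictFDerivAt ψ A y :=
    (hψ.contDiffAt (hU.mem_nhds hy)).hasStrictFDerivAt (by norm_num)
  have hev := hstrict.isLittleO.def hε0
  rw [nhds_prod_eq] at hev
  obtain ⟨W, hp, hpp⟩ := (Filter.eventually_prod_self_iff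
    (r := fun a b => ‖ψ a - ψ b - A (a - b)‖ ≤ ε * ‖a - b‖)).1 hev
  have hcont : ContinuousAt (fun z => √(gramOf (D ψ z)).det) y := by
    have h1 : ContinuousAt (D ψ) y :=
      ((hψ.contDiffAt (hU.mem_nhds hy)).continuousAt_fderiv (by norm_num))
    have h2 : Continuous fun A : (Fin m → ℝ) →L[ℝ] F => √(gramOf A).det := by
      refine Real.continuous_sqrt.comp (Continuous.matrix_det ?_)
      refine continuous_matrix fun a b => ?_
      simp only [gramOf, of_apply]
      fun_prop
    exact h2.continuousAt.comp h1
  have hJpos : 0 < √(gramOf A).det := Real.sqrt_pos.2 (gramOf_posDef A hinj).det_pos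
  have hJ1 : ∀ᶠ z in 𝓝 y, √(gramOf A).det < K * √(gramOf (D ψ z)).det := by
    have := (hcont.const_mul (K : ℝ))
    exact this.eventually_const_lt (by change _ < (K : ℝ) * √(gramOf A).det; nlinarith)
  have hJ2 : ∀ᶠ z in 𝓝 y, √(gramOf (D ψ z)).det < K * √(gramOf A).det :=
    hcont.eventually_lt_const (by change √(gramOf A).det < _; nlinarith)
  refine ⟨{z | z ∈ W ∧ √(gramOf A).det < K * √(gramOf (D ψ z)).det ∧ √(gramOf (D ψ z)).det < K * √(gramOf A).det}, ?_,
    ENNReal.ofReal √(gramOf A).det, ?_⟩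
  · filter_upwards [hp, hJ1, hJ2] with z h1 h2 h3 using ⟨h1, h2, h3⟩
  intro S hS
  have hbound : ∀ x ∈ S, ∀ z ∈ S, ‖ψ x - ψ z - A (x - z)‖ ≤ (1 - (K : ℝ)⁻¹) * ‖T (x - z)‖ := by
    intro x hx z hz
    have h1 := hpp _ (hS hx).1 _ (hS hz).1
    have h2 : ‖x - z‖ ≤ C * ‖T (x - z)‖ := by
      have := hC.le_mul_dist (x - z) 0
      simpa [dist_eq_norm] using this
    calc _ ≤ ε * ‖x - z‖ := h1
      _ ≤ ε * (C * ‖T (x - z)‖) := by gcongr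
      _ = _ := by rw [hε]; field_simp
  rw [← hTvol]
  refine ⟨?_, ?_, ?_⟩
  · refine euclideanHausdorffMeasure_image_le_of_edist_le m fun x hx z hz => ?_
    rw [edist_nndist, edist_nndist, ← ENNReal.coe_mul, ENNReal.coe_le_coe, ← NNReal.coe_le_coe,
      NNReal.coe_mul, coe_nndist, coe_nndist, dist_eq_norm, dist_eq_norm, ← map_sub]
    have h1 := hbound x hx z hz
    have h2 := norm_le_norm_add_norm_sub' (ψ x - ψ z) (A (x - z))
    rw [hT] at h1 ⊢
    -- The upper Lipschitz factor is `1 + (1 - 1/K)`, and `K + 1/K ≥ 2`.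
    have h3 : (2 - (K : ℝ)⁻¹) ≤ K := by
      have : (K : ℝ) * (K : ℝ)⁻¹ = 1 := mul_inv_cancel₀ hK0.ne'
      nlinarith [sq_nonneg ((K : ℝ) - 1)]
    nlinarith [norm_nonneg (A (x - z))]
  · refine euclideanHausdorffMeasure_image_le_of_edist_le m fun x hx z hz => ?_
    rw [edist_nndist, edist_nndist, ← ENNReal.coe_mul, ENNReal.coe_le_coe, ← NNReal.coe_le_coe,
      NNReal.coe_mul, coe_nndist, coe_nndist, dist_eq_norm, dist_eq_norm, ← map_sub]
    have h1 := hbound x hx z hz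
    have h2 := norm_le_norm_add_norm_sub (ψ x - ψ z) (A (x - z))
    rw [hT] at h1 ⊢
    have h3 : (K : ℝ)⁻¹ * ‖A (x - z)‖ ≤ ‖ψ x - ψ z‖ := by linarith
    rwa [inv_mul_le_iff₀ hK0] at h3
  · intro z hz
    rw [← ENNReal.ofReal_coe_nnreal, ← ENNReal.ofReal_mul hK0.le, ← ENNReal.ofReal_mul hK0.le]
    exact ⟨ENNReal.ofReal_le_ofReal hz.2.1.le, ENNReal.ofReal_le_ofReal hz.2.2.le⟩

variable [CompleteSpace F]

/-- The area formula for sets. -/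
theorem euclideanHausdorffMeasure_image_eq_lintegral {ψ : (Fin m → ℝ) → F} {U : Set (Fin m → ℝ)}
    (hU : IsOpen U) (hψ : ContDiffOn ℝ 1 ψ U) (hinj : InjOn ψ U)
    (himm : ∀ y ∈ U, Injective (D ψ y)) {S : Set (Fin m → ℝ)}
    (hS : MeasurableSet S) (hSU : S ⊆ U) :
    (μHE[m] : Measure F) (ψ '' S) = ∫⁻ z in S, ENNReal.ofReal (√(gramOf (D ψ z)).det) := by
  set J : (Fin m → ℝ) → ℝ≥0∞ := fun z => ENNReal.ofReal (√(gramOf (D ψ z)).det)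
  have hJ : Measurable J := (measurable_gramOf_fderiv ψ).ennreal_ofReal
  -- The claim up to a factor: `K ^ m` comes from comparing measures of images and one more `K` from
  -- comparing the density with its local value `J₀`.
  have key : ∀ K : ℝ≥0, 1 < K → (μHE[m] : Measure F) (ψ '' S) ≤ K ^ (m + 1) * ∫⁻ z in S, J z ∧
      ∫⁻ z in S, J z ≤ K ^ (m + 1) * (μHE[m] : Measure F) (ψ '' S) := by
    intro K hK
    choose! V hV J₀ hJ₀ using fun y (hy : y ∈ U) => exists_nhds_area_bounds hU hψ hy (himm y hy) hK
    obtain ⟨t, htU, htc, htcov⟩ := TopologicalSpace.countable_cover_nhdsWithin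
      (s := S) (f := fun y => interior (V y))
      fun y hy => mem_nhdsWithin_of_mem_nhds (interior_mem_nhds.2 (hV y (hSU hy)))
    rcases S.eq_empty_or_nonempty with rfl | hne
    · simp
    have htne : t.Nonempty := by
      obtain ⟨x, hx⟩ := hne
      obtain ⟨y, hy, -⟩ := mem_iUnion₂.1 (htcov hx)
      exact ⟨y, hy⟩
    obtain ⟨f, rfl⟩ := htc.exists_eq_range htne
    -- Countably many neighbourhoods cover `S`; they are made disjoint so that the local estimates
    -- can be summed.
    let W : ℕ → Set (Fin m → ℝ) := fun i => S ∩ disjointed (fun i => interior (V (f i))) i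
    have hWm : ∀ i, MeasurableSet (W i) := fun i =>
      hS.inter (MeasurableSet.disjointed (fun i => isOpen_interior.measurableSet) i)
    have hWd : Pairwise (Function.onFun Disjoint W) := fun i j hij =>
      (disjoint_disjointed _ hij).mono inter_subset_right inter_subset_right
    have hWS : ⋃ i, W i = S := by
      rw [← inter_iUnion, iUnion_disjointed, inter_eq_left]
      simpa using htcov
    have hWV : ∀ i, W i ⊆ V (f i) := fun i =>
      inter_subset_right.trans ((disjointed_subset _ i).trans interior_subset)
    have hWU : ∀ i, W i ⊆ U := fun i => inter_subset_left.trans hSU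
    have h1 : (μHE[m] : Measure F) (ψ '' S) = ∑' i, (μHE[m] : Measure F) (ψ '' W i) := by
      rw [← hWS, image_iUnion, measure_iUnion]
      · intro i j hij
        exact Disjoint.image (hWd hij) hinj (hWU i) (hWU j)
      · intro i
        exact (hWm i).image_of_continuousOn_injOn (hψ.continuousOn.mono (hWU i)) (hinj.mono (hWU i))
    have h2 : ∫⁻ z in S, J z = ∑' i, ∫⁻ z in W i, J z := by
      rw [← lintegral_iUnion hWm hWd, hWS]
    have hi : ∀ i, f i ∈ U := fun i => hSU (htU (mem_range_self i))
    rw [h1, h2, ← ENNReal.tsum_mul_left, ← ENNReal.tsum_mul_left]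
    constructor
    · refine ENNReal.tsum_le_tsum fun i => ?_
      obtain ⟨b1, -, b3⟩ := hJ₀ _ (hi i) (W i) (hWV i)
      refine b1.trans ?_
      rw [pow_succ, mul_assoc]
      refine mul_le_mul_right ?_ _
      rw [← setLIntegral_const, ← lintegral_const_mul _ hJ]
      exact setLIntegral_mono (hJ.const_mul _) fun z hz => (b3 z (hWV i hz)).1
    · refine ENNReal.tsum_le_tsum fun i => ?_
      obtain ⟨-, b2, b3⟩ := hJ₀ _ (hi i) (W i) (hWV i)
      calc ∫⁻ z in W i, J z ≤ ∫⁻ z in W i, K * J₀ (f i) :=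
            setLIntegral_mono measurable_const fun z hz => (b3 z (hWV i hz)).2
        _ = K * (J₀ (f i) * volume (W i)) := by rw [setLIntegral_const, mul_assoc]
        _ ≤ K * (K ^ m * (μHE[m] : Measure F) (ψ '' W i)) := by gcongr
        _ = _ := by rw [pow_succ]; ring
  -- Letting `K` decrease to `1` removes the factor.
  have lim : ∀ a b : ℝ≥0∞, (∀ K : ℝ≥0, 1 < K → a ≤ K ^ (m + 1) * b) → a ≤ b := by
    intro a b h
    have ht : Tendsto (fun K : ℝ≥0 => (K : ℝ≥0∞) ^ (m + 1) * b) (𝓝[>] 1) (𝓝 (1 * b)) := by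
      refine ENNReal.Tendsto.mul_const ?_ (Or.inl one_ne_zero)
      have : Continuous fun K : ℝ≥0 => (K : ℝ≥0∞) ^ (m + 1) :=
        (ENNReal.continuous_pow _).comp ENNReal.continuous_coe
      simpa using (this.tendsto 1).mono_left nhdsWithin_le_nhds
    rw [one_mul] at ht
    refine ge_of_tendsto ht ?_
    filter_upwards [self_mem_nhdsWithin] with K hK using h K hK
  exact le_antisymm (lim _ _ fun K hK => (key K hK).1) (lim _ _ fun K hK => (key K hK).2)

/-- The area formula for sets as an equality of measures. In this form it passes to integrals of
arbitrary functions through the measurable embedding `ψ`. -/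
theorem domRestrict_map_withDensity_gramOf {ψ : (Fin m → ℝ) → F} {U : Set (Fin m → ℝ)}
    (hU : IsOpen U) (hψ : ContDiffOn ℝ 1 ψ U) (hinj : InjOn ψ U)
    (himm : ∀ y ∈ U, Injective (D ψ y)) {S : Set (Fin m → ℝ)}
    (hS : MeasurableSet S) (hSU : S ⊆ U) :
    Measure.map (S.domRestrict ψ) (Measure.comap (↑)
      (volume.withDensity fun z => ENNReal.ofReal (√(gramOf (D ψ z)).det))) =
      (μHE[m] : Measure F).restrict (ψ '' S) := by
  have hemb : MeasurableEmbedding (S.domRestrict ψ) :=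
    (hψ.continuousOn.mono hSU).measurableEmbedding hS (hinj.mono hSU)
  ext A hA
  rw [hemb.map_apply, Measure.restrict_apply hA,
    Measure.comap_apply _ Subtype.coe_injective (fun t ht => hS.subtype_image ht) _ (hemb.measurable hA)]
  have h1 : ((↑) '' (S.domRestrict ψ ⁻¹' A) : Set (Fin m → ℝ)) = S ∩ ψ ⁻¹' A := by
    ext z; simp [and_comm]
  have hm : MeasurableSet (S ∩ ψ ⁻¹' A) := by
    rw [← h1]; exact hS.subtype_image (hemb.measurable hA)
  have h2 : A ∩ ψ '' S = ψ '' (S ∩ ψ ⁻¹' A) := by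
    rw [image_inter_preimage, inter_comm]
  rw [h1, h2, withDensity_apply _ hm, euclideanHausdorffMeasure_image_eq_lintegral hU hψ hinj himm
    hm (inter_subset_left.trans hSU)]

variable {ψ : (Fin m → ℝ) → F} {U S : Set (Fin m → ℝ)}

/-- Integrability in the area formula. -/
theorem integrableOn_image_iff_integrableOn_gramOf (hU : IsOpen U) (hψ : ContDiffOn ℝ 1 ψ U)
    (hinj : InjOn ψ U) (himm : ∀ y ∈ U, Injective (D ψ y))
    (hS : MeasurableSet S) (hSU : S ⊆ U) (f : F → ℝ) :
    IntegrableOn f (ψ '' S) (μHE[m] : Measure F) ↔ IntegrableOn (fun z => √(gramOf (D ψ z)).det * f (ψ z)) S := by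
  have hemb : MeasurableEmbedding (S.domRestrict ψ) :=
    (hψ.continuousOn.mono hSU).measurableEmbedding hS (hinj.mono hSU)
  rw [IntegrableOn, ← domRestrict_map_withDensity_gramOf hU hψ hinj himm hS hSU, hemb.integrable_map_iff]
  simp only [Set.domRestrict_eq, ← Function.comp_assoc, ENNReal.ofReal]
  rw [← (MeasurableEmbedding.subtype_coe hS).integrable_map_iff, map_comap_subtype_coe hS,
    restrict_withDensity hS, integrable_withDensity_iff_integrable_coe_smul₀]
  · simp_rw [IntegrableOn, Real.coe_toNNReal _ (Real.sqrt_nonneg _), Function.comp_apply, smul_eq_mul]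
  · exact (measurable_gramOf_fderiv ψ).real_toNNReal.aemeasurable

/-- The area formula for integrals. -/
theorem integral_image_eq_integral_gramOf (hU : IsOpen U) (hψ : ContDiffOn ℝ 1 ψ U)
    (hinj : InjOn ψ U) (himm : ∀ y ∈ U, Injective (D ψ y))
    (hS : MeasurableSet S) (hSU : S ⊆ U) (f : F → ℝ) :
    ∫ x in ψ '' S, f x ∂(μHE[m] : Measure F) = ∫ z in S, √(gramOf (D ψ z)).det * f (ψ z) := by
  have hemb : MeasurableEmbedding (S.domRestrict ψ) :=
    (hψ.continuousOn.mono hSU).measurableEmbedding hS (hinj.mono hSU)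
  rw [← domRestrict_map_withDensity_gramOf hU hψ hinj himm hS hSU, hemb.integral_map]
  simp only [Set.domRestrict_apply, ← Function.comp_apply (f := f), ENNReal.ofReal]
  rw [← (MeasurableEmbedding.subtype_coe hS).integral_map, map_comap_subtype_coe hS,
    setIntegral_withDensity_eq_setIntegral_smul₀ (measurable_gramOf_fderiv ψ).real_toNNReal.aemeasurable _ hS]
  congr with x
  rw [NNReal.smul_def, Real.coe_toNNReal _ (Real.sqrt_nonneg _), smul_eq_mul]

end AreaFormula

/-! ## Tensoriality of the curvature quantities -/

section Tensoriality

variable {ι : Type} [Fintype ι] [DecidableEq ι]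

/-- `g` is a smooth Riemannian metric near `z`. -/
structure IsMetricAt (g : (ι → ℝ) → Matrix ι ι ℝ) (z : ι → ℝ) : Prop where
  smooth_near : ∀ᶠ w in 𝓝 z, ∀ a b, SmoothAt (fun w => g w a b) w
  posDef_near : ∀ᶠ w in 𝓝 z, (g w).PosDef

theorem IsMetricAt.eventually {g : (ι → ℝ) → Matrix ι ι ℝ} {z : ι → ℝ} (h : IsMetricAt g z) :
    ∀ᶠ w in 𝓝 z, IsMetricAt g w := by
  filter_upwards [h.smooth_near.eventually_nhds,
    h.posDef_near.eventually_nhds] with w h1 h2 using ⟨h1, h2⟩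

theorem IsMetricAt.smooth {g : (ι → ℝ) → Matrix ι ι ℝ} {z : ι → ℝ} (h : IsMetricAt g z) (a b : ι) :
    SmoothAt (fun w => g w a b) z :=
  h.smooth_near.self_of_nhds a b

theorem IsMetricAt.posDef {g : (ι → ℝ) → Matrix ι ι ℝ} {z : ι → ℝ} (h : IsMetricAt g z) : (g z).PosDef :=
  h.posDef_near.self_of_nhds

theorem contDiffAt_matrix_det {V : Type*} [NormedAddCommGroup V] [NormedSpace ℝ V] {n : WithTop ℕ∞}
    {g : V → Matrix ι ι ℝ} {z : V} (h : ∀ a b, ContDiffAt ℝ n (fun w => g w a b) z) :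
    ContDiffAt ℝ n (fun w => (g w).det) z := by
  simp only [Matrix.det_apply]
  refine ContDiffAt.sum fun σ _ => ContDiffAt.const_smul _ ?_
  exact contDiffAt_prod fun i _ => h _ _

/-- By Cramer's rule the entries are quotients of polynomials in the entries of `g`. -/
theorem contDiffAt_matrix_inv {V : Type*} [NormedAddCommGroup V] [NormedSpace ℝ V] {n : WithTop ℕ∞}
    {g : V → Matrix ι ι ℝ} {z : V} (h : ∀ a b, ContDiffAt ℝ n (fun w => g w a b) z)
    (h0 : (g z).det ≠ 0) (a b : ι) : ContDiffAt ℝ n (fun w => (g w)⁻¹ a b) z := by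
  simp only [Matrix.inv_def, Matrix.smul_apply, smul_eq_mul, Ring.inverse_eq_inv', Matrix.adjugate_apply]
  refine ((contDiffAt_matrix_det h).inv h0).mul (contDiffAt_matrix_det fun c d => ?_)
  simp only [Matrix.updateRow_apply]
  split_ifs
  · exact contDiffAt_const
  · exact h c d

theorem IsMetricAt.isUnit_det {g : (ι → ℝ) → Matrix ι ι ℝ} {z : ι → ℝ} (h : IsMetricAt g z) : IsUnit (g z).det :=
  isUnit_iff_ne_zero.2 h.posDef.det_pos.ne'

theorem IsMetricAt.inv_comm {g : (ι → ℝ) → Matrix ι ι ℝ} {z : ι → ℝ} (h : IsMetricAt g z) (a b : ι) :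
    (g z)⁻¹ a b = (g z)⁻¹ b a := by simpa using (h.posDef.isHermitian.inv.apply a b).symm

theorem IsMetricAt.inv_smooth {g : (ι → ℝ) → Matrix ι ι ℝ} {z : ι → ℝ} (h : IsMetricAt g z)
    (a b : ι) : SmoothAt (fun w => (g w)⁻¹ a b) z :=
  contDiffAt_matrix_inv h.smooth h.posDef.det_pos.ne' a b

theorem contDiffAt_partialD {f : (ι → ℝ) → ℝ} {z : ι → ℝ} (h : SmoothAt f z) (i : ι) : SmoothAt (partialD i f) z :=
  h.smooth_fderiv.clm_apply contDiffAt_const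

theorem IsMetricAt.christoffel_smooth {g : (ι → ℝ) → Matrix ι ι ℝ} {z : ι → ℝ}
    (h : IsMetricAt g z) (c a b : ι) : SmoothAt (christoffel g c a b) z := by
  unfold christoffel
  refine contDiffAt_const.mul (ContDiffAt.sum fun l _ => (h.inv_smooth c l).mul ?_)
  exact ((contDiffAt_partialD (h.smooth b l) a).add (contDiffAt_partialD (h.smooth a l) b)).sub
    (contDiffAt_partialD (h.smooth a b) l)

theorem fderiv_apply_eq_sum_partialD (f : (ι → ℝ) → ℝ) (z u : ι → ℝ) : D f z u = ∑ i, u i * partialD i f z := by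
  conv_lhs => rw [← univ_sum_single u]
  rw [map_sum]
  refine sum_congr rfl fun i _ => ?_
  have : single i (u i) = u i • (single i 1 : ι → ℝ) := by
    ext k; by_cases hk : k = i <;> simp [hk]
  rw [this, map_smul, smul_eq_mul, partialD]

/-- The bilinear form with matrix `M`. -/
def formOf (M : Matrix ι ι ℝ) : (ι → ℝ) →L[ℝ] (ι → ℝ) →L[ℝ] ℝ :=
  ∑ a, ∑ b, M a b • (ContinuousLinearMap.proj (R := ℝ) (φ := fun _ : ι => ℝ) a).smulRight
    (ContinuousLinearMap.proj (R := ℝ) (φ := fun _ : ι => ℝ) b)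

theorem formOf_apply (M : Matrix ι ι ℝ) (u v : ι → ℝ) : formOf M u v = ∑ a, ∑ b, M a b * u a * v b := by
  simp [formOf, mul_assoc]

theorem formOf_eq_dotProduct (M : Matrix ι ι ℝ) (u v : ι → ℝ) : formOf M u v = u ⬝ᵥ (M.mulVec v) := by
  simp only [formOf_apply, dotProduct, Matrix.mulVec, mul_sum]
  exact sum_congr rfl fun a _ => sum_congr rfl fun b _ => by ring

theorem formOf_single (M : Matrix ι ι ℝ) (a b : ι) : formOf M (single a 1) (single b 1) = M a b := by
  simp [formOf_apply, Pi.single_apply]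

/-- The Christoffel symbols as a bilinear map. -/
def chrOf (g : (ι → ℝ) → Matrix ι ι ℝ) (z : ι → ℝ) : (ι → ℝ) →L[ℝ] (ι → ℝ) →L[ℝ] (ι → ℝ) :=
  ∑ c, ∑ a, ∑ b, christoffel g c a b z • (ContinuousLinearMap.proj (R := ℝ) (φ := fun _ : ι => ℝ) a).smulRight
      ((ContinuousLinearMap.proj (R := ℝ) (φ := fun _ : ι => ℝ) b).smulRight (single c 1))

theorem chrOf_apply (g : (ι → ℝ) → Matrix ι ι ℝ) (z u v : ι → ℝ) (c : ι) :
    chrOf g z u v c = ∑ a, ∑ b, christoffel g c a b z * u a * v b := by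
  simp [chrOf, Pi.single_apply, mul_assoc]

theorem chrOf_single (g : (ι → ℝ) → Matrix ι ι ℝ) (z : ι → ℝ) (a b c : ι) :
    chrOf g z (single a 1) (single b 1) c = christoffel g c a b z := by
  simp [chrOf_apply, Pi.single_apply]

variable {g : (ι → ℝ) → Matrix ι ι ℝ} {z : ι → ℝ}

theorem contDiffAt_smul_const {V W : Type*} [NormedAddCommGroup V] [NormedSpace ℝ V]
    [NormedAddCommGroup W] [NormedSpace ℝ W] {n : WithTop ℕ∞} {f : V → ℝ} {x : V}
    (h : ContDiffAt ℝ n f x) (w : W) : ContDiffAt ℝ n (fun y => f y • w) x :=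
  h.smul contDiffAt_const

theorem IsMetricAt.formOf_smooth (h : IsMetricAt g z) : SmoothAt (fun w => formOf (g w)) z :=
  ContDiffAt.sum fun a _ => ContDiffAt.sum fun b _ => contDiffAt_smul_const (h.smooth a b) _

theorem IsMetricAt.chrOf_smooth (h : IsMetricAt g z) : SmoothAt (chrOf g) z :=
  ContDiffAt.sum fun c _ => ContDiffAt.sum fun a _ => ContDiffAt.sum fun b _ =>
    contDiffAt_smul_const (h.christoffel_smooth c a b) _

theorem IsMetricAt.fderiv_formOf_apply (h : IsMetricAt g z) (u v w : ι → ℝ) : D (fun x => formOf (g x)) z u v w =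
      ∑ l, ∑ a, ∑ b, partialD l (fun x => g x a b) z * u l * v a * w b := by
  have h1 : D (fun x => formOf (g x)) z u v w = D (fun x => formOf (g x) v w) z u := by
    have hd := h.formOf_smooth.diffAt.hasFDerivAt
    have := ((hd.clm_apply (hasFDerivAt_const v z)).clm_apply (hasFDerivAt_const w z)).fderiv
    rw [this]; simp
  rw [h1, fderiv_apply_eq_sum_partialD]
  refine sum_congr rfl fun l _ => ?_
  have h2 : ∀ a b, HasFDerivAt (fun x => g x a b) (D (fun x => g x a b) z) z := fun a b =>
    (h.smooth a b).diffAt.hasFDerivAt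
  have h3 : HasFDerivAt (fun x => formOf (g x) v w) (∑ a, ∑ b, (v a * w b) • D (fun x => g x a b) z) z := by
    simp only [formOf_apply]
    refine HasFDerivAt.fun_sum fun a _ => HasFDerivAt.fun_sum fun b _ => ?_
    have := ((h2 a b).mul_const (v a * w b))
    simpa only [mul_assoc] using this
  rw [partialD, h3.fderiv]
  simp only [sum_apply, smul_apply, smul_eq_mul, mul_sum, partialD]
  exact sum_congr rfl fun a _ => sum_congr rfl fun b _ => by ring

/-- The Koszul formula. -/
theorem IsMetricAt.koszul (h : IsMetricAt g z) (u v w : ι → ℝ) :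
    formOf (g z) (chrOf g z u v) w = 1 / 2 * (D (fun x => formOf (g x)) z u v w
      + D (fun x => formOf (g x)) z v u w - D (fun x => formOf (g x)) z w u v) := by
  have hP := h.posDef
  have hsym : ∀ a b, g z a b = g z b a := fun a b => by
    have := hP.isHermitian.apply a b; simpa using this.symm
  have hinv : ∀ l d, ∑ c, g z c d * (g z)⁻¹ c l = if d = l then 1 else 0 := by
    intro l d
    have h1 : (g z * (g z)⁻¹) d l = (1 : Matrix ι ι ℝ) d l := by
      rw [mul_nonsing_inv _ (isUnit_iff_ne_zero.2 hP.det_pos.ne')]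
    rw [Matrix.mul_apply, Matrix.one_apply] at h1
    rw [← h1]
    exact sum_congr rfl fun c _ => by rw [hsym]
  -- Lowering the upper index cancels the inverse metric in the definition of the Christoffel
  -- symbols.
  have low : ∀ a b d, ∑ c, g z c d * christoffel g c a b z = 1 / 2 *
      (partialD a (fun z => g z b d) z + partialD b (fun z => g z a d) z
      - partialD d (fun z => g z a b) z) := by
    intro a b d
    simp only [christoffel]
    calc _ = 1 / 2 * ∑ l, (∑ c, g z c d * (g z)⁻¹ c l) * (partialD a (fun z => g z b l) z +
          partialD b (fun z => g z a l) z - partialD l (fun z => g z a b) z) := by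
          simp only [mul_sum, sum_mul]
          rw [sum_comm]
          exact sum_congr rfl fun l _ => sum_congr rfl fun b _ => by ring
      _ = _ := by simp [hinv]
  rw [h.fderiv_formOf_apply, h.fderiv_formOf_apply, h.fderiv_formOf_apply, formOf_apply]
  have e1 : ∑ c, ∑ d, g z c d * chrOf g z u v c * w d =
      ∑ a, ∑ b, ∑ d, (∑ c, g z c d * christoffel g c a b z) * u a * v b * w d := by
    simp only [chrOf_apply, mul_sum, sum_mul]
    calc _ = ∑ d, ∑ c, ∑ a, ∑ b, g z c d * (christoffel g c a b z * u a * v b) * w d :=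
          sum_comm
      _ = ∑ d, ∑ a, ∑ b, ∑ c, g z c d * (christoffel g c a b z * u a * v b) * w d := by
          refine sum_congr rfl fun d _ => ?_
          rw [sum_comm]
          refine sum_congr rfl fun a _ => ?_
          rw [sum_comm]
      _ = ∑ a, ∑ b, ∑ d, ∑ c, g z c d * (christoffel g c a b z * u a * v b) * w d := by
          rw [sum_comm]
          refine sum_congr rfl fun a _ => ?_
          rw [sum_comm]
      _ = _ := sum_congr rfl fun a _ => sum_congr rfl fun b _ =>
          sum_congr rfl fun d _ => sum_congr rfl fun c _ => by ring
  rw [e1]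
  simp only [low]
  have e2 : ∑ l, ∑ a, ∑ b, partialD l (fun x => g x a b) z * v l * u a * w b =
      ∑ a, ∑ l, ∑ b, partialD l (fun x => g x a b) z * v l * u a * w b := sum_comm
  have e3 : ∑ l, ∑ a, ∑ b, partialD l (fun x => g x a b) z * w l * u a * v b =
      ∑ a, ∑ b, ∑ l, partialD l (fun x => g x a b) z * w l * u a * v b := by
    rw [sum_comm]
    exact sum_congr rfl fun a _ => sum_comm
  rw [e2, e3]
  simp only [mul_sum, ← sum_add_distrib, ← sum_sub_distrib]
  exact sum_congr rfl fun a _ => sum_congr rfl fun b _ =>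
    sum_congr rfl fun d _ => by ring

end Tensoriality

/-! ### Curvature under changes of coordinates. -/

section Tensoriality2

variable {ι : Type} [Fintype ι] [DecidableEq ι]

/-- The metric `g'` is the pull-back of `g` by the coordinate change `τ` near `y`. -/
structure IsPullbackAt (g g' : (ι → ℝ) → Matrix ι ι ℝ) (τ : (ι → ℝ) → ι → ℝ) (y : ι → ℝ) :
    Prop where
  metric : IsMetricAt g (τ y)
  metric' : IsMetricAt g' y
  smooth_near : ∀ᶠ z in 𝓝 y, SmoothAt τ z
  form_near : ∀ᶠ z in 𝓝 y, ∀ u v, formOf (g' z) u v = formOf (g (τ z)) (D τ z u) (D τ z v)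

variable {g g' : (ι → ℝ) → Matrix ι ι ℝ} {τ : (ι → ℝ) → ι → ℝ} {y : ι → ℝ}

theorem formOf_self_pos {M : Matrix ι ι ℝ} (hM : M.PosDef) {u : ι → ℝ} (hu : u ≠ 0) : 0 < formOf M u u := by
  rw [formOf_eq_dotProduct]
  simpa using hM.dotProduct_mulVec_pos hu

theorem formOf_comm {M : Matrix ι ι ℝ} (hM : M.PosDef) (u v : ι → ℝ) : formOf M u v = formOf M v u := by
  have hs : ∀ a b, M a b = M b a := fun a b => by
    have := hM.isHermitian.apply a b; simpa using this.symm
  rw [formOf_apply, formOf_apply, sum_comm]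
  refine sum_congr rfl fun a _ => sum_congr rfl fun b _ => ?_
  rw [hs]; ring

theorem two_le_smoothness : minSmoothness ℝ 2 ≤ (∞ : WithTop ℕ∞) := by
  rw [minSmoothness_of_isRCLikeNormedField]
  exact WithTop.coe_le_coe.2 le_top

theorem eq_of_formOf_eq {M : Matrix ι ι ℝ} (hM : M.PosDef) {u v : ι → ℝ}
    (h : ∀ w, formOf M u w = formOf M v w) : u = v := by
  by_contra hne
  have h1 := formOf_self_pos hM (sub_ne_zero.2 hne)
  have h2 := h (u - v)
  have h3 : formOf M (u - v) (u - v) = formOf M u (u - v) - formOf M v (u - v) := by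
    rw [(formOf M).map_sub]; rfl
  linarith

namespace IsPullbackAt

theorem eventually (h : IsPullbackAt g g' τ y) : ∀ᶠ z in 𝓝 y, IsPullbackAt g g' τ z := by
  have hc : ContinuousAt τ y := h.smooth_near.self_of_nhds.continuousAt
  filter_upwards [hc.eventually h.metric.eventually, h.metric'.eventually,
    h.smooth_near.eventually_nhds, h.form_near.eventually_nhds]
    with z h1 h2 h3 h4 using ⟨h1, h2, h3, h4⟩

theorem smooth (h : IsPullbackAt g g' τ y) : SmoothAt τ y := h.smooth_near.self_of_nhds

theorem fderiv_smooth (h : IsPullbackAt g g' τ y) : SmoothAt (D τ) y :=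
  h.smooth.smooth_fderiv

theorem injective (h : IsPullbackAt g g' τ y) : Injective (D τ y) := by
  refine (injective_iff_map_eq_zero _).2 fun v hv => ?_
  by_contra hne
  have h1 := formOf_self_pos h.metric'.posDef hne
  rw [h.form_near.self_of_nhds, hv] at h1
  simp at h1

theorem surjective (h : IsPullbackAt g g' τ y) : Function.Surjective (D τ y) :=
  LinearMap.injective_iff_surjective (f := (D τ y : (ι → ℝ) →ₗ[ℝ] ι → ℝ)) |>.1 h.injective

/-- The product rule in `g'(v, w) = g(dτ v, dτ w)`. The two terms with second derivatives of `τ`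
produce the inhomogeneous term in the transformation law of the Christoffel symbols. -/
theorem fderiv_form (h : IsPullbackAt g g' τ y) (u v w : ι → ℝ) : D (fun x => formOf (g' x)) y u v w =
      D (fun x => formOf (g x)) (τ y) (D τ y u) (D τ y v) (D τ y w)
      + formOf (g (τ y)) (D (D τ) y u v) (D τ y w)
      + formOf (g (τ y)) (D τ y v) (D (D τ) y u w) := by
  have hd := h.metric'.formOf_smooth.diffAt.hasFDerivAt
  have h1 := (hd.clm_apply (hasFDerivAt_const v y)).clm_apply (hasFDerivAt_const w y)
  have hg := h.metric.formOf_smooth.diffAt.hasFDerivAt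
  have hτ := h.smooth.diffAt.hasFDerivAt
  have hτ2 := h.fderiv_smooth.diffAt.hasFDerivAt
  have hc : HasFDerivAt (fun x => formOf (g (τ x)))
    ((D (fun x => formOf (g x)) (τ y)).comp (D τ y)) y := HasFDerivAt.comp y hg hτ
  have h2 := (hc.clm_apply (hτ2.clm_apply (hasFDerivAt_const v y))).clm_apply (hτ2.clm_apply (hasFDerivAt_const w y))
  have h3 : (fun x => formOf (g' x) v w) =ᶠ[𝓝 y] fun x => formOf (g (τ x)) (D τ x v) (D τ x w) :=
    h.form_near.mono fun z hz => hz v w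
  have := h1.unique (h2.congr_of_eventuallyEq h3)
  have := congrArg (fun L => L u) this
  simp at this
  linarith

/-- The transformation law of the Christoffel symbols. -/
theorem fderiv_chrOf (h : IsPullbackAt g g' τ y) (u v : ι → ℝ) : D τ y (chrOf g' y u v) =
      D (D τ) y v u + chrOf g (τ y) (D τ y u) (D τ y v) := by
  have hsymm : ∀ a b, D (D τ) y a b = D (D τ) y b a :=
    h.smooth.isSymmSndFDerivAt two_le_smoothness
  -- Both sides are tested against `dτ w`, where the Koszul formula applies. Six terms with second
  -- derivatives of `τ` appear; by symmetry four cancel and two combine.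
  refine eq_of_formOf_eq h.metric.posDef fun w' => ?_
  obtain ⟨w, rfl⟩ := h.surjective w'
  rw [← h.form_near.self_of_nhds, h.metric'.koszul, map_add, add_apply, h.metric.koszul,
    h.fderiv_form, h.fderiv_form, h.fderiv_form, hsymm u v, hsymm w u, hsymm w v,
    formOf_comm h.metric.posDef (D τ y v), formOf_comm h.metric.posDef (D τ y u)]
  ring

end IsPullbackAt

/-- The Riemann curvature `R(u, v) w` of the connection with Christoffel map `Γ`. -/
def riemOf (Γ : (ι → ℝ) → (ι → ℝ) →L[ℝ] (ι → ℝ) →L[ℝ] (ι → ℝ)) (z u v w : ι → ℝ) : ι → ℝ :=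
  D Γ z u w v - D Γ z v w u + Γ z u (Γ z w v) - Γ z v (Γ z w u)

theorem chrOf_comm {z : ι → ℝ} (h : IsMetricAt g z) (u v : ι → ℝ) : chrOf g z u v = chrOf g z v u := by
  have h0 : ∀ a b, (fun z => g z a b) =ᶠ[𝓝 z] fun z => g z b a := fun a b =>
    h.posDef_near.mono fun w hw => by
      have := hw.isHermitian.apply a b; simpa using this.symm
  have h1 : ∀ c a b, christoffel g c a b z = christoffel g c b a z := fun c a b => by
    simp only [christoffel]
    congr 1
    refine sum_congr rfl fun l _ => ?_
    have : partialD l (fun z => g z a b) z = partialD l (fun z => g z b a) z := by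
      rw [partialD, partialD, (h0 a b).fderiv_eq]
    rw [this]; ring
  ext c
  rw [chrOf_apply, chrOf_apply, sum_comm]
  refine sum_congr rfl fun a _ => sum_congr rfl fun b _ => ?_
  rw [h1]; ring

/-- Differentiate the transformation law of the Christoffel map and antisymmetrize in `u` and `v`.
The third derivatives of `τ` are symmetric and drop out, and the products with second derivatives
cancel by the same law. -/
theorem IsPullbackAt.fderiv_riemOf (h : IsPullbackAt g g' τ y) (u v w : ι → ℝ) : D τ y (riemOf (chrOf g') y u v w) =
      riemOf (chrOf g) (τ y) (D τ y u) (D τ y v) (D τ y w) := by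
  have hΓ' := h.metric'.chrOf_smooth.diffAt.hasFDerivAt
  have hΓ := h.metric.chrOf_smooth.diffAt.hasFDerivAt
  have hτ := h.smooth.diffAt.hasFDerivAt
  have hτ2 := h.fderiv_smooth.diffAt.hasFDerivAt
  have hs3 : SmoothAt (D (D τ)) y := h.fderiv_smooth.smooth_fderiv
  have hτ3 := hs3.diffAt.hasFDerivAt
  have hc : HasFDerivAt (fun x => chrOf g (τ x)) ((D (chrOf g) (τ y)).comp (D τ y)) y := HasFDerivAt.comp y hΓ hτ
  have key : ∀ a b c : ι → ℝ, D (D τ) y a (chrOf g' y b c) + D τ y (D (chrOf g') y a b c) = D (D (D τ)) y a c b +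
      D (chrOf g) (τ y) (D τ y a) (D τ y b) (D τ y c) +
      chrOf g (τ y) (D (D τ) y a b) (D τ y c) +
      chrOf g (τ y) (D τ y b) (D (D τ) y a c) := by
    intro a b c
    have h1 := hτ2.clm_apply ((hΓ'.clm_apply (hasFDerivAt_const b y)).clm_apply (hasFDerivAt_const c y))
    have h2 := ((hτ3.clm_apply (hasFDerivAt_const c y)).clm_apply (hasFDerivAt_const b y)).add
      ((hc.clm_apply (hτ2.clm_apply (hasFDerivAt_const b y))).clm_apply (hτ2.clm_apply (hasFDerivAt_const c y)))
    have h3 := h1.unique (h2.congr_of_eventuallyEq (h.eventually.mono fun z hz => hz.fderiv_chrOf b c))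
    have h4 := congrArg (fun L => L a) h3
    simp at h4
    rw [add_comm, h4]
    abel
  have hsymm : ∀ a b, D (D τ) y a b = D (D τ) y b a :=
    h.smooth.isSymmSndFDerivAt two_le_smoothness
  have hsymm3 : ∀ a b, D (D (D τ)) y a b = D (D (D τ)) y b a :=
    h.fderiv_smooth.isSymmSndFDerivAt two_le_smoothness
  have k1 := key u w v
  have k2 := key v w u
  have c1 := h.fderiv_chrOf u (chrOf g' y w v)
  have c2 := h.fderiv_chrOf v (chrOf g' y w u)
  rw [h.fderiv_chrOf w v, map_add, hsymm _ u] at c1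
  rw [h.fderiv_chrOf w u, map_add, hsymm _ v] at c2
  have s1 := chrOf_comm h.metric (D τ y u) (D (D τ) y v w)
  have s2 := chrOf_comm h.metric (D τ y v) (D (D τ) y u w)
  rw [hsymm3 v u] at k2
  unfold riemOf
  simp only [map_sub, map_add]
  rw [eq_sub_of_add_eq' k1, eq_sub_of_add_eq' k2, c1, c2, s1, s2, hsymm u v]
  abel

/-- The Ricci form, the trace of `u ↦ R(u, v) w`. -/
def ricOf (Γ : (ι → ℝ) → (ι → ℝ) →L[ℝ] (ι → ℝ) →L[ℝ] (ι → ℝ)) (z v w : ι → ℝ) : ℝ :=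
  ∑ c, riemOf Γ z (single c 1) v w c

theorem fderiv_chrOf_apply {z : ι → ℝ} (h : IsMetricAt g z) (u v w : ι → ℝ) (c : ι) :
    D (chrOf g) z u v w c = D (fun x => chrOf g x v w c) z u := by
  have hd := h.chrOf_smooth.diffAt.hasFDerivAt
  have h1 := (hd.clm_apply (hasFDerivAt_const v z)).clm_apply (hasFDerivAt_const w z)
  have h2 := (hasFDerivAt_pi'.1 h1 c).fderiv
  rw [h2]
  simp

/-- The order of the arguments matters: in `ricciCurvature g a b` the index `b` carries the
derivative of the second Christoffel term, so `∂_b` is the traced operator's second slot and `∂_a`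
the vector acted upon. -/
theorem ricciCurvature_eq_ricOf {z : ι → ℝ} (h : IsMetricAt g z) (a b : ι) :
    ricciCurvature g a b z = ricOf (chrOf g) z (single b 1) (single a 1) := by
  unfold ricciCurvature ricOf riemOf
  refine sum_congr rfl fun c _ => ?_
  have h1 : ∀ d e f, D (chrOf g) z (single d 1) (single e 1) (single f 1) c = partialD d (christoffel g c e f) z := by
    intro d e f
    rw [fderiv_chrOf_apply h]
    simp only [chrOf_single]
    rfl
  have h2 : ∀ d (v : ι → ℝ), chrOf g z (single d 1) v c = ∑ l, christoffel g c d l z * v l := by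
    intro d v
    simp [chrOf_apply, Pi.single_apply]
  simp only [Pi.add_apply, Pi.sub_apply, h1, h2, chrOf_single]
  rw [sum_sub_distrib]
  ring

theorem riemOf_linear_left (Γ : (ι → ℝ) → (ι → ℝ) →L[ℝ] (ι → ℝ) →L[ℝ] (ι → ℝ)) (z v w : ι → ℝ) :
    ∃ L : (ι → ℝ) →ₗ[ℝ] ι → ℝ, ∀ u, L u = riemOf Γ z u v w := by
  refine ⟨⟨⟨fun u => riemOf Γ z u v w, fun a b => ?_⟩, fun r a => ?_⟩, fun u => rfl⟩
  · simp only [riemOf, map_add, add_apply]; abel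
  · simp only [riemOf, map_smul, smul_apply, RingHom.id_apply, smul_sub, smul_add]

theorem sum_single_eq_trace (L : (ι → ℝ) →ₗ[ℝ] ι → ℝ) : ∑ c, L (single c 1) c = LinearMap.trace ℝ _ L := by
  rw [LinearMap.trace_eq_matrix_trace ℝ (Pi.basisFun ℝ ι), trace]
  refine sum_congr rfl fun c _ => ?_
  simp

/-- The traced endomorphisms are conjugate under `dτ`, and the trace is invariant under conjugation.
-/
theorem IsPullbackAt.ricOf_eq (h : IsPullbackAt g g' τ y) (v w : ι → ℝ) :
    ricOf (chrOf g') y v w = ricOf (chrOf g) (τ y) (D τ y v) (D τ y w) := by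
  obtain ⟨L', hL'⟩ := riemOf_linear_left (chrOf g') y v w
  obtain ⟨L, hL⟩ := riemOf_linear_left (chrOf g) (τ y) (D τ y v) (D τ y w)
  unfold ricOf
  simp only [← hL, ← hL']
  rw [sum_single_eq_trace, sum_single_eq_trace]
  let J := LinearEquiv.ofBijective (D τ y : (ι → ℝ) →ₗ[ℝ] ι → ℝ) ⟨h.injective, h.surjective⟩
  have : L = J.conj L' := by
    refine LinearMap.ext fun u => ?_
    obtain ⟨u', rfl⟩ := J.surjective u
    rw [LinearEquiv.conj_apply_apply, J.symm_apply_apply, hL, hL']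
    exact (h.fderiv_riemOf u' v w).symm
  rw [this, LinearMap.trace_conj']

theorem eq_transpose_mul_mul_of_formOf {M M' : Matrix ι ι ℝ} (T : (ι → ℝ) →L[ℝ] ι → ℝ)
    (h : ∀ a b, M' a b = formOf M (T (single a 1)) (T (single b 1))) :
    M' = (LinearMap.toMatrix' (T : (ι → ℝ) →ₗ[ℝ] ι → ℝ)).transpose * M *
      LinearMap.toMatrix' (T : (ι → ℝ) →ₗ[ℝ] ι → ℝ) := by
  ext a b
  rw [h, formOf_eq_dotProduct, Matrix.mul_assoc, Matrix.mul_apply]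
  simp only [dotProduct, transpose_apply, LinearMap.toMatrix'_apply]
  rfl

/-- Scalar curvature is invariant under changes of coordinates. -/
theorem IsPullbackAt.scalarCurvature_eq (h : IsPullbackAt g g' τ y) :
    scalarCurvature g' y = scalarCurvature g (τ y) := by
  set T := LinearMap.toMatrix' (D τ y : (ι → ℝ) →ₗ[ℝ] ι → ℝ) with hT
  have hTdet : IsUnit T.det := by
    rw [hT, LinearMap.det_toMatrix']
    exact LinearEquiv.isUnit_det' (LinearEquiv.ofBijective (D τ y : (ι → ℝ) →ₗ[ℝ] ι → ℝ) ⟨h.injective, h.surjective⟩)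
  set R : Matrix ι ι ℝ := of fun a b => ricOf (chrOf g) (τ y) (single a 1) (single b 1) with hR
  set R' : Matrix ι ι ℝ := of fun a b => ricOf (chrOf g') y (single a 1) (single b 1) with hR'
  -- The Ricci form is bilinear, hence determined by its matrix; this lets it transform by
  -- congruence like the metric.
  have hform : ∀ v w, ricOf (chrOf g) (τ y) v w = formOf R v w := by
    intro v w
    let B : (ι → ℝ) →ₗ[ℝ] (ι → ℝ) →ₗ[ℝ] ℝ := LinearMap.mk₂ ℝ (ricOf (chrOf g) (τ y)) ?_ ?_ ?_ ?_
    rotate_left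
    iterate 4
      intro a b c
      simp only [ricOf, riemOf, map_add, map_smul, smul_apply, add_apply, ← sum_add_distrib, mul_sum, Pi.sub_apply,
        Pi.add_apply, Pi.smul_apply, smul_eq_mul]
      exact sum_congr rfl fun c _ => by ring
    have hB : B v w = ∑ a, ∑ b, v a * (w b * B (single a 1) (single b 1)) := by
      have := LinearMap.sum_repr_mul_repr_mul (Pi.basisFun ℝ ι) (Pi.basisFun ℝ ι) (B := B) v w
      rw [← this, Finsupp.sum_fintype _ _ (by simp)]
      refine sum_congr rfl fun a _ => ?_
      rw [Finsupp.sum_fintype _ _ (by simp)]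
      simp
    change B v w = _
    rw [hB, formOf_apply]
    refine sum_congr rfl fun a _ => sum_congr rfl fun b _ => ?_
    change _ = B (single a 1) (single b 1) * _ * _
    ring
  have e1 : R' = T.transpose * R * T := by
    refine eq_transpose_mul_mul_of_formOf _ fun a b => ?_
    rw [← hform, ← h.ricOf_eq]; rfl
  have e2 : g' y = T.transpose * g (τ y) * T := by
    refine eq_transpose_mul_mul_of_formOf _ fun a b => ?_
    rw [← h.form_near.self_of_nhds, formOf_single]
  have s : ∀ (G : (ι → ℝ) → Matrix ι ι ℝ) (z : ι → ℝ), IsMetricAt G z → scalarCurvature G z =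
      ((G z)⁻¹ * of fun a b => ricOf (chrOf G) z (single a 1) (single b 1)).trace := by
    intro G z hG
    unfold scalarCurvature
    rw [trace]
    simp only [diag_apply, Matrix.mul_apply, ricciCurvature_eq_ricOf hG, of_apply]
  -- Both matrices change by the congruence with `T`, so `g⁻¹ R` changes by conjugation and keeps
  -- its trace.
  rw [s _ _ h.metric, s _ _ h.metric', ← hR, ← hR', e1, e2, Matrix.mul_inv_rev, Matrix.mul_inv_rev, trace_mul_comm]
  have e3 : T.transpose * R * T * (T⁻¹ * ((g (τ y))⁻¹ * T.transpose⁻¹)) =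
      T.transpose * (R * (g (τ y))⁻¹) * T.transpose⁻¹ := by
    simp only [Matrix.mul_assoc]
    rw [← Matrix.mul_assoc T, mul_nonsing_inv _ hTdet, Matrix.one_mul]
  have hTdet' : IsUnit T.transpose.det := by rwa [Matrix.det_transpose]
  rw [e3, trace_mul_comm, ← Matrix.mul_assoc, nonsing_inv_mul _ hTdet', Matrix.one_mul, trace_mul_comm]

end Tensoriality2

/-! ### The second fundamental form under changes of coordinates. -/

section SecondFundamentalForm

variable {α β : Type} [Fintype α] [DecidableEq α] [Fintype β] [DecidableEq β]

theorem secondFund_eq_formOf (g : (β → ℝ) → Matrix β β ℝ) (emb : α → β) (ν z : β → ℝ) (a b : α) :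
    secondFund g emb ν z a b = formOf (g z) (chrOf g z (single (emb a) 1) (single (emb b) 1)) ν := by
  simp only [secondFund, formOf_apply, chrOf_single]
  exact sum_congr rfl fun c _ => sum_congr rfl fun l _ => by ring

theorem secondFundNormSq_eq_trace (g : (β → ℝ) → Matrix β β ℝ) (emb : α → β) (ν z : β → ℝ) :
    secondFundNormSq g emb ν z = (((g z).submatrix emb emb)⁻¹ * of (secondFund g emb ν z) *
        ((g z).submatrix emb emb)⁻¹.transpose *
        (of (secondFund g emb ν z)).transpose).trace := by
  simp only [secondFundNormSq, trace, diag_apply, Matrix.mul_apply, transpose_apply, of_apply, sum_mul]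
  refine sum_congr rfl fun a _ => sum_congr rfl fun b _ => ?_
  rw [sum_comm]
  refine sum_congr rfl fun a' _ => sum_congr rfl fun b' _ => ?_
  ring

/-- A function that vanishes on a coordinate plane has vanishing derivatives along the plane. -/
theorem fderiv_eq_zero_of_plane {emb : α → β} {F : (β → ℝ) → ℝ} {y v : β → ℝ}
    (hy : ∀ b ∉ range emb, y b = 0) (hv : ∀ b ∉ range emb, v b = 0)
    (hF : ∀ᶠ z in 𝓝 y, (∀ b ∉ range emb, z b = 0) → F z = 0) :
    D F y v = 0 := by
  by_cases hd : DiffAt F y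
  · have hline : HasDerivAt (fun t : ℝ => y + t • v) v 0 := by
      simpa using ((hasDerivAt_id (0 : ℝ)).smul_const v).const_add y
    have h1 : HasDerivAt (fun t : ℝ => F (y + t • v)) (D F y v) 0 := by
      have h2 : HasFDerivAt F (D F y) (y + (0 : ℝ) • v) := by simpa using hd.hasFDerivAt
      exact h2.comp_hasDerivAt 0 hline
    have h3 : (fun t : ℝ => F (y + t • v)) =ᶠ[𝓝 0] fun _ => 0 := by
      have hc : Tendsto (fun t : ℝ => y + t • v) (𝓝 0) (𝓝 y) := by
        simpa using hline.continuousAt.tendsto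
      filter_upwards [hc.eventually hF] with t ht
      exact ht fun b hb => by simp [hy b hb, hv b hb]
    exact h1.unique ((hasDerivAt_const (0 : ℝ) (0 : ℝ)).congr_of_eventuallyEq h3)
  -- Where `F` is not differentiable, `fderiv` is zero by convention.
  · rw [fderiv_zero_of_not_differentiableAt hd]; rfl

variable {g g' : (β → ℝ) → Matrix β β ℝ} {τ : (β → ℝ) → β → ℝ} {y : β → ℝ}

theorem eq_sum_of_plane {emb : α → β} (hemb : Injective emb) {v : β → ℝ}
    (hv : ∀ b ∉ range emb, v b = 0) : v = ∑ a, v (emb a) • (single (emb a) 1 : β → ℝ) := by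
  ext b
  rw [Finset.sum_apply]
  by_cases hb : b ∈ range emb
  · obtain ⟨a, rfl⟩ := hb
    rw [Finset.sum_eq_single a]
    · simp
    · intro c _ hc
      simp [hemb.ne hc.symm]
    · simp
  · rw [hv b hb]
    refine (sum_eq_zero fun a _ => ?_).symm
    have : b ≠ emb a := fun h => hb ⟨a, h.symm⟩
    simp [this]

/-- The length of the second fundamental form is invariant under changes of coordinates that
preserve the hypersurface. -/
theorem IsPullbackAt.secondFundNormSq_eq (h : IsPullbackAt g g' τ y) {emb : α → β}
    (hemb : Injective emb) (hy : ∀ b ∉ range emb, y b = 0)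
    (hτ : ∀ᶠ z in 𝓝 y, (∀ b ∉ range emb, z b = 0) → ∀ b ∉ range emb, τ z b = 0)
    {ν' : β → ℝ} (hν : ∀ a, formOf (g (τ y)) (single (emb a) 1) (D τ y ν') = 0) :
    secondFundNormSq g' emb ν' y = secondFundNormSq g emb (D τ y ν') (τ y) := by
  have hsingle : ∀ a : α, ∀ b ∉ range emb, (single (emb a) 1 : β → ℝ) b = 0 := by
    intro a b hb
    have : b ≠ emb a := fun h => hb ⟨a, h.symm⟩
    simp [this]
  have hcomp : ∀ z, DiffAt τ z → ∀ v b, D τ z v b = D (fun x => τ x b) z v := by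
    intro z hz v b
    rw [(hasFDerivAt_pi'.1 hz.hasFDerivAt b).fderiv]; rfl
  have hJ : ∀ᶠ z in 𝓝 y, (∀ b ∉ range emb, z b = 0) → ∀ a, ∀ b ∉ range emb, D τ z (single (emb a) 1) b = 0 := by
    filter_upwards [hτ.eventually_nhds, h.smooth_near] with z hz hd hzp a b hb
    rw [hcomp z (hd.diffAt)]
    exact fderiv_eq_zero_of_plane hzp (hsingle a) (hz.mono fun w hw hwp => hw hwp b hb)
  -- Since `τ` maps the plane into itself, its second derivatives in two tangential directions are
  -- tangential as well.
  have hJ2 : ∀ a c, ∀ b ∉ range emb, D (D τ) y (single (emb c) 1) (single (emb a) 1) b = 0 := by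
    intro a c b hb
    have hd := h.fderiv_smooth.diffAt.hasFDerivAt
    have h1 := hasFDerivAt_pi'.1 (hd.clm_apply (hasFDerivAt_const (single (emb a) 1) y)) b
    have h2 := fderiv_eq_zero_of_plane (F := fun x => D τ x (single (emb a) 1) b)
      (v := single (emb c) 1) hy (hsingle c) (hJ.mono fun w hw hwp => hw hwp a b hb)
    rw [h1.fderiv] at h2
    simpa using h2
  have hnorm : ∀ v, (∀ b ∉ range emb, v b = 0) → formOf (g (τ y)) v (D τ y ν') = 0 := by
    intro v hv
    rw [eq_sum_of_plane hemb hv, map_sum, sum_apply]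
    refine sum_eq_zero fun a _ => ?_
    rw [map_smul, smul_apply, hν, smul_zero]
  -- The matrix of `dτ` on the tangent space of the hypersurface; the induced metric and the second
  -- fundamental form both change by congruence with it.
  set t : Matrix α α ℝ := of fun a' a => D τ y (single (emb a) 1) (emb a') with ht
  have hJt : ∀ a, D τ y (single (emb a) 1) = ∑ a', t a' a • (single (emb a') 1 : β → ℝ) := fun a =>
    eq_sum_of_plane hemb (hJ.self_of_nhds hy a)
  have hcongr : ∀ (B : (β → ℝ) →L[ℝ] (β → ℝ) →L[ℝ] ℝ) a b, B (D τ y (single (emb a) 1)) (D τ y (single (emb b) 1)) =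
      (t.transpose * (of fun a b => B (single (emb a) 1) (single (emb b) 1)) * t) a b := by
    intro B a b
    rw [hJt, hJt, Matrix.mul_assoc]
    simp only [map_sum, map_smul, sum_apply, smul_apply, Matrix.mul_apply, transpose_apply,
      of_apply, smul_eq_mul, mul_sum]
    rw [sum_comm]
    exact sum_congr rfl fun c _ => sum_congr rfl fun d _ => by ring
  have eh : (g' y).submatrix emb emb = t.transpose * (g (τ y)).submatrix emb emb * t := by
    have := hcongr (formOf (g (τ y)))
    ext a b
    rw [submatrix_apply, ← formOf_single (g' y), h.form_near.self_of_nhds, this]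
    simp only [formOf_single]
    rfl
  have eA : of (secondFund g' emb ν' y) = t.transpose * of (secondFund g emb (D τ y ν') (τ y)) * t := by
    let B : (β → ℝ) →L[ℝ] (β → ℝ) →L[ℝ] ℝ :=
      (ContinuousLinearMap.compL ℝ (β → ℝ) (β → ℝ) ℝ ((formOf (g (τ y))).flip (D τ y ν'))).comp (chrOf g (τ y))
    have := hcongr B
    ext a b
    -- The inhomogeneous term of the Christoffel law is tangential, so its product with the normal
    -- vanishes.
    rw [of_apply, secondFund_eq_formOf, h.form_near.self_of_nhds, h.fderiv_chrOf, map_add,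
      add_apply, hnorm _ (hJ2 a b), zero_add]
    refine (this a b).trans ?_
    have hB : (of fun a b => B (single (emb a) 1) (single (emb b) 1)) = of (secondFund g emb (D τ y ν') (τ y)) := by
      ext c d
      simp [secondFund_eq_formOf, B]
    rw [hB]
  have hdet' : ((g' y).submatrix emb emb).det ≠ 0 :=
    (h.metric'.posDef.submatrix hemb).det_pos.ne'
  have htd : IsUnit t.det := by
    rw [eh, Matrix.det_mul] at hdet'
    exact isUnit_iff_ne_zero.2 (right_ne_zero_of_mul hdet')
  have htd' : IsUnit t.transpose.det := by rwa [Matrix.det_transpose]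
  rw [secondFundNormSq_eq_trace, secondFundNormSq_eq_trace, eh, eA]
  generalize ((g (τ y)).submatrix emb emb) = H
  generalize of (secondFund g emb (D τ y ν') (τ y)) = A
  simp only [Matrix.mul_inv_rev, Matrix.transpose_mul, Matrix.transpose_transpose,
    Matrix.transpose_nonsing_inv, Matrix.mul_assoc]
  rw [Matrix.nonsing_inv_mul_cancel_left _ _ htd', Matrix.mul_nonsing_inv_cancel_left _ _ htd,
    Matrix.nonsing_inv_mul_cancel_left _ _ htd', trace_mul_comm]
  simp only [Matrix.mul_assoc]
  rw [mul_nonsing_inv _ htd, Matrix.mul_one]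

end SecondFundamentalForm

/-! ### Curvature of warped products. -/

section WarpedProduct

variable {ι P : Type} [Fintype ι] [DecidableEq ι] [Fintype P] [DecidableEq P]

theorem partialD_congr {f f' : (ι → ℝ) → ℝ} {z : ι → ℝ} (h : f =ᶠ[𝓝 z] f') (i : ι) :
    partialD i f z = partialD i f' z := by
  rw [partialD, partialD, h.fderiv_eq]

theorem eventuallyEq_partialD {f f' : (ι → ℝ) → ℝ} {z : ι → ℝ} (h : f =ᶠ[𝓝 z] f') (i : ι) :
    partialD i f =ᶠ[𝓝 z] partialD i f' := by
  filter_upwards [h.eventually_nhds] with w hw using partialD_congr hw i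

theorem eventuallyEq_christoffel {g g' : (ι → ℝ) → Matrix ι ι ℝ} {z : ι → ℝ} (h : g =ᶠ[𝓝 z] g')
    (c a b : ι) : christoffel g c a b =ᶠ[𝓝 z] christoffel g' c a b := by
  filter_upwards [h.eventually_nhds] with w hw
  have h1 : ∀ a b i, partialD i (fun z => g z a b) w = partialD i (fun z => g' z a b) w :=
    fun a b i => partialD_congr (hw.mono fun x hx => by rw [hx]) i
  simp only [christoffel, h1, hw.self_of_nhds]

theorem scalarCurvature_congr {g g' : (ι → ℝ) → Matrix ι ι ℝ} {z : ι → ℝ} (h : g =ᶠ[𝓝 z] g') :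
    scalarCurvature g z = scalarCurvature g' z := by
  have h1 : ∀ c a b i, partialD i (christoffel g c a b) z = partialD i (christoffel g' c a b) z :=
    fun c a b i => partialD_congr (eventuallyEq_christoffel h c a b) i
  have h2 : ∀ c a b, christoffel g c a b z = christoffel g' c a b z :=
    fun c a b => (eventuallyEq_christoffel h c a b).self_of_nhds
  simp only [scalarCurvature, ricciCurvature, h1, h2, h.self_of_nhds]

/-- The restriction of coordinates to the base of a product. -/
def base : ((ι ⊕ P) → ℝ) →L[ℝ] ι → ℝ :=
  ContinuousLinearMap.pi fun i => ContinuousLinearMap.proj (inl i)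

@[simp] theorem base_apply (z : (ι ⊕ P) → ℝ) (i : ι) : base z i = z (inl i) := rfl

/-- A section of `base` through `z` gives the direction from the product to the base. Because of the
equivalence, the formulas for partial derivatives below hold for every `f`, with the default value
of `fderiv` on both sides. -/
theorem differentiableAt_comp_base {f : (ι → ℝ) → ℝ} {z : (ι ⊕ P) → ℝ} :
    DiffAt (fun x : (ι ⊕ P) → ℝ => f (base x)) z ↔ DiffAt f (base z) := by
  refine ⟨fun h => ?_, fun h => h.comp z base.differentiableAt⟩
  let s : (ι → ℝ) → (ι ⊕ P) → ℝ := fun y => Sum.elim y fun p => z (inr p)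
  have hs : DiffAt s (base z) := by
    rw [differentiableAt_pi]
    rintro (i | p)
    exacts [differentiableAt_apply i _, differentiableAt_const _]
  have hsz : s (base z) = z := by ext (i | p) <;> rfl
  exact DifferentiableAt.comp (g := fun x => f (base x)) (f := s) _ (by rwa [hsz]) hs

theorem fderiv_comp_base (f : (ι → ℝ) → ℝ) (z v : (ι ⊕ P) → ℝ) : D (fun x : (ι ⊕ P) → ℝ => f (base x)) z v =
      D f (base z) (base v) := by
  by_cases h : DiffAt f (base z)
  · have := (h.hasFDerivAt.comp z (base (ι := ι) (P := P)).hasFDerivAt).fderiv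
    change D (f ∘ _) z v = _
    rw [this]; rfl
  · rw [fderiv_zero_of_not_differentiableAt h, fderiv_zero_of_not_differentiableAt (mt differentiableAt_comp_base.1 h)]
    rfl

@[simp] theorem partialD_inl_comp_base (f : (ι → ℝ) → ℝ) (z : (ι ⊕ P) → ℝ) (i : ι) :
    partialD (inl i) (fun x : (ι ⊕ P) → ℝ => f (base x)) z = partialD i f (base z) := by
  rw [partialD, fderiv_comp_base, partialD]
  congr 1
  ext k
  simp [Pi.single_apply]

@[simp] theorem partialD_inr_comp_base (f : (ι → ℝ) → ℝ) (z : (ι ⊕ P) → ℝ) (p : P) :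
    partialD (inr p) (fun x : (ι ⊕ P) → ℝ => f (base x)) z = 0 := by
  rw [partialD, fderiv_comp_base]
  rw [show base (single (inr p) 1 : (ι ⊕ P) → ℝ) = 0 by ext k; simp, map_zero]

theorem partialD_eq_zero {f : (ι → ℝ) → ℝ} {z : ι → ℝ} (h : ∀ᶠ x in 𝓝 z, f x = 0) (i : ι) : partialD i f z = 0 :=
  (partialD_congr (f' := fun _ => 0) h i).trans (by simp [partialD])

@[simp] theorem partialD_const (i : ι) (c : ℝ) (z : ι → ℝ) : partialD i (fun _ => c) z = 0 := by
  simp [partialD]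

/-- The warped product metric `h + ∑ exp(w_p)² dt_p²`. -/
def warpOf (h : (ι → ℝ) → Matrix ι ι ℝ) (w : P → (ι → ℝ) → ℝ) (z : (ι ⊕ P) → ℝ) : Matrix (ι ⊕ P) (ι ⊕ P) ℝ :=
  fromBlocks (h (base z)) 0 0 (diagonal fun p => exp (w p (base z)) ^ 2)

/-- The components of the gradient of `f`. -/
def gradOf (h : (ι → ℝ) → Matrix ι ι ℝ) (f : (ι → ℝ) → ℝ) (c : ι) (y : ι → ℝ) : ℝ :=
  ∑ d, (h y)⁻¹ c d * partialD d f y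

/-- The inner product of the gradients of `f` and `f'`. -/
def gradInner (h : (ι → ℝ) → Matrix ι ι ℝ) (f f' : (ι → ℝ) → ℝ) (y : ι → ℝ) : ℝ :=
  ∑ c, partialD c f y * gradOf h f' c y

/-- The Laplacian of `f`, as the divergence of the gradient. -/
def laplaceOf (h : (ι → ℝ) → Matrix ι ι ℝ) (f : (ι → ℝ) → ℝ) (y : ι → ℝ) : ℝ :=
  ∑ c, (partialD c (gradOf h f c) y + ∑ d, christoffel h c c d y * gradOf h f d y)

variable {h : (ι → ℝ) → Matrix ι ι ℝ} {w : P → (ι → ℝ) → ℝ} {z : (ι ⊕ P) → ℝ}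

theorem warpOf_inv (hdet : (h (base z)).det ≠ 0) : (warpOf h w z)⁻¹ = fromBlocks (h (base z))⁻¹ 0 0
      (diagonal fun p => (exp (w p (base z)) ^ 2)⁻¹) := by
  apply Matrix.inv_eq_right_inv
  rw [warpOf, Matrix.fromBlocks_multiply]
  simp only [Matrix.mul_zero, Matrix.zero_mul, add_zero, zero_add, Matrix.diagonal_mul_diagonal,
    mul_nonsing_inv _ (isUnit_iff_ne_zero.2 hdet)]
  rw [← Matrix.fromBlocks_one]
  congr 1
  ext p q
  rw [diagonal_apply, Matrix.one_apply]
  split_ifs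
  · exact mul_inv_cancel₀ (by positivity)
  · rfl

theorem partialD_exp_sq {f : (ι → ℝ) → ℝ} {y : ι → ℝ} (hf : DiffAt f y) (a : ι) :
    partialD a (fun x => exp (f x) ^ 2) y = 2 * exp (f y) ^ 2 * partialD a f y := by
  rw [partialD, (hf.hasFDerivAt.exp.pow 2).fderiv, partialD]
  simp
  ring

section
variable (hdet : (h (base z)).det ≠ 0)
  (hw : ∀ p, DiffAt (w p) (base z))

theorem partialD_warpOf_inl_inl (l : ι ⊕ P) (a b : ι) : partialD l (fun x => warpOf h w x (inl a) (inl b)) z =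
      Sum.elim (fun l => partialD l (fun y => h y a b) (base z)) (fun _ => 0) l := by
  rcases l with l | l
  · exact partialD_inl_comp_base (fun y => h y a b) z l
  · exact partialD_inr_comp_base (fun y => h y a b) z l

theorem partialD_warpOf_inl_inr (l : ι ⊕ P) (a : ι) (p : P) :
    partialD l (fun x => warpOf h w x (inl a) (inr p)) z = 0 := by
  simp [warpOf]

theorem partialD_warpOf_inr_inl (l : ι ⊕ P) (a : ι) (p : P) :
    partialD l (fun x => warpOf h w x (inr p) (inl a)) z = 0 := by
  simp [warpOf]

include hw in
theorem partialD_warpOf_inr_inr (l : ι ⊕ P) (p q : P) : partialD l (fun x => warpOf h w x (inr p) (inr q)) z =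
      if p = q then Sum.elim (fun l => 2 * exp (w p (base z)) ^ 2 *
        partialD l (w p) (base z)) (fun _ => 0) l else 0 := by
  by_cases hpq : p = q
  · subst hpq
    simp only [warpOf, fromBlocks_apply₂₂, Matrix.diagonal_apply_eq, if_true]
    rcases l with l | l
    · rw [partialD_inl_comp_base (fun y => exp (w p y) ^ 2), partialD_exp_sq (hw p)]
      rfl
    · exact partialD_inr_comp_base (fun y => exp (w p y) ^ 2) z l
  · simp [warpOf, hpq]

include hdet hw

/-- The table of Christoffel symbols. With base indices only they are those of `h`. The other ones
that survive contain one fibre index twice: `-exp(2 w_p) ∇^c w_p` with upper base index `c`, and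
`∂_a w_p` with lower base index `a`. -/
theorem christoffel_warpOf_inl_inl_inl (c a b : ι) : christoffel (warpOf h w) (inl c) (inl a) (inl b) z =
      christoffel h c a b (base z) := by
  simp [christoffel, Fintype.sum_sum_type, warpOf_inv hdet, partialD_warpOf_inl_inl]

theorem christoffel_warpOf_inl_inl_inr (c a : ι) (p : P) : christoffel (warpOf h w) (inl c) (inl a) (inr p) z = 0 := by
  simp [christoffel, Fintype.sum_sum_type, warpOf_inv hdet, partialD_warpOf_inl_inl,
    partialD_warpOf_inl_inr, partialD_warpOf_inr_inl]

theorem christoffel_warpOf_inl_inr_inl (c a : ι) (p : P) : christoffel (warpOf h w) (inl c) (inr p) (inl a) z = 0 := by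
  simp [christoffel, Fintype.sum_sum_type, warpOf_inv hdet, partialD_warpOf_inl_inl,
    partialD_warpOf_inl_inr, partialD_warpOf_inr_inl]

theorem christoffel_warpOf_inl_inr_inr (c : ι) (p q : P) : christoffel (warpOf h w) (inl c) (inr p) (inr q) z =
      if p = q then - (exp (w p (base z)) ^ 2 * gradOf h (w p) c (base z))
      else 0 := by
  simp only [christoffel, Fintype.sum_sum_type, warpOf_inv hdet, partialD_warpOf_inr_inl,
    partialD_warpOf_inr_inr hw, fromBlocks_apply₁₁, Matrix.fromBlocks_apply₁₂, gradOf]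
  split_ifs with hpq
  · simp only [Sum.elim_inl, Matrix.zero_apply, zero_mul, sum_const_zero, add_zero, mul_sum, ← sum_neg_distrib]
    exact sum_congr rfl fun l _ => by ring
  · simp

theorem christoffel_warpOf_inr_inl_inl (a b : ι) (p : P) : christoffel (warpOf h w) (inr p) (inl a) (inl b) z = 0 := by
  simp [christoffel, Fintype.sum_sum_type, warpOf_inv hdet, partialD_warpOf_inl_inl, partialD_warpOf_inl_inr]

theorem christoffel_warpOf_inr_inl_inr (a : ι) (p q : P) : christoffel (warpOf h w) (inr p) (inl a) (inr q) z =
      if p = q then partialD a (w p) (base z) else 0 := by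
  simp only [christoffel, Fintype.sum_sum_type, warpOf_inv hdet, partialD_warpOf_inl_inr,
    partialD_warpOf_inr_inr hw, Matrix.fromBlocks_apply₂₁, fromBlocks_apply₂₂,
    Matrix.zero_apply, zero_mul, sum_const_zero, zero_add, Sum.elim_inl,
    diagonal_apply, ite_mul, sum_ite_eq, Finset.mem_univ, if_true]
  by_cases hpq : p = q
  · subst hpq
    have : exp (w p (base z)) ≠ 0 := (Real.exp_pos _).ne'
    simp
    field_simp
  · simp [hpq, Ne.symm hpq]

theorem christoffel_warpOf_inr_inr_inl (a : ι) (p q : P) : christoffel (warpOf h w) (inr p) (inr q) (inl a) z =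
      if p = q then partialD a (w p) (base z) else 0 := by
  rw [← christoffel_warpOf_inr_inl_inr hdet hw a p q]
  simp only [christoffel, Fintype.sum_sum_type, partialD_warpOf_inl_inr,
    partialD_warpOf_inr_inl, partialD_warpOf_inr_inr hw, partialD_warpOf_inl_inl]
  simp

theorem christoffel_warpOf_inr_inr_inr (p q r : P) : christoffel (warpOf h w) (inr p) (inr q) (inr r) z = 0 := by
  simp [christoffel, Fintype.sum_sum_type, warpOf_inv hdet, partialD_warpOf_inr_inl, partialD_warpOf_inr_inr hw]

end

theorem partialD_add {f f' : (ι → ℝ) → ℝ} {y : ι → ℝ} (hf : DiffAt f y)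
    (hf' : DiffAt f' y) (i : ι) :
    partialD i (fun x => f x + f' x) y = partialD i f y + partialD i f' y := by
  rw [partialD, fderiv_fun_add hf hf']; rfl

theorem partialD_neg {f : (ι → ℝ) → ℝ} {y : ι → ℝ} (i : ι) : partialD i (fun x => - f x) y = - partialD i f y := by
  rw [partialD, fderiv_fun_neg]; rfl

theorem partialD_mul {f f' : (ι → ℝ) → ℝ} {y : ι → ℝ} (hf : DiffAt f y)
    (hf' : DiffAt f' y) (i : ι) :
    partialD i (fun x => f x * f' x) y = partialD i f y * f' y + f y * partialD i f' y := by
  rw [partialD, fderiv_fun_mul hf hf', partialD, partialD]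
  simp only [add_apply, smul_apply, smul_eq_mul]
  ring

theorem partialD_sum {κ : Type*} {s : Finset κ} {f : κ → (ι → ℝ) → ℝ} {y : ι → ℝ}
    (hf : ∀ k ∈ s, DiffAt (f k) y) (i : ι) :
    partialD i (fun x => ∑ k ∈ s, f k x) y = ∑ k ∈ s, partialD i (f k) y := by
  rw [partialD, fderiv_fun_sum hf, sum_apply]; rfl

theorem partialD_sum_mul {κ : Type*} {s : Finset κ} {f f' : κ → (ι → ℝ) → ℝ} {y : ι → ℝ}
    (hf : ∀ k, DiffAt (f k) y) (hf' : ∀ k, DiffAt (f' k) y) (i : ι) :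
    partialD i (fun x => ∑ k ∈ s, f k x * f' k x) y =
      ∑ k ∈ s, (partialD i (f k) y * f' k y + f k y * partialD i (f' k) y) := by
  rw [partialD_sum (f := fun k x => f k x * f' k x) fun k _ => (hf k).mul (hf' k)]
  exact sum_congr rfl fun k _ => partialD_mul (hf k) (hf' k) i

theorem contDiffAt_gradOf {y : ι → ℝ} (hm : IsMetricAt h y) {f : (ι → ℝ) → ℝ}
    (hf : SmoothAt f y) (c : ι) : SmoothAt (gradOf h f c) y :=
  ContDiffAt.sum fun d _ => (hm.inv_smooth c d).mul (contDiffAt_partialD hf d)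

theorem christoffel_lower {y : ι → ℝ} (hm : IsMetricAt h y) (a b d : ι) :
    ∑ e, h y e d * christoffel h e a b y = 1 / 2 * (partialD a (fun x => h x b d) y +
      partialD b (fun x => h x a d) y - partialD d (fun x => h x a b) y) := by
  have := hm.koszul (single a 1) (single b 1) (single d 1)
  rw [formOf_apply, hm.fderiv_formOf_apply, hm.fderiv_formOf_apply, hm.fderiv_formOf_apply] at this
  simpa [chrOf_single, Pi.single_apply] using this

theorem IsMetricAt.symm_near {y : ι → ℝ} (hm : IsMetricAt h y) (a b : ι) :
    (fun x => h x a b) =ᶠ[𝓝 y] fun x => h x b a :=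
  hm.posDef_near.mono fun w hw => by
    have := hw.isHermitian.apply a b; simpa using this.symm

/-- The metric is parallel. -/
theorem partialD_metric_eq {y : ι → ℝ} (hm : IsMetricAt h y) (a b c : ι) : partialD c (fun x => h x a b) y =
    ∑ e, h y e b * christoffel h e c a y + ∑ e, h y e a * christoffel h e c b y := by
  rw [christoffel_lower hm, christoffel_lower hm, partialD_congr (hm.symm_near b a) c]
  ring

/-- Differentiate `h h⁻¹ = 1`. -/
theorem partialD_inv {y : ι → ℝ} (hm : IsMetricAt h y) (b d c : ι) : partialD c (fun x => (h x)⁻¹ b d) y =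
      - ∑ a, ∑ e, (h y)⁻¹ b a * partialD c (fun x => h x a e) y * (h y)⁻¹ e d := by
  set A : Matrix ι ι ℝ := of fun a e => partialD c (fun x => h x a e) y with hA
  set B : Matrix ι ι ℝ := of fun a e => partialD c (fun x => (h x)⁻¹ a e) y with hB
  have hdet : IsUnit (h y).det := hm.isUnit_det
  have key : A * (h y)⁻¹ + h y * B = 0 := by
    ext a d
    have h1 : (fun x => ∑ e, h x a e * (h x)⁻¹ e d) =ᶠ[𝓝 y] fun _ => (1 : Matrix ι ι ℝ) a d :=
      hm.posDef_near.mono fun x hx => by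
        change ∑ e, h x a e * (h x)⁻¹ e d = (1 : Matrix ι ι ℝ) a d
        rw [← Matrix.mul_apply, mul_nonsing_inv _ (isUnit_iff_ne_zero.2 hx.det_pos.ne')]
    have h2 := partialD_congr h1 c
    rw [partialD_const, partialD_sum_mul (f := fun e x => h x a e) (f' := fun e x => (h x)⁻¹ e d)
      (fun e => (hm.smooth a e).diffAt) fun e => (hm.inv_smooth e d).diffAt] at h2
    rw [Matrix.add_apply, Matrix.mul_apply, Matrix.mul_apply, ← sum_add_distrib, Matrix.zero_apply, ← h2]
    rfl
  have h3 : B = -((h y)⁻¹ * A * (h y)⁻¹) := by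
    rw [← Matrix.nonsing_inv_mul_cancel_left (A := h y) B hdet, eq_neg_of_add_eq_zero_right key, Matrix.mul_neg,
      Matrix.mul_assoc]
  rw [show partialD c (fun x => (h x)⁻¹ b d) y = B b d from rfl, h3, Matrix.neg_apply, Matrix.mul_apply]
  simp only [Matrix.mul_apply, sum_mul]
  rw [sum_comm]
  rfl

/-- The metric is parallel, hence so is its inverse. -/
theorem partialD_inv_eq {y : ι → ℝ} (hm : IsMetricAt h y) (b d c : ι) : partialD c (fun x => (h x)⁻¹ b d) y =
      - ∑ a, (h y)⁻¹ b a * christoffel h d c a y - ∑ e, christoffel h b c e y * (h y)⁻¹ e d := by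
  have hdet : IsUnit (h y).det := hm.isUnit_det
  have hs : ∀ a b, h y a b = h y b a := fun a b => (hm.symm_near a b).self_of_nhds
  set G : Matrix ι ι ℝ := of fun e a => christoffel h e c a y with hG
  set A : Matrix ι ι ℝ := of fun a e => partialD c (fun x => h x a e) y with hA
  have e1 : A = G.transpose * h y + h y * G := by
    ext a e
    rw [hA, of_apply, partialD_metric_eq hm, Matrix.add_apply, Matrix.mul_apply, Matrix.mul_apply]
    congr 1
    · exact sum_congr rfl fun f _ => mul_comm _ _
    · exact sum_congr rfl fun f _ => by rw [hs]; rfl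
  have e2 : ∑ a, ∑ e, (h y)⁻¹ b a * partialD c (fun x => h x a e) y * (h y)⁻¹ e d = ((h y)⁻¹ * A * (h y)⁻¹) b d := by
    rw [Matrix.mul_apply]
    simp only [Matrix.mul_apply, sum_mul]
    rw [sum_comm]
    rfl
  rw [partialD_inv hm, e2, e1, Matrix.mul_add, Matrix.add_mul, ← Matrix.mul_assoc,
    Matrix.mul_assoc _ (h y) (h y)⁻¹, mul_nonsing_inv _ hdet, Matrix.mul_one,
    ← Matrix.mul_assoc, nonsing_inv_mul _ hdet, Matrix.one_mul, Matrix.add_apply,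
    Matrix.mul_apply, Matrix.mul_apply, neg_add]
  rfl

theorem sum_rotate {κ : Type*} [Fintype κ] (f : ι → ι → κ → ℝ) : ∑ a, ∑ b, ∑ p, f a b p = ∑ p, ∑ a, ∑ b, f a b p := by
  rw [sum_congr rfl fun a _ => sum_comm, sum_comm]

/-- The Laplacian is the trace of the Hessian. -/
theorem sum_hessian_eq_laplaceOf {y : ι → ℝ} (hm : IsMetricAt h y) {f : (ι → ℝ) → ℝ}
    (hf : SmoothAt f y) :
    ∑ a, ∑ b, (h y)⁻¹ a b * (partialD b (partialD a f) y -
      ∑ d, christoffel h d a b y * partialD d f y) = laplaceOf h f y := by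
  have hsymm : ∀ a b, partialD b (partialD a f) y = partialD a (partialD b f) y := by
    intro a b
    have h2 : IsSymmSndFDerivAt ℝ f y := hf.isSymmSndFDerivAt two_le_smoothness
    have hd := hf.smooth_fderiv.diffAt.hasFDerivAt
    have h3 : ∀ a b, partialD b (partialD a f) y = D (D f) y (single b 1) (single a 1) := by
      intro a b
      change D (fun x => D f x (single a 1)) y (single b 1) = _
      rw [(hd.clm_apply (hasFDerivAt_const (single a 1) y)).fderiv]; simp
    rw [h3, h3, h2]
  -- Of the two Christoffel terms in the derivative of `h⁻¹`, one gives the Hessian correction; the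
  -- other cancels the Christoffel term of the divergence.
  have e1 : ∀ c, partialD c (gradOf h f c) y = ∑ d, ((h y)⁻¹ c d * partialD c (partialD d f) y
      - ∑ a, (h y)⁻¹ c a * christoffel h d c a y * partialD d f y
      - ∑ e, christoffel h c c e y * ((h y)⁻¹ e d * partialD d f y)) := by
    intro c
    unfold gradOf
    rw [partialD_sum_mul (f := fun d x => (h x)⁻¹ c d) (f' := fun d => partialD d f)
      (fun d => (hm.inv_smooth c d).diffAt)
      (fun d => (contDiffAt_partialD hf d).diffAt)]
    refine sum_congr rfl fun d _ => ?_
    rw [partialD_inv_eq hm, sub_mul, neg_mul, sum_mul, sum_mul]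
    simp only [mul_assoc]
    ring
  have e2 : ∀ c, ∑ d, christoffel h c c d y * gradOf h f d y =
      ∑ d, ∑ e, christoffel h c c e y * ((h y)⁻¹ e d * partialD d f y) := by
    intro c
    simp only [gradOf, mul_sum]
    rw [sum_comm]
  unfold laplaceOf
  refine sum_congr rfl fun a _ => ?_
  rw [e1, e2, ← sum_add_distrib]
  simp only [sub_add_cancel, mul_sub, sum_sub_distrib, mul_sum]
  congr 1
  · exact sum_congr rfl fun b _ => by rw [hsymm]
  · rw [sum_comm]
    exact sum_congr rfl fun d _ => sum_congr rfl fun b _ => by ring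

variable (hm : IsMetricAt h (base z))
  (hw : ∀ᶠ x in 𝓝 (base z), ∀ p, SmoothAt (w p) x)
include hm hw

theorem eventually_warpOf : ∀ᶠ x in 𝓝 z, (h (base x)).det ≠ 0 ∧ ∀ p, DiffAt (w p) (base x) := by
  have hc : ContinuousAt (base (ι := ι) (P := P)) z := base.continuous.continuousAt
  filter_upwards [hc.eventually hm.posDef_near, hc.eventually hw] with x h1 h2
    using ⟨h1.det_pos.ne', fun p => (h2 p).diffAt⟩

/-- Each fibre subtracts `Hess w_p + dw_p ⊗ dw_p`, which is the Hessian of `exp w_p` divided by `exp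
w_p`. -/
theorem ricciCurvature_warpOf_inl_inl (a b : ι) :
    ricciCurvature (warpOf h w) (inl a) (inl b) z = ricciCurvature h a b (base z) +
      ∑ p, (- partialD b (partialD a (w p)) (base z) + ∑ d, christoffel h d a b (base z) * partialD d (w p) (base z)
        - partialD a (w p) (base z) * partialD b (w p) (base z)) := by
  have hgood := eventually_warpOf hm hw
  obtain ⟨hdet, hwd⟩ := hgood.self_of_nhds
  have e1 : ∀ c a b d, partialD (inl d) (christoffel (warpOf h w) (inl c) (inl a)
      (inl b)) z = partialD d (christoffel h c a b) (base z) := by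
    intro c a b d
    rw [← partialD_inl_comp_base]
    exact partialD_congr (hgood.mono fun x hx => christoffel_warpOf_inl_inl_inl hx.1 hx.2 c a b) _
  have e2 : ∀ p, partialD (inr p) (christoffel (warpOf h w) (inr p) (inl a) (inl b)) z = 0 := fun p =>
    partialD_eq_zero (hgood.mono fun x hx => christoffel_warpOf_inr_inl_inl hx.1 hx.2 a b p) _
  have e3 : ∀ p, partialD (inl b) (christoffel (warpOf h w) (inr p) (inl a)
      (inr p)) z = partialD b (partialD a (w p)) (base z) := by
    intro p
    rw [← partialD_inl_comp_base]
    refine partialD_congr (hgood.mono fun x hx => ?_) _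
    rw [christoffel_warpOf_inr_inl_inr hx.1 hx.2, if_pos rfl]
  simp only [ricciCurvature, Fintype.sum_sum_type, e1, e2, e3,
    christoffel_warpOf_inl_inl_inl hdet hwd, christoffel_warpOf_inl_inl_inr hdet hwd,
    christoffel_warpOf_inr_inl_inl hdet hwd,
    christoffel_warpOf_inr_inl_inr hdet hwd, christoffel_warpOf_inr_inr_inl hdet hwd,
    christoffel_warpOf_inr_inr_inr hdet hwd]
  congr 1
  · simp
  · refine sum_congr rfl fun p _ => ?_
    simp only [if_true, mul_zero, zero_mul, sub_zero, ite_mul, mul_ite, zero_sub]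
    simp [sum_ite_eq', mul_comm]
    ring

theorem ricciCurvature_warpOf_inr_inr (p : P) : ricciCurvature (warpOf h w) (inr p) (inr p) z =
      - (exp (w p (base z)) ^ 2 * (laplaceOf h (w p) (base z) + ∑ q, gradInner h (w q) (w p) (base z))) := by
  have hgood := eventually_warpOf hm hw
  obtain ⟨hdet, hwd⟩ := hgood.self_of_nhds
  have hs := hw.self_of_nhds p
  have e1 : ∀ c, partialD (inl c) (christoffel (warpOf h w) (inl c) (inr p)
      (inr p)) z = - (2 * exp (w p (base z)) ^ 2 * partialD c (w p) (base z) *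
        gradOf h (w p) c (base z) + exp (w p (base z)) ^ 2 *
        partialD c (gradOf h (w p) c) (base z)) := by
    intro c
    have hd1 : DiffAt (fun y => exp (w p y) ^ 2) (base z) :=
      (hwd p).exp.pow 2
    have hd2 : DiffAt (gradOf h (w p) c) (base z) :=
      (contDiffAt_gradOf hm hs c).diffAt
    rw [← partialD_exp_sq (hwd p), ← partialD_mul hd1 hd2, ← partialD_neg, ← partialD_inl_comp_base]
    refine partialD_congr (hgood.mono fun x hx => ?_) _
    rw [christoffel_warpOf_inl_inr_inr hx.1 hx.2, if_pos rfl]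
  have e2 : ∀ q q' r, partialD q' (christoffel (warpOf h w) (inr q) (inr p) (inr r)) z = 0 := fun _ _ _ =>
    partialD_eq_zero (hgood.mono fun x hx => christoffel_warpOf_inr_inr_inr hx.1 hx.2 _ _ _) _
  have e4 : ∀ c, partialD (inr p) (christoffel (warpOf h w) (inl c) (inr p) (inl c)) z = 0 := fun _ =>
    partialD_eq_zero (hgood.mono fun x hx => christoffel_warpOf_inl_inr_inl hx.1 hx.2 _ _ _) _
  simp only [ricciCurvature, Fintype.sum_sum_type, e1, e2, e4,
    christoffel_warpOf_inl_inl_inl hdet hwd, christoffel_warpOf_inl_inl_inr hdet hwd,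
    christoffel_warpOf_inl_inr_inl hdet hwd, christoffel_warpOf_inl_inr_inr hdet hwd,
    christoffel_warpOf_inr_inr_inl hdet hwd,
    christoffel_warpOf_inr_inr_inr hdet hwd]
  simp only [if_true, mul_zero, zero_mul, sub_zero, ite_mul, mul_ite, zero_sub, add_zero, zero_add, sum_const_zero,
    sum_sub_distrib, sum_add_distrib]
  simp only [laplaceOf, gradInner, sum_add_distrib, mul_add, mul_sum, neg_add, ← sum_neg_distrib]
  set E := exp (w p (base z)) ^ 2
  set y := base z
  have t1 : ∀ x, (∑ q, -(if q = p then if p = q then -(E * gradOf h (w p) x y) *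
      partialD x (w q) y else 0 else 0)) = E * gradOf h (w p) x y * partialD x (w p) y := fun x => by
    rw [Finset.sum_eq_single p (fun q _ hq => by simp [hq]) (by simp)]
    simp
  have t2 : (∑ q, ∑ x, if p = q then if q = p then partialD x (w q) y * -(E * gradOf h (w p) x y) else 0 else 0) =
      ∑ x, partialD x (w p) y * -(E * gradOf h (w p) x y) := by
    rw [Finset.sum_eq_single p (fun q _ hq => by simp [hq]) (by simp)]
    simp
  rw [t2, sum_congr rfl fun x _ => t1 x]
  -- Differentiating `exp(2 w_p)` gives a multiple of `|∇w_p|²`, which the two products of mixed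
  -- Christoffel symbols compensate.
  have t3 : ∑ x, -(2 * E * partialD x (w p) y * gradOf h (w p) x y) + ∑ x, E * gradOf h (w p) x y * partialD x (w p) y -
      ∑ x, partialD x (w p) y * -(E * gradOf h (w p) x y) = 0 := by
    rw [← sum_add_distrib, ← sum_sub_distrib]
    exact sum_eq_zero fun x _ => by ring
  simp only [mul_neg, mul_left_comm _ E] at t3 ⊢
  linarith

/-- The scalar curvature of a warped product. -/
theorem scalarCurvature_warpOf : scalarCurvature (warpOf h w) z =
    scalarCurvature h (base z) - 2 * ∑ p, laplaceOf h (w p) (base z) - ∑ p, gradInner h (w p) (w p) (base z)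
      - ∑ p, ∑ q, gradInner h (w q) (w p) (base z) := by
  have hdet := hm.posDef.det_pos.ne'
  set y := base z with hy
  have e1 : ∀ p, (exp (w p y) ^ 2)⁻¹ * -(exp (w p y) ^ 2 * (laplaceOf h (w p) y +
        ∑ q, gradInner h (w q) (w p) y)) = -(laplaceOf h (w p) y +
        ∑ q, gradInner h (w q) (w p) y) := by
    intro p
    have : exp (w p y) ≠ 0 := (Real.exp_pos _).ne'
    field_simp
  have e2 : scalarCurvature (warpOf h w) z = ∑ a, ∑ b, (h y)⁻¹ a b * (ricciCurvature h a b y +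
      ∑ p, (- partialD b (partialD a (w p)) y + ∑ d, christoffel h d a b y * partialD d (w p) y
        - partialD a (w p) y * partialD b (w p) y)) +
      ∑ p, -(laplaceOf h (w p) y + ∑ q, gradInner h (w q) (w p) y) := by
    simp only [scalarCurvature, Fintype.sum_sum_type, warpOf_inv hdet, fromBlocks_apply₁₁,
      Matrix.fromBlocks_apply₁₂, Matrix.fromBlocks_apply₂₁, fromBlocks_apply₂₂,
      Matrix.zero_apply, zero_mul, sum_const_zero, add_zero, zero_add,
      diagonal_apply, ite_mul, sum_ite_eq, Finset.mem_univ, if_true,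
      ricciCurvature_warpOf_inl_inl hm hw, ricciCurvature_warpOf_inr_inr hm hw, ← hy, e1]
  have e3 : ∑ a, ∑ b, (h y)⁻¹ a b * ∑ p, (- partialD b (partialD a (w p)) y +
      ∑ d, christoffel h d a b y * partialD d (w p) y - partialD a (w p) y * partialD b (w p) y) =
      ∑ p, (- laplaceOf h (w p) y - gradInner h (w p) (w p) y) := by
    calc _ = ∑ p, ∑ a, ∑ b, (h y)⁻¹ a b * (- partialD b (partialD a (w p)) y +
      ∑ d, christoffel h d a b y * partialD d (w p) y - partialD a (w p) y * partialD b (w p) y) := by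
          simp only [mul_sum]
          exact sum_rotate _
      _ = _ := by
          refine sum_congr rfl fun p _ => ?_
          rw [← sum_hessian_eq_laplaceOf hm (hw.self_of_nhds p)]
          simp only [gradInner, gradOf, mul_sum, ← sum_neg_distrib, ← sum_sub_distrib]
          refine sum_congr rfl fun a _ => sum_congr rfl fun b _ => ?_
          ring_nf
  rw [e2]
  simp only [mul_add, sum_add_distrib] at e3 ⊢
  rw [e3]
  simp only [scalarCurvature, sum_sub_distrib, sum_neg_distrib, sum_add_distrib]
  ring

end WarpedProduct

/-! ### Metrics in Fermi coordinates along a hypersurface. -/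

section FermiMetric

variable {α β : Type} [Fintype α] [DecidableEq α] [Fintype β] [DecidableEq β]

/-- The coordinates `emb a`, together with the normal coordinate `s₀`, are all coordinates. -/
structure IsHyperplane (emb : α → β) (s₀ : β) : Prop where
  inj : Injective emb
  ne : ∀ a, emb a ≠ s₀
  cover : ∀ b, b = s₀ ∨ b ∈ range emb

variable {emb : α → β} {s₀ : β}

namespace IsHyperplane

theorem sum_eq (H : IsHyperplane emb s₀) (f : β → ℝ) : ∑ b, f b = f s₀ + ∑ a, f (emb a) := by
  have h1 : (Finset.univ : Finset β) = insert s₀ (Finset.univ.image emb) := by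
    ext b
    simp only [Finset.mem_univ, Finset.mem_insert, Finset.mem_image, true_and, true_iff]
    exact H.cover b
  rw [h1, sum_insert (by simpa using H.ne), Finset.sum_image fun a _ b _ h => H.inj h]

theorem notMem_range (H : IsHyperplane emb s₀) {b : β} : b ∉ range emb ↔ b = s₀ := by
  refine ⟨fun h => (H.cover b).resolve_right h, ?_⟩
  rintro rfl ⟨a, ha⟩
  exact H.ne a ha

theorem plane_iff (H : IsHyperplane emb s₀) {x : β → ℝ} : (∀ b ∉ range emb, x b = 0) ↔ x s₀ = 0 := by
  simp only [H.notMem_range, forall_eq]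

end IsHyperplane

/-- Extension of coordinates by zero. -/
def incl (emb : α → β) : (α → ℝ) →L[ℝ] β → ℝ :=
  LinearMap.toContinuousLinearMap (Function.ExtendByZero.linearMap ℝ emb)

theorem incl_emb (H : IsHyperplane emb s₀) (y : α → ℝ) (a : α) : incl emb y (emb a) = y a :=
  H.inj.extend_apply y 0 a

theorem incl_normal (H : IsHyperplane emb s₀) (y : α → ℝ) : incl emb y s₀ = 0 :=
  Function.extend_apply' _ _ _ fun ⟨a, ha⟩ => H.ne a ha

theorem incl_single (H : IsHyperplane emb s₀) (a : α) : incl emb (single a 1) = single (emb a) 1 := by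
  ext b
  rcases H.cover b with rfl | ⟨c, rfl⟩
  · rw [incl_normal H, Pi.single_eq_of_ne (H.ne a).symm]
  · rw [incl_emb H]
    by_cases h : c = a
    · subst h; simp
    · rw [Pi.single_eq_of_ne h, Pi.single_eq_of_ne (H.inj.ne h)]

theorem partialD_comp_incl (H : IsHyperplane emb s₀) {f : (β → ℝ) → ℝ} {y : α → ℝ}
    (hf : DiffAt f (incl emb y)) (a : α) :
    partialD a (fun x => f (incl emb x)) y = partialD (emb a) f (incl emb y) := by
  have := (hf.hasFDerivAt.comp y (incl emb).hasFDerivAt).fderiv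
  change D (f ∘ _) y _ = _
  rw [this, ContinuousLinearMap.comp_apply, incl_single H, partialD]

theorem partialD_emb_eq_zero (H : IsHyperplane emb s₀) {f : (β → ℝ) → ℝ} {x : β → ℝ}
    (hx : x s₀ = 0) {c : ℝ} (hf : ∀ᶠ w in 𝓝 x, w s₀ = 0 → f w = c) (a : α) :
    partialD (emb a) f x = 0 := by
  have h1 := fderiv_eq_zero_of_plane (emb := emb) (F := fun w => f w - c)
    (v := single (emb a) 1) (H.plane_iff.2 hx)
    (H.plane_iff.2 (Pi.single_eq_of_ne (H.ne a).symm _))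
    (hf.mono fun w hw hwp => sub_eq_zero.2 (hw (H.plane_iff.1 hwp)))
  rwa [fderiv_sub_const] at h1

/-- In the coordinates, the hypersurface `x_{s₀} = 0` has unit normal `∂_{s₀}`, and the curves in
the direction of `∂_{s₀}` are geodesics to first order. -/
structure IsFermiAt (g : (β → ℝ) → Matrix β β ℝ) (emb : α → β) (s₀ : β) (y : α → ℝ) : Prop where
  hyper : IsHyperplane emb s₀
  metric : IsMetricAt g (incl emb y)
  unit : ∀ᶠ x in 𝓝 (incl emb y), x s₀ = 0 → g x s₀ s₀ = 1
  normal : ∀ᶠ x in 𝓝 (incl emb y), x s₀ = 0 → ∀ a, g x s₀ (emb a) = 0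
  unit' : ∀ᶠ x in 𝓝 (incl emb y), x s₀ = 0 → partialD s₀ (fun w => g w s₀ s₀) x = 0
  normal' : ∀ᶠ x in 𝓝 (incl emb y), x s₀ = 0 → ∀ a, partialD s₀ (fun w => g w s₀ (emb a)) x = 0

/-- The metric of the hypersurface. -/
def restr (g : (β → ℝ) → Matrix β β ℝ) (emb : α → β) (y : α → ℝ) : Matrix α α ℝ :=
  (g (incl emb y)).submatrix emb emb

/-- The normal derivative of the metric along the hypersurface. -/
def nDeriv (g : (β → ℝ) → Matrix β β ℝ) (emb : α → β) (s₀ : β) (y : α → ℝ) : Matrix α α ℝ :=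
  of fun a b => partialD s₀ (fun x => g x (emb a) (emb b)) (incl emb y)

/-- The second normal derivative of the metric along the hypersurface. -/
def nDeriv2 (g : (β → ℝ) → Matrix β β ℝ) (emb : α → β) (s₀ : β) (y : α → ℝ) : Matrix α α ℝ :=
  of fun a b => partialD s₀ (partialD s₀ fun x => g x (emb a) (emb b)) (incl emb y)

theorem IsMetricAt.restr (H : IsHyperplane emb s₀) {g : (β → ℝ) → Matrix β β ℝ} {y : α → ℝ}
    (hg : IsMetricAt g (incl emb y)) : IsMetricAt (restr g emb) y := by
  have hc : ContinuousAt (incl emb) y := (incl emb).continuous.continuousAt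
  constructor
  · filter_upwards [hc.eventually hg.smooth_near] with w hw a b
    exact (hw (emb a) (emb b)).comp w (incl emb).contDiff.contDiffAt
  · filter_upwards [hc.eventually hg.posDef_near] with w hw
    exact hw.submatrix H.inj

namespace IsFermiAt

variable {g : (β → ℝ) → Matrix β β ℝ} {y : α → ℝ}

local notation "Y" => incl emb y

theorem eventually (h : IsFermiAt g emb s₀ y) : ∀ᶠ w in 𝓝 y, IsFermiAt g emb s₀ w := by
  have hc : ContinuousAt (incl emb) y := (incl emb).continuous.continuousAt
  filter_upwards [hc.eventually h.metric.eventually, hc.eventually h.unit.eventually_nhds,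
    hc.eventually h.normal.eventually_nhds,
    hc.eventually h.unit'.eventually_nhds,
    hc.eventually h.normal'.eventually_nhds] with w h1 h2 h3 h4 h5
    using ⟨h.hyper, h1, h2, h3, h4, h5⟩

theorem hyper_metric (h : IsFermiAt g emb s₀ y) : IsMetricAt (restr g emb) y :=
  h.metric.restr h.hyper

variable (h : IsFermiAt g emb s₀ y)
include h

theorem g_ss : g Y s₀ s₀ = 1 := h.unit.self_of_nhds (incl_normal h.hyper y)

theorem g_sa (a : α) : g Y s₀ (emb a) = 0 :=
  h.normal.self_of_nhds (incl_normal h.hyper y) a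

theorem g_as (a : α) : g Y (emb a) s₀ = 0 := by
  have := (h.metric.symm_near (emb a) s₀).self_of_nhds
  exact this.trans (h.g_sa a)

theorem inv_s (b : β) : (g Y)⁻¹ s₀ b = (1 : Matrix β β ℝ) s₀ b := by
  rw [← mul_nonsing_inv _ h.metric.isUnit_det, Matrix.mul_apply]
  simp [h.hyper.sum_eq, h.g_ss, h.g_sa]

theorem inv_ss : (g Y)⁻¹ s₀ s₀ = 1 := (h.inv_s s₀).trans (Matrix.one_apply_eq _)

theorem inv_sa (a : α) : (g Y)⁻¹ s₀ (emb a) = 0 :=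
  (h.inv_s _).trans (Matrix.one_apply_ne (h.hyper.ne a).symm)

theorem inv_as (a : α) : (g Y)⁻¹ (emb a) s₀ = 0 := by
  rw [h.metric.inv_comm, h.inv_sa]

theorem inv_ab (a b : α) : (g Y)⁻¹ (emb a) (emb b) = (restr g emb y)⁻¹ a b := by
  rw [Matrix.inv_eq_right_inv (A := restr g emb y) (B := ((g Y)⁻¹).submatrix emb emb), submatrix_apply]
  ext a b
  have e := congrFun (congrFun (mul_nonsing_inv _ h.metric.isUnit_det) (emb a)) (emb b)
  rw [Matrix.mul_apply, h.hyper.sum_eq, h.g_as, zero_mul, zero_add] at e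
  rw [Matrix.mul_apply]
  simp only [restr, submatrix_apply]
  rw [e, Matrix.one_apply, Matrix.one_apply]
  simp only [h.hyper.inj.eq_iff]

theorem d_s_ss : partialD s₀ (fun w => g w s₀ s₀) Y = 0 :=
  h.unit'.self_of_nhds (incl_normal h.hyper y)

theorem d_s_sa (a : α) : partialD s₀ (fun w => g w s₀ (emb a)) Y = 0 :=
  h.normal'.self_of_nhds (incl_normal h.hyper y) a

theorem d_s_as (a : α) : partialD s₀ (fun w => g w (emb a) s₀) Y = 0 := by
  rw [partialD_congr (h.metric.symm_near (emb a) s₀), h.d_s_sa]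

theorem d_c_ss (c : α) : partialD (emb c) (fun w => g w s₀ s₀) Y = 0 :=
  partialD_emb_eq_zero h.hyper (incl_normal h.hyper y) h.unit c

theorem d_c_sa (c a : α) : partialD (emb c) (fun w => g w s₀ (emb a)) Y = 0 :=
  partialD_emb_eq_zero h.hyper (incl_normal h.hyper y) (h.normal.mono fun _ hx hp => hx hp a) c

theorem d_c_as (c a : α) : partialD (emb c) (fun w => g w (emb a) s₀) Y = 0 := by
  rw [partialD_congr (h.metric.symm_near (emb a) s₀), h.d_c_sa]

theorem d_c_ab (c a b : α) : partialD (emb c) (fun w => g w (emb a) (emb b)) Y =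
    partialD c (fun x => restr g emb x a b) y :=
  (partialD_comp_incl h.hyper ((h.metric.smooth _ _).diffAt) c).symm

theorem d_s_ab (a b : α) : partialD s₀ (fun w => g w (emb a) (emb b)) Y = nDeriv g emb s₀ y a b := rfl

theorem chr_cab (c a b : α) : christoffel g (emb c) (emb a) (emb b) Y = christoffel (restr g emb) c a b y := by
  simp only [christoffel, h.hyper.sum_eq, h.inv_as, h.inv_ab, h.d_c_ab, zero_mul, zero_add]

theorem chr_sab (a b : α) : christoffel g s₀ (emb a) (emb b) Y = - (1 / 2) * nDeriv g emb s₀ y a b := by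
  simp only [christoffel, h.hyper.sum_eq, h.inv_ss, h.inv_sa, h.d_c_as, h.d_s_ab, zero_mul, sum_const_zero, add_zero]
  ring

theorem chr_cas (c a : α) : christoffel g (emb c) (emb a) s₀ Y =
    1 / 2 * ∑ d, (restr g emb y)⁻¹ c d * nDeriv g emb s₀ y a d := by
  simp only [christoffel, h.hyper.sum_eq, h.inv_as, h.inv_ab, h.d_c_sa, h.d_c_as, h.d_s_ab,
    zero_mul, zero_add, sub_zero]

theorem chr_csa (c a : α) : christoffel g (emb c) s₀ (emb a) Y =
    1 / 2 * ∑ d, (restr g emb y)⁻¹ c d * nDeriv g emb s₀ y a d := by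
  simp only [christoffel, h.hyper.sum_eq, h.inv_as, h.inv_ab, h.d_c_sa, h.d_s_ab,
    zero_mul, zero_add, sub_zero, add_zero]

theorem chr_sas (a : α) : christoffel g s₀ (emb a) s₀ Y = 0 := by
  simp [christoffel, h.hyper.sum_eq, h.inv_ss, h.inv_sa, h.d_c_ss, h.d_s_as]

theorem chr_ssa (a : α) : christoffel g s₀ s₀ (emb a) Y = 0 := by
  simp [christoffel, h.hyper.sum_eq, h.inv_ss, h.inv_sa, h.d_c_ss, h.d_s_as, h.d_s_sa]

theorem chr_css (c : α) : christoffel g (emb c) s₀ s₀ Y = 0 := by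
  simp [christoffel, h.hyper.sum_eq, h.inv_as, h.d_c_ss, h.d_s_sa]

theorem chr_sss : christoffel g s₀ s₀ s₀ Y = 0 := by
  simp [christoffel, h.hyper.sum_eq, h.inv_ss, h.inv_sa, h.d_s_ss]

/-- The formulas for the Christoffel symbols hold only along the hypersurface, but there they may be
differentiated in tangential directions. -/
theorem d_tangential {F : (β → ℝ) → ℝ} {f : (α → ℝ) → ℝ}
    (hF : DiffAt F Y)
    (hf : ∀ᶠ w in 𝓝 y, F (incl emb w) = f w) (c : α) :
    partialD (emb c) F Y = partialD c f y := by
  rw [← partialD_comp_incl h.hyper hF]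
  exact partialD_congr hf c

theorem d_c_chr_cab (e c a b : α) : partialD (emb e) (christoffel g (emb c) (emb a) (emb b))
    Y = partialD e (christoffel (restr g emb) c a b) y :=
  h.d_tangential ((h.metric.christoffel_smooth _ _ _).diffAt) (h.eventually.mono fun _ hw => hw.chr_cab c a b) e

theorem d_c_chr_sas (e a : α) : partialD (emb e) (christoffel g s₀ (emb a) s₀) Y = 0 := by
  rw [h.d_tangential ((h.metric.christoffel_smooth _ _ _).diffAt)
    (h.eventually.mono fun _ hw => hw.chr_sas a) e, partialD_const]

theorem d_c_chr_css (e c : α) : partialD (emb e) (christoffel g (emb c) s₀ s₀) Y = 0 := by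
  rw [h.d_tangential ((h.metric.christoffel_smooth _ _ _).diffAt)
    (h.eventually.mono fun _ hw => hw.chr_css c) e, partialD_const]

theorem d_s_inv_ss : partialD s₀ (fun x => (g x)⁻¹ s₀ s₀) Y = 0 := by
  simp [partialD_inv h.metric, h.hyper.sum_eq, h.inv_ss, h.inv_sa, h.inv_as, h.d_s_ss]

theorem d_s_inv_sa (a : α) : partialD s₀ (fun x => (g x)⁻¹ s₀ (emb a)) Y = 0 := by
  simp [partialD_inv h.metric, h.hyper.sum_eq, h.inv_ss, h.inv_sa, h.d_s_sa]

theorem d_s_inv_as (a : α) : partialD s₀ (fun x => (g x)⁻¹ (emb a) s₀) Y = 0 := by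
  simp [partialD_inv h.metric, h.hyper.sum_eq, h.inv_ss, h.inv_as, h.d_s_as]

theorem d_s_inv_ab (a b : α) : partialD s₀ (fun x => (g x)⁻¹ (emb a) (emb b)) Y =
    - ((restr g emb y)⁻¹ * nDeriv g emb s₀ y * (restr g emb y)⁻¹) a b := by
  rw [partialD_inv h.metric]
  simp only [h.hyper.sum_eq, h.inv_sa, h.inv_as, h.inv_ab, h.d_s_ab, zero_mul, mul_zero, zero_add,
    sum_const_zero, Matrix.mul_apply, sum_mul]
  rw [sum_comm]

end IsFermiAt

end FermiMetric

/-! ### The Gauss and Riccati equations in Fermi coordinates. -/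

section FermiCurvature

variable {α β : Type} [Fintype α] [DecidableEq α] [Fintype β] [DecidableEq β]

theorem partialD_comm {f : (β → ℝ) → ℝ} {y : β → ℝ} (hf : SmoothAt f y) (a b : β) :
    partialD b (partialD a f) y = partialD a (partialD b f) y := by
  have hd := hf.smooth_fderiv.diffAt
  have e : ∀ a b, partialD b (partialD a f) y = D (D f) y (single b 1) (single a 1) := fun a b => by
    change D (fun x => D f x (single a 1)) y _ = _
    rw [fderiv_clm_apply hd (differentiableAt_const _)]
    simp
  rw [e, e]
  exact hf.isSymmSndFDerivAt two_le_smoothness _ _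

theorem partialD_sub {f f' : (β → ℝ) → ℝ} {y : β → ℝ} (hf : DiffAt f y)
    (hf' : DiffAt f' y) (i : β) :
    partialD i (fun x => f x - f' x) y = partialD i f y - partialD i f' y := by
  rw [partialD, fderiv_fun_sub hf hf']; rfl

theorem partialD_const_mul {f : (β → ℝ) → ℝ} {y : β → ℝ} (hf : DiffAt f y)
    (c : ℝ) (i : β) : partialD i (fun x => c * f x) y = c * partialD i f y := by
  rw [partialD, fderiv_const_mul hf]; rfl

theorem IsMetricAt.partialD_christoffel {g : (β → ℝ) → Matrix β β ℝ} {x : β → ℝ}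
    (hg : IsMetricAt g x) (e c a b : β) :
    partialD e (christoffel g c a b) x = 1 / 2 * ∑ l,
      (partialD e (fun z => (g z)⁻¹ c l) x * (partialD a (fun z => g z b l) x +
        partialD b (fun z => g z a l) x - partialD l (fun z => g z a b) x) +
      (g x)⁻¹ c l * (partialD e (partialD a fun z => g z b l) x +
        partialD e (partialD b fun z => g z a l) x - partialD e (partialD l fun z => g z a b) x)) := by
  have hd : ∀ a b c, DiffAt (partialD a fun z => g z b c) x := fun a b c =>
    (contDiffAt_partialD (hg.smooth b c) a).diffAt
  have hi : ∀ l, DiffAt (fun z => (g z)⁻¹ c l) x := fun l =>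
    (hg.inv_smooth c l).diffAt
  have hk : ∀ l, DiffAt (fun z => partialD a (fun z => g z b l) z +
      partialD b (fun z => g z a l) z - partialD l (fun z => g z a b) z) x := fun l =>
    ((hd a b l).add (hd b a l)).sub (hd l a b)
  have hs : DiffAt (fun z => ∑ l, (g z)⁻¹ c l * (partialD a (fun z => g z b l) z +
      partialD b (fun z => g z a l) z - partialD l (fun z => g z a b) z)) x :=
    DifferentiableAt.fun_sum fun l _ => (hi l).mul (hk l)
  change partialD e (fun z => _) x = _
  simp only [christoffel]
  rw [partialD_const_mul hs, partialD_sum_mul hi hk]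
  congr 1
  refine sum_congr rfl fun l _ => ?_
  rw [partialD_sub (f := fun z => partialD a (fun z => g z b l) z + partialD b (fun z => g z a l) z)
    ((hd a b l).add (hd b a l)) (hd l a b), partialD_add (hd a b l) (hd b a l)]

variable {emb : α → β} {s₀ : β}

namespace IsFermiAt

variable {g : (β → ℝ) → Matrix β β ℝ} {y : α → ℝ} (h : IsFermiAt g emb s₀ y)
include h

local notation "Y" => incl emb y
local notation "Hi" => (restr g emb y)⁻¹
local notation "Dg" => nDeriv g emb s₀ y
local notation "DDg" => nDeriv2 g emb s₀ y

/-- Partial derivatives commute, and `∂_s g_{sa}` vanishes along the hypersurface. -/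
theorem d_s_d_c_sa (c a : α) : partialD s₀ (partialD (emb c) fun z => g z s₀ (emb a)) Y = 0 := by
  rw [partialD_comm (h.metric.smooth _ _)]
  exact partialD_emb_eq_zero h.hyper (incl_normal h.hyper y) (h.normal'.mono fun _ hx hp => hx hp a) c

theorem d_s_d_c_as (c a : α) : partialD s₀ (partialD (emb c) fun z => g z (emb a) s₀) Y = 0 := by
  rw [partialD_congr (eventuallyEq_partialD (h.metric.symm_near (emb a) s₀) _), h.d_s_d_c_sa]

theorem d_s_chr_sab (a b : α) : partialD s₀ (christoffel g s₀ (emb a) (emb b)) Y = - (1 / 2) * DDg a b := by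
  rw [h.metric.partialD_christoffel]
  simp only [h.hyper.sum_eq, h.inv_ss, h.inv_sa, h.d_s_inv_ss, h.d_s_inv_sa, h.d_s_d_c_as,
    zero_mul, sum_const_zero, add_zero, zero_add, zero_sub, one_mul]
  rw [nDeriv2, of_apply]
  ring

theorem d_s_chr_csa (c a : α) : partialD s₀ (christoffel g (emb c) s₀ (emb a)) Y =
      1 / 2 * ∑ d, (- (Hi * Dg * Hi) c d * Dg a d + Hi c d * DDg a d) := by
  rw [h.metric.partialD_christoffel]
  simp only [h.hyper.sum_eq, h.inv_as, h.inv_ab, h.d_s_inv_as, h.d_s_inv_ab,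
    h.d_s_d_c_sa, h.d_c_sa, h.d_s_ab, zero_mul, add_zero, zero_add, sub_zero]
  rfl

theorem nDeriv_comm (a b : α) : Dg a b = Dg b a :=
  partialD_congr (h.metric.symm_near _ _) s₀

theorem restr_inv_comm (a b : α) : Hi a b = Hi b a := h.hyper_metric.inv_comm a b

theorem trace_inv_mul (B : Matrix α α ℝ) : (Hi * B).trace = ∑ a, ∑ b, Hi a b * B a b := by
  rw [trace, sum_comm]
  refine sum_congr rfl fun c _ => ?_
  rw [diag_apply, Matrix.mul_apply]
  exact sum_congr rfl fun d _ => by rw [h.restr_inv_comm]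

/-- All Christoffel symbols on the hypersurface are those of its own metric or are built from `∂_s
g`. Beyond the intrinsic Ricci tensor there remain the second normal derivative and terms quadratic
in `∂_s g`. -/
theorem ricci_tangential (a b : α) : ricciCurvature g (emb a) (emb b) Y =
      ricciCurvature (restr g emb) a b y - 1 / 2 * DDg a b
      + 1 / 2 * (Dg * Hi * Dg) a b
      - 1 / 4 * (Hi * Dg).trace * Dg a b := by
  have e1 : (Dg * Hi * Dg) a b = ∑ c, (∑ d, Hi c d * Dg a d) * Dg b c := by
    simp only [Matrix.mul_apply]
    refine sum_congr rfl fun c _ => ?_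
    rw [h.nDeriv_comm b c, sum_congr rfl fun d _ => by rw [h.restr_inv_comm d c, mul_comm]]
  have e2 : (Dg * Hi * Dg) a b = ∑ c, (∑ d, Hi c d * Dg b d) * Dg a c := by
    rw [Matrix.mul_assoc]
    simp only [Matrix.mul_apply]
    refine sum_congr rfl fun c _ => ?_
    rw [mul_comm, sum_congr rfl fun d _ => by rw [h.nDeriv_comm d b]]
  simp only [ricciCurvature, h.hyper.sum_eq, h.d_s_chr_sab, h.d_c_chr_cab, h.d_c_chr_sas,
    h.chr_cab, h.chr_sab, h.chr_sas, h.chr_ssa, h.chr_sss, h.chr_cas,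
    sum_add_distrib, sum_sub_distrib, mul_zero, zero_mul, zero_add,
    sub_zero, zero_sub, sum_const_zero]
  have e4 : ∑ c, (1 / 2 * ∑ d, Hi c d * Dg c d) * (-(1 / 2) * Dg a b) = - (1 / 4) * (Hi * Dg).trace * Dg a b := by
    rw [h.trace_inv_mul, ← sum_mul, ← mul_sum]
    ring
  have e5 : ∑ c, (-(1 / 2) * Dg b c) * (1 / 2 * ∑ d, Hi c d * Dg a d) = - (1 / 4) * (Dg * Hi * Dg) a b := by
    rw [e1, mul_sum]
    exact sum_congr rfl fun c _ => by ring
  have e6 : ∑ c, (1 / 2 * ∑ d, Hi c d * Dg b d) * (-(1 / 2) * Dg a c) = - (1 / 4) * (Dg * Hi * Dg) a b := by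
    rw [e2, mul_sum]
    exact sum_congr rfl fun c _ => by ring
  rw [e4, e5, e6]
  ring

/-- The traced Riccati equation. With `A = -½ ∂_s g` the last term is `|A|²`. -/
theorem ricci_normal : ricciCurvature g s₀ s₀ Y = - (1 / 2) * (Hi * DDg).trace + 1 / 4 * (Hi * Dg * Hi * Dg).trace := by
  have e1 : (Hi * Dg * Hi * Dg).trace = ∑ c, ∑ d, (Hi * Dg * Hi) c d * Dg c d := by
    rw [trace]
    exact sum_congr rfl fun c _ => by
      rw [diag_apply, Matrix.mul_apply]
      exact sum_congr rfl fun d _ => by rw [h.nDeriv_comm c d]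
  have e3 : (Hi * Dg * Hi * Dg).trace = ∑ c, ∑ e, (∑ d, Hi c d * Dg e d) * (∑ d, Hi e d * Dg c d) := by
    rw [Matrix.mul_assoc, trace]
    refine sum_congr rfl fun c _ => ?_
    rw [diag_apply, Matrix.mul_apply]
    refine sum_congr rfl fun e _ => ?_
    simp only [Matrix.mul_apply]
    congr 1
    all_goals
      refine sum_congr rfl fun d _ => ?_
      rw [h.nDeriv_comm d]
  simp only [ricciCurvature, h.hyper.sum_eq, h.d_s_chr_csa, h.d_c_chr_css,  h.chr_ssa, h.chr_sss, h.chr_css, h.chr_csa,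
    sum_add_distrib, mul_zero, zero_add,
    zero_sub, sum_const_zero, sub_self, sum_neg_distrib,
    ← mul_sum, neg_mul]
  rw [← e1, ← h.trace_inv_mul]
  have e4 : ∑ c, ∑ e, (1 / 2 * ∑ d, Hi c d * Dg e d) * (1 / 2 * ∑ d, Hi e d * Dg c d) = 1 / 4 * (Hi * Dg * Hi *
      Dg).trace := by
    rw [e3, mul_sum]
    refine sum_congr rfl fun c _ => ?_
    rw [mul_sum]
    exact sum_congr rfl fun e _ => by ring
  rw [e4]
  ring

/-- The twice contracted Gauss equation combined with the Riccati equation. -/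
theorem scalarCurvature_eq : scalarCurvature g Y = scalarCurvature (restr g emb) y - (Hi * DDg).trace
      + 3 / 4 * (Hi * Dg * Hi * Dg).trace
      - 1 / 4 * (Hi * Dg).trace ^ 2 := by
  simp only [scalarCurvature, h.hyper.sum_eq, h.inv_ss, h.inv_sa, h.inv_as, h.inv_ab, zero_mul,
    sum_const_zero, add_zero, zero_add, one_mul, h.ricci_normal, h.ricci_tangential]
  have e : ∀ t : ℝ, ∑ a, ∑ b, Hi a b * (ricciCurvature (restr g emb) a b y - 1 / 2 * DDg a b
      + 1 / 2 * (Dg * Hi * Dg) a b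
      - t * Dg a b) =
      (∑ a, ∑ b, Hi a b * ricciCurvature (restr g emb) a b y)
      - 1 / 2 * (Hi * DDg).trace
      + 1 / 2 * (Hi * (Dg * Hi * Dg)).trace
      - t * (Hi * Dg).trace := by
    intro t
    rw [h.trace_inv_mul, h.trace_inv_mul, h.trace_inv_mul]
    simp only [mul_sum, ← sum_add_distrib, ← sum_sub_distrib]
    exact sum_congr rfl fun c _ => sum_congr rfl fun d _ => by ring
  rw [e, ← Matrix.mul_assoc, ← Matrix.mul_assoc]
  ring

/-- The second fundamental form is half of the normal derivative of the metric. -/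
theorem secondFundNormSq_eq : secondFundNormSq g emb (single s₀ 1) Y = 1 / 4 * (Hi * Dg * Hi * Dg).trace := by
  have hA : of (secondFund g emb (single s₀ 1) Y) = (-(1 / 2) : ℝ) • Dg := by
    ext a b
    rw [of_apply, secondFund]
    simp only [Pi.single_apply, mul_ite, mul_one, mul_zero, sum_ite_eq', Finset.mem_univ, if_true]
    simp only [h.hyper.sum_eq, mul_one, mul_zero, h.g_ss, h.g_as, sum_const_zero, add_zero, h.chr_sab]
    rfl
  have h1 : (Hi).transpose = Hi := by
    ext a b; rw [transpose_apply, h.restr_inv_comm]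
  have h2 : (Dg).transpose = Dg := by
    ext a b; rw [transpose_apply, h.nDeriv_comm]
  rw [secondFundNormSq_eq_trace, hA]
  change (Hi * _ * (Hi).transpose * _).trace = _
  rw [h1, Matrix.transpose_smul, h2]
  simp only [Matrix.mul_smul, Matrix.smul_mul, Matrix.trace_smul, smul_eq_mul]
  ring

end IsFermiAt

end FermiCurvature

/-! ### Derivatives of determinants, volume densities and divergences. -/

section VolumeDensity

variable {α β : Type} [Fintype α] [DecidableEq α] [Fintype β] [DecidableEq β]

/-- Jacobi's formula. The Leibniz expansion differentiates one column at a time, and a determinant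
with one column replaced is an entry of the adjugate times that column. -/
theorem hasDerivAt_matrix_det {M : ℝ → Matrix α α ℝ} {M' : Matrix α α ℝ} {t : ℝ}
    (h : ∀ a b, HasDerivAt (fun s => M s a b) (M' a b) t) :
    HasDerivAt (fun s => (M s).det) ((M t).adjugate * M').trace t := by
  have h1 : HasDerivAt (fun s => (M s).det) (∑ σ : Equiv.Perm α, (Equiv.Perm.sign σ : ℤ) •
      ∑ i, (∏ j ∈ Finset.univ.erase i, M t (σ j) j) • M' (σ i) i) t := by
    simp only [Matrix.det_apply]
    refine HasDerivAt.fun_sum fun σ _ => ?_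
    have h2 := (HasDerivAt.fun_finsetProd (u := Finset.univ) (f := fun i s => M s (σ i) i)
      (f' := fun i => M' (σ i) i) fun i _ => h (σ i) i)
    have h3 := h2.const_mul (((Equiv.Perm.sign σ : ℤ) : ℝ))
    simpa [Units.smul_def] using h3
  convert h1 using 1
  have h4 : ∀ i, ((M t).adjugate * M') i i = ((M t).updateCol i fun k => M' k i).det := fun i => by
    rw [← Matrix.cramer_apply, Matrix.cramer_eq_adjugate_mulVec]
    rfl
  simp only [trace, diag_apply, h4, Matrix.det_apply]
  rw [sum_comm]
  refine sum_congr rfl fun σ _ => ?_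
  rw [Finset.smul_sum]
  refine sum_congr rfl fun i _ => ?_
  rw [← Finset.mul_prod_erase _ _ (Finset.mem_univ i), Matrix.updateCol_self, smul_eq_mul, mul_comm, Units.smul_def]
  congr 2
  refine Finset.prod_congr rfl fun j hj => ?_
  rw [Matrix.updateCol_ne (Finset.ne_of_mem_erase hj)]

theorem hasDerivAt_sqrt_det {M : ℝ → Matrix α α ℝ} {M' : Matrix α α ℝ} {t : ℝ}
    (hM : (M t).PosDef) (h : ∀ a b, HasDerivAt (fun s => M s a b) (M' a b) t) :
    HasDerivAt (fun s => √(M s).det) (1 / 2 * √(M t).det * ((M t)⁻¹ * M').trace) t := by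
  have hd := hM.det_pos
  convert (hasDerivAt_matrix_det h).sqrt hd.ne' using 1
  rw [Matrix.inv_def, Ring.inverse_eq_inv', Matrix.smul_mul, Matrix.trace_smul, smul_eq_mul]
  have hs : √(M t).det ≠ 0 := (Real.sqrt_pos.2 hd).ne'
  field_simp
  rw [Real.sq_sqrt hd.le]

/-- Cramer's rule gives differentiability, and differentiating `M M⁻¹ = 1` then gives the value. -/
theorem hasDerivAt_matrix_inv {M : ℝ → Matrix α α ℝ} {M' : Matrix α α ℝ} {t : ℝ}
    (hM : ∀ᶠ s in 𝓝 t, (M s).PosDef) (h : ∀ a b, HasDerivAt (fun s => M s a b) (M' a b) t) (a b : α) :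
    HasDerivAt (fun s => (M s)⁻¹ a b) (- ((M t)⁻¹ * M' * (M t)⁻¹) a b) t := by
  have hM0 := hM.self_of_nhds
  have hdet : IsUnit (M t).det := isUnit_iff_ne_zero.2 hM0.det_pos.ne'
  have hdiff : ∀ a b, DiffAt (fun s => (M s)⁻¹ a b) t := by
    intro a b
    have e : ∀ s, (M s)⁻¹ a b = (M s).det⁻¹ * ((M s).updateRow b (single a 1)).det := fun s => by
      rw [Matrix.inv_def, Ring.inverse_eq_inv', Matrix.smul_apply, Matrix.adjugate_apply, smul_eq_mul]
    simp only [e]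
    refine ((hasDerivAt_matrix_det h).differentiableAt.inv hM0.det_pos.ne').mul ?_
    refine (hasDerivAt_matrix_det (M := fun s => (M s).updateRow b (single a 1))
      (M' := M'.updateRow b 0) fun c d => ?_).differentiableAt
    by_cases hc : c = b
    · subst hc; simpa using hasDerivAt_const t _
    · simpa [Matrix.updateRow_ne hc] using h c d
  set B : Matrix α α ℝ := of fun a b => deriv (fun s => (M s)⁻¹ a b) t with hB
  have hB' : ∀ a b, HasDerivAt (fun s => (M s)⁻¹ a b) (B a b) t := fun a b => (hdiff a b).hasDerivAt
  have h1 : M' * (M t)⁻¹ + M t * B = 0 := by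
    ext a b
    have h2 : HasDerivAt (fun s => ∑ c, M s a c * (M s)⁻¹ c b) (∑ c, (M' a c * (M t)⁻¹ c b + M t a c * B c b)) t :=
      HasDerivAt.fun_sum fun c _ => (h a c).mul (hB' c b)
    have h3 : (fun s => ∑ c, M s a c * (M s)⁻¹ c b) =ᶠ[𝓝 t] fun _ => (1 : Matrix α α ℝ) a b := by
      filter_upwards [hM] with s hs
      rw [← Matrix.mul_apply, mul_nonsing_inv _ (isUnit_iff_ne_zero.2 hs.det_pos.ne')]
    have h4 := h2.unique ((hasDerivAt_const t _).congr_of_eventuallyEq h3)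
    rw [sum_add_distrib] at h4
    simpa [Matrix.mul_apply] using h4
  have h5 : B = - ((M t)⁻¹ * M' * (M t)⁻¹) := by
    have : (M t)⁻¹ * (M' * (M t)⁻¹ + M t * B) = 0 := by rw [h1, Matrix.mul_zero]
    rw [Matrix.mul_add, ← Matrix.mul_assoc, ← Matrix.mul_assoc, nonsing_inv_mul _ hdet, Matrix.one_mul] at this
    exact eq_neg_of_add_eq_zero_right this
  have := hB' a b
  rw [h5] at this
  exact this

theorem hasDerivAt_trace_inv_mul {M M₁ : ℝ → Matrix α α ℝ} {M' M₂ : Matrix α α ℝ} {t : ℝ}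
    (hM : ∀ᶠ s in 𝓝 t, (M s).PosDef) (h : ∀ a b, HasDerivAt (fun s => M s a b) (M' a b) t)
    (h₁ : ∀ a b, HasDerivAt (fun s => M₁ s a b) (M₂ a b) t) :
    HasDerivAt (fun s => ((M s)⁻¹ * M₁ s).trace) (((M t)⁻¹ * M₂).trace - ((M t)⁻¹ * M' * (M t)⁻¹ * M₁ t).trace) t := by
  have h2 : HasDerivAt (fun s => ∑ a, ∑ b, (M s)⁻¹ a b * M₁ s b a)
      (∑ a, ∑ b, (- ((M t)⁻¹ * M' * (M t)⁻¹) a b * M₁ t b a + (M t)⁻¹ a b * M₂ b a)) t :=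
    HasDerivAt.fun_sum fun a _ => HasDerivAt.fun_sum fun b _ =>
      (hasDerivAt_matrix_inv hM h a b).mul (h₁ b a)
  have tr : ∀ A B : Matrix α α ℝ, (A * B).trace = ∑ a, ∑ b, A a b * B b a := fun _ _ => rfl
  simp only [tr]
  refine h2.congr_deriv ?_
  simp only [sum_add_distrib, neg_mul, sum_neg_distrib]
  ring

/-- The second derivative of a volume density. -/
theorem hasDerivAt_deriv_sqrt_det {M M₁ : ℝ → Matrix α α ℝ} {M₂ : Matrix α α ℝ} {t : ℝ}
    (hM : ∀ᶠ s in 𝓝 t, (M s).PosDef)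
    (h : ∀ᶠ s in 𝓝 t, ∀ a b, HasDerivAt (fun s => M s a b) (M₁ s a b) s)
    (h₁ : ∀ a b, HasDerivAt (fun s => M₁ s a b) (M₂ a b) t) :
    HasDerivAt (deriv fun s => √(M s).det)
      (1 / 2 * √(M t).det * (((M t)⁻¹ * M₂).trace - ((M t)⁻¹ * M₁ t * (M t)⁻¹ * M₁ t).trace)
        + 1 / 4 * √(M t).det * ((M t)⁻¹ * M₁ t).trace ^ 2) t := by
  have h2 : (deriv fun s => √(M s).det) =ᶠ[𝓝 t] fun s => 1 / 2 * √(M s).det * ((M s)⁻¹ * M₁ s).trace := by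
    filter_upwards [hM, h] with s hs hs' using (hasDerivAt_sqrt_det hs hs').deriv
  refine HasDerivAt.congr_of_eventuallyEq ?_ h2
  have h3 := ((hasDerivAt_sqrt_det hM.self_of_nhds h.self_of_nhds).const_mul (1 / 2)).mul
    (hasDerivAt_trace_inv_mul hM h.self_of_nhds h₁)
  exact h3.congr_deriv (by ring)

theorem hasDerivAt_partialD {f : (β → ℝ) → ℝ} {x : β → ℝ} (i : β) (t : ℝ)
    (hf : DiffAt f (x + t • single i 1)) :
    HasDerivAt (fun t : ℝ => f (x + t • single i 1)) (partialD i f (x + t • single i 1)) t := by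
  have hline : HasDerivAt (fun t : ℝ => x + t • (single i 1 : β → ℝ)) (single i 1) t := by
    simpa using ((hasDerivAt_id t).smul_const (single i 1 : β → ℝ)).const_add x
  exact hf.hasFDerivAt.comp_hasDerivAt t hline

theorem hasDerivAt_partialD_zero {f : (β → ℝ) → ℝ} {x : β → ℝ} (i : β)
    (hf : DiffAt f x) :
    HasDerivAt (fun t : ℝ => f (x + t • single i 1)) (partialD i f x) 0 := by
  simpa using hasDerivAt_partialD (x := x) i 0 (by simpa using hf)

theorem partialD_sqrt_det {h : (α → ℝ) → Matrix α α ℝ} {y : α → ℝ} (hm : IsMetricAt h y) (i : α) :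
    partialD i (fun x => √(h x).det) y =
      1 / 2 * √(h y).det * ((h y)⁻¹ * of fun a b => partialD i (fun x => h x a b) y).trace := by
  have hd : SmoothAt (fun x => √(h x).det) y :=
    (contDiffAt_matrix_det hm.smooth).sqrt hm.posDef.det_pos.ne'
  have h1 := hasDerivAt_partialD_zero i (hd.diffAt)
  have h2 := hasDerivAt_sqrt_det (M := fun t : ℝ => h (y + t • single i 1)) (t := 0)
    (M' := of fun a b => partialD i (fun x => h x a b) y) (by simpa using hm.posDef)
    fun a b => hasDerivAt_partialD_zero i ((hm.smooth a b).diffAt)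
  simpa using h1.unique h2

/-- Two of the three metric derivatives cancel under the trace, by symmetry; the rest is the
logarithmic derivative of `√det h`. -/
theorem sum_christoffel_self {h : (α → ℝ) → Matrix α α ℝ} {y : α → ℝ} (hm : IsMetricAt h y) (i : α) :
    ∑ c, christoffel h c c i y = 1 / 2 * ((h y)⁻¹ * of fun a b => partialD i (fun x => h x a b) y).trace := by
  have hs : ∀ a b i, partialD i (fun x => h x a b) y = partialD i (fun x => h x b a) y :=
    fun a b i => partialD_congr (hm.symm_near a b) i
  have hi : ∀ a b, (h y)⁻¹ a b = (h y)⁻¹ b a := fun a b => by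
    have := hm.posDef.isHermitian.inv.apply a b
    simpa using this.symm
  simp only [christoffel, trace, diag_apply, Matrix.mul_apply, of_apply]
  rw [← mul_sum]
  congr 1
  have e : ∑ c, ∑ l, (h y)⁻¹ c l * partialD c (fun z => h z i l) y =
      ∑ c, ∑ l, (h y)⁻¹ c l * partialD l (fun z => h z c i) y := by
    rw [sum_comm]
    exact sum_congr rfl fun c _ => sum_congr rfl fun l _ => by
      rw [hi l c, hs i c l]
  simp only [mul_add, mul_sub, sum_add_distrib, sum_sub_distrib]
  rw [e, add_sub_cancel_left]
  exact sum_congr rfl fun c _ => sum_congr rfl fun l _ => by rw [hs c l i]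

/-- The divergence form of the Laplacian. -/
theorem sqrt_det_mul_divergence {h : (α → ℝ) → Matrix α α ℝ} {y : α → ℝ} (hm : IsMetricAt h y)
    {Y : α → (α → ℝ) → ℝ} (hY : ∀ c, DiffAt (Y c) y) :
    ∑ c, partialD c (fun x => √(h x).det * Y c x) y =
      √(h y).det * ∑ c, (partialD c (Y c) y + ∑ d, christoffel h c c d y * Y d y) := by
  have hd : DiffAt (fun x => √(h x).det) y :=
    ((contDiffAt_matrix_det hm.smooth).sqrt hm.posDef.det_pos.ne').diffAt
  rw [sum_add_distrib, sum_comm (f := fun c d => christoffel h c c d y * Y d y)]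
  simp only [← sum_mul, sum_christoffel_self hm]
  rw [← sum_add_distrib, mul_sum]
  refine sum_congr rfl fun c _ => ?_
  rw [partialD_mul hd (hY c), partialD_sqrt_det hm]
  ring

theorem sqrt_det_mul_laplaceOf {h : (α → ℝ) → Matrix α α ℝ} {y : α → ℝ} (hm : IsMetricAt h y)
    {f : (α → ℝ) → ℝ} (hf : SmoothAt f y) :
    √(h y).det * laplaceOf h f y = ∑ c, partialD c (fun x => √(h x).det * gradOf h f c x) y := by
  rw [sqrt_det_mul_divergence hm fun c => (contDiffAt_gradOf hm hf c).diffAt]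
  rfl

end VolumeDensity

/-! ### First and second variation of the volume density. -/

section DensityVariation

variable {α β : Type} [Fintype α] [DecidableEq α] [Fintype β] [DecidableEq β]

/-- The derivative in the direction of the parameter of a family of maps. -/
def timeD {W : Type*} [NormedAddCommGroup W] [NormedSpace ℝ W] (G : ℝ × (α → ℝ) → W)
    (w : ℝ × (α → ℝ)) : W := D G w (1, 0)

/-- The derivative of the members of a family of maps. -/
def spaceD {W : Type*} [NormedAddCommGroup W] [NormedSpace ℝ W] (v : α → ℝ)
    (G : ℝ × (α → ℝ) → W) (w : ℝ × (α → ℝ)) : W := D G w (0, v)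

section

variable {W : Type*} [NormedAddCommGroup W] [NormedSpace ℝ W] {G : ℝ × (α → ℝ) → W}
  {w : ℝ × (α → ℝ)}

theorem contDiffAt_timeD (h : SmoothAt G w) : SmoothAt (timeD G) w :=
  h.smooth_fderiv.clm_apply contDiffAt_const

theorem contDiffAt_spaceD (h : SmoothAt G w) (v : α → ℝ) : SmoothAt (spaceD v G) w :=
  h.smooth_fderiv.clm_apply contDiffAt_const

theorem hasDerivAt_timeD {s : ℝ} {y : α → ℝ} (h : DiffAt G (s, y)) :
    HasDerivAt (fun t => G (t, y)) (timeD G (s, y)) s :=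
  h.hasFDerivAt.comp_hasDerivAt s ((hasDerivAt_id s).prodMk (hasDerivAt_const s y))

theorem timeD_spaceD (h : SmoothAt G w) (v : α → ℝ) : timeD (spaceD v G) w = spaceD v (timeD G) w := by
  have hd := h.smooth_fderiv.diffAt
  have e : ∀ p q : ℝ × (α → ℝ), D (fun x => D G x p) w q = D (D G) w q p := fun p q => by
    rw [fderiv_clm_apply hd (differentiableAt_const _)]
    simp
  change D (fun x => D G x _) w _ = D (fun x => D G x _) w _
  rw [e, e]
  exact h.isSymmSndFDerivAt two_le_smoothness _ _

theorem fderiv_slice {s : ℝ} {y : α → ℝ} (h : DiffAt G (s, y)) (v : α → ℝ) :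
    D (fun x => G (s, x)) y v = spaceD v G (s, y) := by
  have := (h.hasFDerivAt.comp y ((hasFDerivAt_const s y).prodMk (hasFDerivAt_id y))).fderiv
  change D (G ∘ _) y v = _
  rw [this]
  simp [spaceD]

end

/-- The matrix of the pull-back of `g` under a member of a family of maps. -/
def pullGram (g : (β → ℝ) → Matrix β β ℝ) (P : ℝ × (α → ℝ) → β → ℝ) (y : α → ℝ) (s : ℝ) : Matrix α α ℝ :=
  of fun a b => formOf (g (P (s, y))) (spaceD (single a 1) P (s, y)) (spaceD (single b 1) P (s, y))

/-- A family of maps into the ambient space that starts at the hypersurface, with normal initial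
velocity. -/
structure IsVariationAt (emb : α → β) (s₀ : β) (y : α → ℝ) (P : ℝ × (α → ℝ) → β → ℝ)
    (f : (α → ℝ) → ℝ) : Prop where
  smooth_near : ∀ᶠ w in 𝓝 ((0 : ℝ), y), SmoothAt P w
  zero : ∀ᶠ x in 𝓝 y, P (0, x) = incl emb x
  velocity : ∀ᶠ x in 𝓝 y, timeD P (0, x) = f x • single s₀ 1

/-- The components of the metric along a family of maps, differentiated. -/
theorem hasDerivAt_formOf_curve {g : ℝ → Matrix β β ℝ} {g' : Matrix β β ℝ} {p q : ℝ → β → ℝ}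
    {p' q' : β → ℝ} {s : ℝ} (hg : ∀ c d, HasDerivAt (fun t => g t c d) (g' c d) s)
    (hp : HasDerivAt p p' s) (hq : HasDerivAt q q' s) :
    HasDerivAt (fun t => formOf (g t) (p t) (q t))
      (formOf g' (p s) (q s) + formOf (g s) p' (q s) + formOf (g s) (p s) q') s := by
  simp only [formOf_apply, ← sum_add_distrib]
  refine HasDerivAt.fun_sum fun c _ => HasDerivAt.fun_sum fun d _ => ?_
  exact (((hg c d).mul (hasDerivAt_pi.1 hp c)).mul (hasDerivAt_pi.1 hq d)).congr_deriv
    (by simp only [Pi.mul_apply]; ring)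

/-- The derivative of the pull-back metric with respect to the parameter. -/
def pullGramD (g : (β → ℝ) → Matrix β β ℝ) (P : ℝ × (α → ℝ) → β → ℝ) (y : α → ℝ) (s : ℝ) : Matrix α α ℝ :=
  of fun a b => formOf (of fun c d => D (fun z => g z c d) (P (s, y)) (timeD P (s, y)))
      (spaceD (single a 1) P (s, y)) (spaceD (single b 1) P (s, y))
    + formOf (g (P (s, y))) (spaceD (single a 1) (timeD P) (s, y)) (spaceD (single b 1) P (s, y))
    + formOf (g (P (s, y))) (spaceD (single a 1) P (s, y)) (spaceD (single b 1) (timeD P) (s, y))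

variable {emb : α → β} {s₀ : β} {g : (β → ℝ) → Matrix β β ℝ} {y : α → ℝ}
  {P : ℝ × (α → ℝ) → β → ℝ} {f : (α → ℝ) → ℝ}

namespace IsFermiAt

local notation "Y" => incl emb y
local notation "h₀" => restr g emb
local notation "Hi" => (restr g emb y)⁻¹
local notation "Dg" => nDeriv g emb s₀ y
local notation "DDg" => nDeriv2 g emb s₀ y
local notation "acc" => timeD (timeD P)

theorem fderiv_metric_ab (h : IsFermiAt g emb s₀ y) (v : β → ℝ) (a b : α) :
    D (fun z => g z (emb a) (emb b)) Y v = v s₀ * Dg a b + ∑ e, v (emb e) * partialD e (fun x => h₀ x a b) y := by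
  rw [fderiv_apply_eq_sum_partialD, h.hyper.sum_eq]
  simp only [h.d_s_ab, h.d_c_ab]

section

variable (h : IsFermiAt g emb s₀ y) (hP : IsVariationAt emb s₀ y P f)
include h hP

theorem variation_zero : P (0, y) = Y := hP.zero.self_of_nhds

theorem variation_metric : ∀ᶠ s in 𝓝 (0 : ℝ), IsMetricAt g (P (s, y)) ∧ SmoothAt P (s, y) := by
  have hc : ContinuousAt (fun s : ℝ => (s, y)) 0 := by fun_prop
  have hc' : ContinuousAt (fun s : ℝ => P (s, y)) 0 :=
    ContinuousAt.comp (f := fun s : ℝ => (s, y)) hP.smooth_near.self_of_nhds.continuousAt hc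
  have := h.metric.eventually
  rw [← h.variation_zero hP] at this
  exact (hc'.eventually this).and (hc.eventually hP.smooth_near)

theorem spaceD_zero (v : α → ℝ) : spaceD v P (0, y) = incl emb v := by
  rw [← fderiv_slice (hP.smooth_near.self_of_nhds.diffAt)]
  rw [(show (fun x => P (0, x)) =ᶠ[𝓝 y] incl emb from hP.zero).fderiv_eq]
  rw [ContinuousLinearMap.fderiv]

theorem differentiableAt_speed : DiffAt f y := by
  have h1 : DiffAt (fun x => timeD P (0, x) s₀) y := by
    have := (contDiffAt_timeD hP.smooth_near.self_of_nhds).diffAt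
    exact differentiableAt_pi.1 (this.comp y (by fun_prop : DiffAt (fun x => ((0:ℝ), x)) y)) s₀
  refine h1.congr_of_eventuallyEq (hP.velocity.mono fun x hx => ?_)
  simp [hx]

theorem spaceD_timeD_zero (v : α → ℝ) : spaceD v (timeD P) (0, y) = D f y v • single s₀ 1 := by
  rw [← fderiv_slice ((contDiffAt_timeD hP.smooth_near.self_of_nhds).diffAt),
    (show (fun x => timeD P (0, x)) =ᶠ[𝓝 y] fun x => f x • single s₀ 1 from
      hP.velocity).fderiv_eq, fderiv_smul_const (h.differentiableAt_speed hP)]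
  rfl

omit h in
theorem hasDerivAt_metric_variation {s : ℝ} (hg : IsMetricAt g (P (s, y)))
    (hs : SmoothAt P (s, y)) (c d : β) :
    HasDerivAt (fun t => g (P (t, y)) c d) (D (fun z => g z c d) (P (s, y)) (timeD P (s, y))) s := by
  have h1 := (hg.smooth c d).diffAt.hasFDerivAt
  exact h1.comp_hasDerivAt s (hasDerivAt_timeD (hs.diffAt))

theorem hasDerivAt_pullGram : ∀ᶠ s in 𝓝 (0 : ℝ), ∀ a b,
    HasDerivAt (fun t => pullGram g P y t a b) (pullGramD g P y s a b) s := by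
  filter_upwards [h.variation_metric hP] with s ⟨hg, hs⟩ a b
  have hq : ∀ v, HasDerivAt (fun t => spaceD v P (t, y)) (spaceD v (timeD P) (s, y)) s := fun v => by
    rw [← timeD_spaceD hs]
    exact hasDerivAt_timeD ((contDiffAt_spaceD hs v).diffAt)
  exact hasDerivAt_formOf_curve (hasDerivAt_metric_variation hP hg hs) (hq _) (hq _)

theorem pullGram_zero : pullGram g P y 0 = h₀ y := by
  ext a b
  simp only [pullGram, of_apply, h.spaceD_zero hP, h.variation_zero hP, incl_single h.hyper, formOf_single]
  rfl

theorem posDef_pullGram : ∀ᶠ s in 𝓝 (0 : ℝ), (pullGram g P y s).PosDef := by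
  have hc : ContinuousAt (fun s => (pullGram g P y s).det) 0 := by
    simp only [Matrix.det_apply]
    refine tendsto_finsetSum _ fun σ _ => Tendsto.const_smul (tendsto_finsetProd _ fun a _ => ?_) _
    exact ((h.hasDerivAt_pullGram hP).self_of_nhds (σ a) a).continuousAt
  have h0 : (pullGram g P y 0).det ≠ 0 := by
    rw [h.pullGram_zero hP]; exact h.hyper_metric.posDef.det_pos.ne'
  filter_upwards [hc.eventually_ne h0, h.variation_metric hP] with s hs hm
  -- A pull-back `Bᴴ g B` is positive semidefinite for every `s`; the determinant, non-zero for
  -- small `s`, makes it definite.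
  have e : pullGram g P y s = (of fun c a => spaceD (single a 1) P (s, y) c).conjTranspose *
      g (P (s, y)) * of fun c a => spaceD (single a 1) P (s, y) c := by
    ext a b
    simp only [pullGram, of_apply, formOf_apply, Matrix.mul_apply, Matrix.conjTranspose_apply, star_trivial, sum_mul]
    rw [sum_comm]
    exact sum_congr rfl fun _ _ => sum_congr rfl fun _ _ => by ring
  refine Matrix.PosSemidef.posDef_iff_isUnit ?_ |>.2 ((Matrix.isUnit_iff_isUnit_det _).2 (isUnit_iff_ne_zero.2 hs))
  rw [e]
  exact hm.1.posDef.posSemidef.conjTranspose_mul_mul_same _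

theorem hasDerivAt_pullGram_zero (a b : α) : HasDerivAt (fun t => pullGram g P y t a b) (f y * Dg a b) 0 := by
  refine ((h.hasDerivAt_pullGram hP).self_of_nhds a b).congr_deriv ?_
  have hv : timeD P (0, y) = f y • single s₀ 1 := hP.velocity.self_of_nhds
  simp only [pullGramD, h.spaceD_zero hP, h.variation_zero hP, h.spaceD_timeD_zero hP, hv,
    incl_single h.hyper, formOf_single, map_smul, smul_apply, smul_eq_mul, h.g_as, h.g_sa,
    of_apply, mul_zero, add_zero]
  rw [← h.d_s_ab]; rfl

/-- The first variation of the volume density. -/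
theorem hasDerivAt_sqrt_det_pullGram : HasDerivAt (fun s => √(pullGram g P y s).det) (1 / 2 * √(h₀ y).det *
      (f y * (Hi * Dg).trace)) 0 := by
  have h1 := hasDerivAt_sqrt_det (M := pullGram g P y) (M' := f y • Dg)
    (h.posDef_pullGram hP).self_of_nhds (h.hasDerivAt_pullGram_zero hP)
  rwa [h.pullGram_zero hP, Matrix.mul_smul, Matrix.trace_smul, smul_eq_mul] at h1

theorem hasDerivAt_fderiv_metric_zero (c d : β) : HasDerivAt (fun s => D (fun z => g z c d) (P (s, y)) (timeD P (s, y)))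
      (f y ^ 2 * partialD s₀ (partialD s₀ fun z => g z c d) Y + D (fun z => g z c d) Y (acc (0, y))) 0 := by
  obtain ⟨hg, hs⟩ := (h.variation_metric hP).self_of_nhds
  have hd : DiffAt (D fun z => g z c d) (P (0, y)) :=
    (hg.smooth c d).smooth_fderiv.diffAt
  have h1 := hd.hasFDerivAt.comp_hasDerivAt (0 : ℝ) (hasDerivAt_timeD (hs.diffAt))
  have h2 := h1.clm_apply (hasDerivAt_timeD ((contDiffAt_timeD hs).diffAt))
  refine h2.congr_deriv ?_
  have hv : timeD P (0, y) = f y • single s₀ 1 := hP.velocity.self_of_nhds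
  rw [hv, h.variation_zero hP]
  simp only [map_smul, smul_apply, smul_eq_mul]
  have e : partialD s₀ (partialD s₀ fun z => g z c d) Y = D (D fun z => g z c d) Y (single s₀ 1) (single s₀ 1) := by
    change D (fun x => D (fun z => g z c d) x (single s₀ 1)) _ _ = _
    rw [h.variation_zero hP] at hd
    rw [fderiv_clm_apply hd (differentiableAt_const _)]
    simp
  rw [e]
  simp only [Function.comp_apply, h.variation_zero hP]
  ring

/-- The second derivative of the pull-back metric. -/
theorem hasDerivAt_deriv_pullGram (a b : α) : HasDerivAt (fun s => pullGramD g P y s a b)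
      (f y ^ 2 * DDg a b + 2 * (partialD a f y * partialD b f y) + (acc (0, y) s₀ * Dg a b
        + ∑ e, acc (0, y) (emb e) * partialD e (fun x => h₀ x a b) y
        + ∑ c, partialD a (fun x => acc (0, x) (emb c)) y * h₀ y c b
        + ∑ c, partialD b (fun x => acc (0, x) (emb c)) y * h₀ y a c)) 0 := by
  obtain ⟨hg, hs⟩ := (h.variation_metric hP).self_of_nhds
  have hq : ∀ v, HasDerivAt (fun t => spaceD v P (t, y)) (spaceD v (timeD P) (0, y)) 0 := fun v => by
    rw [← timeD_spaceD hs]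
    exact hasDerivAt_timeD ((contDiffAt_spaceD hs v).diffAt)
  have hr : ∀ v, HasDerivAt (fun t => spaceD v (timeD P) (t, y)) (spaceD v acc (0, y)) 0 := fun v => by
    rw [← timeD_spaceD (contDiffAt_timeD hs)]
    exact hasDerivAt_timeD ((contDiffAt_spaceD (contDiffAt_timeD hs) v).diffAt)
  have hM := hasDerivAt_metric_variation hP hg hs
  have h1 := hasDerivAt_formOf_curve (g := fun s => of fun c d =>
    D (fun z => g z c d) (P (s, y)) (timeD P (s, y)))
    (g' := of fun c d => f y ^ 2 * partialD s₀ (partialD s₀ fun z => g z c d) Y + D (fun z => g z c d) Y (acc (0, y)))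
    (fun c d => by simpa only [of_apply] using h.hasDerivAt_fderiv_metric_zero hP c d) (hq (single a 1)) (hq (single b 1))
  have h2 := hasDerivAt_formOf_curve (g' := of fun c d =>
    D (fun z => g z c d) (P (0, y)) (timeD P (0, y))) hM (hr (single a 1)) (hq (single b 1))
  have h3 := hasDerivAt_formOf_curve (g' := of fun c d =>
    D (fun z => g z c d) (P (0, y)) (timeD P (0, y))) hM (hq (single a 1)) (hr (single b 1))
  refine ((h1.add h2).add h3).congr_deriv ?_
  have hv : timeD P (0, y) = f y • single s₀ 1 := hP.velocity.self_of_nhds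
  have hdA : ∀ c, DiffAt (fun x => acc (0, x) c) y := fun c => by
    have := (contDiffAt_timeD (contDiffAt_timeD hs)).diffAt
    exact differentiableAt_pi.1 (this.comp y (by fun_prop : DiffAt (fun x => ((0:ℝ), x)) y)) c
  have hacc : ∀ v c, spaceD v acc (0, y) c = D (fun x => acc (0, x) c) y v := fun v c => by
    have h4 := (contDiffAt_timeD (contDiffAt_timeD hs)).diffAt
    rw [← fderiv_slice h4]
    have h5 : DiffAt (fun x => acc (0, x)) y :=
      h4.comp y (by fun_prop : DiffAt (fun x => ((0:ℝ), x)) y)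
    rw [(hasFDerivAt_pi'.1 h5.hasFDerivAt c).fderiv]
    rfl
  have hl : ∀ (u : β → ℝ) b, formOf (g Y) u (single (emb b) 1) = ∑ c, u (emb c) * h₀ y c b := fun u b => by
    rw [formOf_apply, h.hyper.sum_eq]
    simp [h.hyper.sum_eq, h.g_sa, Pi.single_apply, h.hyper.inj.eq_iff, (h.hyper.ne _).symm, restr, mul_comm]
  have hl' : ∀ (u : β → ℝ) b, formOf (g Y) (single (emb b) 1) u = ∑ c, u (emb c) * h₀ y b c := fun u b => by
    rw [formOf_apply, sum_comm, h.hyper.sum_eq]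
    simp [h.hyper.sum_eq, h.g_as, Pi.single_apply, h.hyper.inj.eq_iff, (h.hyper.ne _).symm, restr, mul_comm]
  have z1 : ∀ a, D (fun z => g z s₀ (emb a)) Y (single s₀ 1) = 0 :=
    fun a => h.d_s_sa a
  have z2 : ∀ a, D (fun z => g z (emb a) s₀) Y (single s₀ 1) = 0 :=
    fun a => h.d_s_as a
  simp only [h.spaceD_zero hP, h.variation_zero hP, h.spaceD_timeD_zero hP, hv,
    incl_single h.hyper, formOf_single, map_smul, smul_apply, smul_eq_mul,
    of_apply, mul_zero, add_zero, zero_add, z1, z2, h.g_ss, hl, hl', hacc,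
    h.fderiv_metric_ab]
  simp only [nDeriv2, of_apply, partialD]
  ring

/-- The second variation of the volume density of a minimal hypersurface. -/
theorem hasDerivAt_deriv_sqrt_det_pullGram
    (h0 : (Hi * Dg).trace = 0) :
    HasDerivAt (deriv fun s => √(pullGram g P y s).det) (√(h₀ y).det * (gradInner h₀ f f y
        - 1 / 2 * (scalarCurvature g Y - scalarCurvature h₀ y + secondFundNormSq g emb (single s₀ 1) Y) * f y ^ 2)
        + ∑ c, partialD c (fun x => √(h₀ x).det * acc (0, x) (emb c)) y) 0 := by
  have h1 := hasDerivAt_deriv_sqrt_det (M := pullGram g P y) (h.posDef_pullGram hP)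
    (M₁ := pullGramD g P y) (M₂ := of fun a b => f y ^ 2 * DDg a b + 2 * (partialD a f y * partialD b f y)
        + (acc (0, y) s₀ * Dg a b
        + ∑ e, acc (0, y) (emb e) * partialD e (fun x => h₀ x a b) y
        + ∑ c, partialD a (fun x => acc (0, x) (emb c)) y * h₀ y c b
        + ∑ c, partialD b (fun x => acc (0, x) (emb c)) y * h₀ y a c))
    (h.hasDerivAt_pullGram hP) fun a b => by simpa only [of_apply] using h.hasDerivAt_deriv_pullGram hP a b
  refine h1.congr_deriv ?_
  have e0 : pullGramD g P y 0 = f y • Dg := by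
    ext a b
    exact ((h.hasDerivAt_pullGram hP).self_of_nhds a b).unique (h.hasDerivAt_pullGram_zero hP a b)
  rw [e0, h.pullGram_zero hP]
  have hA : ∀ c, DiffAt (fun x => acc (0, x) (emb c)) y := fun c => by
    have := (contDiffAt_timeD (contDiffAt_timeD hP.smooth_near.self_of_nhds)).diffAt
    exact differentiableAt_pi.1 (this.comp y (by fun_prop : DiffAt (fun x => ((0 : ℝ), x)) y)) (emb c)
  have hD : DiffAt (fun x => √(h₀ x).det) y :=
    ((contDiffAt_matrix_det h.hyper_metric.smooth).sqrt h.hyper_metric.posDef.det_pos.ne').diffAt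
  -- The tangential acceleration enters the second derivative of the metric as a Lie derivative.
  -- Half of its trace, times the density, is the divergence of the tangential acceleration.
  have hdiv : ∑ c, partialD c (fun x => √(h₀ x).det * acc (0, x) (emb c)) y = √(h₀ y).det * (∑ c,
        partialD c (fun x => acc (0, x) (emb c)) y + 1 / 2 * ∑ c,
        acc (0, y) (emb c) * (Hi * of fun a b => partialD c (fun x => h₀ x a b) y).trace) := by
    rw [mul_sum, ← sum_add_distrib, mul_sum]
    refine sum_congr rfl fun c _ => ?_
    rw [partialD_mul hD (hA c), partialD_sqrt_det h.hyper_metric]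
    ring
  have tr : ∀ B : Matrix α α ℝ, (Hi * B).trace = ∑ a, ∑ b, Hi a b * B b a := fun B => rfl
  have hsymm : ∀ a b, h₀ y a b = h₀ y b a := fun a b => (h.hyper_metric.symm_near a b).self_of_nhds
  have hgrad : ∀ (A : α → α → ℝ), ∑ a, ∑ b, Hi a b * ∑ c, A b c * h₀ y c a = ∑ c, A c c := fun A => by
    have h1 := (tr (of A * h₀ y)).symm
    rw [← Matrix.mul_assoc, trace_mul_comm, ← Matrix.mul_assoc, mul_nonsing_inv _ h.hyper_metric.isUnit_det,
      Matrix.one_mul] at h1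
    simpa only [Matrix.mul_apply, of_apply, trace, diag_apply] using h1
  have e2 : (Hi * of fun a b => f y ^ 2 * DDg a b + 2 * (partialD a f y * partialD b f y) + (acc (0, y) s₀ * Dg a b
        + ∑ e, acc (0, y) (emb e) * partialD e (fun x => h₀ x a b) y
        + ∑ c, partialD a (fun x => acc (0, x) (emb c)) y * h₀ y c b
        + ∑ c, partialD b (fun x => acc (0, x) (emb c)) y * h₀ y a c)).trace =
      f y ^ 2 * (Hi * DDg).trace
      + 2 * gradInner h₀ f f y
      + (∑ c, acc (0, y) (emb c) * (Hi * of fun a b => partialD c (fun x => h₀ x a b) y).trace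
        + 2 * ∑ c, partialD c (fun x => acc (0, x) (emb c)) y) := by
    have t1 : ∑ a, ∑ b, Hi a b * (f y ^ 2 * DDg b a) = f y ^ 2 * (Hi * DDg).trace := by
      simp only [tr, mul_sum]
      exact sum_congr rfl fun _ _ => sum_congr rfl fun _ _ => by ring
    have t2 : ∑ a, ∑ b, Hi a b * (2 * (partialD b f y * partialD a f y)) = 2 * gradInner h₀ f f y := by
      simp only [gradInner, gradOf, mul_sum]
      exact sum_congr rfl fun _ _ => sum_congr rfl fun _ _ => by ring
    -- The normal acceleration is multiplied by the mean curvature, which is zero.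
    have t3 : ∑ a, ∑ b, Hi a b * (acc (0, y) s₀ * Dg b a) = 0 := by
      rw [tr] at h0
      simp only [mul_left_comm _ (acc (0, y) s₀), ← mul_sum, h0, mul_zero]
    have t4 : ∑ a, ∑ b, Hi a b * ∑ e, acc (0, y) (emb e) * partialD e (fun x => h₀ x b a) y = ∑ c, acc (0, y) (emb c) *
        (Hi * of fun a b => partialD c (fun x => h₀ x a b) y).trace := by
      simp only [tr, mul_sum, of_apply]
      rw [sum_rotate]
      exact sum_congr rfl fun _ _ => sum_congr rfl fun _ _ =>
        sum_congr rfl fun _ _ => by ring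
    have t5 := hgrad fun b c => partialD b (fun x => acc (0, x) (emb c)) y
    have t6 : ∑ a, ∑ b, Hi a b * ∑ c, partialD a (fun x =>
        acc (0, x) (emb c)) y * h₀ y b c = ∑ c, partialD c (fun x =>
        acc (0, x) (emb c)) y := by
      rw [← t5, sum_comm]
      refine sum_congr rfl fun b _ => sum_congr rfl fun a _ => ?_
      rw [h.restr_inv_comm a b]
      congr 1
      exact sum_congr rfl fun c _ => by rw [hsymm b c]
    rw [tr]
    simp only [of_apply, mul_add, sum_add_distrib]
    rw [t1, t2, t3, t4, t5, t6]
    ring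
  -- The trace of `∂_s² g` is exchanged for scalar curvatures. This is the identity `Ric(ν,ν) + |A|²
  -- = ½ (R - R_Σ + |A|²)` for vanishing mean curvature.
  rw [e2, hdiv, h.scalarCurvature_eq, h.secondFundNormSq_eq, h0]
  simp only [Matrix.smul_mul, Matrix.mul_smul, Matrix.trace_smul, smul_eq_mul, h0]
  ring
end

end IsFermiAt

end DensityVariation

notation:max "Ξ" => planeParam
notation:max "γ" e:max j:max => inducedMetric (Ξ e j)

/-! ### Charts that flatten submanifolds. -/

section FlatCharts

variable {N : ℕ}

/-- `headCoords` as a continuous linear map. -/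
def headCLM (N j : ℕ) : Amb N →L[ℝ] Fin j → ℝ :=
  LinearMap.toContinuousLinearMap {
      toFun := headCoords j
      map_add' := fun v w => by ext i; simp only [headCoords, Pi.add_apply]; split_ifs <;> simp
      map_smul' := fun c v => by
        ext i; simp only [headCoords, Pi.smul_apply, RingHom.id_apply]; split_ifs <;> simp }

/-- `padCoords` as a continuous linear map. -/
def padCLM (N j : ℕ) : (Fin j → ℝ) →L[ℝ] Amb N :=
  LinearMap.toContinuousLinearMap {
      toFun := padCoords j
      map_add' := fun v w => by
        ext i; simp only [padCoords, PiLp.add_apply]; split_ifs <;> simp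
      map_smul' := fun c v => by
        ext i; simp only [padCoords, PiLp.smul_apply, RingHom.id_apply]; split_ifs <;> simp }

theorem coe_headCLM (j : ℕ) : ⇑(headCLM N j) = headCoords j := rfl

theorem coe_padCLM (j : ℕ) : ⇑(padCLM N j) = padCoords j := rfl

theorem headCoords_apply {j : ℕ} (hj : j ≤ N) (v : Amb N) (i : Fin j) :
    headCoords j v i = v ⟨i.1, i.2.trans_le hj⟩ := dif_pos _

theorem padCoords_apply_of_lt {j : ℕ} (y : Fin j → ℝ) {i : Fin N} (h : i.1 < j) :
    padCoords j y i = y ⟨i.1, h⟩ := dif_pos h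

theorem padCoords_apply_of_le {j : ℕ} (y : Fin j → ℝ) {i : Fin N} (h : j ≤ i.1) :
    padCoords j y i = 0 := dif_neg h.not_gt

theorem headCoords_padCoords {j : ℕ} (hj : j ≤ N) (y : Fin j → ℝ) : headCoords j (padCoords j y : Amb N) = y := by
  ext i
  rw [headCoords_apply hj, padCoords_apply_of_lt y (i := ⟨i.1, i.2.trans_le hj⟩) i.2]

theorem padCoords_headCoords {j : ℕ} {v : Amb N} (h : ∀ i : Fin N, j ≤ i.1 → v i = 0) :
    padCoords j (headCoords j v) = v := by
  ext i
  by_cases hi : i.1 < j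
  · rw [padCoords_apply_of_lt _ hi, headCoords, dif_pos i.2]
  · rw [padCoords_apply_of_le _ (not_lt.1 hi), h i (not_lt.1 hi)]

/-- The parameters of the submanifold flattened by `e`. -/
def dom (e : Chart N) (j : ℕ) : Set (Fin j → ℝ) :=
  {y | padCoords j y ∈ e.target}

theorem isOpen_dom (e : Chart N) (j : ℕ) : IsOpen (dom e j) :=
  e.open_target.preimage (padCLM N j).continuous

theorem dom_mem_nhds {e : Chart N} {j : ℕ} {y : Fin j → ℝ} (hy : y ∈ dom e j) : dom e j ∈ 𝓝 y :=
  (isOpen_dom e j).mem_nhds hy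

namespace Flattens

variable {L : ℕ → Set (Amb N)} {I : Set ℕ} {e : Chart N} {j : ℕ}
  {y : Fin j → ℝ} {x : Amb N}

theorem contDiffAt (h : Flattens L I e) (hx : x ∈ e.source) : SmoothAt e x :=
  h.smooth.contDiffAt (e.open_source.mem_nhds hx)

theorem contDiffAt_symm (h : Flattens L I e) (hx : x ∈ e.target) : SmoothAt e.symm x :=
  h.smooth_symm.contDiffAt (e.open_target.mem_nhds hx)

theorem mono {I' : Set ℕ} (h : Flattens L I e) (hI : I' ⊆ I) : Flattens L I' e :=
  ⟨h.smooth, h.smooth_symm, fun j hj => h.flat j (hI hj)⟩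

theorem planeParam_mem_source (hy : y ∈ dom e j) : Ξ e j y ∈ e.source :=
  e.map_target hy

theorem apply_planeParam (hy : y ∈ dom e j) : e (Ξ e j y) = padCoords j y :=
  e.right_inv hy

theorem headCoords_planeParam (hjN : j ≤ N) (hy : y ∈ dom e j) : headCoords j (e (Ξ e j y)) = y := by
  rw [apply_planeParam hy, headCoords_padCoords hjN]

theorem planeParam_mem (h : Flattens L I e) (hj : j ∈ I) (hy : y ∈ dom e j) : Ξ e j y ∈ L j := by
  rw [h.flat j hj _ (planeParam_mem_source hy), apply_planeParam hy]
  exact fun i hi => padCoords_apply_of_le y hi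

theorem pad_head (h : Flattens L I e) (hj : j ∈ I) (hx : x ∈ e.source) (hxL : x ∈ L j) :
    padCoords j (headCoords j (e x)) = e x :=
  padCoords_headCoords ((h.flat j hj x hx).1 hxL)

theorem head_mem (h : Flattens L I e) (hj : j ∈ I) (hx : x ∈ e.source) (hxL : x ∈ L j) :
    headCoords j (e x) ∈ dom e j := by
  rw [dom, mem_ofPred_eq, h.pad_head hj hx hxL]
  exact e.map_source hx

theorem planeParam_head (h : Flattens L I e) (hj : j ∈ I) (hx : x ∈ e.source) (hxL : x ∈ L j) :
    Ξ e j (headCoords j (e x)) = x := by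
  rw [planeParam, h.pad_head hj hx hxL, e.left_inv hx]

theorem image_planeParam (h : Flattens L I e) (hj : j ∈ I) : Ξ e j '' dom e j = L j ∩ e.source := by
  ext x
  constructor
  · rintro ⟨y, hy, rfl⟩
    exact ⟨h.planeParam_mem hj hy, planeParam_mem_source hy⟩
  · exact fun hx => ⟨_, h.head_mem hj hx.2 hx.1, h.planeParam_head hj hx.2 hx.1⟩

theorem injOn_planeParam (hjN : j ≤ N) : InjOn (Ξ e j) (dom e j) :=
  fun y hy y' hy' hyy => by
    rw [← headCoords_planeParam hjN hy, hyy, headCoords_planeParam hjN hy']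

theorem contDiffAt_planeParam (h : Flattens L I e) (hy : y ∈ dom e j) : SmoothAt (Ξ e j) y :=
  (h.contDiffAt_symm hy).comp y (padCLM N j).contDiff.contDiffAt

theorem contDiffOn_planeParam (h : Flattens L I e) : ContDiffOn ℝ ∞ (Ξ e j) (dom e j) :=
  fun _ hy => (h.contDiffAt_planeParam hy).contDiffWithinAt

theorem fderiv_apply_fderiv_planeParam (h : Flattens L I e) (hy : y ∈ dom e j)
    (v : Fin j → ℝ) :
    D e (Ξ e j y) (D (Ξ e j) y v) = padCoords j v := by
  have h1 : (fun z => e (Ξ e j z)) =ᶠ[𝓝 y] padCLM N j := by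
    filter_upwards [dom_mem_nhds hy] with z hz using apply_planeParam hz
  have h3 := (h.contDiffAt (planeParam_mem_source hy)).diffAt.hasFDerivAt
  have h4 := (h.contDiffAt_planeParam hy).diffAt.hasFDerivAt
  have h5 := (h3.comp y h4).unique ((padCLM N j).hasFDerivAt.congr_of_eventuallyEq h1)
  exact DFunLike.congr_fun h5 v

theorem injective_fderiv (h : Flattens L I e) (hx : x ∈ e.source) : Injective (D e x) := fun u v huv => by
  have h3 := (h.contDiffAt hx).diffAt.hasFDerivAt
  have h4 := (h.contDiffAt_symm (e.map_source hx)).diffAt.hasFDerivAt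
  have h1 : (fun z => e.symm (e z)) =ᶠ[𝓝 x] id := by
    filter_upwards [e.open_source.mem_nhds hx] with z hz using e.left_inv hz
  have h5 := (h4.comp x h3).unique ((hasFDerivAt_id x).congr_of_eventuallyEq h1)
  have e1 : ∀ v, D e.symm (e x) (D e x v) = v := DFunLike.congr_fun h5
  rw [← e1 u, huv, e1 v]

theorem injective_fderiv_planeParam (h : Flattens L I e) (hjN : j ≤ N) (hy : y ∈ dom e j) :
    Injective (D (Ξ e j) y) := fun u v huv => by
  have := h.fderiv_apply_fderiv_planeParam hy u
  rw [huv, h.fderiv_apply_fderiv_planeParam hy v] at this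
  rw [← headCoords_padCoords hjN u, ← this, headCoords_padCoords hjN]

theorem isMetricAt (h : Flattens L I e) (hjN : j ≤ N) (hy : y ∈ dom e j) : IsMetricAt (γ e j) y := by
  have hd := dom_mem_nhds hy
  constructor
  · filter_upwards [hd] with z hz a b
    have h1 := (h.contDiffAt_planeParam hz).smooth_fderiv
    exact (h1.clm_apply contDiffAt_const).inner ℝ (h1.clm_apply contDiffAt_const)
  · filter_upwards [hd] with z hz
    exact gramOf_posDef _ (h.injective_fderiv_planeParam hjN hz)

theorem formOf_inducedMetric (ψ : (Fin j → ℝ) → Amb N) (y u v : Fin j → ℝ) :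
    formOf (inducedMetric ψ y) u v = inner ℝ (D ψ y u) (D ψ y v) := by
  rw [formOf_apply]
  conv_rhs => rw [← univ_sum_single u, ← univ_sum_single v, map_sum, map_sum, sum_inner]
  refine sum_congr rfl fun a _ => ?_
  rw [inner_sum]
  refine sum_congr rfl fun b _ => ?_
  have e : ∀ (w : Fin j → ℝ) a, D ψ y (single a (w a)) = w a • D ψ y (single a 1) := fun w a => by
    rw [← map_smul, ← Pi.single_smul, smul_eq_mul, mul_one]
  rw [e, e, real_inner_smul_left, real_inner_smul_right, inducedMetric, of_apply]
  ring

/-- The tangent space of the flattened submanifold. -/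
theorem tangentSpan_eq (h : Flattens L I e) (hj : j ∈ I) (hy : y ∈ dom e j) :
    tangentSpan (L j) (Ξ e j y) = LinearMap.range (D (Ξ e j) y).toLinearMap := by
  have hx := planeParam_mem_source hy
  refine le_antisymm (Submodule.span_le.2 fun v hv => ?_) ?_
  · have hde := (h.contDiffAt hx).diffAt.hasFDerivAt
    -- The last coordinates of `e` vanish on `L j`, so their derivatives vanish on its tangent cone.
    have h1 : ∀ i : Fin N, j ≤ i.1 → D e (Ξ e j y) v i = 0 := fun i hi => by
      have h2 : HasFDerivWithinAt (fun z => e z i) ((EuclideanSpace.proj i : Amb N →L[ℝ] ℝ).comp (D e (Ξ e j y))) (L j)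
          (Ξ e j y) :=
        ((EuclideanSpace.proj i : Amb N →L[ℝ] ℝ).hasFDerivAt.comp _ hde).hasFDerivWithinAt
      have h3 : HasFDerivWithinAt (fun z => e z i) (0 : Amb N →L[ℝ] ℝ) (L j) (Ξ e j y) := by
        refine (hasFDerivWithinAt_const (0 : ℝ) _ _).congr_of_eventuallyEq ?_ ?_
        · filter_upwards [self_mem_nhdsWithin, mem_nhdsWithin_of_mem_nhds (e.open_source.mem_nhds hx)] with z hz hz'
          exact (h.flat j hj z hz').1 hz i hi
        · exact (h.flat j hj _ hx).1 (h.planeParam_mem hj hy) i hi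
      exact h2.unique_on h3 hv
    refine ⟨headCoords j (D e (Ξ e j y) v), h.injective_fderiv hx ?_⟩
    exact (h.fderiv_apply_fderiv_planeParam hy _).trans (padCoords_headCoords h1)
  · rintro _ ⟨v, rfl⟩
    refine Submodule.subset_span ?_
    have h1 := (h.contDiffAt_planeParam hy).diffAt.hasFDerivAt.hasFDerivWithinAt (s := dom e j)
    -- Conversely, the parameter domain is open, so every direction is tangent to it, and the
    -- parametrization carries it into `L j`.
    have h2 : v ∈ tangentConeAt ℝ (dom e j) y := by
      rw [← univ_inter (dom e j), tangentConeAt_inter_nhds (dom_mem_nhds hy), tangentConeAt_univ]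
      trivial
    refine tangentConeAt_mono ?_ (HasFDerivWithinAt.mapsTo_tangent_cone h1 h2)
    rw [h.image_planeParam hj]
    exact inter_subset_left

end Flattens

/-- The inverse function theorem. -/
theorem exists_openPartialHomeomorph {f : Amb N → Amb N} {x : Amb N} {W : Set (Amb N)} (hW : IsOpen W)
    (hx : x ∈ W) (hf : ContDiffOn ℝ ∞ f W) (hinj : Injective (D f x)) :
    ∃ E : Chart N, x ∈ E.source ∧ E.source ⊆ W ∧ ⇑E = f ∧
      ContDiffOn ℝ ∞ E E.source ∧ ContDiffOn ℝ ∞ E.symm E.target := by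
  have hfx : ∀ z ∈ W, SmoothAt f z := fun z hz => hf.contDiffAt (hW.mem_nhds hz)
  have key : ∀ z, Injective (D f z) → ∃ L : Amb N ≃L[ℝ] Amb N, (L : Amb N →L[ℝ] Amb N) = D f z := fun z hz =>
    ⟨(LinearEquiv.ofInjectiveEndo (D f z).toLinearMap hz).toContinuousLinearEquiv, by
      ext v; rfl⟩
  obtain ⟨L, hL⟩ := key x hinj
  have hdx : HasFDerivAt f (L : Amb N →L[ℝ] Amb N) x := by
    rw [hL]; exact (hfx x hx).diffAt.hasFDerivAt
  set E₀ := (hfx x hx).toOpenPartialHomeomorph f hdx (by simp) with hE₀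
  have hcoe : ⇑E₀ = f := (hfx x hx).toOpenPartialHomeomorph_coe hdx (by simp)
  have hxE : x ∈ E₀.source := (hfx x hx).mem_toOpenPartialHomeomorph_source hdx (by simp)
  -- Restricting to points with invertible derivative makes the inverse smooth on its whole domain
  -- and not only at the image of `x`.
  set V : Set (Amb N) := {z ∈ W | (D f z).det ≠ 0} with hV
  have hVo : IsOpen V := by
    have hc : ContinuousOn (fun z => (D f z).det) W :=
      ContinuousLinearMap.continuous_det.comp_continuousOn (hf.continuousOn_fderiv_of_isOpen hW (by simp))
    exact hc.isOpen_inter_preimage hW isOpen_ne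
  have hdet : ∀ z, (D f z).det ≠ 0 ↔ Injective (D f z) := fun z => by
    rw [ContinuousLinearMap.det, ← isUnit_iff_ne_zero, ← LinearMap.isUnit_iff_isUnit_det,
      LinearMap.isUnit_iff_ker_eq_bot, LinearMap.ker_eq_bot]
    rfl
  have hxV : x ∈ V := ⟨hx, (hdet x).2 hinj⟩
  refine ⟨E₀.restrOpen V hVo, ⟨hxE, hxV⟩, fun z hz => hz.2.1, hcoe, ?_, ?_⟩
  · intro z hz
    change ContDiffWithinAt ℝ ∞ E₀ _ z
    rw [hcoe]
    exact (hfx z hz.2.1).contDiffWithinAt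
  · intro z hz
    have hz' : (E₀.restrOpen V hVo).symm z ∈ (E₀.restrOpen V hVo).source :=
      (E₀.restrOpen V hVo).map_target hz
    have hzW : E₀.symm z ∈ V := hz'.2
    obtain ⟨L', hL'⟩ := key _ ((hdet _).1 hzW.2)
    refine ((E₀.restrOpen V hVo).contDiffAt_symm (f₀' := L') hz ?_ ?_).contDiffWithinAt
    · change HasFDerivAt E₀ _ (E₀.symm z)
      rw [hL', hcoe]
      exact (hfx _ hzW.1).diffAt.hasFDerivAt
    · change SmoothAt E₀ (E₀.symm z)
      rw [hcoe]
      exact hfx _ hzW.1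

end FlatCharts

/-! ### Charts that flatten several leaves at once. -/

section FlatChartExistence

variable {N : ℕ}

/-- A vector all of whose coordinates but the first `j` vanish. -/
theorem eq_zero_of_headCoords {j : ℕ} {v : Amb N} (h : ∀ i : Fin N, j ≤ i.1 → v i = 0)
    (h' : headCoords j v = 0) : v = 0 := by
  rw [← padCoords_headCoords h, h', ← coe_padCLM, map_zero]

/-- Coordinates that flatten a submanifold and a hypersurface of it can be combined. -/
theorem Flattens.exists_insert {L : ℕ → Set (Amb N)} {I : Set ℕ} {m : ℕ}
    {e e' : Chart N} (hm : m + 1 ≤ N) (hI : m + 1 ∈ I)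
    (hIm : ∀ i ∈ I, m + 1 ≤ i) (he : Flattens L I e) (he' : Flattens L {m} e')
    (hL : L m ⊆ L (m + 1)) {x : Amb N} (hx : x ∈ e.source) (hx' : x ∈ e'.source) (hxm : x ∈ L m) :
    ∃ E : Chart N, x ∈ E.source ∧ Flattens L (insert m I) E := by
  have hmN : m ≤ N := m.le_succ.trans hm
  have hdx : DiffAt e x := (he.contDiffAt hx).diffAt
  have hdx' : DiffAt e' x := (he'.contDiffAt hx').diffAt
  -- the tangent spaces at `x`
  set p := headCoords m (e' x) with hp
  set q := headCoords (m + 1) (e x) with hq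
  have hpd : p ∈ dom e' m := he'.head_mem rfl hx' hxm
  have hqd : q ∈ dom e (m + 1) := he.head_mem hI hx (hL hxm)
  have hpx : Ξ e' m p = x := he'.planeParam_head rfl hx' hxm
  have hqx : Ξ e (m + 1) q = x := he.planeParam_head hI hx (hL hxm)
  have tan' : ∀ v : Amb N, (∃ u, D (Ξ e' m) p u = v) → ∀ i : Fin N, m ≤ i.1 → D e' x v i = 0 := by
    rintro _ ⟨u, rfl⟩ i hi
    rw [← hpx, he'.fderiv_apply_fderiv_planeParam hpd, padCoords_apply_of_le _ hi]
  -- a vector transversal to the hypersurface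
  obtain ⟨w, hwne, hw0, hwline⟩ : ∃ w : Fin (m + 1) → ℝ, w ≠ 0 ∧ headCoords m (D e' x (D (Ξ e (m + 1)) q w)) = 0 ∧
      ∀ v, headCoords m (D e' x (D (Ξ e (m + 1)) q v)) = 0 → ∃ c : ℝ, v = c • w := by
    -- The `m` flat coordinates of the hypersurface, differentiated along `L (m + 1)`. The map is
    -- onto because the tangent space of `L m` lies in that of `L (m + 1)`, so its kernel is a line.
    set A : (Fin (m + 1) → ℝ) →ₗ[ℝ] (Fin m → ℝ) :=
      ((headCLM N m).comp ((D e' x).comp (D (Ξ e (m + 1)) q))).toLinearMap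
      with hA
    have hsurj : Function.Surjective A := by
      intro u
      have h1 : D (Ξ e' m) p u ∈ tangentSpan (L (m + 1)) x := by
        have h2 : tangentSpan (L m) x ≤ tangentSpan (L (m + 1)) x :=
          Submodule.span_mono (tangentConeAt_mono hL)
        refine h2 ?_
        rw [← hpx, he'.tangentSpan_eq rfl hpd]
        exact ⟨u, rfl⟩
      rw [← hqx, he.tangentSpan_eq hI hqd] at h1
      obtain ⟨v, hv⟩ := h1
      refine ⟨v, ?_⟩
      change headCoords m (D e' x (D (Ξ e (m + 1)) q v)) = u
      rw [show D (Ξ e (m + 1)) q v = D (Ξ e' m) p u from hv, ← hpx,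
        he'.fderiv_apply_fderiv_planeParam hpd, headCoords_padCoords hmN]
    have hker : Module.finrank ℝ (LinearMap.ker A) = 1 := by
      have h1 := A.finrank_range_add_finrank_ker
      rw [LinearMap.range_eq_top.2 hsurj, finrank_top] at h1
      simp only [Module.finrank_fin_fun] at h1
      omega
    obtain ⟨w, hwne, hw⟩ := finrank_eq_one_iff'.1 hker
    refine ⟨w, fun h => hwne (Subtype.ext h), w.2, fun v hv => ?_⟩
    obtain ⟨c, hc⟩ := hw ⟨v, hv⟩
    exact ⟨c, (congrArg Subtype.val hc).symm⟩
  -- Among the coordinates of `e'` that vanish on `L m`, one has non-zero derivative in the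
  -- transversal direction. It becomes the new coordinate number `m`.
  obtain ⟨r, hrm, hr⟩ : ∃ r : Fin N, m ≤ r.1 ∧ D e' x (D (Ξ e (m + 1)) q w) r ≠ 0 := by
    by_contra! hcon
    have h1 := eq_zero_of_headCoords hcon hw0
    have h2 := he'.injective_fderiv hx' (h1.trans (map_zero _).symm)
    exact hwne (he.injective_fderiv_planeParam hm hqd (h2.trans (map_zero _).symm))
  -- the new coordinates
  set f : Amb N → Amb N := fun y => WithLp.toLp 2 fun l : Fin N =>
    if l.1 < m then e' y l else if l.1 = m then e' y r else e y l with hf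
  set W := e.source ∩ e'.source with hW
  have hWo : IsOpen W := e.open_source.inter e'.open_source
  have hfW : ContDiffOn ℝ ∞ f W := by
    rw [contDiffOn_euclidean]
    intro l
    have h1 : ∀ i, ContDiffOn ℝ ∞ (fun y => e y i) W := fun i =>
      contDiffOn_euclidean.1 (he.smooth.mono inter_subset_left) i
    have h2 : ∀ i, ContDiffOn ℝ ∞ (fun y => e' y i) W := fun i =>
      contDiffOn_euclidean.1 (he'.smooth.mono inter_subset_right) i
    simp only [hf]
    split_ifs
    exacts [h2 l, h2 r, h1 l]
  have hfd : ∀ v l, D f x v l = if l.1 < m then D e' x v l else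
      if l.1 = m then D e' x v r else D e x v l := by
    intro v l
    have h0 : ∀ (G : Amb N → Amb N) i, DiffAt G x →
        HasFDerivAt (fun y => G y i) ((EuclideanSpace.proj i : Amb N →L[ℝ] ℝ).comp (D G x)) x :=
      fun G i hG => (EuclideanSpace.proj i : Amb N →L[ℝ] ℝ).hasFDerivAt.comp x hG.hasFDerivAt
    have h1 := h0 f l ((hfW.contDiffAt (hWo.mem_nhds ⟨hx, hx'⟩)).diffAt)
    simp only [hf] at h1
    split_ifs with c1 c2
    · simp only [c1, if_true] at h1
      exact DFunLike.congr_fun (h1.unique (h0 e' l hdx')) v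
    · simp only [c2, if_true, if_false, lt_irrefl] at h1
      exact DFunLike.congr_fun (h1.unique (h0 e' r hdx')) v
    · simp only [c1, c2, if_false] at h1
      exact DFunLike.congr_fun (h1.unique (h0 e l hdx)) v
  have hinj : Injective (D f x) := by
    rw [injective_iff_map_eq_zero]
    intro v hv
    have hl : ∀ l, D f x v l = 0 := fun l => by rw [hv]; rfl
    simp only [hfd] at hl
    -- A vector in the kernel is tangent to `L (m + 1)` by its last coordinates and a multiple of
    -- `w` by its first `m`; the coordinate `r` then excludes a non-zero multiple.
    have hvt : v = D (Ξ e (m + 1)) q (headCoords (m + 1) (D e x v)) := by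
      refine he.injective_fderiv hx ?_
      have h1 := he.fderiv_apply_fderiv_planeParam hqd (headCoords (m + 1) (D e x v))
      rw [hqx] at h1
      rw [h1, padCoords_headCoords]
      intro i hi
      have := hl i
      rwa [if_neg (by omega), if_neg (by omega)] at this
    obtain ⟨c, hc⟩ := hwline (headCoords (m + 1) (D e x v)) (by
      rw [← hvt]
      ext i
      rw [headCoords_apply hmN]
      have := hl ⟨i.1, i.2.trans_le hmN⟩
      rwa [if_pos i.2] at this)
    have h2 := hl ⟨m, hm⟩
    rw [if_neg (lt_irrefl m), if_pos rfl, hvt, hc, map_smul, map_smul, PiLp.smul_apply, smul_eq_mul, mul_eq_zero] at h2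
    have hc0 : c = 0 := h2.resolve_right hr
    rw [hvt, hc, hc0, zero_smul, map_zero]
  obtain ⟨E₀, hxE, hEW, hEf, hEs, hEs'⟩ := exists_openPartialHomeomorph hWo ⟨hx, hx'⟩ hfW hinj
  -- shrink the domain
  set t : Amb N → Amb N := fun z => e'.symm (padCLM N m (headCLM N m (e' z))) with ht
  set V := (e'.source ∩ (fun z => padCLM N m (headCLM N m (e' z))) ⁻¹' e'.target) ∩ t ⁻¹' E₀.source with hV
  have hVo : IsOpen V := by
    have h1 : ContinuousOn (fun z => padCLM N m (headCLM N m (e' z))) e'.source := by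
      exact (padCLM N m).continuous.comp_continuousOn ((headCLM N m).continuous.comp_continuousOn e'.continuousOn)
    have h2 := h1.isOpen_inter_preimage e'.open_source e'.open_target
    have h3 : ContinuousOn t (e'.source ∩ (fun z => padCLM N m (headCLM N m (e' z))) ⁻¹' e'.target) :=
      e'.symm.continuousOn.comp (h1.mono inter_subset_left) fun z hz => hz.2
    exact h3.isOpen_inter_preimage h2 E₀.open_source
  have htx : t x = x := he'.planeParam_head rfl hx' hxm
  have hxV : x ∈ V := by
    refine ⟨⟨hx', ?_⟩, ?_⟩
    · exact hpd
    · rw [mem_preimage, htx]; exact hxE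
  refine ⟨E₀.restrOpen V hVo, ⟨hxE, hxV⟩, ?_, ?_, ?_⟩
  · exact hEs.mono inter_subset_left
  · exact hEs'.mono fun z hz => hz.1
  · intro i hi y hy
    have hyW := hEW hy.1
    change y ∈ L i ↔ ∀ l : Fin N, i ≤ l.1 → E₀ y l = 0
    rw [hEf]
    rcases hi with rfl | hi
    · have fwd : ∀ y ∈ W, y ∈ L i → ∀ l : Fin N, i ≤ l.1 → f y l = 0 := by
        intro y hyW hyi l hl
        simp only [hf]
        rw [if_neg (by omega)]
        split_ifs with hl'
        · exact (he'.flat i rfl y hyW.2).1 hyi r hrm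
        · exact (he.flat (i + 1) hI y hyW.1).1 (hL hyi) l (by omega)
      refine ⟨fwd y hyW, fun h => ?_⟩
      -- The flat projection `t y` lies in `L i` and has the same new coordinates as `y`. By
      -- injectivity of the chart they coincide, so `y` is in `L i`; the smaller domain keeps `t y`
      -- in the chart.
      have hz : t y ∈ L i := he'.planeParam_mem rfl hy.2.1.2
      have hzE : t y ∈ E₀.source := hy.2.2
      have hez : e' (t y) = padCoords i (headCoords i (e' y)) := e'.right_inv hy.2.1.2
      have : E₀ (t y) = E₀ y := by
        rw [hEf]
        ext l
        by_cases hl : i ≤ l.1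
        · rw [h l hl, fwd _ (hEW hzE) hz l hl]
        · simp only [hf]
          rw [if_pos (not_le.1 hl), if_pos (not_le.1 hl), hez, padCoords_apply_of_lt _ (not_le.1 hl),
            headCoords_apply hmN]
      rw [← E₀.injOn hzE hy.1 this]
      exact hz
    · rw [he.flat i hi y hyW.1]
      have := hIm i hi
      refine forall₂_congr fun l hl => ?_
      simp only [hf]
      rw [if_neg (by omega), if_neg (by omega)]

namespace Slicing

variable {n k : ℕ} {S : Slicing N n} {Ω : Set (Amb N)}

namespace IsMinimal

theorem reg_subset_succ (hS : S.IsMinimal Ω k) {j : ℕ} (hj : j ∈ Ico k n) : S.reg j ⊆ S.reg (j + 1) := fun _ hx =>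
  ⟨hS.nested j hj hx.1, fun i hi => hx.2 i ⟨j.le_succ.trans hi.1, hi.2⟩⟩

theorem reg_mono (hS : S.IsMinimal Ω k) {j i : ℕ} (hj : k ≤ j) (hji : j ≤ i) (hi : i ≤ n) : S.reg j ⊆ S.reg i := by
  induction i, hji using Nat.le_induction with
  | base => exact subset_rfl
  | succ i hji ih => exact (ih (by omega)).trans (hS.reg_subset_succ ⟨hj.trans hji, hi⟩)

/-- Near the regular points, all the leaves above are flattened by one coordinate system. -/
theorem exists_flattens (hS : S.IsMinimal Ω k) {j : ℕ} (hkj : k ≤ j) (hj : j ≤ n) {x : Amb N}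
    (hx : x ∈ S.reg j) : ∃ e : Chart N, x ∈ e.source ∧ Flattens S.leaf (Icc j n) e := by
  obtain ⟨d, hd⟩ : ∃ d, n = j + d := ⟨n - j, by omega⟩
  -- Descending induction on `j`: the top leaf has a chart by regularity, and each step inserts one
  -- more hypersurface.
  induction d generalizing j with
  | zero =>
    obtain ⟨e, hxe, he⟩ := hx.2 j ⟨le_rfl, hj⟩
    refine ⟨e, hxe, he.smooth, he.smooth_symm, fun i hi => ?_⟩
    obtain rfl : i = j := le_antisymm (by have := hi.2; omega) hi.1
    exact he.flat i rfl
  | succ d ih =>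
    have hjk : j ∈ Ico k n := ⟨hkj, by omega⟩
    obtain ⟨e, hxe, he⟩ := ih (by omega) (by omega) (hS.reg_subset_succ hjk hx) (by omega)
    obtain ⟨e', hxe', he'⟩ := hx.2 j ⟨le_rfl, hj⟩
    have h1 : Flattens S.leaf {j} e' := ⟨he'.smooth, he'.smooth_symm, fun i hi => by
      obtain rfl : i = j := hi
      exact he'.flat i rfl⟩
    obtain ⟨E, hxE, hE⟩ := Flattens.exists_insert (m := j) (I := Icc (j + 1) n) ((Nat.succ_le_of_lt hjk.2).trans hS.dim_le)
      ⟨le_rfl, hjk.2⟩ (fun i hi => hi.1) he h1 (hS.nested j hjk) hxe hxe' hx.1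
    refine ⟨E, hxE, hE.mono fun i hi => ?_⟩
    rcases hi.1.eq_or_lt with h | h
    exacts [Or.inl h.symm, Or.inr ⟨h, hi.2⟩]

end IsMinimal

end Slicing

end FlatChartExistence

/-! ### Existence of Fermi charts. -/

section FermiChart

variable {N : ℕ}

theorem isHyperplane_castSucc (j : ℕ) : IsHyperplane (castSucc (n := j)) (last j) where
  inj := Fin.castSucc_injective j
  ne := fun a => (Fin.castSucc_lt_last a).ne
  cover := fun b => by
    rcases Fin.eq_castSucc_or_eq_last b with ⟨a, rfl⟩ | rfl
    exacts [Or.inr ⟨a, rfl⟩, Or.inl rfl]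

theorem padCoords_incl {j : ℕ} (y : Fin j → ℝ) : (padCoords (j + 1) (incl castSucc y) : Amb N) = padCoords j y := by
  ext i
  rcases lt_trichotomy i.1 j with h | h | h
  · rw [padCoords_apply_of_lt _ h, padCoords_apply_of_lt _ (h.trans (Nat.lt_succ_self j))]
    exact incl_emb (isHyperplane_castSucc j) y ⟨i.1, h⟩
  · rw [padCoords_apply_of_le _ h.ge, padCoords_apply_of_lt _ (h.trans_lt (Nat.lt_succ_self j))]
    have : (⟨i.1, h.trans_lt (Nat.lt_succ_self j)⟩ : Fin (j + 1)) = last j := Fin.ext h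
    rw [this]
    exact incl_normal (isHyperplane_castSucc j) y
  · rw [padCoords_apply_of_le _ h.le, padCoords_apply_of_le _ h]

theorem planeParam_incl (e : Chart N) {j : ℕ} (y : Fin j → ℝ) : Ξ e (j + 1) (incl castSucc y) = Ξ e j y := by
  rw [planeParam, padCoords_incl, planeParam]

theorem incl_mem_dom {e : Chart N} {j : ℕ}
    {y : Fin j → ℝ} : incl castSucc y ∈ dom e (j + 1) ↔ y ∈ dom e j := by
  simp only [dom, mem_ofPred_eq, padCoords_incl]

/-- The fields along the hypersurface that `e` flattens are `∂_s` and are geodesic to first order. -/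
structure IsFermiChart (ν : Amb N → Amb N) (j : ℕ) (e : Chart N) :
    Prop where
  velocity : ∀ y ∈ dom e j, D (Ξ e (j + 1)) (incl castSucc y) (single (last j) 1) = ν (Ξ e j y)
  acceleration : ∀ y ∈ dom e j, ∀ v, inner ℝ (D (fun w => D (Ξ e (j + 1)) w (single (last j) 1))
      (incl castSucc y) (single (last j) 1))
    (D (Ξ e (j + 1)) (incl castSucc y) v) = 0

/-- The derivative of the velocity of the image of a curve. -/
theorem hasDerivAt_fderiv_curve {V W : Type*} [NormedAddCommGroup V] [NormedSpace ℝ V]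
    [NormedAddCommGroup W] [NormedSpace ℝ W] {F : V → W} {c c' : ℝ → V} {c'' : V} {t : ℝ}
    (hF : SmoothAt F (c t)) (hc : HasDerivAt c (c' t) t) (hc' : HasDerivAt c' c'' t) :
    HasDerivAt (fun s => D F (c s) (c' s)) (D (D F) (c t) (c' t) (c' t) + D F (c t) c'') t := by
  have h1 := hF.smooth_fderiv.diffAt.hasFDerivAt
  exact (h1.comp_hasDerivAt t hc).clm_apply hc'

theorem fderiv_fderiv_apply {V W : Type*} [NormedAddCommGroup V] [NormedSpace ℝ V]
    [NormedAddCommGroup W] [NormedSpace ℝ W] {F : V → W} {x : V} (hF : SmoothAt F x) (u v : V) :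
    D (fun z => D F z u) x v = D (D F) x v u := by
  have h1 := hF.smooth_fderiv.diffAt
  rw [fderiv_clm_apply h1 (differentiableAt_const _)]
  simp

set_option maxHeartbeats 1000000 in
-- In the old chart the new normal coordinate lines are the parabolas `y + s n(y) - ½ s² C(y)`. The
-- linear term makes the initial velocity equal to `ν`, and the quadratic term removes the
-- tangential part `C` of the acceleration that the straight lines have. Second order contact with
-- geodesics is all that the curvature formulas need, so no differential equation has to be solved.
theorem Flattens.exists_isFermiChart {L : ℕ → Set (Amb N)} {I : Set ℕ} {j : ℕ}
    {e : Chart N} (he : Flattens L I e) (hj : j ∈ I) (hj' : j + 1 ∈ I)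
    (hI : ∀ i ∈ I, j ≤ i) (hjN : j + 1 ≤ N) {ν : Amb N → Amb N}
    (hν : ∀ y ∈ dom e j, SmoothAt (fun y => ν (Ξ e j y)) y)
    (hνt : ∀ y ∈ dom e j, ν (Ξ e j y) ∈ tangentSpan (L (j + 1)) (Ξ e j y))
    (hνn : ∀ y ∈ dom e j, ν (Ξ e j y) ∉ tangentSpan (L j) (Ξ e j y))
    {x : Amb N} (hx : x ∈ e.source) (hxL : x ∈ L j) :
    ∃ E : Chart N, x ∈ E.source ∧ Flattens L I E ∧ IsFermiChart ν j E := by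
  have H := isHyperplane_castSucc j
  have hjN' : j ≤ N := j.le_succ.trans hjN
  set Ψ := Ξ e (j + 1) with hΨ
  set es : Fin (j + 1) → ℝ := single (last j) 1
  set ext := incl (castSucc (n := j)) with hext
  -- the components of the normal
  set n : (Fin j → ℝ) → Fin (j + 1) → ℝ := fun y =>
    headCoords (j + 1) (D e (Ξ e j y) (ν (Ξ e j y))) with hn
  have hmem : ∀ {y}, y ∈ dom e j → ext y ∈ dom e (j + 1) :=
    incl_mem_dom.2
  have hdn : ∀ y ∈ dom e j, D Ψ (ext y) (n y) = ν (Ξ e j y) := by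
    intro y hy
    have h1 := hνt y hy
    rw [← planeParam_incl, he.tangentSpan_eq hj' (hmem hy)] at h1
    obtain ⟨w, hw⟩ := h1
    have h2 := he.fderiv_apply_fderiv_planeParam (hmem hy) w
    rw [planeParam_incl] at hw h2
    have hw' : D (Ξ e (j + 1)) (ext y) w = ν (Ξ e j y) := hw
    rw [hw'] at h2
    rw [hn]
    simp only
    rw [h2, headCoords_padCoords hjN, hΨ, hw']
  -- Otherwise `ν` would be tangent to the hypersurface.
  have hns : ∀ y ∈ dom e j, n y (last j) ≠ 0 := by
    intro y hy h0
    refine hνn y hy ?_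
    rw [he.tangentSpan_eq hj hy]
    obtain ⟨w, h1⟩ : ∃ w, n y = ext w := by
      refine ⟨fun a => n y a.castSucc, ?_⟩
      ext b
      rcases H.cover b with rfl | ⟨a, rfl⟩
      · rw [h0, hext, incl_normal H]
      · rw [hext, incl_emb H]
    refine ⟨w, ?_⟩
    rw [← hdn y hy, h1]
    have h2 : (fun y => Ψ (ext y)) = Ξ e j := funext fun y => planeParam_incl e y
    have h3 := (he.contDiffAt_planeParam (hmem hy)).diffAt.hasFDerivAt.comp y
      ext.hasFDerivAt
    change D (Ξ e j) y _ = _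
    rw [← h2, show (fun y => Ψ (ext y)) = Ψ ∘ ext from rfl, h3.fderiv]
    rfl
  have hnsm : ∀ y ∈ dom e j, SmoothAt n y := by
    intro y hy
    have h1 : SmoothAt (fun y => D e (Ξ e j y)) y :=
      (he.contDiffAt (planeParam_mem_source hy)).smooth_fderiv.comp y
        (he.contDiffAt_planeParam hy)
    exact (headCLM N (j + 1)).contDiff.contDiffAt.comp y (h1.clm_apply (hν y hy))
  -- the tangential acceleration of the straight lines
  set A : (Fin j → ℝ) → Amb N := fun y => D (D Ψ) (ext y) (n y) (n y) with hA
  set C : (Fin j → ℝ) → Fin (j + 1) → ℝ := fun y a =>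
    ∑ b, (inducedMetric Ψ (ext y))⁻¹ a b * inner ℝ (D Ψ (ext y) (single b 1)) (A y) with hC
  -- `C` is defined with the inverse metric so that its image is the orthogonal projection of the
  -- acceleration to the tangent space.
  have hAC : ∀ y ∈ dom e j, ∀ v, inner ℝ (A y - D Ψ (ext y) (C y)) (D Ψ (ext y) v) = 0 := by
    intro y hy v
    have hm := he.isMetricAt hjN (hmem hy)
    have h1 : ∀ c, inner ℝ (A y - D Ψ (ext y) (C y)) (D Ψ (ext y) (single c 1)) = 0 := by
      intro c
      rw [inner_sub_left, ← formOf_inducedMetric, formOf_apply]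
      simp only [Pi.single_apply, mul_ite, mul_one, mul_zero, sum_ite_eq', Finset.mem_univ, if_true]
      have h2 : ∀ b, ∑ a, inducedMetric Ψ (ext y) c a * (inducedMetric Ψ (ext y))⁻¹ a b =
          (1 : Matrix _ _ ℝ) c b := fun b => by
        rw [← Matrix.mul_apply, mul_nonsing_inv _ hm.isUnit_det]
      have h3 : ∀ a, inducedMetric Ψ (ext y) a c = inducedMetric Ψ (ext y) c a := fun a =>
        (hm.symm_near a c).self_of_nhds
      simp only [h3, hC, mul_sum, ← mul_assoc]
      rw [sum_comm]
      simp only [← sum_mul, h2, Matrix.one_apply, ite_mul, one_mul, zero_mul, sum_ite_eq, Finset.mem_univ, if_true]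
      rw [real_inner_comm, sub_self]
    rw [← univ_sum_single v, map_sum, inner_sum]
    refine sum_eq_zero fun c _ => ?_
    have : D Ψ (ext y) (single c (v c)) = v c • D Ψ (ext y) (single c 1) := by
      rw [← map_smul, ← Pi.single_smul, smul_eq_mul, mul_one]
    rw [this, real_inner_smul_right, h1, mul_zero]
  have hCsm : ∀ y ∈ dom e j, SmoothAt C y := by
    intro y hy
    have hm := he.isMetricAt hjN (hmem hy)
    have hps := he.contDiffAt_planeParam (hmem hy)
    have he1 : SmoothAt ext y := ext.contDiff.contDiffAt
    have h1 : SmoothAt (fun y => D Ψ (ext y)) y :=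
      hps.smooth_fderiv.comp y he1
    have h2 : SmoothAt (fun y => D (D Ψ) (ext y)) y :=
      hps.smooth_fderiv.smooth_fderiv.comp y he1
    have h3 : SmoothAt A y := (h2.clm_apply (hnsm y hy)).clm_apply (hnsm y hy)
    rw [contDiffAt_pi]
    intro a
    refine ContDiffAt.sum fun b _ => ContDiffAt.mul ?_ ?_
    · exact (hm.inv_smooth a b).comp y he1
    · exact (h1.clm_apply contDiffAt_const).inner ℝ h3
  -- the change of coordinates
  set p : Fin N := ⟨j, hjN⟩ with hp
  set Φ : Amb N → Amb N := fun z => z + z p • (padCLM N (j + 1) (n (headCLM N j z)) -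
    EuclideanSpace.single p 1) - (1 / 2 * z p ^ 2) • padCLM N (j + 1) (C (headCLM N j z)) with hΦ
  -- The factor by which `Φ` multiplies the coordinate `p`. Coordinates after `p` are unchanged, so
  -- where the factor is non-zero `Φ` preserves the conditions that define each leaf `L i`, `i ≥ j`.
  set fac : Amb N → ℝ := fun z => n (headCLM N j z) (last j) - 1 / 2 * z p * C (headCLM N j z) (last j) with hfac
  set W₀ : Set (Amb N) := headCLM N j ⁻¹' dom e j with hW₀
  have hW₀o : IsOpen W₀ := (isOpen_dom e j).preimage (headCLM N j).continuous
  have hnW : ContDiffOn ℝ ∞ (fun z => n (headCLM N j z)) W₀ := fun z hz =>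
    ((hnsm _ hz).comp z (headCLM N j).contDiff.contDiffAt).contDiffWithinAt
  have hCW : ContDiffOn ℝ ∞ (fun z => C (headCLM N j z)) W₀ := fun z hz =>
    ((hCsm _ hz).comp z (headCLM N j).contDiff.contDiffAt).contDiffWithinAt
  have hpW : ContDiffOn ℝ ∞ (fun z : Amb N => z p) W₀ :=
    (EuclideanSpace.proj p : Amb N →L[ℝ] ℝ).contDiff.contDiffOn
  have hΦW : ContDiffOn ℝ ∞ Φ W₀ := by
    refine (contDiffOn_id.add (hpW.smul ?_)).sub ((contDiffOn_const.mul (hpW.pow 2)).smul ?_)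
    · exact ((padCLM N (j + 1)).contDiff.comp_contDiffOn hnW).sub contDiffOn_const
    · exact (padCLM N (j + 1)).contDiff.comp_contDiffOn hCW
  set W := W₀ ∩ fac ⁻¹' {0}ᶜ with hW
  have hWo : IsOpen W := by
    refine ContinuousOn.isOpen_inter_preimage ?_ hW₀o isOpen_compl_singleton
    exact ((contDiffOn_pi.1 hnW _).continuousOn).sub
      ((continuousOn_const.mul hpW.continuousOn).mul (contDiffOn_pi.1 hCW _).continuousOn)
  have hΦl : ∀ z l, Φ z l = if l.1 < j then Φ z l else if l = p then z p * fac z else z l := by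
    intro z l
    split_ifs with h1 h2
    · rfl
    · rw [h2]
      simp only [hΦ, hfac, PiLp.add_apply, PiLp.sub_apply, PiLp.smul_apply, smul_eq_mul, coe_padCLM]
      have : p.1 < j + 1 := Nat.lt_succ_self j
      rw [padCoords_apply_of_lt _ this, padCoords_apply_of_lt _ this]
      have hl : (⟨p.1, this⟩ : Fin (j + 1)) = last j := rfl
      rw [hl]
      simp
      ring
    · have h3 : j + 1 ≤ l.1 := by
        have : l.1 ≠ j := fun h => h2 (Fin.ext h)
        omega
      simp only [hΦ, PiLp.add_apply, PiLp.sub_apply, PiLp.smul_apply, smul_eq_mul, coe_padCLM]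
      rw [padCoords_apply_of_le _ h3, padCoords_apply_of_le _ h3]
      simp [h2]
  have hplane : ∀ z, z p = 0 → Φ z = z := fun z hz => by simp [hΦ, hz]
  set y₀ := headCoords j (e x) with hy₀
  have hy₀d : y₀ ∈ dom e j := he.head_mem hj hx hxL
  have hexp : e x p = 0 := (he.flat j hj x hx).1 hxL p le_rfl
  have hxW : e x ∈ W := by
    refine ⟨hy₀d, ?_⟩
    simp only [mem_preimage, mem_compl_iff, mem_singleton_iff, hfac, hexp, mul_zero, zero_mul, sub_zero]
    exact hns y₀ hy₀d
  have hinj : Injective (D Φ (e x)) := by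
    have hd : ∀ v, D Φ (e x) v = v + v p • (padCLM N (j + 1) (n y₀) - EuclideanSpace.single p 1) := by
      intro v
      have g1 : HasFDerivAt (fun z : Amb N => z p) (EuclideanSpace.proj p : Amb N →L[ℝ] ℝ) (e x) :=
        (EuclideanSpace.proj p : Amb N →L[ℝ] ℝ).hasFDerivAt
      have g2 := (hnW.contDiffAt (hW₀o.mem_nhds hxW.1)).diffAt.hasFDerivAt
      have g3 := (hCW.contDiffAt (hW₀o.mem_nhds hxW.1)).diffAt.hasFDerivAt
      have g4 := ((hasFDerivAt_id (e x)).add (g1.smul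
        (((padCLM N (j + 1)).hasFDerivAt.comp _ g2).sub_const (EuclideanSpace.single p 1)))).sub
        (((g1.pow 2).const_mul (1 / 2)).smul ((padCLM N (j + 1)).hasFDerivAt.comp _ g3))
      have g5 : D Φ (e x) = _ := g4.fderiv
      rw [g5]
      simp [hexp]
      rfl
    rw [injective_iff_map_eq_zero]
    intro v hv
    rw [hd] at hv
    have h1 : (v + v p • (padCLM N (j + 1) (n y₀) - EuclideanSpace.single p 1) : Amb N) p = 0 := by
      rw [hv]; rfl
    have h2 : padCLM N (j + 1) (n y₀) p = n y₀ (last j) :=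
      padCoords_apply_of_lt _ (Nat.lt_succ_self j)
    rw [PiLp.add_apply, PiLp.smul_apply, PiLp.sub_apply, h2] at h1
    have h3 : v p = 0 := by
      have h4 : v p * n y₀ (last j) = 0 := by
        simp at h1
        linarith
      exact (mul_eq_zero.1 h4).resolve_right (hns y₀ hy₀d)
    simpa [h3] using hv
  obtain ⟨E₁, hxE, hEW, hEΦ, hEs, hEs'⟩ := exists_openPartialHomeomorph hWo hxW (hΦW.mono inter_subset_left) hinj
  have hE₁x : E₁ (e x) = e x := by rw [hEΦ, hplane _ hexp]
  have hiff : ∀ z ∈ W, ∀ l : Fin N, j ≤ l.1 → (Φ z l = 0 ↔ z l = 0) := by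
    intro z hz l hl
    rw [hΦl, if_neg hl.not_gt]
    split_ifs with h
    · rw [h, mul_eq_zero, or_iff_left (show ¬ fac z = 0 from hz.2)]
    · rfl
  set E := e.trans E₁.symm with hE
  have hsymm : ∀ i, Ξ E i = fun z => e.symm (Φ (padCLM N i z)) := fun i => by
    funext z
    change e.symm (E₁ _) = _
    rw [hEΦ]
    rfl
  have hEfl : Flattens L I E := by
    refine ⟨?_, ?_, ?_⟩
    · intro z hz
      rw [hE, OpenPartialHomeomorph.trans_source] at hz
      refine ContDiffAt.contDiffWithinAt ?_
      exact (hEs'.contDiffAt (E₁.open_target.mem_nhds hz.2)).comp z (he.contDiffAt hz.1)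
    · intro z hz
      rw [hE, OpenPartialHomeomorph.trans_target] at hz
      refine ContDiffAt.contDiffWithinAt ?_
      exact (he.contDiffAt_symm hz.2).comp z (hEs.contDiffAt (E₁.open_source.mem_nhds hz.1))
    · intro i hi z hz
      rw [hE, OpenPartialHomeomorph.trans_source] at hz
      have hz1 : E₁.symm (e z) ∈ E₁.source := E₁.map_target hz.2
      have hz2 : e z = Φ (E₁.symm (e z)) := by
        rw [← hEΦ]; exact (E₁.right_inv hz.2).symm
      rw [he.flat i hi z hz.1]
      refine forall₂_congr fun l hl => ?_
      conv_lhs => rw [hz2]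
      exact hiff _ (hEW hz1) l ((hI i hi).trans hl)
  refine ⟨E, ?_, hEfl, ?_⟩
  · rw [hE, OpenPartialHomeomorph.trans_source]
    refine ⟨hx, ?_⟩
    change e x ∈ E₁.target
    rw [← hE₁x]
    exact E₁.map_source hxE
  -- the curves in the normal direction
  have hdom : ∀ y ∈ dom E j, y ∈ dom e j := by
    intro y hy
    have hy' : padCoords j y ∈ E.target := hy
    rw [hE, OpenPartialHomeomorph.trans_target] at hy'
    have := (hEW hy'.1).1
    rw [hW₀, mem_preimage, coe_headCLM, headCoords_padCoords hjN'] at this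
    exact this
  have hcurve : ∀ y (s : ℝ), Ξ E (j + 1) (ext y + s • es) = Ψ (ext y + s • n y - (1 / 2 * s ^ 2) • C y) := by
    intro y s
    rw [hsymm, hΨ, planeParam]
    simp only
    congr 1
    have h1 : padCLM N (j + 1) (ext y + s • es) = padCLM N j y + s • EuclideanSpace.single p 1 := by
      rw [map_add, map_smul]
      congr 1
      · exact padCoords_incl y
      · congr 1
        ext l
        rw [coe_padCLM]
        by_cases hl : l.1 < j + 1
        · rw [padCoords_apply_of_lt _ hl]
          simp only [es, Pi.single_apply, PiLp.single_apply, hp, Fin.ext_iff, Fin.val_last]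
        · rw [padCoords_apply_of_le _ (not_lt.1 hl), PiLp.single_apply, if_neg]
          intro h
          rw [h] at hl
          exact hl (Nat.lt_succ_self j)
    have h2 : (padCLM N j y + s • EuclideanSpace.single p 1 : Amb N) p = s := by
      rw [PiLp.add_apply, coe_padCLM, padCoords_apply_of_le _ (show j ≤ p.1 from le_rfl)]
      simp
    have h3 : headCLM N j (padCLM N j y + s • EuclideanSpace.single p 1) = y := by
      ext a
      rw [coe_headCLM, headCoords_apply hjN', PiLp.add_apply, coe_padCLM,
        padCoords_apply_of_lt _ (i := ⟨a.1, a.2.trans_le hjN'⟩) a.2]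
      have : (⟨a.1, a.2.trans_le hjN'⟩ : Fin N) ≠ p := fun h => a.2.ne (Fin.ext_iff.1 h)
      simp [this]
    rw [h1]
    simp only [hΦ, h2, h3]
    change _ = padCLM N (j + 1) _
    rw [map_sub, map_add, map_smul, map_smul,
      show padCLM N (j + 1) (ext y) = padCLM N j y from padCoords_incl y, smul_sub]
    abel
  -- The velocities of the two descriptions of the same curve agree near `s = 0`; their values and
  -- derivatives at `0` give the velocity and the acceleration of the new chart.
  have key : ∀ y ∈ dom E j, D (Ξ E (j + 1)) (ext y) es = ν (Ξ E j y) ∧ D (fun w => D (Ξ E (j + 1)) w es) (ext y)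
        es = A y - D Ψ (ext y) (C y) := by
    intro y hy
    have hye := hdom y hy
    have hyE : ext y ∈ dom E (j + 1) := incl_mem_dom.2 hy
    have hline : ∀ s, HasDerivAt (fun s : ℝ => ext y + s • es) es s := fun s => by
      simpa using ((hasDerivAt_id s).smul_const es).const_add (ext y)
    have hc : ∀ s, HasDerivAt (fun s : ℝ => ext y + s • n y - (1 / 2 * s ^ 2) • C y) (n y - s • C y) s := fun s => by
      have h1 := ((hasDerivAt_id s).smul_const (n y)).const_add (ext y)
      have h2 := (((hasDerivAt_id s).pow 2).const_mul (1 / 2)).smul_const (C y)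
      refine (h1.sub h2).congr_deriv ?_
      simp
    have nE : ∀ᶠ s : ℝ in 𝓝 0, ext y + s • es ∈ dom E (j + 1) := by
      have := (hline 0).continuousAt.tendsto
      simp at this
      exact this.eventually ((isOpen_dom E (j + 1)).mem_nhds hyE)
    have ne : ∀ᶠ s : ℝ in 𝓝 0, ext y + s • n y - (1 / 2 * s ^ 2) • C y ∈ dom e (j + 1) := by
      have := (hc 0).continuousAt.tendsto
      simp [-one_div] at this
      exact this.eventually ((isOpen_dom e (j + 1)).mem_nhds (hmem hye))
    have heq : ∀ᶠ s : ℝ in 𝓝 0, D (Ξ E (j + 1)) (ext y + s • es) es =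
        D Ψ (ext y + s • n y - (1 / 2 * s ^ 2) • C y) (n y - s • C y) := by
      filter_upwards [nE, ne] with s h1 h2
      have d1 := (hEfl.contDiffAt_planeParam h1).diffAt.hasFDerivAt.comp_hasDerivAt s (hline s)
      have d2 := (he.contDiffAt_planeParam h2).diffAt.hasFDerivAt.comp_hasDerivAt s (hc s)
      have d3 : (Ξ E (j + 1) ∘ fun s : ℝ => ext y + s • es) =
          (Ξ e (j + 1) ∘ fun s : ℝ => ext y + s • n y - (1 / 2 * s ^ 2) • C y) :=
        funext fun s => hcurve y s
      rw [d3] at d1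
      exact d1.unique d2
    constructor
    · have h1 := heq.self_of_nhds
      simp at h1
      rw [h1, hdn y hye, ← planeParam_incl, ← planeParam_incl E]
      congr 1
      simpa using (hcurve y 0).symm
    · have d1 := hasDerivAt_fderiv_curve (c := fun s : ℝ => ext y + s • es)
        (c' := fun _ => es) (t := 0)
        (by simpa using hEfl.contDiffAt_planeParam hyE) (hline 0) (hasDerivAt_const _ _)
      have d4 : HasDerivAt (fun s : ℝ => n y - s • C y) (- C y) 0 := by
        simpa using ((hasDerivAt_id (0 : ℝ)).smul_const (C y)).const_sub (n y)
      have d5 := (hasDerivAt_fderiv_curve (F := Ψ) (t := 0)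
        (c := fun s : ℝ => ext y + s • n y - (1 / 2 * s ^ 2) • C y)
        (by simpa using he.contDiffAt_planeParam (hmem hye)) (hc 0) d4).congr_of_eventuallyEq heq
      have d6 := d1.unique d5
      simp at d6
      rw [fderiv_fderiv_apply (hEfl.contDiffAt_planeParam hyE), d6, sub_eq_add_neg]
  refine ⟨fun y hy => (key y hy).1, fun y hy v => ?_⟩
  rw [(key y hy).2]
  have hyE : ext y ∈ dom E (j + 1) := incl_mem_dom.2 hy
  have h1 : Ξ E (j + 1) (ext y) = Ψ (ext y) := by simpa using hcurve y 0
  -- Both charts parametrize the same leaf, so the tangent vectors of the new one are tangent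
  -- vectors of the old one.
  have h2 : D (Ξ E (j + 1)) (ext y) v ∈ tangentSpan (L (j + 1)) (Ξ E (j + 1) (ext y)) := by
    rw [hEfl.tangentSpan_eq hj' hyE]; exact ⟨v, rfl⟩
  rw [h1, he.tangentSpan_eq hj' (hmem (hdom y hy))] at h2
  obtain ⟨w, hw⟩ := h2
  rw [← show D Ψ (ext y) w = _ from hw]
  exact hAC y (hdom y hy) w

end FermiChart

/-! ### Warped metrics with weights: positivity, restriction, Fermi position. -/

section WarpedBlocks

variable {ι κ P : Type} [Fintype ι] [DecidableEq ι] [Fintype κ] [DecidableEq κ] [Fintype P]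
  [DecidableEq P]

/-- The metric `h + ∑ U_p² dt_p²`. -/
def blockOf (h : (ι → ℝ) → Matrix ι ι ℝ) (U : P → (ι → ℝ) → ℝ) (z : (ι ⊕ P) → ℝ) : Matrix (ι ⊕ P) (ι ⊕ P) ℝ :=
  fromBlocks (h (base z)) 0 0 (diagonal fun p => U p (base z) ^ 2)

/-- The functions `U_p` are smooth and positive near `y`. -/
def IsWeightAt (U : P → (ι → ℝ) → ℝ) (y : ι → ℝ) : Prop :=
  ∀ᶠ x in 𝓝 y, ∀ p, SmoothAt (U p) x ∧ 0 < U p x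

variable {h : (ι → ℝ) → Matrix ι ι ℝ} {U : P → (ι → ℝ) → ℝ} {z : (ι ⊕ P) → ℝ}

theorem formOf_blockOf (u v : (ι ⊕ P) → ℝ) : formOf (blockOf h U z) u v = formOf (h (base z)) (base u) (base v) +
      ∑ p, U p (base z) ^ 2 * u (inr p) * v (inr p) := by
  simp [formOf_apply, blockOf, Fintype.sum_sum_type, diagonal_apply]

theorem blockOf_eventuallyEq_warpOf (hU : IsWeightAt U (base z)) :
    blockOf h U =ᶠ[𝓝 z] warpOf h fun p y => log (U p y) := by
  have hc : ContinuousAt (base (ι := ι) (P := P)) z := base.continuous.continuousAt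
  filter_upwards [hc.eventually hU] with x hx
  simp only [blockOf, warpOf]
  congr 2
  funext p
  rw [Real.exp_log (hx p).2]

theorem isMetricAt_blockOf (hm : IsMetricAt h (base z)) (hU : IsWeightAt U (base z)) : IsMetricAt (blockOf h U) z := by
  have hc : ContinuousAt (base (ι := ι) (P := P)) z := base.continuous.continuousAt
  have hb : ∀ x : (ι ⊕ P) → ℝ, SmoothAt (base (ι := ι) (P := P)) x :=
    fun x => (base (ι := ι) (P := P)).contDiff.contDiffAt
  constructor
  · filter_upwards [hc.eventually hm.smooth_near, hc.eventually hU] with x hx hx'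
    rintro (a | p) (b | q)
    · exact (hx a b).comp x (hb x)
    · exact contDiffAt_const
    · exact contDiffAt_const
    · by_cases hpq : p = q
      · subst hpq
        simp only [blockOf, fromBlocks_apply₂₂, Matrix.diagonal_apply_eq]
        exact ((hx' p).1.comp x (hb x)).pow 2
      · simp only [blockOf, fromBlocks_apply₂₂, Matrix.diagonal_apply_ne _ hpq]
        exact contDiffAt_const
  · filter_upwards [hc.eventually hm.posDef_near, hc.eventually hU] with x hx hx'
    have hs : (blockOf h U x).IsHermitian := by
      refine Matrix.IsHermitian.fromBlocks hx.isHermitian (by simp) ?_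
      rw [Matrix.IsHermitian, Matrix.diagonal_conjTranspose]
      rfl
    refine Matrix.PosDef.of_dotProduct_mulVec_pos hs fun v hv => ?_
    have e : star v ⬝ᵥ (blockOf h U x).mulVec v = formOf (blockOf h U x) v v := by
      rw [formOf_eq_dotProduct]; rfl
    rw [e, formOf_blockOf]
    have h2 : 0 ≤ ∑ p, U p (base x) ^ 2 * v (inr p) * v (inr p) :=
      sum_nonneg fun p _ => by
        rw [mul_assoc]; exact mul_nonneg (sq_nonneg _) (mul_self_nonneg _)
    by_cases hv0 : (base v : ι → ℝ) = 0
    · have h3 : ∃ p, v (inr p) ≠ 0 := by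
        by_contra! hcon
        refine hv (funext ?_)
        rintro (i | p)
        exacts [congrFun hv0 i, hcon p]
      obtain ⟨p, hp⟩ := h3
      rw [hv0, map_zero, zero_add]
      refine Finset.sum_pos' (fun p _ => ?_) ⟨p, Finset.mem_univ _, ?_⟩
      · rw [mul_assoc]; exact mul_nonneg (sq_nonneg _) (mul_self_nonneg _)
      · rw [mul_assoc]; exact mul_pos (pow_pos (hx' p).2 2) (mul_self_pos.2 hp)
    · exact add_pos_of_pos_of_nonneg (formOf_self_pos hx hv0) h2

theorem det_blockOf : (blockOf h U z).det = (h (base z)).det * ∏ p, U p (base z) ^ 2 := by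
  rw [blockOf, Matrix.det_fromBlocks_zero₂₁, Matrix.det_diagonal]

theorem isHyperplane_sumMap {emb : κ → ι} {s₀ : ι} (H : IsHyperplane emb s₀) :
    IsHyperplane (Sum.map emb id : κ ⊕ P → ι ⊕ P) (inl s₀) where
  inj := Function.Injective.sumMap H.inj Function.injective_id
  ne := by
    rintro (a | p) hh
    · exact H.ne a (Sum.inl_injective hh)
    · cases hh
  cover := by
    rintro (b | p)
    · rcases H.cover b with rfl | ⟨a, rfl⟩
      exacts [Or.inl rfl, Or.inr ⟨inl a, rfl⟩]
    · exact Or.inr ⟨inr p, rfl⟩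

theorem base_incl {emb : κ → ι} {s₀ : ι} (H : IsHyperplane emb s₀) (x : (κ ⊕ P) → ℝ) :
    base (incl (Sum.map emb id : κ ⊕ P → ι ⊕ P) x) = incl emb (base x) := by
  have H' := isHyperplane_sumMap (P := P) H
  ext b
  rcases H.cover b with rfl | ⟨a, rfl⟩
  · rw [base_apply, incl_normal H', incl_normal H]
  · rw [incl_emb H, base_apply, base_apply]
    exact incl_emb H' x (inl a)

theorem restr_blockOf {emb : κ → ι} {s₀ : ι} (H : IsHyperplane emb s₀) : restr (blockOf h U) (Sum.map emb id) =
      blockOf (restr h emb) fun p y => U p (incl emb y) := by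
  funext x
  ext a b
  simp only [restr, blockOf, submatrix_apply, base_incl H]
  rcases a with a | p <;> rcases b with b | q <;> simp [diagonal_apply]

/-- Fibre directions are orthogonal to the base everywhere, so the Fermi conditions for the warped
metric reduce to those of `h`. -/
theorem isFermiAt_blockOf {emb : κ → ι} {s₀ : ι} {x : (κ ⊕ P) → ℝ}
    (hf : IsFermiAt h emb s₀ (base x)) (hU : IsWeightAt U (incl emb (base x))) :
    IsFermiAt (blockOf h U) (Sum.map emb id) (inl s₀) x := by
  have H := hf.hyper
  have hb : base (incl (Sum.map emb id : κ ⊕ P → ι ⊕ P) x) = incl emb (base x) := base_incl H x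
  have hc : ContinuousAt (base (ι := ι) (P := P))
      (incl (Sum.map emb id : κ ⊕ P → ι ⊕ P) x) := base.continuous.continuousAt
  rw [ContinuousAt, hb] at hc
  have h0 : ∀ (a : ι) (w : (ι ⊕ P) → ℝ), partialD (inl s₀) (fun z => blockOf h U z (inl s₀) (inl a)) w =
        partialD s₀ (fun z => h z s₀ a) (base w) := fun a w =>
    partialD_inl_comp_base (fun z => h z s₀ a) w s₀
  refine ⟨isHyperplane_sumMap H, isMetricAt_blockOf ?_ ?_, ?_, ?_, ?_, ?_⟩
  · rw [hb]; exact hf.metric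
  · rw [hb]; exact hU
  · filter_upwards [hc.eventually hf.unit] with w hw using hw
  · filter_upwards [hc.eventually hf.normal] with w hw hw0
    rintro (a | p)
    exacts [hw hw0 a, rfl]
  · filter_upwards [hc.eventually hf.unit'] with w hw hw0
    rw [h0]; exact hw hw0
  · filter_upwards [hc.eventually hf.normal'] with w hw hw0
    rintro (a | p)
    · exact (h0 (emb a) w).trans (hw hw0 a)
    · exact partialD_const (inl s₀) 0 w

theorem contDiffAt_sumElim_base {τ : (ι → ℝ) → ι → ℝ} {x : (ι ⊕ P) → ℝ}
    (hx : SmoothAt τ (base x)) : SmoothAt (fun x : (ι ⊕ P) → ℝ => Sum.elim (τ (base x)) fun p => x (inr p)) x := by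
  rw [contDiffAt_pi]
  rintro (i | p)
  · exact (contDiffAt_pi.1 hx i).comp x (base (ι := ι) (P := P)).contDiff.contDiffAt
  · exact (ContinuousLinearMap.proj (R := ℝ) (φ := fun _ : ι ⊕ P => ℝ) (inr p)).contDiff.contDiffAt

theorem fderiv_sumElim_base {τ : (ι → ℝ) → ι → ℝ} {x : (ι ⊕ P) → ℝ}
    (hx : SmoothAt τ (base x)) (v : (ι ⊕ P) → ℝ) :
    D (fun x : (ι ⊕ P) → ℝ => Sum.elim (τ (base x)) fun p => x (inr p)) x v =
      Sum.elim (D τ (base x) (base v)) fun p => v (inr p) := by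
  have hd1 := (contDiffAt_sumElim_base hx).diffAt
  have hd2 : DiffAt τ (base x) := hx.diffAt
  ext i
  have h1 := DFunLike.congr_fun (hasFDerivAt_pi'.1 hd1.hasFDerivAt i).fderiv v
  refine h1.symm.trans ?_
  rcases i with i | p
  · exact (fderiv_comp_base (fun y => τ y i) x v).trans
      (DFunLike.congr_fun (hasFDerivAt_pi'.1 hd2.hasFDerivAt i).fderiv _)
  · exact DFunLike.congr_fun (ContinuousLinearMap.proj (R := ℝ) (φ := fun _ : ι ⊕ P => ℝ) (inr p)).fderiv v

theorem isPullbackAt_blockOf {h' : (ι → ℝ) → Matrix ι ι ℝ} {U' : P → (ι → ℝ) → ℝ}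
    {τ : (ι → ℝ) → ι → ℝ} (hτ : IsPullbackAt h h' τ (base z))
    (hU : IsWeightAt U (τ (base z))) (hU' : IsWeightAt U' (base z))
    (hUU : ∀ᶠ x in 𝓝 (base z), ∀ p, U' p x = U p (τ x)) :
    IsPullbackAt (blockOf h U) (blockOf h' U') (fun x => Sum.elim (τ (base x)) fun p => x (inr p)) z := by
  have hc : ContinuousAt (base (ι := ι) (P := P)) z := base.continuous.continuousAt
  refine ⟨isMetricAt_blockOf hτ.metric hU, isMetricAt_blockOf hτ.metric' hU', ?_, ?_⟩
  · filter_upwards [hc.eventually hτ.smooth_near] with x hx using contDiffAt_sumElim_base hx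
  · filter_upwards [hc.eventually hτ.smooth_near, hc.eventually hτ.form_near, hc.eventually hUU] with x hx hx' hx'' u v
    have hd := fderiv_sumElim_base (P := P) hx
    rw [formOf_blockOf, formOf_blockOf, hd, hd, hx']
    simp only [hx'']
    rfl

end WarpedBlocks

/-! ### Induced metrics, transition maps and tangential gradients. -/

section ChartGeometry

variable {N : ℕ} {L : ℕ → Set (Amb N)} {I I' : Set ℕ} {j : ℕ}
  {e e' : Chart N}

theorem restr_inducedMetric (h : Flattens L I e) {y : Fin j → ℝ} (hy : y ∈ dom e j) :
    restr (γ e (j + 1)) castSucc y = (γ e j) y := by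
  have H := isHyperplane_castSucc j
  have h2 : Ξ e (j + 1) ∘ incl castSucc = Ξ e j :=
    funext fun y => planeParam_incl e y
  have h3 := ((h.contDiffAt_planeParam (incl_mem_dom.2 hy)).differentiableAt
    (by simp)).hasFDerivAt.comp y (incl castSucc).hasFDerivAt
  rw [h2] at h3
  ext a b
  simp only [restr, inducedMetric, submatrix_apply, of_apply, h3.fderiv, ContinuousLinearMap.comp_apply, incl_single H]

/-- Pointwise properties of a plane hold near its points. -/
theorem eventually_plane {κ ι : Type} [Fintype κ] [DecidableEq κ] [Fintype ι] [DecidableEq ι]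
    {emb : κ → ι} {s₀ : ι} (H : IsHyperplane emb s₀) {p : (ι → ℝ) → Prop} {O : Set (κ → ℝ)}
    (hD : IsOpen O) {y : κ → ℝ} (hy : y ∈ O) (h : ∀ x ∈ O, p (incl emb x)) :
    ∀ᶠ x in 𝓝 (incl emb y), x s₀ = 0 → p x := by
  have hc : Continuous fun (x : ι → ℝ) a => x (emb a) := by fun_prop
  have h1 : (fun a => incl emb y (emb a)) = y := funext fun a => incl_emb H y a
  filter_upwards [hc.continuousAt.eventually (hD.mem_nhds (by simpa only [h1] using hy))] with x hx hx0
  have : x = incl emb fun a => x (emb a) := by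
    ext b
    rcases H.cover b with rfl | ⟨a, rfl⟩
    · rw [hx0, incl_normal H]
    · rw [incl_emb H]
  rw [this]
  exact h _ hx

theorem partialD_inner {ι : Type} [Fintype ι] [DecidableEq ι] {F G : (ι → ℝ) → Amb N} {x : ι → ℝ}
    (hF : DiffAt F x) (hG : DiffAt G x) (i : ι) :
    partialD i (fun z => inner ℝ (F z) (G z)) x =
      inner ℝ (F x) (D G x (single i 1)) + inner ℝ (D F x (single i 1)) (G x) := by
  rw [partialD, fderiv_inner_apply ℝ hF hG]

/-- In a Fermi chart, the hypersurface is in Fermi position. -/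
theorem IsFermiChart.isFermiAt {ν : Amb N → Amb N} (hF : IsFermiChart ν j e) (he : Flattens L I e)
    (hj : j ∈ I) (hjN : j + 1 ≤ N)
    (hν : ∀ y ∈ dom e j, ‖ν (Ξ e j y)‖ = 1)
    (hνn : ∀ y ∈ dom e j, ν (Ξ e j y) ∈ (tangentSpan (L j) (Ξ e j y))ᗮ)
    {y : Fin j → ℝ} (hy : y ∈ dom e j) :
    IsFermiAt (γ e (j + 1)) castSucc (last j) y := by
  have H := isHyperplane_castSucc j
  have hmem : ∀ {y}, y ∈ dom e j → incl castSucc y ∈ dom e (j + 1) :=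
    incl_mem_dom.2
  have hcast : ∀ y ∈ dom e j, ∀ a, D (Ξ e (j + 1)) (incl castSucc y) (single (castSucc a) 1) =
      D (Ξ e j) y (single a 1) := by
    intro y hy a
    have h2 : Ξ e (j + 1) ∘ incl castSucc = Ξ e j :=
      funext fun y => planeParam_incl e y
    have h3 := (he.contDiffAt_planeParam (hmem hy)).diffAt.hasFDerivAt.comp y (incl castSucc).hasFDerivAt
    rw [h2] at h3
    rw [h3.fderiv, ContinuousLinearMap.comp_apply, incl_single H]
  have hunit : ∀ y ∈ dom e j, (γ e (j + 1)) (incl castSucc y) (last j) (last j) = 1 := by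
    intro y hy
    rw [inducedMetric, of_apply, hF.velocity y hy, real_inner_self_eq_norm_sq, hν y hy, one_pow]
  have hnorm : ∀ y ∈ dom e j, ∀ a, (γ e (j + 1)) (incl castSucc y) (last j) (castSucc a) = 0 := by
    intro y hy a
    rw [inducedMetric, of_apply, hF.velocity y hy, hcast y hy, real_inner_comm]
    refine hνn y hy _ ?_
    rw [he.tangentSpan_eq hj hy]
    exact ⟨_, rfl⟩
  have hdiff : ∀ y ∈ dom e j, ∀ v, DiffAt (fun w => D (Ξ e (j + 1)) w v) (incl castSucc y) := fun y hy v =>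
    ((he.contDiffAt_planeParam (hmem hy)).smooth_fderiv.clm_apply
      contDiffAt_const).diffAt
  refine ⟨H, he.isMetricAt hjN (hmem hy), eventually_plane H (isOpen_dom e j) hy hunit,
    eventually_plane H (isOpen_dom e j) hy hnorm,
    eventually_plane H (isOpen_dom e j) hy fun y hy => ?_,
    eventually_plane H (isOpen_dom e j) hy fun y hy a => ?_⟩
  · refine (partialD_inner (hdiff y hy _) (hdiff y hy _) _).trans ?_
    rw [real_inner_comm, hF.acceleration y hy, add_zero]
  · refine (partialD_inner (hdiff y hy _) (hdiff y hy _) _).trans ?_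
    rw [hF.acceleration y hy, add_zero]
    -- The unit length of `∂_s` along the hypersurface gives `⟨∂_a ∂_s, ∂_s⟩ = 0`. By symmetry of
    -- second derivatives this is also the part of `∂_s g_{sa}` that the acceleration condition
    -- leaves.
    have h1 : partialD (castSucc a) (fun w => (γ e (j + 1)) w (last j) (last j)) (incl castSucc y) = 0 :=
      partialD_emb_eq_zero H (incl_normal H y) (eventually_plane H (isOpen_dom e j) hy hunit) a
    have h2 := (partialD_inner (hdiff y hy (single (last j) 1))
      (hdiff y hy (single (last j) 1)) (castSucc a)).symm.trans h1
    have hs := he.contDiffAt_planeParam (hmem hy)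
    rw [fderiv_fderiv_apply hs] at h2 ⊢
    have h3 : IsSymmSndFDerivAt ℝ (Ξ e (j + 1)) (incl castSucc y) :=
      hs.isSymmSndFDerivAt two_le_smoothness
    rw [h3]
    rw [real_inner_comm, ← two_mul] at h2
    rw [real_inner_comm]
    exact (mul_eq_zero.1 h2).resolve_left two_ne_zero

/-- The change of coordinates between two flattening charts. -/
def transition (e e' : Chart N) (j : ℕ) (y : Fin j → ℝ) : Fin j → ℝ :=
  headCoords j (e (Ξ e' j y))

theorem transition_spec (he : Flattens L I e) (he' : Flattens L I' e') (hj : j ∈ I) (hj' : j ∈ I')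
    {y : Fin j → ℝ} (hy : y ∈ dom e' j) (hye : Ξ e' j y ∈ e.source) :
    transition e e' j y ∈ dom e j ∧ Ξ e j (transition e e' j y) = Ξ e' j y :=
  ⟨he.head_mem hj hye (he'.planeParam_mem hj' hy), he.planeParam_head hj hye (he'.planeParam_mem hj' hy)⟩

theorem contDiffAt_transition (he : Flattens L I e) (he' : Flattens L I' e')
    {y : Fin j → ℝ} (hy : y ∈ dom e' j) (hye : Ξ e' j y ∈ e.source) :
    SmoothAt (transition e e' j) y :=
  (headCLM N j).contDiff.contDiffAt.comp y ((he.contDiffAt hye).comp y (he'.contDiffAt_planeParam hy))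

theorem eventually_mem_source (he' : Flattens L I' e')
    {y : Fin j → ℝ} (hy : y ∈ dom e' j) (hye : Ξ e' j y ∈ e.source) :
    ∀ᶠ z in 𝓝 y, z ∈ dom e' j ∧ Ξ e' j z ∈ e.source :=
  Filter.Eventually.and (dom_mem_nhds hy)
    ((he'.contDiffAt_planeParam hy).continuousAt.eventually (e.open_source.mem_nhds hye))

theorem fderiv_planeParam_transition (he : Flattens L I e) (he' : Flattens L I' e') (hj : j ∈ I)
    (hj' : j ∈ I') {y : Fin j → ℝ} (hy : y ∈ dom e' j) (hye : Ξ e' j y ∈ e.source)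
    (v : Fin j → ℝ) : D (Ξ e j) (transition e e' j y) (D (transition e e' j) y v) = D (Ξ e' j) y v := by
  have h1 : Ξ e j ∘ transition e e' j =ᶠ[𝓝 y] Ξ e' j :=
    (eventually_mem_source he' hy hye).mono fun z hz => (transition_spec he he' hj hj' hz.1 hz.2).2
  have h2 := ((he.contDiffAt_planeParam (transition_spec he he' hj hj' hy hye).1).differentiableAt
    (by simp)).hasFDerivAt.comp y
    (contDiffAt_transition he he' hy hye).diffAt.hasFDerivAt
  have h3 := h2.unique (((he'.contDiffAt_planeParam hy).differentiableAt
    (by simp)).hasFDerivAt.congr_of_eventuallyEq h1)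
  exact DFunLike.congr_fun h3 v

theorem isPullbackAt_transition (he : Flattens L I e) (he' : Flattens L I' e') (hj : j ∈ I)
    (hj' : j ∈ I') (hjN : j ≤ N) {y : Fin j → ℝ} (hy : y ∈ dom e' j)
    (hye : Ξ e' j y ∈ e.source) :
    IsPullbackAt (γ e j) (γ e' j) (transition e e' j) y := by
  refine ⟨he.isMetricAt hjN (transition_spec he he' hj hj' hy hye).1, he'.isMetricAt hjN hy, ?_, ?_⟩
  · filter_upwards [eventually_mem_source he' hy hye] with z hz using contDiffAt_transition he he' hz.1 hz.2
  · filter_upwards [eventually_mem_source he' hy hye] with z hz u v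
    rw [Flattens.formOf_inducedMetric, Flattens.formOf_inducedMetric,
      fderiv_planeParam_transition he he' hj hj' hz.1 hz.2,
      fderiv_planeParam_transition he he' hj hj' hz.1 hz.2]

/-- The square length of a covector on the image of an injective linear map. -/
theorem norm_sq_comp_subtypeL {T : Submodule ℝ (Amb N)} (A : (Fin j → ℝ) →L[ℝ] Amb N)
    (hA : Injective A) (hT : T = LinearMap.range A.toLinearMap) (l : Amb N →L[ℝ] ℝ) :
    ‖l.comp T.subtypeL‖ ^ 2 = ∑ a, ∑ b, (gramOf A)⁻¹ a b * l (A (single a 1)) * l (A (single b 1)) := by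
  have hdet : IsUnit (gramOf A).det := isUnit_iff_ne_zero.2 (gramOf_posDef A hA).det_pos.ne'
  -- The coefficients of the Riesz representative of the restricted covector.
  set v : Fin j → ℝ := fun a => ∑ b, (gramOf A)⁻¹ a b * l (A (single b 1)) with hv
  have hinner : ∀ u w : Fin j → ℝ, inner ℝ (A u) (A w) = ∑ a, ∑ b, u a * w b * gramOf A a b := by
    intro u w
    have e : ∀ (w : Fin j → ℝ) a, A (single a (w a)) = w a • A (single a 1) := fun w a => by
      rw [← map_smul, ← Pi.single_smul, smul_eq_mul, mul_one]
    conv_lhs => rw [← univ_sum_single u, ← univ_sum_single w, map_sum, map_sum, sum_inner]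
    refine sum_congr rfl fun a _ => ?_
    rw [inner_sum]
    refine sum_congr rfl fun b _ => ?_
    rw [e, e, real_inner_smul_left, real_inner_smul_right, mul_assoc]
    rfl
  have hsymm : ∀ a b, gramOf A a b = gramOf A b a := fun a b => real_inner_comm (A (single b 1)) (A (single a 1))
  have hrep : ∀ u : Fin j → ℝ, inner ℝ (A v) (A u) = l (A u) := by
    intro u
    have h1 : ∀ b, ∑ a, v a * gramOf A a b = l (A (single b 1)) := by
      intro b
      simp only [hv, sum_mul]
      rw [sum_comm]
      have h2 : ∀ c, ∑ a, gramOf A b a * (gramOf A)⁻¹ a c = (1 : Matrix _ _ ℝ) b c := fun c => by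
        rw [← Matrix.mul_apply, mul_nonsing_inv _ hdet]
      have h3 : ∀ c, ∑ a, (gramOf A)⁻¹ a c * l (A (single c 1)) * gramOf A a b =
          (1 : Matrix _ _ ℝ) b c * l (A (single c 1)) := fun c => by
        rw [← h2, sum_mul]
        exact sum_congr rfl fun a _ => by rw [hsymm a b]; ring
      simp only [h3, Matrix.one_apply, ite_mul, one_mul, zero_mul, sum_ite_eq, Finset.mem_univ, if_true]
    rw [hinner, sum_comm]
    conv_rhs => rw [← univ_sum_single u, map_sum, map_sum]
    refine sum_congr rfl fun b _ => ?_
    have h4 : A (single b (u b)) = u b • A (single b 1) := by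
      rw [← map_smul, ← Pi.single_smul, smul_eq_mul, mul_one]
    rw [h4, map_smul, smul_eq_mul, ← h1, mul_sum]
    exact sum_congr rfl fun a _ => by ring
  have hAv : A v ∈ T := by rw [hT]; exact ⟨v, rfl⟩
  have hl : l.comp T.subtypeL = innerSL ℝ (⟨A v, hAv⟩ : T) := by
    ext ⟨w, hw⟩
    rw [hT] at hw
    obtain ⟨u, rfl⟩ := hw
    exact (hrep u).symm
  rw [hl, innerSL_apply_norm, ← real_inner_self_eq_norm_sq]
  change inner ℝ (A v) (A v) = _
  rw [hrep]
  have h5 : A v = ∑ a, v a • A (single a 1) := by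
    conv_lhs => rw [← univ_sum_single v, map_sum]
    refine sum_congr rfl fun a _ => ?_
    rw [← map_smul, ← Pi.single_smul, smul_eq_mul, mul_one]
  rw [h5, map_sum]
  refine sum_congr rfl fun a _ => ?_
  rw [map_smul, smul_eq_mul, hv, sum_mul]
  exact sum_congr rfl fun b _ => by ring

theorem Flattens.fderiv_comp_planeParam (he : Flattens L I e) (hj : j ∈ I) {y : Fin j → ℝ}
    (hy : y ∈ dom e j) {f : Amb N → ℝ}
    (hf : DifferentiableWithinAt ℝ f (L j) (Ξ e j y)) :
    D (fun z => f (Ξ e j z)) y = (fderivWithin ℝ f (L j) (Ξ e j y)).comp (D (Ξ e j) y) :=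
  (HasFDerivWithinAt.comp_hasFDerivAt y hf.hasFDerivWithinAt (he.contDiffAt_planeParam hy).diffAt.hasFDerivAt (by
      filter_upwards [dom_mem_nhds hy] with z hz using he.planeParam_mem hj hz)).fderiv

/-- The tangential gradient in coordinates. -/
theorem gradSq_planeParam (he : Flattens L I e) (hj : j ∈ I) (hjN : j ≤ N) {y : Fin j → ℝ}
    (hy : y ∈ dom e j) {f : Amb N → ℝ}
    (hf : DifferentiableWithinAt ℝ f (L j) (Ξ e j y)) :
    gradSq (L j) f (Ξ e j y) = gradInner (γ e j) (fun z => f (Ξ e j z)) (fun z => f (Ξ e j z)) y := by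
  have h1 := he.fderiv_comp_planeParam hj hy hf
  rw [gradSq, norm_sq_comp_subtypeL (D (Ξ e j) y) (he.injective_fderiv_planeParam hjN hy) (he.tangentSpan_eq hj hy)]
  simp only [gradInner, gradOf, partialD, h1, ContinuousLinearMap.comp_apply, mul_sum]
  exact sum_congr rfl fun a _ => sum_congr rfl fun b _ => by
    rw [show (γ e j) y = gramOf (D (Ξ e j) y) from rfl]
    ring

end ChartGeometry

/-! ### The curvature quantities of a slicing in arbitrary charts. -/

section SlicingCharts

variable {N n k : ℕ} {S : Slicing N n} {Ω : Set (Amb N)}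

namespace Slicing

theorem warpedMetric_eq_blockOf (S : Slicing N n) (e : Chart N) (j m : ℕ) : S.warpedMetric e j m = blockOf (γ e j)
      fun (p : Finset.Ico m n) y => S.u p.1 (Ξ e j y) := rfl

theorem mem_reg_of_flattens {j i : ℕ} {e : Chart N}
    (he : Flattens S.leaf (Icc j n) e) (hi : j ≤ i) {x : Amb N} (hx : x ∈ e.source)
    (hxi : x ∈ S.leaf i) : x ∈ S.reg i :=
  ⟨hxi, fun l hl => ⟨e, hx, he.smooth, he.smooth_symm, fun l' hl' => by
    obtain rfl : l' = l := hl'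
    exact he.flat l' ⟨hi.trans hl.1, hl.2⟩⟩⟩

theorem planeParam_mem_reg {j i : ℕ} {e : Chart N}
    (he : Flattens S.leaf (Icc j n) e) (hi : i ∈ Icc j n) {y : Fin i → ℝ}
    (hy : y ∈ dom e i) : Ξ e i y ∈ S.reg i :=
  mem_reg_of_flattens he hi.1 (Flattens.planeParam_mem_source hy) (he.planeParam_mem hi hy)

namespace IsMinimal

variable (hS : S.IsMinimal Ω k)
include hS

theorem contDiffOn_u {p : ℕ} (hp : p ∈ Icc k n) : ContDiffOn ℝ ∞ (S.u p) (S.reg p) := by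
  rcases hp.2.eq_or_lt with rfl | h
  · exact contDiffOn_const.congr fun x hx => hS.u_top x hx.1
  · exact (hS.eigenfunction p ⟨hp.1, h⟩).smooth

theorem u_pos {p : ℕ} (hp : p ∈ Icc k n) {x : Amb N} (hx : x ∈ S.reg p) : 0 < S.u p x := by
  rcases hp.2.eq_or_lt with rfl | h
  · rw [hS.u_top x hx.1]; exact one_pos
  · exact (hS.eigenfunction p ⟨hp.1, h⟩).pos x hx

/-- Functions that are smooth on the regular set are smooth in flattening charts. -/
theorem contDiffAt_comp_planeParam {j i p : ℕ} (hj : k ≤ j)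
    {e : Chart N} (he : Flattens S.leaf (Icc j n) e) (hi : i ∈ Icc j n)
    (hip : i ≤ p) (hp : p ≤ n) {W : Type*} [NormedAddCommGroup W] [NormedSpace ℝ W] {f : Amb N → W}
    (hf : ContDiffOn ℝ ∞ f (S.reg p)) {y : Fin i → ℝ} (hy : y ∈ dom e i) :
    SmoothAt (fun y => f (Ξ e i y)) y := by
  have hsub := hS.reg_mono (hj.trans hi.1) hip hp
  have h1 := hf.mono hsub
  exact (h1.comp he.contDiffOn_planeParam fun z hz => planeParam_mem_reg he hi hz).contDiffAt
    (dom_mem_nhds hy)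

theorem isWeightAt {j i m : ℕ} (hj : k ≤ j) {e : Chart N}
    (he : Flattens S.leaf (Icc j n) e) (hi : i ∈ Icc j n) (him : i ≤ m) {y : Fin i → ℝ}
    (hy : y ∈ dom e i) :
    IsWeightAt (fun (p : Finset.Ico m n) y => S.u p.1 (Ξ e i y)) y := by
  filter_upwards [dom_mem_nhds hy] with z hz p
  have hp := Finset.mem_Ico.1 p.2
  have hkp : p.1 ∈ Icc k n := ⟨(hj.trans hi.1).trans (him.trans hp.1), hp.2.le⟩
  exact ⟨hS.contDiffAt_comp_planeParam hj he hi (him.trans hp.1) hp.2.le (hS.contDiffOn_u hkp) hz,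
    hS.u_pos hkp (hS.reg_mono (hj.trans hi.1) (him.trans hp.1) hp.2.le (planeParam_mem_reg he hi hz))⟩

theorem chart_spec {j : ℕ} (hkj : k ≤ j) (hj : j ≤ n) {x : Amb N} (hx : x ∈ S.reg j) :
    x ∈ (S.chart j x).source ∧ Flattens S.leaf (Icc j n) (S.chart j x) := by
  have h := hS.exists_flattens hkj hj hx
  rw [chart, dif_pos h]
  exact h.choose_spec

theorem isPullbackAt_warpedMetric {j j' i m : ℕ} (hj : k ≤ j) (hj' : k ≤ j') 
    {e e' : Chart N} (he : Flattens S.leaf (Icc j n) e)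
    (he' : Flattens S.leaf (Icc j' n) e') (hi : i ∈ Icc j n) (hi' : i ∈ Icc j' n) (him : i ≤ m)
    {z : (Fin i ⊕ Finset.Ico m n) → ℝ} (hy : base z ∈ dom e' i)
    (hye : Ξ e' i (base z) ∈ e.source) :
    IsPullbackAt (S.warpedMetric e i m) (S.warpedMetric e' i m)
      (fun x => Sum.elim (transition e e' i (base x)) fun p => x (inr p)) z := by
  refine isPullbackAt_blockOf (isPullbackAt_transition he he' hi hi' (hi.2.trans hS.dim_le) hy hye)
    (hS.isWeightAt hj he hi him (transition_spec he he' hi hi' hy hye).1)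
    (hS.isWeightAt hj' he' hi' him hy) ?_
  filter_upwards [eventually_mem_source he' hy hye] with x hx p
  rw [(transition_spec he he' hi hi' hx.1 hx.2).2]

/-- Scalar curvatures do not depend on the chart. -/
theorem scalarCurvature_warpedMetric_eq {j j' i m : ℕ} (hj : k ≤ j) (hj' : k ≤ j') 
    {e e' : Chart N} (he : Flattens S.leaf (Icc j n) e)
    (he' : Flattens S.leaf (Icc j' n) e') (hi : i ∈ Icc j n) (hi' : i ∈ Icc j' n) (him : i ≤ m)
    {x : Amb N} (hx : x ∈ e.source) (hx' : x ∈ e'.source) (hxi : x ∈ S.leaf i)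
    (t : Finset.Ico m n → ℝ) :
    scalarCurvature (S.warpedMetric e' i m) (Sum.elim (headCoords i (e' x)) t) =
      scalarCurvature (S.warpedMetric e i m) (Sum.elim (headCoords i (e x)) t) := by
  have h1 : Ξ e' i (headCoords i (e' x)) = x := he'.planeParam_head hi' hx' hxi
  have h2 := hS.isPullbackAt_warpedMetric (z := Sum.elim (headCoords i (e' x)) t) hj hj' he he' hi hi'
    him (he'.head_mem hi' hx' hxi) (by
      change Ξ e' i (headCoords i (e' x)) ∈ _; rwa [h1])
  rw [h2.scalarCurvature_eq]
  congr 1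
  change Sum.elim (headCoords i (e (Ξ e' i (headCoords i (e' x))))) t = _
  rw [h1]

/-- The chart in the definition is an arbitrary choice. Invariance of scalar curvature allows any
chart that flattens the leaves, also one adapted to a lower leaf. -/
theorem scalHat_eq {j i : ℕ} (hj : k ≤ j) {e : Chart N}
    (he : Flattens S.leaf (Icc j n) e) (hi : i ∈ Icc j n) {x : Amb N} (hx : x ∈ e.source)
    (hxi : x ∈ S.leaf i) : S.scalHat i x =
      scalarCurvature (S.warpedMetric e i i) (Sum.elim (headCoords i (e x)) 0) := by
  have hr := mem_reg_of_flattens he hi.1 hx hxi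
  obtain ⟨h1, h2⟩ := hS.chart_spec (hj.trans hi.1) hi.2 hr
  exact hS.scalarCurvature_warpedMetric_eq hj (hj.trans hi.1) he h2 hi ⟨le_rfl, hi.2⟩ le_rfl hx h1 hxi 0

theorem scal_eq {j i : ℕ} (hj : k ≤ j) {e : Chart N}
    (he : Flattens S.leaf (Icc j n) e) (hi : i ∈ Icc j n) {x : Amb N} (hx : x ∈ e.source)
    (hxi : x ∈ S.leaf i) : S.scal i x = scalarCurvature (γ e i) (headCoords i (e x)) := by
  have hr := mem_reg_of_flattens he hi.1 hx hxi
  obtain ⟨h1, h2⟩ := hS.chart_spec (hj.trans hi.1) hi.2 hr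
  have hx' : Ξ (S.chart i x) i (headCoords i (S.chart i x x)) = x :=
    h2.planeParam_head ⟨le_rfl, hi.2⟩ h1 hxi
  have h3 := (isPullbackAt_transition he h2 hi ⟨le_rfl, hi.2⟩ (hi.2.trans hS.dim_le)
    (h2.head_mem ⟨le_rfl, hi.2⟩ h1 hxi) (by rwa [hx'])).scalarCurvature_eq
  rwa [transition, hx'] at h3

theorem nu_ne {j : ℕ} (hj : j ∈ Ico k n) {x : Amb N} (hx : x ∈ S.reg j) :
    S.nu j x ∉ tangentSpan (S.leaf j) x := fun h => by
  have h1 := hS.nu_normal j hj x hx _ h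
  rw [inner_self_eq_zero] at h1
  have h2 := hS.nu_unit j hj x hx
  rw [h1, norm_zero] at h2
  exact zero_ne_one h2

/-- Fermi charts of the slicing. -/
theorem exists_isFermiChart {j : ℕ} (hj : j ∈ Ico k n) {x : Amb N} (hx : x ∈ S.reg j) :
    ∃ e : Chart N, x ∈ e.source ∧ Flattens S.leaf (Icc j n) e ∧ IsFermiChart (S.nu j) j e := by
  obtain ⟨e, hxe, he⟩ := hS.exists_flattens hj.1 hj.2.le hx
  have hjI : j ∈ Icc j n := ⟨le_rfl, hj.2.le⟩
  have hjI' : j + 1 ∈ Icc j n := ⟨j.le_succ, hj.2⟩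
  exact he.exists_isFermiChart hjI hjI' (fun i hi => hi.1) (hjI'.2.trans hS.dim_le)
    (fun y hy => hS.contDiffAt_comp_planeParam hj.1 he hjI le_rfl hj.2.le (hS.nu_smooth j hj) hy)
    (fun y hy => hS.nu_tangent j hj _ (planeParam_mem_reg he hjI hy))
    (fun y hy => hS.nu_ne hj (planeParam_mem_reg he hjI hy)) hxe hx.1

theorem isFermiAt_warpedMetric {j : ℕ} (hj : j ∈ Ico k n)
    {e : Chart N} (he : Flattens S.leaf (Icc j n) e)
    (hF : IsFermiChart (S.nu j) j e) {z : (Fin j ⊕ Finset.Ico (j + 1) n) → ℝ}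
    (hz : base z ∈ dom e j) :
    IsFermiAt (S.warpedMetric e (j + 1) (j + 1)) (Sum.map castSucc id) (inl (last j)) z := by
  have hjI : j ∈ Icc j n := ⟨le_rfl, hj.2.le⟩
  have hjI' : j + 1 ∈ Icc j n := ⟨j.le_succ, hj.2⟩
  refine isFermiAt_blockOf (hF.isFermiAt he hjI (hjI'.2.trans hS.dim_le)
    (fun y hy => hS.nu_unit j hj _ (planeParam_mem_reg he hjI hy))
    (fun y hy => hS.nu_normal j hj _ (planeParam_mem_reg he hjI hy)) hz)
    (hS.isWeightAt hj.1 he hjI' le_rfl (incl_mem_dom.2 hz))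

theorem incl_sumMap_elim {j m : ℕ} (y : Fin j → ℝ) (t : Finset.Ico m n → ℝ) :
    incl (Sum.map castSucc id : Fin j ⊕ Finset.Ico m n → _) (Sum.elim y t) = Sum.elim (incl castSucc y) t := by
  have H := isHyperplane_castSucc j
  have H' := isHyperplane_sumMap (P := Finset.Ico m n) H
  ext b
  rcases b with b | p
  · exact congrFun (base_incl H (Sum.elim y t)) b
  · exact incl_emb H' (Sum.elim y t) (inr p)

omit hS in
/-- Changes of flattening charts preserve the hypersurface. -/
theorem transition_plane {L : ℕ → Set (Amb N)} {I I' : Set ℕ} {j : ℕ}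
    {c e : Chart N} (hc : Flattens L I c) (he : Flattens L I' e)
    (hj : j ∈ I) (hj' : j ∈ I') (hjN : j + 1 ≤ N) {y : Fin j → ℝ} (hy : y ∈ dom e j)
    (hyc : Ξ e (j + 1) (incl castSucc y) ∈ c.source) :
    ∀ᶠ w in 𝓝 (incl castSucc y), w (last j) = 0 → transition c e (j + 1) w (last j) = 0 := by
  rw [planeParam_incl] at hyc
  refine eventually_plane (isHyperplane_castSucc j)
    (O := interior {w | w ∈ dom e j ∧ Ξ e j w ∈ c.source}) isOpen_interior
    (mem_interior_iff_mem_nhds.2 (eventually_mem_source he hy hyc)) fun w hw => ?_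
  have hw' := interior_subset hw
  rw [transition, planeParam_incl, headCoords_apply hjN]
  exact (hc.flat j hj _ hw'.2).1 (he.planeParam_mem hj' hw'.1) _ le_rfl

omit hS in
-- In a Fermi chart the coordinate vector `∂_s` is `ν`, so the transition map takes it to the
-- coordinates of `ν` in the other chart.
theorem fderiv_transition_normal {j : ℕ}  {c e : Chart N} (he : Flattens S.leaf (Icc j n) e)
    (hc : Flattens S.leaf (Icc j n) c) (hF : IsFermiChart (S.nu j) j e) {y : Fin j → ℝ}
    (hy : y ∈ dom e j) (hyc : Ξ e j y ∈ c.source) :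
    D (transition c e (j + 1)) (incl castSucc y) (single (last j) 1) =
      headCoords (j + 1) (D c (Ξ e j y) (S.nu j (Ξ e j y))) := by
  have hye := incl_mem_dom.2 hy
  have d1 := (hc.contDiffAt hyc).diffAt.hasFDerivAt
  rw [← planeParam_incl e y] at d1
  have d2 := (headCLM N (j + 1)).hasFDerivAt.comp _ (d1.comp _ (he.contDiffAt_planeParam hye).diffAt.hasFDerivAt)
  have d3 : D (transition c e (j + 1)) (incl castSucc y) = _ := d2.fderiv
  rw [d3]
  simp only [ContinuousLinearMap.comp_apply]
  rw [hF.velocity y hy, planeParam_incl]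
  rfl

/-- Orthogonality of `ν` to the leaf, read in the chart `c`; this is the normality that the
invariance of the second fundamental form requires. -/
theorem formOf_normal {j : ℕ} (hj : j ∈ Ico k n) {c e : Chart N} (he : Flattens S.leaf (Icc j n) e)
    (hF : IsFermiChart (S.nu j) j e) {y : Fin j → ℝ} 
    (hyc : Ξ e j y ∈ c.source) (hc : Flattens S.leaf (Icc j n) c) 
    (hy : y ∈ dom e j) (a : Fin j) :
    formOf ((γ c (j + 1)) (headCoords (j + 1) (c (Ξ e j y)))) (single (castSucc a) 1)
      (headCoords (j + 1) (D c (Ξ e j y) (S.nu j (Ξ e j y)))) = 0 := by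
  have hjI : j ∈ Icc j n := ⟨le_rfl, hj.2.le⟩
  have hjI' : j + 1 ∈ Icc j n := ⟨j.le_succ, hj.2⟩
  have hjN : j + 1 ≤ N := hjI'.2.trans hS.dim_le
  have hye := incl_mem_dom.2 hy
  have hxr := planeParam_mem_reg he hjI hy
  have ht : headCoords (j + 1) (c (Ξ e j y)) = transition c e (j + 1) (incl castSucc y) := by
    rw [transition, planeParam_incl]
  rw [Flattens.formOf_inducedMetric, ← fderiv_transition_normal he hc hF hy hyc, ht,
    fderiv_planeParam_transition hc he hjI' hjI' hye (by rwa [planeParam_incl]),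
    hF.velocity y hy]
  refine hS.nu_normal j hj _ hxr _ ?_
  have h3 := hc.tangentSpan_eq hjI (hc.head_mem hjI hyc hxr.1)
  rw [hc.planeParam_head hjI hyc hxr.1] at h3
  rw [h3]
  have h4 := (hc.contDiffAt_planeParam (j := j + 1) (incl_mem_dom.2
    (hc.head_mem hjI hyc hxr.1))).diffAt.hasFDerivAt.comp _
    (incl (castSucc (n := j))).hasFDerivAt
  have h5 : Ξ c (j + 1) ∘ incl castSucc = Ξ c j :=
    funext fun y => planeParam_incl c y
  rw [h5] at h4
  refine ⟨single a 1, ?_⟩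
  change D (Ξ c j) _ _ = _
  rw [h4.fderiv, ContinuousLinearMap.comp_apply, incl_single (isHyperplane_castSucc j), ← ht]
  congr 2
  rw [← headCoords_padCoords hjN (incl _ _), padCoords_incl, hc.pad_head hjI hyc hxr.1]

omit hS in
theorem formOf_warpedMetric_elim {i m : ℕ} (c : Chart N)
    (u : Fin i → ℝ) (t : Finset.Ico m n → ℝ) (v : (Fin i ⊕ Finset.Ico m n) → ℝ) (w : Fin i → ℝ)
    (S : Slicing N n) :
    formOf (S.warpedMetric c i m (Sum.elim u t)) v (Sum.elim w 0) = formOf (γ c i u) (base v) w := by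
  rw [warpedMetric_eq_blockOf, formOf_blockOf]
  simp only [Sum.elim_inr, Pi.zero_apply, mul_zero, sum_const_zero, add_zero]
  rfl

/-- The second fundamental form in a Fermi chart. -/
theorem tildeASq_eq {j : ℕ} (hj : j ∈ Ico k n) {e : Chart N}
    (he : Flattens S.leaf (Icc j n) e) (hF : IsFermiChart (S.nu j) j e) {y : Fin j → ℝ}
    (hy : y ∈ dom e j) : S.tildeASq j (Ξ e j y) =
      secondFundNormSq (S.warpedMetric e (j + 1) (j + 1)) (Sum.map castSucc id) (single (inl (last j)) 1)
        (incl (Sum.map castSucc id : Fin j ⊕ Finset.Ico (j + 1) n → _) (Sum.elim y 0)) := by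
  have hjI : j ∈ Icc j n := ⟨le_rfl, hj.2.le⟩
  have hjI' : j + 1 ∈ Icc j n := ⟨j.le_succ, hj.2⟩
  have hjN : j + 1 ≤ N := hjI'.2.trans hS.dim_le
  have H := isHyperplane_castSucc j
  have H' := isHyperplane_sumMap (P := Finset.Ico (j + 1) n) H
  set x := Ξ e j y with hx
  have hxr : x ∈ S.reg j := planeParam_mem_reg he hjI hy
  obtain ⟨h1, h2⟩ := hS.chart_spec hj.1 hj.2.le hxr
  set c := S.chart j x with hc
  have hxx : Ξ e (j + 1) (incl castSucc y) = x := planeParam_incl e y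
  have hye := incl_mem_dom.2 hy
  have hyc : Ξ e (j + 1) (incl castSucc y) ∈ c.source := by rwa [hxx]
  set z : (Fin (j + 1) ⊕ Finset.Ico (j + 1) n) → ℝ := Sum.elim (incl castSucc y) 0 with hz
  have hbz : base z = incl castSucc y := rfl
  have hpb := hS.isPullbackAt_warpedMetric (m := j + 1) (z := z) hj.1 hj.1 h2 he hjI' hjI' le_rfl hye hyc
  have hτ := contDiffAt_transition h2 he hye hyc
  set ν' : (Fin (j + 1) ⊕ Finset.Ico (j + 1) n) → ℝ := single (inl (last j)) 1 with hν'
  have hbν : base ν' = single (last j) 1 := by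
    ext b
    simp [hν', Pi.single_apply]
  have hdν : D (fun w : (Fin (j + 1) ⊕ Finset.Ico (j + 1) n) → ℝ =>
      Sum.elim (transition c e (j + 1) (base w)) fun p => w (inr p)) z ν' =
      Sum.elim (headCoords (j + 1) (D c x (S.nu j x))) 0 := by
    rw [fderiv_sumElim_base (by rw [hbz]; exact hτ), hbν, hbz,
      fderiv_transition_normal he h2 hF hy h1]
    congr 1
  have hτz : Sum.elim (transition c e (j + 1) (base z)) (fun p => z (inr p)) =
      Sum.elim (headCoords (j + 1) (c x)) 0 := by
    rw [hbz, transition, hxx]; rfl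
  -- The transition map times the identity of the fibres preserves the hypersurface and takes `∂_s`
  -- to the normal used in the definition of `tildeASq`.
  have key := hpb.secondFundNormSq_eq (emb := Sum.map castSucc id) H'.inj
    (H'.plane_iff.2 (incl_normal H y)) ?_ (ν' := ν') ?_
  · rw [incl_sumMap_elim hS, key, hdν, hτz, tildeASq, if_pos hj.2]
  · have hb : ContinuousAt (base (ι := Fin (j + 1)) (P := Finset.Ico (j + 1) n)) z :=
      base.continuous.continuousAt
    have h3 := transition_plane h2 he hjI hjI hjN hy hyc
    filter_upwards [hb.eventually h3] with w hw
    rw [H'.plane_iff, H'.plane_iff]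
    exact hw
  · intro a
    rw [hdν]
    refine (congrArg (fun w => formOf (S.warpedMetric c (j + 1) (j + 1) w) _ _) hτz).trans ?_
    refine (formOf_warpedMetric_elim _ _ _ _ _ _).trans ?_
    rcases a with a | p
    · refine (DFunLike.congr_fun (congrArg (formOf _) ?_) _).trans (hS.formOf_normal hj he hF h1 h2 hy a)
      ext b
      simp [Pi.single_apply]
    · have e2 : base (single (Sum.map castSucc id (inr p)) 1 : (Fin (j + 1) ⊕ Finset.Ico (j + 1) n) → ℝ) = 0 := by
        ext b
        simp []
      refine (DFunLike.congr_fun (congrArg (formOf _) e2) _).trans ?_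
      rw [map_zero]; rfl

end IsMinimal

end Slicing

end SlicingCharts

/-! ### Integrals over compact sets in parameter space. -/

section CompactIntegrals

variable {α : Type} [Fintype α] [DecidableEq α]

/-- The integral of a partial derivative of a compactly supported function vanishes. -/
theorem integral_partialD_eq_zero {f : (α → ℝ) → ℝ} (hf : ContDiff ℝ 1 f) (hc : HasCompactSupport f)
    (a : α) : ∫ y, partialD a f y = 0 := by
  obtain ⟨C, hC⟩ := hf.lipschitzWith_of_hasCompactSupport hc one_ne_zero
  -- Integration by parts against the constant `1`; it reverses the direction, hence the minus sign.
  have h1 := LipschitzWith.integral_lineDeriv_mul_eq (μ := volume) (LipschitzWith.const (α := α → ℝ) (1 : ℝ)) hC hc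
    (-(single a 1))
  have h2 : ∀ y, lineDeriv ℝ (fun _ : α → ℝ => (1 : ℝ)) y (-(single a 1)) = 0 := fun y => by
    simp [lineDeriv]
  simp only [h2, zero_mul, integral_zero, neg_neg, mul_one] at h1
  rw [h1]
  refine integral_congr_ae (.of_forall fun y => ?_)
  exact ((hf.differentiable one_ne_zero y).lineDeriv_eq_fderiv).symm

/-- The extension of `f` by zero is `C¹` on the whole space, because `f` already vanishes on `U`
outside the compact set `K`. -/
theorem setIntegral_partialD_eq_zero {f : (α → ℝ) → ℝ} {U K : Set (α → ℝ)} (hU : IsOpen U)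
    (hK : IsCompact K) (hKU : K ⊆ U) (hf : ∀ y ∈ U, ContDiffAt ℝ 1 f y) (h0 : ∀ y ∈ U \ K, f y = 0)
    (a : α) : ∫ y in U, partialD a f y = 0 := by
  have e1 : ∀ y ∈ U, U.indicator f =ᶠ[𝓝 y] f := fun y hy =>
    eventuallyEq_of_mem (hU.mem_nhds hy) fun z hz => indicator_of_mem hz f
  have e2 : ∀ y ∉ K, U.indicator f =ᶠ[𝓝 y] fun _ => 0 := fun y hy => by
    filter_upwards [hK.isClosed.isOpen_compl.mem_nhds hy] with z hz
    by_cases h : z ∈ U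
    · rw [indicator_of_mem h, h0 z ⟨h, hz⟩]
    · exact indicator_of_notMem h f
  have h1 : ContDiff ℝ 1 (U.indicator f) := contDiff_iff_contDiffAt.2 fun y => by
    by_cases h : y ∈ U
    · exact (hf y h).congr_of_eventuallyEq (e1 y h)
    · exact contDiffAt_const.congr_of_eventuallyEq (e2 y fun h' => h (hKU h'))
  have h2 : HasCompactSupport (U.indicator f) := HasCompactSupport.intro hK fun y hy =>
    (e2 y hy).self_of_nhds
  rw [← integral_partialD_eq_zero h1 h2 a, ← setIntegral_eq_integral_of_forall_compl_eq_zero (s := U)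
    (f := partialD a (U.indicator f))]
  · exact setIntegral_congr_fun hU.measurableSet fun y hy => (partialD_congr (e1 y hy) a).symm
  · intro y hy
    rw [partialD_congr (e2 y fun h' => hy (hKU h')), partialD_const]

/-- Differentiation under the integral over a compact set. -/
theorem hasDerivAt_setIntegral_timeD {G : ℝ × (α → ℝ) → ℝ} {B : Set (α → ℝ)} (hB : IsCompact B) {s₀ : ℝ}
    (hG : ∀ᶠ s in 𝓝 s₀, ∀ y ∈ B, ContDiffAt ℝ 1 G (s, y)) :
    HasDerivAt (fun s => ∫ y in B, G (s, y)) (∫ y in B, timeD G (s₀, y)) s₀ := by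
  obtain ⟨r, hr, hball⟩ := Metric.eventually_nhds_iff_ball.1 hG
  have hcG : ∀ s ∈ Metric.ball s₀ r, ContinuousOn (fun y => G (s, y)) B := fun s hs y hy =>
    (ContinuousAt.comp (f := fun y => (s, y)) (hball s hs y hy).continuousAt (by fun_prop)).continuousWithinAt
  have hcT : ∀ s ∈ Metric.ball s₀ r, ∀ y ∈ B, ContinuousAt (timeD G) (s, y) := fun s hs y hy =>
    ((hball s hs y hy).fderiv_right (m := 0) (by simp)).continuousAt.clm_apply continuousAt_const
  have hr2 : 0 < r / 2 := by positivity
  have hsub : Metric.closedBall s₀ (r / 2) ⊆ Metric.ball s₀ r :=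
    Metric.closedBall_subset_ball (by linarith)
  obtain ⟨C, hC⟩ := ((isCompact_closedBall s₀ (r / 2)).prod hB).exists_bound_of_continuousOn
    (f := timeD G) fun w hw => (hcT w.1 (hsub hw.1) w.2 hw.2).continuousWithinAt
  have hs₀ : s₀ ∈ Metric.ball s₀ r := Metric.mem_ball_self hr
  refine (hasDerivAt_integral_of_dominated_loc_of_deriv_le (μ := volume.restrict B)
    (F := fun s y => G (s, y)) (F' := fun s y => timeD G (s, y)) (bound := fun _ => C)
    (Metric.ball_mem_nhds s₀ hr2) ?_ ?_ ?_ ?_ ?_ ?_).2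
  · filter_upwards [Metric.ball_mem_nhds s₀ hr] with s hs using (hcG s hs).aestronglyMeasurable hB.measurableSet
  · exact (hcG s₀ hs₀).integrableOn_compact hB
  · refine ContinuousOn.aestronglyMeasurable (fun y hy => ?_) hB.measurableSet
    exact (ContinuousAt.comp (f := fun y => (s₀, y)) (hcT s₀ hs₀ y hy) (by fun_prop)).continuousWithinAt
  · filter_upwards [ae_restrict_mem hB.measurableSet] with y hy s hs
    exact hC (s, y) ⟨Metric.ball_subset_closedBall hs, hy⟩
  · exact integrableOn_const hB.measure_lt_top.ne
  · filter_upwards [ae_restrict_mem hB.measurableSet] with y hy s hs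
    exact hasDerivAt_timeD ((hball s (hsub (Metric.ball_subset_closedBall hs)) y hy).differentiableAt one_ne_zero)

theorem eventually_hasDerivAt_setIntegral {G : ℝ × (α → ℝ) → ℝ} {B : Set (α → ℝ)} (hB : IsCompact B)
    (hG : ∀ y ∈ B, ∀ᶠ w in 𝓝 ((0 : ℝ), y), SmoothAt G w) : ∀ᶠ s in 𝓝 0,
      HasDerivAt (fun s => ∫ y in B, G (s, y)) (∫ y in B, timeD G (s, y)) s ∧
      HasDerivAt (fun s => ∫ y in B, timeD G (s, y)) (∫ y in B, timeD (timeD G) (s, y)) s := by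
  have h1 : ∀ᶠ s in 𝓝 (0 : ℝ), ∀ y ∈ B, SmoothAt G (s, y) :=
    hB.eventually_forall_of_forall_eventually hG
  filter_upwards [h1.eventually_nhds] with s hs
  exact ⟨hasDerivAt_setIntegral_timeD hB (hs.mono fun t ht y hy => (ht y hy).of_le (by simp)),
    hasDerivAt_setIntegral_timeD hB (hs.mono fun t ht y hy =>
      (contDiffAt_timeD (ht y hy)).of_le (by simp))⟩

/-- The derivatives of a finite sum of integrals over compact sets. -/
theorem hasDerivAt_sum_setIntegral {T : Type*} [Fintype T] {G : T → ℝ × (α → ℝ) → ℝ}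
    {B : T → Set (α → ℝ)} (hB : ∀ t, IsCompact (B t))
    (hG : ∀ t, ∀ y ∈ B t, ∀ᶠ w in 𝓝 ((0 : ℝ), y), SmoothAt (G t) w) :
    HasDerivAt (fun s => ∑ t, ∫ y in B t, G t (s, y)) (∑ t, ∫ y in B t, timeD (G t) (0, y)) 0 ∧
    HasDerivAt (deriv fun s => ∑ t, ∫ y in B t, G t (s, y)) (∑ t, ∫ y in B t, timeD (timeD (G t)) (0, y)) 0 := by
  have h1 := eventually_all.2 fun t => eventually_hasDerivAt_setIntegral (hB t) (hG t)
  refine ⟨HasDerivAt.fun_sum fun t _ => (h1.self_of_nhds t).1, ?_⟩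
  refine (HasDerivAt.fun_sum fun t _ => (h1.self_of_nhds t).2).congr_of_eventuallyEq ?_
  filter_upwards [h1] with s hs
  exact (HasDerivAt.fun_sum fun t _ => (hs t).1).deriv

end CompactIntegrals

/-! ### Partitions of unity and the divergence theorem on a leaf. -/

section ChartCovers

open scoped Manifold

variable {N : ℕ}

/-- Finitely many flattening charts, with smooth functions that form a partition of unity near the
set `C`. -/
structure ChartCover (L : ℕ → Set (Amb N)) (I : Set ℕ) (C : Set (Amb N)) {T : Type} [Fintype T]
    (e : T → Chart N) (χ : T → Amb N → ℝ) : Prop where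
  flattens : ∀ t, Flattens L I (e t)
  smooth : ∀ t, ContDiff ℝ ∞ (χ t)
  subset : ∀ t, tsupport (χ t) ⊆ (e t).source
  nonneg : ∀ t x, 0 ≤ χ t x
  sum_eq : ∀ x ∈ C, ∀ᶠ z in 𝓝 x, ∑ t, χ t z = 1

theorem exists_chartCover {L : ℕ → Set (Amb N)} {I : Set ℕ} {C : Set (Amb N)} (hC : IsCompact C)
    {p : Chart N → Prop}
    (h : ∀ x ∈ C, ∃ e : Chart N, x ∈ e.source ∧ Flattens L I e ∧ p e) :
    ∃ (T : Type) (_ : Fintype T) (e : T → Chart N)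
      (χ : T → Amb N → ℝ), ChartCover L I C e χ ∧ ∀ t, p (e t) := by
  have : Nonempty (Chart N) := ⟨.refl _⟩
  choose! e hxe hfl hp using h
  have hr : ∀ x ∈ C, ∃ r > 0, Metric.closedBall x r ⊆ (e x).source := fun x hx =>
    Metric.nhds_basis_closedBall.mem_iff.1 ((e x).open_source.mem_nhds (hxe x hx))
  choose! r hr0 hr using hr
  obtain ⟨t, ht⟩ := hC.elim_nhds_subcover' (fun x _ => Metric.ball x (r x))
    fun x hx => Metric.ball_mem_nhds x (hr0 x hx)
  -- The partition is made on a larger compact set, so that its sum is `1` near every point of `C`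
  -- and not only at it; derivatives of the sum then vanish on `C`.
  obtain ⟨C', hC', hsub, hsub'⟩ := exists_compact_between hC
    (isOpen_iUnion fun x : t => Metric.isOpen_ball (x := x.1.1) (ε := r x.1.1)) (by
      intro x hx
      obtain ⟨y, hy, hxy⟩ := mem_iUnion₂.1 (ht hx)
      exact mem_iUnion.2 ⟨⟨y, hy⟩, hxy⟩)
  obtain ⟨f, hf⟩ := SmoothPartitionOfUnity.exists_isSubordinate 𝓘(ℝ, Amb N) hC'.isClosed
    (fun x : t => Metric.ball x.1.1 (r x.1.1)) (fun x => Metric.isOpen_ball) hsub'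
  refine ⟨t, inferInstance, fun x => e x.1.1, fun x => f x, ⟨fun x => hfl _ x.1.2, fun x => ?_,
    fun x => ?_, fun x z => f.nonneg x z, fun x hx => ?_⟩, fun x => hp _ x.1.2⟩
  · exact contMDiff_iff_contDiff.1 (f x).contMDiff
  · exact ((hf x).trans Metric.ball_subset_closedBall).trans (hr _ x.1.2)
  · filter_upwards [isOpen_interior.mem_nhds (hsub hx)] with z hz
    rw [← finsum_eq_sum_of_fintype]
    exact f.sum_eq_one (interior_subset hz)

variable {L : ℕ → Set (Amb N)} {I : Set ℕ} {j : ℕ} {C : Set (Amb N)}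

/-- The part of the parameter domain that corresponds to a subset. -/
def paramPiece (e : Chart N) (j : ℕ) (C : Set (Amb N)) : Set (Fin j → ℝ) := {y | y ∈ dom e j ∧ Ξ e j y ∈ C}

theorem paramPiece_subset (e : Chart N) : paramPiece e j C ⊆ dom e j := fun _ h => h.1

section

variable {e : Chart N}

theorem Flattens.image_paramPiece (h : Flattens L I e) (hj : j ∈ I) (hCL : C ⊆ L j)
    (hCe : C ⊆ e.source) : Ξ e j '' paramPiece e j C = C := by
  refine Subset.antisymm (image_subset_iff.2 fun y hy => hy.2) fun x hx => ?_
  have h1 := h.planeParam_head hj (hCe hx) (hCL hx)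
  exact ⟨_, ⟨h.head_mem hj (hCe hx) (hCL hx), by rwa [h1]⟩, h1⟩

theorem Flattens.isCompact_paramPiece (h : Flattens L I e) (hj : j ∈ I) (hjN : j ≤ N)
    (hC : IsCompact C) (hCL : C ⊆ L j) (hCe : C ⊆ e.source) : IsCompact (paramPiece e j C) := by
  have h1 : paramPiece e j C = (fun x => headCLM N j (e x)) '' C := by
    refine Subset.antisymm (fun y hy => ⟨_, hy.2, Flattens.headCoords_planeParam hjN hy.1⟩) ?_
    rintro _ ⟨x, hx, rfl⟩
    have h1 := h.planeParam_head hj (hCe hx) (hCL hx)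
    exact ⟨h.head_mem hj (hCe hx) (hCL hx), (congrArg (· ∈ C) h1).mpr hx⟩
  rw [h1]
  exact hC.image_of_continuousOn ((headCLM N j).continuous.comp_continuousOn (e.continuousOn.mono hCe))

variable {F : Amb N → Amb N} (h : Flattens L I e) (hjN : j ≤ N)
  (hF : ContDiff ℝ ∞ F) (hinj : Injective F)
  (himm : ∀ x, Injective (D F x))
include h hF

theorem Flattens.contDiffAt_deformed {y : Fin j → ℝ} (hy : y ∈ dom e j) : SmoothAt (fun y => F (Ξ e j y)) y :=
  hF.contDiffAt.comp y (h.contDiffAt_planeParam hy)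

theorem Flattens.continuousOn_sqrt_gramOf_deformed :
    ContinuousOn (fun y => √(gramOf (D (fun y => F (Ξ e j y)) y)).det) (dom e j) := by
  intro y hy
  refine (ContinuousAt.sqrt ?_).continuousWithinAt
  refine ContDiffAt.continuousAt (𝕜 := ℝ) (n := 0) (contDiffAt_matrix_det fun a b => ?_)
  have h1 := (h.contDiffAt_deformed hF hy).fderiv_right (m := 0) (by simp)
  exact (h1.clm_apply contDiffAt_const).inner ℝ (h1.clm_apply contDiffAt_const)

include hjN himm in
theorem Flattens.injective_fderiv_deformed {y : Fin j → ℝ} (hy : y ∈ dom e j) :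
    Injective (D (fun y => F (Ξ e j y)) y) := by
  have h1 := ((hF.differentiable (by simp)) (Ξ e j y)).hasFDerivAt.comp y
    (h.contDiffAt_planeParam hy).diffAt.hasFDerivAt
  rw [show D (fun y => F (Ξ e j y)) y = _ from h1.fderiv]
  exact (himm _).comp (h.injective_fderiv_planeParam hjN hy)

include hjN hinj himm in
/-- The area formula for images of compact pieces of a chart. -/
theorem Flattens.integral_image_piece (hj : j ∈ I) (hC : IsCompact C) (hCL : C ⊆ L j)
    (hCe : C ⊆ e.source) {r : Amb N → ℝ} (hr : ContinuousOn (fun x => r (F x)) C) :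
    IntegrableOn r (F '' C) μHE[j] ∧ ∫ x in F '' C, r x ∂μHE[j] =
      ∫ y in paramPiece e j C, √(gramOf (D (fun y => F (Ξ e j y)) y)).det * r (F (Ξ e j y)) := by
  have h1 : F '' C = (fun y => F (Ξ e j y)) '' paramPiece e j C := by
    conv_lhs => rw [← h.image_paramPiece hj hCL hCe, image_image]
  have hK := h.isCompact_paramPiece hj hjN hC hCL hCe
  have hd : ContDiffOn ℝ 1 (fun y => F (Ξ e j y)) (dom e j) := fun y hy =>
    ((h.contDiffAt_deformed hF hy).of_le (by simp)).contDiffWithinAt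
  have hi : InjOn (fun y => F (Ξ e j y)) (dom e j) := fun x hx y hy hxy =>
    Flattens.injOn_planeParam hjN hx hy (hinj hxy)
  have hm := fun y (hy : y ∈ dom e j) => h.injective_fderiv_deformed hjN hF himm hy
  rw [h1]
  refine ⟨?_, integral_image_eq_integral_gramOf (isOpen_dom e j) hd hi hm hK.measurableSet (paramPiece_subset e) r⟩
  rw [integrableOn_image_iff_integrableOn_gramOf (isOpen_dom e j) hd hi hm hK.measurableSet (paramPiece_subset e) r]
  refine ContinuousOn.integrableOn_compact hK (ContinuousOn.mul
    ((h.continuousOn_sqrt_gramOf_deformed hF).mono (paramPiece_subset e)) ?_)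
  exact hr.comp (h.contDiffOn_planeParam.continuousOn.mono (paramPiece_subset e)) fun y hy => hy.2

end

namespace ChartCover

variable {T : Type} [Fintype T] {e : T → Chart N} {χ : T → Amb N → ℝ}
  (h : ChartCover L I C e χ) (hj : j ∈ I) (hjN : j ≤ N) (hC : IsCompact C) (hCL : C ⊆ L j)
include h hj hjN hC hCL

omit h hj hjN hCL in
theorem isCompact_inter (t : T) : IsCompact (C ∩ tsupport (χ t)) := hC.inter_right (isClosed_tsupport _)

/-- Integrals over images of compact sets, by means of a partition of unity. -/
theorem integral_image_eq_sum {F : Amb N → Amb N} (hF : ContDiff ℝ ∞ F) (hinj : Injective F)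
    (himm : ∀ x, Injective (D F x)) {r : Amb N → ℝ}
    (hr : ContinuousOn (fun x => r (F x)) C) :
    IntegrableOn r (F '' C) μHE[j] ∧ ∫ x in F '' C, r x ∂μHE[j] =
      ∑ t, ∫ y in paramPiece (e t) j (C ∩ tsupport (χ t)), χ t (Ξ (e t) j y) *
        (√(gramOf (D (fun y => F (Ξ (e t) j y)) y)).det * r (F (Ξ (e t) j y))) := by
  -- The inverse of the deformation carries the cutoff functions along, so that the partition of
  -- unity stays attached to the undeformed set.
  set G := Function.invFun F
  have hG : ∀ x, G (F x) = x := Function.leftInverse_invFun hinj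
  have hm : MeasurableSet (F '' C) := (hC.image hF.continuous).measurableSet
  have key : ∀ t, _ := fun t => (h.flattens t).integral_image_piece hjN hF hinj himm hj
    (isCompact_inter hC t) (inter_subset_left.trans hCL) (inter_subset_right.trans (h.subset t))
    (r := fun x => χ t (G x) * r x) (by
      simp only [hG]
      exact (h.smooth t).continuous.continuousOn.mul (hr.mono inter_subset_left))
  have hsub : ∀ t, F '' (C ∩ tsupport (χ t)) ⊆ F '' C := fun t => image_mono inter_subset_left
  have hz : ∀ t, ∀ x ∈ F '' C \ F '' (C ∩ tsupport (χ t)), χ t (G x) * r x = 0 := by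
    rintro t _ ⟨⟨x, hx, rfl⟩, hx'⟩
    rw [hG, image_eq_zero_of_notMem_tsupport fun h => hx' ⟨x, ⟨hx, h⟩, rfl⟩, zero_mul]
  have hi : ∀ t, IntegrableOn (fun x => χ t (G x) * r x) (F '' C) μHE[j] := fun t =>
    (key t).1.of_forall_sdiff_eq_zero hm (hz t)
  have hs : ∀ x ∈ F '' C, r x = ∑ t, χ t (G x) * r x := by
    rintro _ ⟨x, hx, rfl⟩
    rw [← sum_mul, hG, (h.sum_eq x hx).self_of_nhds, one_mul]
  constructor
  · exact IntegrableOn.congr_fun (integrable_finsetSum _ fun t _ => hi t) (fun x hx => (hs x hx).symm) hm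
  · rw [setIntegral_congr_fun hm hs, integral_finsetSum _ fun t _ => hi t]
    refine sum_congr rfl fun t _ => ?_
    rw [setIntegral_eq_of_subset_of_forall_sdiff_eq_zero hm (hsub t) (hz t), (key t).2]
    refine integral_congr_ae (.of_forall fun y => ?_)
    simp only [hG]
    ring

omit h hj hjN hC hCL in
-- Both sides are tangential and have the same products with tangent vectors. The right side depends
-- on the chart and the left side does not, so local computations can be added up.
theorem pushforward_eq_starProjection {e : Chart N}
    (he : Flattens L I e) (hj : j ∈ I) {y : Fin j → ℝ} (hy : y ∈ dom e j) {w : Amb N}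
    {Y : Fin j → ℝ} (hwY : ∀ v, inner ℝ w (D (Ξ e j) y v) = formOf (γ e j y) Y v) :
    (tangentSpan (L j) (Ξ e j y)).starProjection w = D (Ξ e j) y Y := by
  have h1 := he.tangentSpan_eq hj hy
  refine Submodule.eq_starProjection_of_mem_of_inner_eq_zero ?_ fun v hv => ?_
  · rw [h1]; exact ⟨Y, rfl⟩
  · rw [h1] at hv
    obtain ⟨v, rfl⟩ := hv
    rw [inner_sub_left, sub_eq_zero]
    exact (hwY v).trans (Flattens.formOf_inducedMetric _ _ _ _)

omit hC hCL in
-- Integration by parts in one chart moves the derivative to the cutoff. There is no boundary term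
-- because the field vanishes outside `C` and the cutoff outside its support.
theorem integral_divergence_piece (hK : IsCompact (paramPiece (e t) j (C ∩ tsupport (χ t)))) {r : Amb N → ℝ} {Y : (Fin j → ℝ) → Fin j → ℝ}
    (hY0 : ∀ y ∈ dom (e t) j, Ξ (e t) j y ∉ C → Y y = 0)
    (hY : ∀ y ∈ dom (e t) j, ∀ a, ContDiffAt ℝ 1 (fun y =>
      √(γ (e t) j y).det * r (Ξ (e t) j y) * Y y a) y) :
    ∫ y in paramPiece (e t) j (C ∩ tsupport (χ t)), χ t (Ξ (e t) j y) *
      ∑ a, partialD a (fun y => √(γ (e t) j y).det * r (Ξ (e t) j y) * Y y a) y =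
    -∫ y in paramPiece (e t) j (C ∩ tsupport (χ t)), √(γ (e t) j y).det *
      (r (Ξ (e t) j y) * D (χ t) (Ξ (e t) j y) (D (Ξ (e t) j) y (Y y))) := by
  set K := paramPiece (e t) j (C ∩ tsupport (χ t)) with hKdef
  set Dv : Fin j → (Fin j → ℝ) → ℝ := fun a y => √(γ (e t) j y).det * r (Ξ (e t) j y) * Y y a with hD
  have hKU : K ⊆ dom (e t) j := paramPiece_subset _
  have hU := isOpen_dom (e t) j
  have hψ := fun y (hy : y ∈ dom (e t) j) => (h.flattens t).contDiffAt_planeParam hy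
  have hχ : ∀ y ∈ dom (e t) j, ContDiffAt ℝ 1 (fun y => χ t (Ξ (e t) j y)) y :=
    fun y hy => ((h.smooth t).contDiffAt.comp y (hψ y hy)).of_le (by simp)
  have h0 : ∀ a, ∀ y ∈ dom (e t) j \ K, χ t (Ξ (e t) j y) * Dv a y = 0 := by
    rintro a y ⟨hy, hyK⟩
    by_cases hyC : Ξ (e t) j y ∈ C
    · rw [image_eq_zero_of_notMem_tsupport fun h => hyK ⟨hy, hyC, h⟩, zero_mul]
    · simp only [hD, hY0 y hy hyC, Pi.zero_apply, mul_zero]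
  have h1 : ∀ a, ∫ y in K, partialD a (fun y => χ t (Ξ (e t) j y) * Dv a y) y = 0 := by
    intro a
    rw [← setIntegral_partialD_eq_zero hU hK hKU (fun y hy => (hχ y hy).mul (hY y hy a)) (h0 a) a]
    refine (setIntegral_eq_of_subset_of_forall_sdiff_eq_zero hU.measurableSet hKU ?_).symm
    intro y hy
    have : (fun y => χ t (Ξ (e t) j y) * Dv a y) =ᶠ[𝓝 y] fun _ => 0 := by
      filter_upwards [(hU.sdiff hK.isClosed).mem_nhds hy] with z hz using h0 a z hz
    rw [partialD_congr this, partialD_const]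
  have h2 : ∀ a, ∀ y ∈ K, partialD a (fun y => χ t (Ξ (e t) j y) * Dv a y) y = χ t (Ξ (e t) j y) * partialD a (Dv a) y +
        partialD a (fun y => χ t (Ξ (e t) j y)) y * Dv a y := fun a y hy => by
    rw [partialD_mul ((hχ y (hKU hy)).differentiableAt one_ne_zero) ((hY y (hKU hy) a).differentiableAt one_ne_zero)]
    ring
  have hc : ∀ {f : (Fin j → ℝ) → ℝ} (_ : ∀ y ∈ dom (e t) j, ContDiffAt ℝ 1 f y) (a : Fin j),
      ContinuousOn (partialD a f) K := fun hf a y hy =>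
    (((hf y (hKU hy)).fderiv_right (m := 0) (by simp)).clm_apply
      contDiffAt_const).continuousAt.continuousWithinAt
  have i1 : ∀ a, IntegrableOn (fun y => χ t (Ξ (e t) j y) * partialD a (Dv a) y) K :=
    fun a => ContinuousOn.integrableOn_compact hK (ContinuousOn.mul
      (fun y hy => (hχ y (hKU hy)).continuousAt.continuousWithinAt) (hc (fun y hy => hY y hy a) a))
  have i2 : ∀ a, IntegrableOn (fun y => partialD a (fun y => χ t (Ξ (e t) j y)) y * Dv a y) K :=
    fun a => ContinuousOn.integrableOn_compact hK (ContinuousOn.mul (hc hχ a)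
      (fun y hy => (hY y (hKU hy) a).continuousAt.continuousWithinAt))
  have h3 : ∀ a, ∫ y in K, χ t (Ξ (e t) j y) * partialD a (Dv a) y =
      -∫ y in K, partialD a (fun y => χ t (Ξ (e t) j y)) y * Dv a y := fun a => by
    rw [eq_neg_iff_add_eq_zero, ← integral_add (i1 a) (i2 a), ← h1 a]
    exact setIntegral_congr_fun hK.measurableSet fun y hy => (h2 a y hy).symm
  simp only [mul_sum]
  rw [integral_finsetSum _ fun a _ => i1 a]
  simp only [h3]
  rw [sum_neg_distrib, ← integral_finsetSum _ fun a _ => i2 a]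
  congr 1
  refine setIntegral_congr_fun hK.measurableSet fun y hy => ?_
  have hd := ((h.smooth t).differentiable (by simp) (Ξ (e t) j y)).hasFDerivAt.comp y
    (hψ y (hKU hy)).diffAt.hasFDerivAt
  have h4 : D (fun y => χ t (Ξ (e t) j y)) y = _ := hd.fderiv
  have h5 := fderiv_apply_eq_sum_partialD (fun y => χ t (Ξ (e t) j y)) y (Y y)
  rw [h4, ContinuousLinearMap.comp_apply] at h5
  simp only [h5, hD, mul_sum]
  exact sum_congr rfl fun a _ => by ring

/-- The divergence theorem on a submanifold, by means of a partition of unity. -/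
theorem sum_integral_divergence_eq_zero {w : Amb N → Amb N} (hw : ∀ x ∈ L j \ C, w x = 0)
    {r : Amb N → ℝ} {Y : T → (Fin j → ℝ) → Fin j → ℝ}
    (hY : ∀ t, ∀ y ∈ dom (e t) j, ∀ a, ContDiffAt ℝ 1 (fun y =>
      √(γ (e t) j y).det * r (Ξ (e t) j y) * Y t y a) y)
    (hwY : ∀ t, ∀ y ∈ dom (e t) j, ∀ v, inner ℝ (w (Ξ (e t) j y)) (D (Ξ (e t) j) y v) =
      formOf (γ (e t) j y) (Y t y) v) :
    ∑ t, ∫ y in paramPiece (e t) j (C ∩ tsupport (χ t)), χ t (Ξ (e t) j y) *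
      ∑ a, partialD a (fun y => √(γ (e t) j y).det * r (Ξ (e t) j y) * Y t y a) y = 0 := by
  have hK : ∀ t, IsCompact (paramPiece (e t) j (C ∩ tsupport (χ t))) := fun t =>
    (h.flattens t).isCompact_paramPiece hj hjN (isCompact_inter hC t)
      (inter_subset_left.trans hCL) (inter_subset_right.trans (h.subset t))
  have hY0 : ∀ t, ∀ y ∈ dom (e t) j, Ξ (e t) j y ∉ C → Y t y = 0 := by
    intro t y hy hyC
    refine eq_of_formOf_eq ((h.flattens t).isMetricAt hjN hy).posDef fun v => ?_
    rw [← hwY t y hy, hw _ ⟨(h.flattens t).planeParam_mem hj hy, hyC⟩, inner_zero_left, map_zero]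
    rfl
  -- The integrand left by integration by parts, written without coordinates: the derivative of the
  -- cutoff along the tangential part of `w`.
  set β : T → Amb N → ℝ := fun t x => r x * D (χ t) x ((tangentSpan (L j) x).starProjection (w x)) with hβ
  have hproj := fun t y (hy : y ∈ dom (e t) j) =>
    pushforward_eq_starProjection (h.flattens t) hj hy (hwY t y hy)
  have hβ0 : ∀ t, ∀ x ∈ C \ (C ∩ tsupport (χ t)), β t x = 0 := by
    intro t x hx
    have : D (χ t) x = 0 := by
      by_contra h'
      exact hx.2 ⟨hx.1, support_fderiv_subset ℝ h'⟩
    simp [hβ, this]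
  have key : ∀ t, IntegrableOn (β t) (C ∩ tsupport (χ t)) μHE[j] ∧
      ∫ x in C ∩ tsupport (χ t), β t x ∂μHE[j] = ∫ y in paramPiece (e t) j (C ∩ tsupport (χ t)),
        √(γ (e t) j y).det * β t (Ξ (e t) j y) := by
    intro t
    have hCe : C ∩ tsupport (χ t) ⊆ (e t).source := inter_subset_right.trans (h.subset t)
    have hCL' : C ∩ tsupport (χ t) ⊆ L j := inter_subset_left.trans hCL
    have hd : ContDiffOn ℝ 1 (Ξ (e t) j) (dom (e t) j) :=
      (h.flattens t).contDiffOn_planeParam.of_le (by simp)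
    have hm := fun y (hy : y ∈ dom (e t) j) =>
      (h.flattens t).injective_fderiv_planeParam hjN hy
    have hi := Flattens.injOn_planeParam (e := e t) hjN
    have him := (h.flattens t).image_paramPiece hj hCL' hCe
    refine ⟨?_, ?_⟩
    · rw [← him, integrableOn_image_iff_integrableOn_gramOf (isOpen_dom _ j) hd hi hm
        (hK t).measurableSet (paramPiece_subset _)]
      have hcont : ContinuousOn (fun y => ∑ a, partialD a (fun y => χ t (Ξ (e t) j y)) y *
          (√(γ (e t) j y).det * r (Ξ (e t) j y) * Y t y a))
          (paramPiece (e t) j (C ∩ tsupport (χ t))) := by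
        refine continuousOn_finsetSum _ fun a _ y hy => (ContinuousAt.mul ?_
          (hY t y hy.1 a).continuousAt).continuousWithinAt
        exact (contDiffAt_partialD ((h.smooth t).contDiffAt.comp y
          ((h.flattens t).contDiffAt_planeParam hy.1)) a).continuousAt
      refine (hcont.integrableOn_compact (hK t)).congr_fun (fun y hy => ?_) (hK t).measurableSet
      have hd := ((h.smooth t).differentiable (by simp) (Ξ (e t) j y)).hasFDerivAt.comp y
        ((h.flattens t).contDiffAt_planeParam hy.1).diffAt.hasFDerivAt
      have h4 : D (fun y => χ t (Ξ (e t) j y)) y = _ := hd.fderiv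
      have h5 := fderiv_apply_eq_sum_partialD (fun y => χ t (Ξ (e t) j y)) y (Y t y)
      rw [h4, ContinuousLinearMap.comp_apply] at h5
      simp only [hβ, hproj t y hy.1, h5, mul_sum]
      refine sum_congr rfl fun a _ => ?_
      change _ = √(γ (e t) j y).det * _
      ring
    · have := integral_image_eq_integral_gramOf (isOpen_dom _ j) hd hi hm
        (hK t).measurableSet (paramPiece_subset _) (β t)
      rw [him] at this
      exact this
  have h1 : ∀ t, ∫ y in paramPiece (e t) j (C ∩ tsupport (χ t)), χ t (Ξ (e t) j y) *
      ∑ a, partialD a (fun y => √(γ (e t) j y).det * r (Ξ (e t) j y) * Y t y a) y = -∫ x in C, β t x ∂μHE[j] := by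
    intro t
    rw [h.integral_divergence_piece hj hjN (hK t) (hY0 t) (hY t),
      setIntegral_eq_of_subset_of_forall_sdiff_eq_zero hC.measurableSet inter_subset_left (hβ0 t),
      (key t).2]
    congr 1
    refine setIntegral_congr_fun (hK t).measurableSet fun y hy => ?_
    simp only [hβ, hproj t y hy.1]
  simp only [h1]
  rw [sum_neg_distrib, ← integral_finsetSum _ fun t _ =>
    (key t).1.of_forall_sdiff_eq_zero hC.measurableSet (hβ0 t), neg_eq_zero]
  rw [← integral_zero (Amb N) ℝ (μ := μHE[j].restrict C)]
  refine setIntegral_congr_fun hC.measurableSet fun x hx => ?_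
  -- The cutoff functions have sum `1` near `x`, so their derivatives add up to zero.
  have h2 : D (fun z => ∑ t, χ t z) x = 0 := by
    rw [(show (fun z => ∑ t, χ t z) =ᶠ[𝓝 x] fun _ => 1 from h.sum_eq x hx).fderiv_eq]
    simp
  rw [fderiv_fun_sum fun t _ => (h.smooth t).differentiable (by simp) x] at h2
  simp only [hβ, ← mul_sum]
  rw [← sum_apply, h2]
  simp

end ChartCover

end ChartCovers

/-! ### Variation of weighted volume through warped products. -/

section WarpedVariation

variable {ι κ P : Type} [Fintype ι] [DecidableEq ι] [Fintype κ] [DecidableEq κ] [Fintype P]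
  [DecidableEq P] {h : (ι → ℝ) → Matrix ι ι ℝ} {U : P → (ι → ℝ) → ℝ} {emb : κ → ι} {s₀ : ι}
  {Q : ℝ × (κ → ℝ) → ι → ℝ} {f : (κ → ℝ) → ℝ}

/-- The product of a family of maps with the identity of the fibre. -/
def liftVar (Q : ℝ × (κ → ℝ) → ι → ℝ) (w : ℝ × ((κ ⊕ P) → ℝ)) : (ι ⊕ P) → ℝ :=
  Sum.elim (Q (w.1, base w.2)) fun p => w.2 (inr p)

theorem contDiffAt_liftVar {w : ℝ × ((κ ⊕ P) → ℝ)} {n : WithTop ℕ∞}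
    (hQ : ContDiffAt ℝ n Q (w.1, base w.2)) : ContDiffAt ℝ n (liftVar Q) w := by
  have h1 : ContDiffAt ℝ n (fun w : ℝ × ((κ ⊕ P) → ℝ) => (w.1, (base w.2 : κ → ℝ))) w :=
    contDiffAt_fst.prodMk (base.contDiff.contDiffAt.comp w contDiffAt_snd)
  rw [contDiffAt_pi]
  rintro (i | p)
  · exact contDiffAt_pi.1 (hQ.comp (g := Q) w h1) i
  · exact ((ContinuousLinearMap.proj (R := ℝ) (φ := fun _ : κ ⊕ P => ℝ) (inr p)).comp
      (ContinuousLinearMap.snd ℝ ℝ ((κ ⊕ P) → ℝ))).contDiff.contDiffAt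

theorem fderiv_liftVar {w : ℝ × ((κ ⊕ P) → ℝ)} (hQ : ContDiffAt ℝ 1 Q (w.1, base w.2))
    (s : ℝ) (v : (κ ⊕ P) → ℝ) : D (liftVar Q) w (s, v) =
      Sum.elim (D Q (w.1, base w.2) (s, base v)) fun p => v (inr p) := by
  have hd := ((contDiffAt_liftVar hQ).differentiableAt one_ne_zero).hasFDerivAt
  have h1 := (hQ.differentiableAt one_ne_zero).hasFDerivAt.comp w
    ((hasFDerivAt_fst (𝕜 := ℝ)).prodMk ((base (ι := κ) (P := P)).hasFDerivAt.comp w hasFDerivAt_snd))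
  ext i
  have h2 := hasFDerivAt_pi'.1 hd i
  rcases i with i | p
  · exact DFunLike.congr_fun (h2.unique (hasFDerivAt_pi'.1 h1 i)) (s, v)
  · exact DFunLike.congr_fun (h2.unique ((ContinuousLinearMap.proj (R := ℝ) (φ := fun _ : κ ⊕ P => ℝ)
      (inr p)).comp (ContinuousLinearMap.snd ℝ ℝ ((κ ⊕ P) → ℝ))).hasFDerivAt) (s, v)

theorem timeD_liftVar {w : ℝ × ((κ ⊕ P) → ℝ)} (hQ : ContDiffAt ℝ 1 Q (w.1, base w.2)) :
    timeD (liftVar Q) w = Sum.elim (timeD Q (w.1, base w.2)) 0 := by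
  rw [timeD, fderiv_liftVar hQ, map_zero]; rfl

theorem spaceD_liftVar {w : ℝ × ((κ ⊕ P) → ℝ)} (hQ : ContDiffAt ℝ 1 Q (w.1, base w.2))
    (v : (κ ⊕ P) → ℝ) : spaceD v (liftVar Q) w = Sum.elim (spaceD (base v) Q (w.1, base w.2)) fun p => v (inr p) :=
  fderiv_liftVar hQ 0 v

theorem tendsto_slice (s : ℝ) (z : (κ ⊕ P) → ℝ) : Tendsto (fun w : ℝ × ((κ ⊕ P) → ℝ) =>
    (w.1, (base w.2 : κ → ℝ))) (𝓝 (s, z)) (𝓝 (s, base z)) :=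
  (continuous_fst.prodMk (base.continuous.comp continuous_snd)).tendsto (s, z)

theorem timeD_timeD_liftVar {z : (κ ⊕ P) → ℝ}
    (hQ : ∀ᶠ w in 𝓝 ((0 : ℝ), (base z : κ → ℝ)), SmoothAt Q w) :
    timeD (timeD (liftVar Q)) (0, z) = Sum.elim (timeD (timeD Q) (0, base z)) 0 := by
  have h0 : SmoothAt (liftVar (P := P) Q) (0, z) := contDiffAt_liftVar (w := (0, z)) hQ.self_of_nhds
  have h1 := hasDerivAt_timeD ((contDiffAt_timeD h0).diffAt)
  have h2 := hasDerivAt_timeD ((contDiffAt_timeD hQ.self_of_nhds).diffAt)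
  have h3 : (fun t => timeD (liftVar (P := P) Q) (t, z)) =ᶠ[𝓝 0] fun t => Sum.elim (timeD Q (t, base z)) 0 := by
    have hc : Tendsto (fun t : ℝ => (t, z)) (𝓝 0) (𝓝 (0, z)) := by
      have : Continuous fun t : ℝ => (t, z) := by fun_prop
      exact this.tendsto 0
    filter_upwards [hc.eventually ((tendsto_slice 0 z).eventually hQ)] with t ht
    exact timeD_liftVar (w := (t, z)) (ht.of_le (by simp))
  refine (h1.congr_of_eventuallyEq h3.symm).unique (hasDerivAt_pi.2 ?_)
  rintro (i | p)
  · exact hasDerivAt_pi.1 h2 i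
  · exact hasDerivAt_const _ _

theorem IsVariationAt.lift {z : (κ ⊕ P) → ℝ} (H : IsHyperplane emb s₀)
    (hQ : IsVariationAt emb s₀ (base z) Q f) :
    IsVariationAt (Sum.map emb id) (inl s₀) z (liftVar Q) fun z => f (base z) := by
  have H' := isHyperplane_sumMap (P := P) H
  have hb : Tendsto (base (ι := κ) (P := P)) (𝓝 z) (𝓝 (base z)) :=
    base.continuous.tendsto z
  have hz : Tendsto (fun x : κ → ℝ => ((0 : ℝ), x)) (𝓝 (base z)) (𝓝 (0, base z)) := by
    have : Continuous fun x : κ → ℝ => ((0 : ℝ), x) := by fun_prop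
    exact this.tendsto _
  refine ⟨?_, ?_, ?_⟩
  · filter_upwards [(tendsto_slice 0 z).eventually hQ.smooth_near] with w hw using contDiffAt_liftVar hw
  · filter_upwards [hb.eventually hQ.zero] with x hx
    ext b
    rcases b with b | p
    · change Q (0, base x) b = _
      rw [hx, ← base_incl H x]; rfl
    · exact (incl_emb H' x (inr p)).symm
  · filter_upwards [hb.eventually hQ.velocity, hb.eventually (hz.eventually hQ.smooth_near)] with x hx hx'
    rw [timeD_liftVar (w := (0, x)) (hx'.of_le (by simp))]
    ext b
    rcases b with b | p
    · change timeD Q (0, base x) b = _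
      rw [hx]
      simp [Pi.single_apply]
    · simp

theorem pullGram_liftVar {z : (κ ⊕ P) → ℝ} {s : ℝ} (hQ : ContDiffAt ℝ 1 Q (s, base z)) :
    pullGram (blockOf h U) (liftVar Q) z s = fromBlocks (pullGram h Q (base z) s) 0 0
      (diagonal fun p => U p (Q (s, base z)) ^ 2) := by
  have e : ∀ v : (κ ⊕ P) → ℝ, spaceD v (liftVar (P := P) Q) (s, z) = _ :=
    spaceD_liftVar (w := (s, z)) hQ
  have b1 : ∀ a : κ, (base (single (inl a) 1 : (κ ⊕ P) → ℝ)) = single a 1 := fun a => by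
    ext b; simp [Pi.single_apply]
  have b2 : ∀ p : P, (base (single (inr p) 1 : (κ ⊕ P) → ℝ)) = (0 : κ → ℝ) := fun a => by
    ext b; simp []
  have b3 : ∀ (v : ι → ℝ) (t : P → ℝ), (base (Sum.elim v t) : ι → ℝ) = v := fun v t => rfl
  have b4 : (base (liftVar (P := P) Q (s, z)) : ι → ℝ) = Q (s, base z) := rfl
  have b5 : spaceD (0 : κ → ℝ) Q (s, base z) = 0 := by
    rw [spaceD, show ((0 : ℝ), (0 : κ → ℝ)) = 0 from rfl, map_zero]
  ext a b
  simp only [pullGram, of_apply, e, formOf_blockOf, b3, b4, Sum.elim_inr]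
  rcases a with a | p <;> rcases b with b | q
  · simp [b1]
  · simp [b1, b2, b5]
  · simp [b1, b2, b5]
  · simp only [b2, b5, Pi.single_apply, diagonal_apply, Sum.inr.injEq, map_zero, zero_add,
      fromBlocks_apply₂₂, mul_ite, mul_one, mul_zero, sum_ite_eq', Finset.mem_univ, if_true]
    split_ifs with h1 h2 h2
    exacts [by rw [h1], absurd h1.symm h2, absurd h2.symm h1, rfl]

/-- The fibres contribute the product of the weights to the volume density. So the weighted density
of a family is the unweighted density of its lift to the warped product. -/
theorem sqrt_det_pullGram_liftVar {z : (κ ⊕ P) → ℝ} {s : ℝ} (hQ : ContDiffAt ℝ 1 Q (s, base z))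
    (hU : ∀ p, 0 ≤ U p (Q (s, base z))) :
    √(pullGram (blockOf h U) (liftVar Q) z s).det = √(pullGram h Q (base z) s).det * ∏ p, U p (Q (s, base z)) := by
  rw [pullGram_liftVar hQ, Matrix.det_fromBlocks_zero₂₁, Matrix.det_diagonal, Finset.prod_pow,
    Real.sqrt_mul' _ (sq_nonneg _), Real.sqrt_sq (Finset.prod_nonneg fun p _ => hU p)]

theorem sqrt_det_blockOf {z : (ι ⊕ P) → ℝ} (hU : ∀ p, 0 ≤ U p (base z)) :
    √(blockOf h U z).det = √(h (base z)).det * ∏ p, U p (base z) := by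
  rw [det_blockOf, Finset.prod_pow, Real.sqrt_mul' _ (sq_nonneg _), Real.sqrt_sq (Finset.prod_nonneg fun p _ => hU p)]

theorem gradInner_blockOf {z : (ι ⊕ P) → ℝ} (hm : IsMetricAt h (base z))
    (hU : IsWeightAt U (base z)) (f f' : (ι → ℝ) → ℝ) :
    gradInner (blockOf h U) (fun x => f (base x)) (fun x => f' (base x)) z = gradInner h f f' (base z) := by
  simp only [gradInner, gradOf, (blockOf_eventuallyEq_warpOf hU).self_of_nhds,
    warpOf_inv hm.posDef.det_pos.ne', Fintype.sum_sum_type, partialD_inl_comp_base,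
    partialD_inr_comp_base, fromBlocks_apply₁₁, zero_mul, mul_zero,
    sum_const_zero, add_zero]

namespace IsFermiAt

variable {y : κ → ℝ} (hf : IsFermiAt h emb s₀ y) (hU : IsWeightAt U (incl emb y))
  (hQ : IsVariationAt emb s₀ y Q f)
include hf hU hQ

theorem weight_near : ∀ᶠ s in 𝓝 (0 : ℝ), √(pullGram (blockOf h U) (liftVar Q) (Sum.elim y 0) s).det =
      √(pullGram h Q y s).det * ∏ p, U p (Q (s, y)) := by
  have hQ0 := hQ.smooth_near.self_of_nhds
  have hc : Tendsto (fun s : ℝ => (s, y)) (𝓝 0) (𝓝 (0, y)) := by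
    have : Continuous fun s : ℝ => (s, y) := by fun_prop
    exact this.tendsto 0
  have hU' : ∀ᶠ x in 𝓝 (Q (0, y)), ∀ p, SmoothAt (U p) x ∧ 0 < U p x := by
    rw [hQ.zero.self_of_nhds]; exact hU
  filter_upwards [hc.eventually hQ.smooth_near, hc.eventually (hQ0.continuousAt.eventually hU')] with s h1 h2
  exact sqrt_det_pullGram_liftVar (z := Sum.elim y 0) (h1.of_le (by simp)) fun p => (h2 p).2.le

/-- The first variation of the weighted volume density. -/
theorem hasDerivAt_weighted_density : HasDerivAt (fun s => √(pullGram h Q y s).det * ∏ p, U p (Q (s, y)))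
      (1 / 2 * (√(restr h emb y).det * ∏ p, U p (incl emb y)) *
        (f y * ((restr (blockOf h U) (Sum.map emb id) (Sum.elim y 0))⁻¹ *
          nDeriv (blockOf h U) (Sum.map emb id) (inl s₀) (Sum.elim y 0)).trace)) 0 := by
  have hf' := isFermiAt_blockOf (P := P) (x := Sum.elim y 0) hf hU
  have hQ' := IsVariationAt.lift (P := P) (z := Sum.elim y 0) hf.hyper hQ
  refine ((hf'.hasDerivAt_sqrt_det_pullGram hQ').congr_of_eventuallyEq
    (EventuallyEq.symm (hf.weight_near hU hQ))).congr_deriv ?_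
  rw [restr_blockOf hf.hyper, sqrt_det_blockOf fun p => (hU.self_of_nhds p).2.le]
  rfl

/-- The second variation of the weighted volume density. -/
theorem hasDerivAt_deriv_weighted_density
    (h0 : ((restr (blockOf h U) (Sum.map emb id) (Sum.elim y 0))⁻¹ *
          nDeriv (blockOf h U) (Sum.map emb id) (inl s₀) (Sum.elim y 0)).trace = 0) :
    HasDerivAt (deriv fun s => √(pullGram h Q y s).det * ∏ p, U p (Q (s, y)))
      (√(restr h emb y).det * (∏ p, U p (incl emb y)) * (gradInner (restr h emb) f f y - 1 / 2 *
        (scalarCurvature (blockOf h U) (incl (Sum.map emb id) (Sum.elim y 0))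
          - scalarCurvature (blockOf (restr h emb) fun p y => U p (incl emb y)) (Sum.elim y 0)
          + secondFundNormSq (blockOf h U) (Sum.map emb id) (single (inl s₀) 1)
            (incl (Sum.map emb id) (Sum.elim y 0))) * f y ^ 2)
        + ∑ c, partialD c (fun x => √(restr h emb x).det * (∏ p, U p (incl emb x)) *
            timeD (timeD Q) (0, x) (emb c)) y) 0 := by
  have hf' := isFermiAt_blockOf (P := P) (x := Sum.elim y 0) hf hU
  have hQ' := IsVariationAt.lift (P := P) (z := Sum.elim y 0) hf.hyper hQ
  have hUy : IsWeightAt (fun p y => U p (incl emb y)) y := by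
    have hc : ContinuousAt (incl emb) y := (incl emb).continuous.continuousAt
    filter_upwards [hc.eventually hU] with x hx p
    exact ⟨(hx p).1.comp x (incl emb).contDiff.contDiffAt, (hx p).2⟩
  refine ((hf'.hasDerivAt_deriv_sqrt_det_pullGram hQ' h0).congr_of_eventuallyEq
    (EventuallyEq.deriv (EventuallyEq.symm (hf.weight_near hU hQ)))).congr_deriv ?_
  rw [restr_blockOf hf.hyper]
  congr 1
  · congr 1
    · exact sqrt_det_blockOf fun p => (hU.self_of_nhds p).2.le
    · congr 1
      exact gradInner_blockOf (z := Sum.elim y 0) hf.hyper_metric hUy f f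
  · rw [Fintype.sum_sum_type]
    have hb : Tendsto (base (ι := κ) (P := P)) (𝓝 (Sum.elim y 0)) (𝓝 y) :=
      base.continuous.tendsto (Sum.elim y 0)
    have hz : Tendsto (fun x : κ → ℝ => ((0 : ℝ), x)) (𝓝 y) (𝓝 (0, y)) := by
      have : Continuous fun x : κ → ℝ => ((0 : ℝ), x) := by fun_prop
      exact this.tendsto _
    have e1 : ∀ᶠ x in 𝓝 (Sum.elim y 0 : (κ ⊕ P) → ℝ), √(blockOf (restr h emb)
        (fun p y => U p (incl emb y)) x).det = √(restr h emb (base x)).det * (∏ p, U p (incl emb (base x))) ∧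
        timeD (timeD (liftVar Q)) (0, x) = Sum.elim (timeD (timeD Q) (0, base x)) 0 := by
      filter_upwards [hb.eventually hUy,
        hb.eventually (hz.eventually hQ.smooth_near.eventually_nhds)] with x h1 h2
      exact ⟨sqrt_det_blockOf fun p => (h1 p).2.le, timeD_timeD_liftVar h2⟩
    -- The lifted family does not move along the fibres, so the divergence has base directions only.
    have e2 : ∀ p : P, partialD (inr p) (fun x => √(blockOf (restr h emb) (fun p y => U p (incl emb y)) x).det *
        timeD (timeD (liftVar Q)) (0, x) (Sum.map emb id (inr p))) (Sum.elim y 0) = 0 := fun p => by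
      refine (partialD_congr (f' := fun _ => 0) (e1.mono fun x hx => ?_) _).trans (partialD_const _ _ _)
      simp [hx.2]
    simp only [e2, sum_const_zero, add_zero]
    refine sum_congr rfl fun c _ => ?_
    refine (partialD_congr (f' := fun x => (fun x => √(restr h emb x).det *
      (∏ p, U p (incl emb x)) * timeD (timeD Q) (0, x) (emb c)) (base x))
      (e1.mono fun x hx => ?_) _).trans (partialD_inl_comp_base (fun x =>
        √(restr h emb x).det * (∏ p, U p (incl emb x)) * timeD (timeD Q) (0, x) (emb c)) _ _)
    simp only [hx.1, hx.2, Sum.map_inl, Sum.elim_inl]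

end IsFermiAt

end WarpedVariation

/-! ### Deformations in charts. -/

section ChartFlows

variable {N n k : ℕ} {S : Slicing N n} {Ω : Set (Amb N)}

/-- A deformation, in the coordinates of a chart. -/
def chartFlow (e : Chart N) (j : ℕ) (F : ℝ → Amb N → Amb N)
    (w : ℝ × (Fin j → ℝ)) : Fin (j + 1) → ℝ :=
  headCoords (j + 1) (e (F w.1 (Ξ e j w.2)))

/-- The domain on which a deformation stays in the chart. -/
def flowDomain (e : Chart N) (j : ℕ) (F : ℝ → Amb N → Amb N) :
    Set (ℝ × (Fin j → ℝ)) := {w | w.2 ∈ dom e j ∧ F w.1 (Ξ e j w.2) ∈ e.source}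

namespace Slicing

/-- The weighted volume density of a deformation. -/
def flowDensity (S : Slicing N n) (e : Chart N) (j : ℕ)
    (F : ℝ → Amb N → Amb N) (w : ℝ × (Fin j → ℝ)) : ℝ :=
  √(gramOf (D (fun y => F w.1 (Ξ e j y)) w.2)).det * S.rho (j + 1) (F w.1 (Ξ e j w.2))

namespace IsDeformation

variable {j : ℕ} {F : ℝ → Amb N → Amb N} {K : Set (Amb N)} (dF : S.IsDeformation Ω j F K)
include dF

theorem contDiff (s : ℝ) : ContDiff ℝ ∞ (F s) := dF.smooth.comp (contDiff_const.prodMk contDiff_id)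

theorem mem_leaf (s : ℝ) {x : Amb N} : F s x ∈ S.leaf (j + 1) ↔ x ∈ S.leaf (j + 1) := by
  conv_lhs => rw [← dF.preserves s]
  exact (dF.bij s).1.mem_set_image

/-- A bijection that is the identity outside `K` permutes `K`. -/
theorem image_eq (s : ℝ) : F s '' K = K := by
  have h1 : F s '' Kᶜ = Kᶜ := (image_congr fun x hx => dF.off s x hx).trans (image_id' _)
  rw [image_compl_eq (dF.bij s)] at h1
  exact compl_injective h1

theorem injective_fderiv (s : ℝ) (x : Amb N) : Injective (D (F s) x) :=
  (dF.bij_fderiv s x).1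

variable {L : ℕ → Set (Amb N)} {I : Set ℕ} {e : Chart N}

theorem contDiffAt_family (he : Flattens L I e) {w : ℝ × (Fin j → ℝ)} (hw : w.2 ∈ dom e j) :
    SmoothAt (fun w : ℝ × (Fin j → ℝ) => F w.1 (Ξ e j w.2)) w :=
  ContDiffAt.comp (g := fun p : ℝ × Amb N => F p.1 p.2) (f := fun w : ℝ × (Fin j → ℝ) =>
    (w.1, Ξ e j w.2)) w dF.smooth.contDiffAt
    (contDiffAt_fst.prodMk ((he.contDiffAt_planeParam hw).comp w contDiffAt_snd))

theorem isOpen_flowDomain (he : Flattens L I e) : IsOpen (flowDomain e j F) := by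
  have h1 : IsOpen {w : ℝ × (Fin j → ℝ) | w.2 ∈ dom e j} :=
    (isOpen_dom e j).preimage continuous_snd
  exact ContinuousOn.isOpen_inter_preimage (fun w hw =>
    (dF.contDiffAt_family he hw).continuousAt.continuousWithinAt) h1 e.open_source

theorem zero_mem_flowDomain {y : Fin j → ℝ} (hy : y ∈ dom e j) :
    ((0 : ℝ), y) ∈ flowDomain e j F :=
  ⟨hy, by rw [dF.zero]; exact Flattens.planeParam_mem_source hy⟩

theorem contDiffAt_chartFlow (he : Flattens L I e) {w : ℝ × (Fin j → ℝ)} (hw : w ∈ flowDomain e j F) :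
    SmoothAt (chartFlow e j F) w :=
  (headCLM N (j + 1)).contDiff.contDiffAt.comp w
    (ContDiffAt.comp (g := e) w (he.contDiffAt hw.2) (dF.contDiffAt_family he hw.1))

end IsDeformation

namespace IsMinimal

variable (hS : S.IsMinimal Ω k)
include hS

theorem contDiffOn_rho {j : ℕ} (hj : k ≤ j) : ContDiffOn ℝ ∞ (S.rho j) (S.reg j) := by
  refine contDiffOn_prod fun p hp => ?_
  have hp' := Finset.mem_Icc.1 hp
  exact (hS.contDiffOn_u ⟨hj.trans hp'.1, hp'.2⟩).mono (hS.reg_mono hj hp'.1 hp'.2)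

theorem rho_pos {j : ℕ} (hj : k ≤ j) {x : Amb N} (hx : x ∈ S.reg j) : 0 < S.rho j x :=
  Finset.prod_pos fun p hp => by
    have hp' := Finset.mem_Icc.1 hp
    exact hS.u_pos ⟨hj.trans hp'.1, hp'.2⟩ (hS.reg_mono hj hp'.1 hp'.2 hx)

theorem rho_eq_prod {j : ℕ} (hj : j ∈ Icc k n) {x : Amb N} (hx : x ∈ S.reg j) :
    S.rho j x = ∏ p : Finset.Ico j n, S.u p.1 x := by
  have hn : S.u n x = 1 := hS.u_top x (hS.reg_mono hj.1 hj.2 le_rfl hx).1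
  rw [rho, Finset.prod_coe_sort (Finset.Ico j n) fun p => S.u p x, ← Finset.Ico_insert_right hj.2,
    Finset.prod_insert (by simp), hn, one_mul]

variable {j : ℕ} (hj : j ∈ Ico k n) {e : Chart N}
  (he : Flattens S.leaf (Icc j n) e) {F : ℝ → Amb N → Amb N} {K : Set (Amb N)}
  (dF : S.IsDeformation Ω j F K)
include hj he dF

theorem flow_mem_reg {w : ℝ × (Fin j → ℝ)} (hw : w ∈ flowDomain e j F) : F w.1 (Ξ e j w.2) ∈ S.reg (j + 1) :=
  mem_reg_of_flattens he j.le_succ hw.2 ((dF.mem_leaf w.1).2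
    (hS.nested j hj (he.planeParam_mem ⟨le_rfl, hj.2.le⟩ hw.1)))

theorem chartFlow_spec {w : ℝ × (Fin j → ℝ)} (hw : w ∈ flowDomain e j F) : chartFlow e j F w ∈ dom e (j + 1) ∧
      Ξ e (j + 1) (chartFlow e j F w) = F w.1 (Ξ e j w.2) :=
  ⟨he.head_mem ⟨j.le_succ, hj.2⟩ hw.2 (hS.flow_mem_reg hj he dF hw).1,
    he.planeParam_head ⟨j.le_succ, hj.2⟩ hw.2 (hS.flow_mem_reg hj he dF hw).1⟩

theorem contDiffAt_flowDensity {w : ℝ × (Fin j → ℝ)} (hw : w ∈ flowDomain e j F) :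
    SmoothAt (S.flowDensity e j F) w := by
  have hjN : j ≤ N := hj.2.le.trans hS.dim_le
  have hO := dF.isOpen_flowDomain he
  refine ContDiffAt.mul (ContDiffAt.sqrt (contDiffAt_matrix_det fun a b => ?_) ?_) ?_
  · have h1 := fun a => contDiffAt_spaceD (dF.contDiffAt_family he hw.1) (single a (1 : ℝ))
    refine ((h1 a).inner ℝ (h1 b)).congr_of_eventuallyEq ?_
    filter_upwards [hO.mem_nhds hw] with z hz
    have h2 := fun a => fderiv_slice (s := z.1) (y := z.2) ((dF.contDiffAt_family he hz.1).diffAt) (single a (1 : ℝ))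
    simp only [gramOf, of_apply]
    exact congrArg₂ _ (h2 a) (h2 b)
  · exact (gramOf_posDef _ (he.injective_fderiv_deformed hjN (dF.contDiff w.1)
      (dF.injective_fderiv w.1) hw.1)).det_pos.ne'
  · exact ((hS.contDiffOn_rho (hj.1.trans j.le_succ)).comp (fun z hz =>
      (dF.contDiffAt_family he hz.1).contDiffWithinAt)
      fun z hz => hS.flow_mem_reg hj he dF hz).contDiffAt (hO.mem_nhds hw)

/-- The deformation preserves `Σ_{j+1}`, so within the chart it factors through the parametrization
of that leaf, and its Gram matrix is the pull-back of the induced metric of `Σ_{j+1}`. -/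
theorem flowDensity_eq {s : ℝ} {y : Fin j → ℝ} (hw : (s, y) ∈ flowDomain e j F) : S.flowDensity e j F (s, y) =
      √(pullGram (γ e (j + 1)) (chartFlow e j F) y s).det *
        ∏ p : Finset.Ico (j + 1) n, S.u p.1 (Ξ e (j + 1) (chartFlow e j F (s, y))) := by
  have hO := dF.isOpen_flowDomain he
  obtain ⟨h1, h2⟩ := hS.chartFlow_spec hj he dF hw
  rw [flowDensity, hS.rho_eq_prod ⟨hj.1.trans j.le_succ, hj.2⟩ (hS.flow_mem_reg hj he dF hw), h2]
  congr 3
  have hq := (dF.contDiffAt_chartFlow he hw).diffAt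
  have hq' : HasFDerivAt (fun x => chartFlow e j F (s, x)) _ y :=
    hq.hasFDerivAt.comp y ((hasFDerivAt_const s y).prodMk (hasFDerivAt_id y))
  have hd := (he.contDiffAt_planeParam h1).diffAt.hasFDerivAt.comp y hq'
  have heq : (fun x => F s (Ξ e j x)) =ᶠ[𝓝 y] Ξ e (j + 1) ∘ fun x => chartFlow e j F (s, x) := by
    have : Tendsto (fun x : Fin j → ℝ => (s, x)) (𝓝 y) (𝓝 (s, y)) :=
      (by fun_prop : Continuous fun x : Fin j → ℝ => (s, x)).tendsto y
    filter_upwards [this.eventually (hO.mem_nhds hw)] with x hx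
    exact (hS.chartFlow_spec hj he dF (w := (s, x)) hx).2.symm
  ext a b
  rw [pullGram, of_apply, Flattens.formOf_inducedMetric, ← fderiv_slice hq, ← fderiv_slice hq,
    hq'.fderiv, gramOf, of_apply]
  change inner ℝ (D (fun x => F s (Ξ e j x)) y _) (D (fun x => F s (Ξ e j x)) y _) = _
  rw [heq.fderiv_eq, hd.fderiv]
  rfl

/-- In a Fermi chart `ν` is the field `∂_s`, so the velocity `φ ν` has coordinates `φ ∂_s`. -/
theorem isVariationAt_chartFlow (hF : IsFermiChart (S.nu j) j e) {φ : Amb N → ℝ}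
    (hφ : ∀ x ∈ S.reg j, deriv (fun s => F s x) 0 = φ x • S.nu j x) {y : Fin j → ℝ}
    (hy : y ∈ dom e j) : IsVariationAt castSucc (last j) y (chartFlow e j F) fun y => φ (Ξ e j y) := by
  have hjI : j ∈ Icc j n := ⟨le_rfl, hj.2.le⟩
  have hjN : j + 1 ≤ N := hj.2.trans_le hS.dim_le
  have hU := dom_mem_nhds hy
  have hn : ∀ x ∈ dom e j, D e (Ξ e j x) (S.nu j (Ξ e j x)) = padCoords (j + 1) (single (last j) 1) := fun x hx => by
    have := he.fderiv_apply_fderiv_planeParam (incl_mem_dom.2 hx) (single (last j) 1)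
    rwa [hF.velocity x hx, planeParam_incl] at this
  refine ⟨?_, ?_, ?_⟩
  · filter_upwards [(dF.isOpen_flowDomain he).mem_nhds (dF.zero_mem_flowDomain hy)] with w hw using
      dF.contDiffAt_chartFlow he hw
  · filter_upwards [hU] with x hx
    rw [chartFlow, dF.zero, Flattens.apply_planeParam hx, ← padCoords_incl, headCoords_padCoords hjN]
  · filter_upwards [hU] with x hx
    have h0 := dF.zero_mem_flowDomain hx
    have h1 := hasDerivAt_timeD ((dF.contDiffAt_chartFlow he h0).diffAt)
    have h2 := hasDerivAt_timeD ((dF.contDiffAt_family he (w := ((0 : ℝ), x)) hx).diffAt)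
    have h3 : timeD (fun w : ℝ × (Fin j → ℝ) => F w.1 (Ξ e j w.2)) (0, x) = φ (Ξ e j x) • S.nu j (Ξ e j x) :=
      h2.deriv.symm.trans (hφ _ (planeParam_mem_reg he hjI hx))
    have h4 : HasFDerivAt e (D e (Ξ e j x)) (F 0 (Ξ e j x)) := by
      rw [dF.zero]
      exact (he.contDiffAt (Flattens.planeParam_mem_source hx)).diffAt.hasFDerivAt
    have h5 := (headCLM N (j + 1)).hasFDerivAt.comp_hasDerivAt (0 : ℝ)
      (h4.comp_hasDerivAt (f := fun s => F s (Ξ e j x)) (0 : ℝ) h2)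
    refine (h1.unique h5).trans ?_
    rw [h3, map_smul, map_smul, hn x hx, coe_headCLM, headCoords_padCoords hjN]

end IsMinimal

end Slicing

end ChartFlows

/-! ### The local second variation formula. -/

section SecondVariation

variable {N n k : ℕ} {S : Slicing N n} {Ω : Set (Amb N)}

namespace Slicing

/-- The mean curvature of the warped product over `Σ_j`, in a Fermi chart. -/
def meanTrace (S : Slicing N n) (e : Chart N) (j : ℕ) (y : Fin j → ℝ) : ℝ :=
  ((restr (S.warpedMetric e (j + 1) (j + 1)) (Sum.map castSucc id) (Sum.elim y 0))⁻¹ *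
    nDeriv (S.warpedMetric e (j + 1) (j + 1)) (Sum.map castSucc id) (inl (last j)) (Sum.elim y 0)).trace

/-- The scalar curvature of `g_j + ∑_{p>j} u_p² dt_p²`. -/
def scalMid (S : Slicing N n) (j : ℕ) (x : Amb N) : ℝ :=
  scalarCurvature (S.warpedMetric (S.chart j x) j (j + 1)) (Sum.elim (headCoords j (S.chart j x x)) 0)

/-- The potential of the second variation. -/
def potential (S : Slicing N n) (j : ℕ) (x : Amb N) : ℝ :=
  S.scalHat (j + 1) x - S.scalMid j x + S.tildeASq j x

/-- The initial acceleration of a deformation, in a chart. -/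
def chartAccel (e : Chart N) (j : ℕ) (F : ℝ → Amb N → Amb N)
    (y : Fin j → ℝ) (a : Fin j) : ℝ := timeD (timeD (chartFlow e j F)) (0, y) (castSucc a)

theorem timeD_timeD_eq {α : Type} [Fintype α] [DecidableEq α] {W : Type*} [NormedAddCommGroup W]
    [NormedSpace ℝ W] {G : ℝ × (α → ℝ) → W} {y : α → ℝ}
    (hG : ∀ᶠ w in 𝓝 ((0 : ℝ), y), SmoothAt G w) :
    (deriv fun s => G (s, y)) =ᶠ[𝓝 0] (fun s => timeD G (s, y)) ∧
    HasDerivAt (deriv fun s => G (s, y)) (timeD (timeD G) (0, y)) 0 := by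
  have hc : Tendsto (fun s : ℝ => (s, y)) (𝓝 0) (𝓝 (0, y)) :=
    (by fun_prop : Continuous fun s : ℝ => (s, y)).tendsto 0
  have h1 : (deriv fun s => G (s, y)) =ᶠ[𝓝 0] fun s => timeD G (s, y) := by
    filter_upwards [hc.eventually hG] with s hs using (hasDerivAt_timeD (hs.diffAt)).deriv
  exact ⟨h1, (hasDerivAt_timeD ((contDiffAt_timeD hG.self_of_nhds).differentiableAt
    (by simp))).congr_of_eventuallyEq h1⟩

namespace IsMinimal

variable (hS : S.IsMinimal Ω k)
include hS

theorem isCompact_leaf_inter {j : ℕ} (hj : j ∈ Icc k n) {K : Set (Amb N)} (hK : IsCompact K)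
    (hKΩ : K ⊆ Ω) : IsCompact (S.leaf j ∩ K) := by
  obtain ⟨C, hC, h⟩ := hS.leaf_closed j hj
  have : S.leaf j ∩ K = K ∩ C := by
    rw [h]; ext x; exact ⟨fun hx => ⟨hx.2, hx.1.2⟩, fun hx => ⟨⟨hKΩ hx.1, hx.2⟩, hx.1⟩⟩
  rw [this]
  exact hK.inter_right hC

theorem scalMid_eq {j : ℕ} (hkj : k ≤ j) (hj : j ≤ n) {e : Chart N}
    (he : Flattens S.leaf (Icc j n) e) {x : Amb N} (hx : x ∈ e.source)
    (hxi : x ∈ S.leaf j) : S.scalMid j x =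
      scalarCurvature (S.warpedMetric e j (j + 1)) (Sum.elim (headCoords j (e x)) 0) := by
  obtain ⟨h1, h2⟩ := hS.chart_spec hkj hj (mem_reg_of_flattens he le_rfl hx hxi)
  exact hS.scalarCurvature_warpedMetric_eq hkj hkj he h2 ⟨le_rfl, hj⟩ ⟨le_rfl, hj⟩ j.le_succ hx h1 hxi 0

section

variable {j : ℕ} (hj : j ∈ Ico k n) {e : Chart N}
  (he : Flattens S.leaf (Icc j n) e) (hF : IsFermiChart (S.nu j) j e)
include hj he

theorem headCoords_succ_planeParam {y : Fin j → ℝ} (hy : y ∈ dom e j) :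
    headCoords (j + 1) (e (Ξ e j y)) = incl castSucc y := by
  rw [Flattens.apply_planeParam hy, ← padCoords_incl,
    headCoords_padCoords (Nat.succ_le_of_lt (hj.2.trans_le hS.dim_le))]

theorem prod_incl {y : Fin j → ℝ} (hy : y ∈ dom e j) :
    ∏ p : Finset.Ico (j + 1) n, S.u p.1 (Ξ e (j + 1) (incl castSucc y)) = S.rho (j + 1) (Ξ e j y) := by
  rw [planeParam_incl, hS.rho_eq_prod ⟨hj.1.trans j.le_succ, hj.2⟩
    (hS.reg_mono hj.1 j.le_succ hj.2 (planeParam_mem_reg he ⟨le_rfl, hj.2.le⟩ hy))]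

theorem blockOf_restr_eventuallyEq {y : Fin j → ℝ} (hy : y ∈ dom e j) : (blockOf (restr (γ e (j + 1)) castSucc)
      fun (p : Finset.Ico (j + 1) n) y => S.u p.1 (Ξ e (j + 1) (incl castSucc y)))
      =ᶠ[𝓝 (Sum.elim y 0)] S.warpedMetric e j (j + 1) := by
  have hb : Tendsto (base (ι := Fin j) (P := Finset.Ico (j + 1) n)) (𝓝 (Sum.elim y 0)) (𝓝 y) :=
    base.continuous.tendsto (Sum.elim y 0)
  filter_upwards [hb.eventually (dom_mem_nhds hy)] with z hz
  simp only [blockOf, restr_inducedMetric he hz, planeParam_incl]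
  rfl

variable {F : ℝ → Amb N → Amb N} {K : Set (Amb N)} (dF : S.IsDeformation Ω j F K) {φ : Amb N → ℝ}
  (hφ : ∀ x ∈ S.reg j, deriv (fun s => F s x) 0 = φ x • S.nu j x) {y : Fin j → ℝ}
  (hy : y ∈ dom e j)
include dF hy

theorem flowDensity_eventuallyEq : (fun s => S.flowDensity e j F (s, y)) =ᶠ[𝓝 0] fun s =>
      √(pullGram (γ e (j + 1)) (chartFlow e j F) y s).det *
        ∏ p : Finset.Ico (j + 1) n, S.u p.1 (Ξ e (j + 1) (chartFlow e j F (s, y))) := by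
  have hc : Tendsto (fun s : ℝ => (s, y)) (𝓝 0) (𝓝 (0, y)) :=
    (by fun_prop : Continuous fun s : ℝ => (s, y)).tendsto 0
  filter_upwards [hc.eventually ((dF.isOpen_flowDomain he).mem_nhds (dF.zero_mem_flowDomain hy))] with s hs
  exact hS.flowDensity_eq hj he dF hs

theorem eventually_contDiffAt_flowDensity : ∀ᶠ w in 𝓝 ((0 : ℝ), y), SmoothAt (S.flowDensity e j F) w := by
  filter_upwards [(dF.isOpen_flowDomain he).mem_nhds (dF.zero_mem_flowDomain hy)] with w hw
  exact hS.contDiffAt_flowDensity hj he dF hw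

include hF hφ

theorem timeD_flowDensity : timeD (S.flowDensity e j F) (0, y) = 1 / 2 * (√(γ e j y).det * S.rho (j + 1) (Ξ e j y)) *
      (φ (Ξ e j y) * S.meanTrace e j y) := by
  have hjI : j ∈ Icc j n := ⟨le_rfl, hj.2.le⟩
  have hjI' : j + 1 ∈ Icc j n := ⟨j.le_succ, hj.2⟩
  have h1 := (hF.isFermiAt he hjI (hjI'.2.trans hS.dim_le)
    (fun y hy => hS.nu_unit j hj _ (planeParam_mem_reg he hjI hy))
    (fun y hy => hS.nu_normal j hj _ (planeParam_mem_reg he hjI hy)) hy).hasDerivAt_weighted_density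
    (hS.isWeightAt hj.1 he hjI' le_rfl (incl_mem_dom.2 hy))
    (hS.isVariationAt_chartFlow hj he dF hF hφ hy)
  have h2 := hasDerivAt_timeD ((hS.eventually_contDiffAt_flowDensity hj he dF hy).self_of_nhds.differentiableAt
    (by simp))
  rw [h2.unique (h1.congr_of_eventuallyEq (hS.flowDensity_eventuallyEq hj he dF hy)),
    restr_inducedMetric he hy, hS.prod_incl hj he hy]
  rfl

/-- The unweighted formula in the warped product, with its scalar curvatures and second fundamental
form recognized as chart-independent quantities of the slicing. The last sum is a divergence and
will integrate to zero. -/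
theorem timeD_timeD_flowDensity (h0 : S.meanTrace e j y = 0) : timeD (timeD (S.flowDensity e j F)) (0, y) =
      √(γ e j y).det * (S.rho (j + 1) (Ξ e j y) * (gradInner (γ e j) (fun y => φ (Ξ e j y)) (fun y => φ (Ξ e j y)) y -
          1 / 2 * S.potential j (Ξ e j y) * φ (Ξ e j y) ^ 2)) +
      ∑ a, partialD a (fun x => √(γ e j x).det * S.rho (j + 1) (Ξ e j x) * chartAccel e j F x a) y := by
  have hjI : j ∈ Icc j n := ⟨le_rfl, hj.2.le⟩
  have hjI' : j + 1 ∈ Icc j n := ⟨j.le_succ, hj.2⟩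
  have hxs := Flattens.planeParam_mem_source hy
  have hxl := he.planeParam_mem hjI hy
  have h1 := (hF.isFermiAt he hjI (hjI'.2.trans hS.dim_le)
    (fun y hy => hS.nu_unit j hj _ (planeParam_mem_reg he hjI hy))
    (fun y hy => hS.nu_normal j hj _ (planeParam_mem_reg he hjI hy)) hy).hasDerivAt_deriv_weighted_density
    (hS.isWeightAt hj.1 he hjI' le_rfl (incl_mem_dom.2 hy))
    (hS.isVariationAt_chartFlow hj he dF hF hφ hy) h0
  have h2 := (timeD_timeD_eq (hS.eventually_contDiffAt_flowDensity hj he dF hy)).2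
  rw [h2.unique (h1.congr_of_eventuallyEq (hS.flowDensity_eventuallyEq hj he dF hy).deriv)]
  have e1 : scalarCurvature _ (Sum.elim y 0) = _ :=
    scalarCurvature_congr (hS.blockOf_restr_eventuallyEq hj he hy)
  have e2 : S.potential j (Ξ e j y) =
      scalarCurvature (S.warpedMetric e (j + 1) (j + 1)) (incl (Sum.map castSucc id) (Sum.elim y 0))
        - scalarCurvature (blockOf (restr (γ e (j + 1)) castSucc)
          fun (p : Finset.Ico (j + 1) n) y => S.u p.1 (Ξ e (j + 1) (incl castSucc y)))
          (Sum.elim y 0) + secondFundNormSq (S.warpedMetric e (j + 1) (j + 1)) (Sum.map castSucc id)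
            (single (inl (last j)) 1) (incl (Sum.map castSucc id) (Sum.elim y 0)) := by
    rw [potential, hS.scalHat_eq hj.1 he hjI' hxs (hS.nested j hj hxl),
      hS.scalMid_eq hj.1 hj.2.le he hxs hxl, hS.tildeASq_eq hj he hF hy,
      hS.headCoords_succ_planeParam hj he hy,
      Flattens.headCoords_planeParam (hj.2.le.trans hS.dim_le) hy, ← e1, ← incl_sumMap_elim hS]
  congr 1
  · rw [restr_inducedMetric he hy, hS.prod_incl hj he hy, e2, mul_assoc]
    congr 3
    simp only [gradInner, gradOf, restr_inducedMetric he hy]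
  · refine sum_congr rfl fun a _ => partialD_congr ?_ a
    filter_upwards [dom_mem_nhds hy] with x hx
    rw [restr_inducedMetric he hx, hS.prod_incl hj he hx]
    rfl

/-- The tangential part of the acceleration. -/
theorem inner_accel (v : Fin j → ℝ) : inner ℝ (deriv (deriv fun s => F s (Ξ e j y)) 0) (D (Ξ e j) y v) =
      formOf (γ e j y) (chartAccel e j F y) v := by
  have hjI : j ∈ Icc j n := ⟨le_rfl, hj.2.le⟩
  have hjI' : j + 1 ∈ Icc j n := ⟨j.le_succ, hj.2⟩
  have H := isHyperplane_castSucc j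
  have hye := incl_mem_dom.2 hy
  have hfer := hF.isFermiAt he hjI (hjI'.2.trans hS.dim_le)
    (fun y hy => hS.nu_unit j hj _ (planeParam_mem_reg he hjI hy))
    (fun y hy => hS.nu_normal j hj _ (planeParam_mem_reg he hjI hy)) hy
  have hv := hS.isVariationAt_chartFlow hj he dF hF hφ hy
  have hO := (dF.isOpen_flowDomain he).mem_nhds (dF.zero_mem_flowDomain hy)
  have hc : Tendsto (fun s : ℝ => (s, y)) (𝓝 0) (𝓝 (0, y)) :=
    (by fun_prop : Continuous fun s : ℝ => (s, y)).tendsto 0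
  have hq0 : chartFlow e j F (0, y) = incl castSucc y := hv.zero.self_of_nhds
  have hq1 : timeD (chartFlow e j F) (0, y) = φ (Ξ e j y) • single (last j) 1 :=
    hv.velocity.self_of_nhds
  have hsm := he.contDiffAt_planeParam hye
  have h1 : (deriv fun s => F s (Ξ e j y)) =ᶠ[𝓝 0] fun s =>
      D (Ξ e (j + 1)) (chartFlow e j F (s, y)) (timeD (chartFlow e j F) (s, y)) := by
    filter_upwards [hc.eventually (eventually_eventually_nhds.2 hO)] with s hs
    have hs' := hs.self_of_nhds
    have hd := (he.contDiffAt_planeParam (hS.chartFlow_spec hj he dF hs').1).diffAt.hasFDerivAt.comp_hasDerivAt s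
      (hasDerivAt_timeD ((dF.contDiffAt_chartFlow he hs').diffAt))
    refine (hd.congr_of_eventuallyEq ?_).deriv
    have hc' : Tendsto (fun t : ℝ => (t, y)) (𝓝 s) (𝓝 (s, y)) :=
      (by fun_prop : Continuous fun s : ℝ => (s, y)).tendsto s
    filter_upwards [hc'.eventually hs] with t ht using (hS.chartFlow_spec hj he dF (w := (t, y)) ht).2.symm
  have hq := hv.smooth_near.self_of_nhds
  have h2 := hasDerivAt_fderiv_curve (t := (0 : ℝ)) (F := Ξ e (j + 1))
    (c := fun s => chartFlow e j F (s, y)) (by simp only [hq0]; exact hsm)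
    (hasDerivAt_timeD (hq.diffAt))
    (hasDerivAt_timeD ((contDiffAt_timeD hq).diffAt))
  rw [h1.deriv_eq, h2.deriv]
  simp only [hq0, hq1]
  have h3 := hsm.diffAt.hasFDerivAt.comp y (incl (castSucc (n := j))).hasFDerivAt
  have h4 : Ξ e (j + 1) ∘ incl castSucc = Ξ e j :=
    funext fun y => planeParam_incl e y
  rw [h4] at h3
  -- By the Fermi condition the second derivative of the parametrization in direction `∂_s` is
  -- normal to `Σ_{j+1}`. So the tangential acceleration in space is the coordinate acceleration.
  have h5 := hF.acceleration y hy (incl castSucc v)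
  rw [fderiv_fderiv_apply hsm] at h5
  rw [h3.fderiv, ContinuousLinearMap.comp_apply, inner_add_left, map_smul, map_smul, smul_apply,
    inner_smul_left, inner_smul_left, h5, mul_zero, mul_zero, zero_add, ← Flattens.formOf_inducedMetric,
    ← restr_inducedMetric he hy]
  simp only [formOf_apply, H.sum_eq, incl_normal H, incl_emb H, hfer.g_sa, zero_mul, mul_zero, zero_add, sum_const_zero]
  rfl

end

end IsMinimal

end Slicing

end SecondVariation

/-! ### Construction of deformations with given normal velocity. -/

section LocalDeformations

variable {N n k : ℕ} {S : Slicing N n} {Ω : Set (Amb N)}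

/-- Small multiples of a compactly supported field of constant direction perturb the identity to a
diffeomorphism. -/
theorem exists_shear {g : Amb N → ℝ} (hg : ContDiff ℝ ∞ g) (hc : HasCompactSupport g) (E : Amb N) :
    ∃ ε > 0, ∀ τ : ℝ, |τ| ≤ ε → Bijective (fun z => z + (τ * g z) • E) ∧
      ∀ z, Injective (D (fun z => z + (τ * g z) • E) z) := by
  obtain ⟨C, hC⟩ := hg.lipschitzWith_of_hasCompactSupport hc (by simp)
  -- For such `τ` the perturbation of the identity has Lipschitz constant at most `1/2`.
  refine ⟨1 / (2 * ((C + 1) * (‖E‖ + 1))), by positivity, fun τ hτ => ?_⟩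
  have hb : |τ| * C * ‖E‖ ≤ 1 / 2 := by
    have h1 : (C : ℝ) * ‖E‖ ≤ (C + 1) * (‖E‖ + 1) := by
      nlinarith [norm_nonneg E, C.coe_nonneg]
    calc |τ| * C * ‖E‖ = |τ| * (C * ‖E‖) := by ring
      _ ≤ 1 / (2 * ((C + 1) * (‖E‖ + 1))) * ((C + 1) * (‖E‖ + 1)) := by gcongr
      _ = 1 / 2 := by field_simp
  have hl : ∀ x y, ‖(τ * g x) • E - (τ * g y) • E‖ ≤ 1 / 2 * ‖x - y‖ := fun x y => by
    rw [← sub_smul, ← mul_sub, norm_smul, norm_mul, Real.norm_eq_abs]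
    have h1 := hC.norm_sub_le x y
    calc |τ| * ‖g x - g y‖ * ‖E‖ ≤ |τ| * (C * ‖x - y‖) * ‖E‖ := by gcongr
      _ = |τ| * C * ‖E‖ * ‖x - y‖ := by ring
      _ ≤ 1 / 2 * ‖x - y‖ := by gcongr
  refine ⟨⟨fun x y hxy => ?_, fun w => ?_⟩, fun z => ?_⟩
  · have h1 : x - y = (τ * g y) • E - (τ * g x) • E := by
      rw [sub_eq_sub_iff_add_eq_add, add_comm ((τ * g y) • E) y]; exact hxy
    have h2 := hl y x
    rw [← h1, norm_sub_rev y x] at h2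
    rw [← sub_eq_zero, ← norm_eq_zero]
    linarith [norm_nonneg (x - y)]
  -- A preimage of `w` is a fixed point of the contraction `z ↦ w - τ g(z) E`.
  · have hw : ContractingWith (1 / 2 : NNReal) fun z => w - (τ * g z) • E := by
      refine ⟨by norm_num, LipschitzWith.of_dist_le_mul fun x y => ?_⟩
      rw [dist_eq_norm, dist_eq_norm, sub_sub_sub_cancel_left, norm_sub_rev]
      exact (hl x y).trans (by simp)
    refine ⟨hw.fixedPoint _, ?_⟩
    have h1 : w - _ = hw.fixedPoint _ := hw.fixedPoint_isFixedPt
    change hw.fixedPoint _ + _ = w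
    nth_rw 1 [← h1]
    rw [sub_add_cancel]
  · have hd : HasFDerivAt (fun z => z + (τ * g z) • E) _ z := (hasFDerivAt_id z).add
      (((hg.differentiable (by simp) z).hasFDerivAt.const_mul τ).smul_const E)
    rw [hd.fderiv, injective_iff_map_eq_zero]
    intro v hv
    have h1 : v = -((τ * D g z v) • E) := eq_neg_of_add_eq_zero_left hv
    have h2 : ‖D g z v‖ ≤ C * ‖v‖ := (ContinuousLinearMap.le_opNorm _ _).trans
      (mul_le_mul_of_nonneg_right (norm_fderiv_le_of_lipschitz ℝ hC) (norm_nonneg v))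
    have h3 : ‖v‖ ≤ 1 / 2 * ‖v‖ := by
      conv_lhs => rw [h1, norm_neg, norm_smul, norm_mul, Real.norm_eq_abs]
      calc |τ| * ‖D g z v‖ * ‖E‖ ≤ |τ| * (C * ‖v‖) * ‖E‖ := by gcongr
        _ = |τ| * C * ‖E‖ * ‖v‖ := by ring
        _ ≤ 1 / 2 * ‖v‖ := by gcongr
    rw [← norm_eq_zero]
    linarith [norm_nonneg v]

open Classical in
/-- The conjugation of a map with a chart. -/
def conjMap (e : Chart N) (T : Amb N → Amb N) (x : Amb N) : Amb N :=
  if x ∈ e.source then e.symm (T (e x)) else x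

section

variable {e : Chart N} {T : Amb N → Amb N} {G : Set (Amb N)}
  (hT : Bijective T) (hG : ∀ z ∉ G, T z = z) (hGe : G ⊆ e.target)
include hT hG hGe

theorem shear_mem_target {z : Amb N} : T z ∈ e.target ↔ z ∈ e.target := by
  by_cases hz : z ∈ G
  · refine iff_of_true (hGe ?_) (hGe hz)
    by_contra h
    have := hT.1 (hG _ h)
    rw [this] at h
    exact h hz
  · rw [hG z hz]

theorem conjMap_mem_source {x : Amb N} : conjMap e T x ∈ e.source ↔ x ∈ e.source := by
  by_cases hx : x ∈ e.source
  · rw [conjMap, if_pos hx]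
    exact iff_of_true (e.map_target ((shear_mem_target hT hG hGe).2 (e.map_source hx))) hx
  · rw [conjMap, if_neg hx]

theorem apply_conjMap {x : Amb N} (hx : x ∈ e.source) : e (conjMap e T x) = T (e x) := by
  rw [conjMap, if_pos hx, e.right_inv ((shear_mem_target hT hG hGe).2 (e.map_source hx))]

theorem bijective_conjMap : Bijective (conjMap e T) := by
  refine ⟨fun x y hxy => ?_, fun y => ?_⟩
  · by_cases hx : x ∈ e.source
    · have hy := (conjMap_mem_source hT hG hGe).1 (hxy ▸ (conjMap_mem_source hT hG hGe).2 hx)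
      refine e.injOn hx hy (hT.1 ?_)
      rw [← apply_conjMap hT hG hGe hx, hxy, apply_conjMap hT hG hGe hy]
    · have hy : y ∉ e.source := fun hy => hx
        ((conjMap_mem_source hT hG hGe).1 (hxy ▸ (conjMap_mem_source hT hG hGe).2 hy))
      rwa [conjMap, conjMap, if_neg hx, if_neg hy] at hxy
  · by_cases hy : y ∈ e.source
    · obtain ⟨z, hz⟩ := hT.2 (e y)
      have hzt : z ∈ e.target := (shear_mem_target hT hG hGe).1 (hz ▸ e.map_source hy)
      refine ⟨e.symm z, ?_⟩
      rw [conjMap, if_pos (e.map_target hzt), e.right_inv hzt, hz, e.left_inv hy]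
    · exact ⟨y, by rw [conjMap, if_neg hy]⟩

omit hT hGe in
theorem conjMap_off {x : Amb N} (hx : x ∉ e.symm '' G) : conjMap e T x = x := by
  by_cases hxe : x ∈ e.source
  · rw [conjMap, if_pos hxe, hG _ fun h => hx ⟨_, h, e.left_inv hxe⟩, e.left_inv hxe]
  · rw [conjMap, if_neg hxe]

end

/-- Normal variations supported in a Fermi chart. -/
theorem Slicing.IsMinimal.exists_isNormalVariation (hS : S.IsMinimal Ω k) {j : ℕ} (hj : j ∈ Ico k n)
    {e : Chart N} (he : Flattens S.leaf (Icc j n) e)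
    (hF : IsFermiChart (S.nu j) j e) {g : Amb N → ℝ} (hg : ContDiff ℝ ∞ g) (hc : HasCompactSupport g)
    (hgt : tsupport g ⊆ e.target) (hgΩ : ∀ z ∈ tsupport g, e.symm z ∈ Ω) :
    ∃ F, S.IsNormalVariation Ω j (e.source.indicator fun x => g (e x)) F (e.symm '' tsupport g) := by
  have hjI : j ∈ Icc j n := ⟨le_rfl, hj.2.le⟩
  have hjI' : j + 1 ∈ Icc j n := ⟨j.le_succ, hj.2⟩
  have hjN : j < N := hj.2.trans_le hS.dim_le
  -- The coordinate direction of `ν` in the chart. Its coordinates of index at least `j + 1` vanish,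
  -- so shears along it preserve `Σ_{j+1}`.
  set E : Amb N := padCoords (j + 1) (single (last j) 1) with hE
  have hE0 : ∀ i : Fin N, j + 1 ≤ i.1 → E i = 0 := fun i hi => padCoords_apply_of_le _ hi
  obtain ⟨ε, hε, hsh⟩ := exists_shear hg hc E
  -- The deformation must be a diffeomorphism for every time `s`. This amplitude stays within `[-ε,
  -- ε]` and has derivative `1` at `s = 0`.
  set τ : ℝ → ℝ := fun s => ε * Real.sin (s / ε) with hτ
  have hτε : ∀ s, |τ s| ≤ ε := fun s => by
    rw [hτ, abs_mul, abs_of_pos hε]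
    exact mul_le_of_le_one_right hε.le (Real.abs_sin_le_one _)
  have hτs : ContDiff ℝ ∞ τ := contDiff_const.mul (Real.contDiff_sin.comp (contDiff_id.div_const ε))
  set T : ℝ → Amb N → Amb N := fun s z => z + (τ s * g z) • E with hTdef
  have hT := fun s => (hsh (τ s) (hτε s)).1
  have hG : ∀ s, ∀ z ∉ tsupport g, T s z = z := fun s z hz => by
    simp only [hTdef, image_eq_zero_of_notMem_tsupport hz, mul_zero, zero_smul, add_zero]
  have hTs : ContDiff ℝ ∞ fun p : ℝ × Amb N => T p.1 p.2 :=
    contDiff_snd.add (((hτs.comp contDiff_fst).mul (hg.comp contDiff_snd)).smul contDiff_const)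
  have hK : IsCompact (e.symm '' tsupport g) := hc.isCompact.image_of_continuousOn (e.continuousOn_symm.mono hgt)
  have hKs : e.symm '' tsupport g ⊆ e.source := image_subset_iff.2 fun z hz => e.map_target (hgt hz)
  have hloc : ∀ s, ∀ x ∈ e.source, (fun p : ℝ × Amb N => conjMap e (T p.1) p.2) =ᶠ[𝓝 (s, x)]
      fun p => e.symm (T p.1 (e p.2)) := fun s x hx => by
    filter_upwards [(e.open_source.preimage continuous_snd).mem_nhds (show (s, x).2 ∈ _ from hx)] with p hp
    exact if_pos hp
  -- Outside the chart domain a point is off the compact support, so the map is the identity near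
  -- it; this gives smoothness across the boundary of the chart.
  have hoff : ∀ s, ∀ x ∉ e.source, (fun p : ℝ × Amb N => conjMap e (T p.1) p.2) =ᶠ[𝓝 (s, x)]
      fun p => p.2 := fun s x hx => by
    have hm : (s, x).2 ∈ (e.symm '' tsupport g)ᶜ := fun h => hx (hKs h)
    filter_upwards [(hK.isClosed.isOpen_compl.preimage continuous_snd).mem_nhds hm] with p hp
    exact conjMap_off (hG p.1) hp
  have hsm : ∀ s, ∀ x ∈ e.source, SmoothAt (fun p : ℝ × Amb N => e.symm (T p.1 (e p.2))) (s, x) :=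
    fun s x hx => ContDiffAt.comp (g := e.symm) (f := fun p : ℝ × Amb N => T p.1 (e p.2)) (s, x)
      (he.contDiffAt_symm ((shear_mem_target (hT s) (hG s) hgt).2 (e.map_source hx)))
      (ContDiffAt.comp (g := fun p : ℝ × Amb N => T p.1 p.2) (f := fun p : ℝ × Amb N => (p.1, e p.2))
        (s, x) hTs.contDiffAt (contDiffAt_fst.prodMk ((he.contDiffAt hx).comp (s, x) contDiffAt_snd)))
  have hsl : ∀ (s : ℝ) x, Tendsto (fun z : Amb N => (s, z)) (𝓝 x) (𝓝 (s, x)) := fun s x =>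
    (by fun_prop : Continuous fun z : Amb N => (s, z)).tendsto x
  have hmem : ∀ s x, conjMap e (T s) x ∈ S.leaf (j + 1) ↔ x ∈ S.leaf (j + 1) := by
    intro s x
    by_cases hx : x ∈ e.source
    · rw [he.flat _ hjI' _ ((conjMap_mem_source (hT s) (hG s) hgt).2 hx), he.flat _ hjI' _ hx,
        apply_conjMap (hT s) (hG s) hgt hx]
      refine forall₂_congr fun i hi => ?_
      simp [hE0 i hi]
    · rw [conjMap, if_neg hx]
  have hbij := fun s => bijective_conjMap (hT s) (hG s) hgt
  refine ⟨fun s => conjMap e (T s), ⟨hK, ?_, ?_, ?_, ?_, hbij, ?_, ?_, ?_⟩, ?_, ?_⟩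
  · rintro _ ⟨z, hz, rfl⟩; exact hgΩ z hz
  · exact fun x hx => mem_reg_of_flattens he j.le_succ (hKs hx.1) hx.2
  · refine contDiff_iff_contDiffAt.2 fun ⟨s, x⟩ => ?_
    by_cases hx : x ∈ e.source
    · exact (hsm s x hx).congr_of_eventuallyEq (hloc s x hx)
    · exact contDiffAt_snd.congr_of_eventuallyEq (hoff s x hx)
  · intro x
    by_cases hx : x ∈ e.source
    · rw [conjMap, if_pos hx]
      simp [hTdef, hτ, e.left_inv hx]
    · rw [conjMap, if_neg hx]
  · intro s x
    suffices h : Injective (D (conjMap e (T s)) x) from ⟨h, LinearMap.injective_iff_surjective.1 h⟩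
    by_cases hx : x ∈ e.source
    · have ht := (shear_mem_target (hT s) (hG s) hgt).2 (e.map_source hx)
      have h1 : conjMap e (T s) =ᶠ[𝓝 x] fun z => e.symm (T s (e z)) := (hsl s x).eventually (hloc s x hx)
      have he' : Flattens S.leaf ∅ e.symm := ⟨he.smooth_symm, he.smooth, by simp⟩
      have hd := (he.contDiffAt_symm ht).diffAt.hasFDerivAt.comp x
        (((hTs.comp (contDiff_const.prodMk contDiff_id)).differentiable (by simp)
          (e x)).hasFDerivAt.comp x (he.contDiffAt hx).diffAt.hasFDerivAt)
      rw [h1.fderiv_eq, show D (fun z => e.symm (T s (e z))) x = _ from hd.fderiv]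
      exact (he'.injective_fderiv ht).comp (((hsh _ (hτε s)).2 (e x)).comp (he.injective_fderiv hx))
    · have h1 : conjMap e (T s) =ᶠ[𝓝 x] fun z => z := (hsl s x).eventually (hoff s x hx)
      rw [h1.fderiv_eq, fderiv_fun_id]
      exact Function.injective_id
  · intro s
    ext y
    refine ⟨?_, fun hy => ?_⟩
    · rintro ⟨x, hx, rfl⟩; exact (hmem s x).2 hx
    · obtain ⟨x, rfl⟩ := (hbij s).2 y
      exact ⟨x, (hmem s x).1 hy, rfl⟩
  · exact fun s x hx => conjMap_off (hG s) hx
  · exact fun x hx => mem_reg_of_flattens he le_rfl (hKs hx.1) hx.2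
  · intro x hx
    by_cases hxe : x ∈ e.source
    · have hy : headCoords j (e x) ∈ dom e j := he.head_mem hjI hxe hx.1
      have hyx : Ξ e j (headCoords j (e x)) = x := he.planeParam_head hjI hxe hx.1
      have hex : padCoords (j + 1) (incl castSucc (headCoords j (e x))) = e x := by
        rw [padCoords_incl, he.pad_head hjI hxe hx.1]
      have hds : HasFDerivAt e.symm (D e.symm (e x)) (e x) :=
        (he.contDiffAt_symm (e.map_source hxe)).diffAt.hasFDerivAt
      have hv := hF.velocity _ hy
      rw [hyx] at hv
      have hd1 : HasFDerivAt (Ξ e (j + 1)) ((D e.symm (e x)).comp (padCLM N (j + 1)))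
          (incl castSucc (headCoords j (e x))) := by
        have hds' : HasFDerivAt e.symm (D e.symm (e x)) (padCLM N (j + 1) (incl castSucc (headCoords j (e x)))) := by
          rw [coe_padCLM, hex]; exact hds
        exact hds'.comp _ (padCLM N (j + 1)).hasFDerivAt
      rw [hd1.fderiv] at hv
      have hτ0 : HasDerivAt τ 1 0 := by
        have h1 := ((hasDerivAt_id (0 : ℝ)).div_const ε).sin.const_mul ε
        refine h1.congr_deriv ?_
        simp [hε.ne']
      have hT0 : HasDerivAt (fun s => T s (e x)) (g (e x) • E) 0 := by
        have h1 := ((hτ0.mul_const (g (e x))).smul_const E).const_add (e x)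
        rwa [one_mul] at h1
      have hTz : T 0 (e x) = e x := by simp [hTdef, hτ]
      have h2 := HasFDerivAt.comp_hasDerivAt (l := e.symm) (f := fun s => T s (e x)) (0 : ℝ)
        (by rw [hTz]; exact hds) hT0
      have h3 : (fun s => conjMap e (T s) x) = fun s => e.symm (T s (e x)) := funext fun s => if_pos hxe
      rw [h3, indicator_of_mem hxe, ← hv]
      refine h2.deriv.trans ?_
      rw [map_smul]; rfl
    · have h3 : (fun s => conjMap e (T s) x) = fun s => x := funext fun s => if_neg hxe
      rw [h3, indicator_of_notMem hxe, deriv_const, zero_smul]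

end LocalDeformations

/-! ### Regularity of the geometric quantities, and the fundamental lemma. -/

section Continuity

variable {α β : Type} [Fintype α] [DecidableEq α] [Fintype β] [DecidableEq β]

theorem IsMetricAt.scalarCurvature_smooth {g : (β → ℝ) → Matrix β β ℝ} {z : β → ℝ} (h : IsMetricAt g z) :
    SmoothAt (scalarCurvature g) z := by
  have hc := fun c a b => h.christoffel_smooth c a b
  refine ContDiffAt.sum fun a _ => ContDiffAt.sum fun b _ => (h.inv_smooth a b).mul
    (ContDiffAt.sum fun c _ => ((contDiffAt_partialD (hc c a b) c).sub
      (contDiffAt_partialD (hc c a c) b)).add (ContDiffAt.sum fun l _ => ?_))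
  exact ((hc c c l).mul (hc l a b)).sub ((hc c b l).mul (hc l a c))

theorem IsMetricAt.secondFundNormSq_smooth {g : (β → ℝ) → Matrix β β ℝ} {z : β → ℝ} (h : IsMetricAt g z)
    {emb : α → β} (hemb : Injective emb) (ν : β → ℝ) :
    SmoothAt (secondFundNormSq g emb ν) z := by
  have hi : ∀ a b, SmoothAt (fun z => ((g z).submatrix emb emb)⁻¹ a b) z := fun a b =>
    contDiffAt_matrix_inv (fun a b => h.smooth (emb a) (emb b)) (h.posDef.submatrix hemb).det_pos.ne' a b
  have hs : ∀ a b, SmoothAt (fun z => secondFund g emb ν z a b) z := fun a b =>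
    ContDiffAt.sum fun c _ => ContDiffAt.sum fun l _ =>
      ((h.christoffel_smooth c _ _).mul (h.smooth c l)).mul contDiffAt_const
  exact ContDiffAt.sum fun a _ => ContDiffAt.sum fun b _ => ContDiffAt.sum fun a' _ =>
    ContDiffAt.sum fun b' _ => (((hi a a').mul (hi b b')).mul (hs a b)).mul (hs a' b')

theorem IsFermiAt.continuousAt_trace {g : (β → ℝ) → Matrix β β ℝ} {emb : α → β} {s₀ : β} {y : α → ℝ}
    (h : IsFermiAt g emb s₀ y) :
    ContinuousAt (fun y => ((restr g emb y)⁻¹ * nDeriv g emb s₀ y).trace) y := by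
  simp only [trace, Matrix.diag, Matrix.mul_apply]
  refine tendsto_finsetSum _ fun a _ => tendsto_finsetSum _ fun b _ =>
    ContinuousAt.mul (h.hyper_metric.inv_smooth a b).continuousAt ?_
  exact ((contDiffAt_partialD (h.metric.smooth (emb b) (emb a)) s₀).comp y (incl emb).contDiff.contDiffAt).continuousAt

theorem continuousAt_gradInner {h : (α → ℝ) → Matrix α α ℝ} {y : α → ℝ} (hm : IsMetricAt h y)
    {f f' : (α → ℝ) → ℝ} (hf : SmoothAt f y) (hf' : SmoothAt f' y) :
    ContinuousAt (gradInner h f f') y :=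
  (ContDiffAt.sum fun c _ => (contDiffAt_partialD hf c).mul (contDiffAt_gradOf hm hf' c)).continuousAt

/-- Continuous functions that integrate to zero against all test functions vanish. -/
theorem eq_zero_of_forall_integral_eq_zero {V : Set (α → ℝ)} (hV : IsOpen V) {M : (α → ℝ) → ℝ}
    (hM : ContinuousOn M V) (h : ∀ ζ : (α → ℝ) → ℝ, ContDiff ℝ ∞ ζ → HasCompactSupport ζ →
      tsupport ζ ⊆ V → ∫ y in V, ζ y * M y = 0) {y : α → ℝ} (hy : y ∈ V) : M y = 0 := by
  have h1 := hV.ae_eq_zero_of_integral_contDiff_smul_eq_zero (μ := volume)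
    (hM.locallyIntegrableOn hV.measurableSet) fun ζ h1 h2 h3 => by
      rw [← setIntegral_eq_integral_of_forall_compl_eq_zero (s := V) (fun x hx => by
        rw [image_eq_zero_of_notMem_tsupport fun h => hx (h3 h), zero_smul])]
      exact h ζ h1 h2 h3
  have h2 : M =ᵐ[volume.restrict V] fun _ => 0 := (ae_restrict_iff' hV.measurableSet).2 h1
  exact Measure.eqOn_open_of_ae_eq h2 hV hM continuousOn_const hy

variable {N n k : ℕ} {S : Slicing N n} {Ω : Set (Amb N)}

namespace Slicing.IsMinimal

variable (hS : S.IsMinimal Ω k)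
include hS

omit hS in
theorem leaf_inter_subset_reg {j : ℕ} {e : Chart N}
    (he : Flattens S.leaf (Icc j n) e) {x : Amb N} (hx : x ∈ e.source) : S.reg j ∈ 𝓝[S.leaf j] x :=
  mem_nhdsWithin.2 ⟨e.source, e.open_source, hx, fun _ hz => mem_reg_of_flattens he le_rfl hz.1 hz.2⟩

/-- Continuity on the regular set is continuity in charts. -/
theorem continuousOn_reg {j : ℕ} (hj : j ∈ Icc k n) {f : Amb N → ℝ}
    (h : ∀ x ∈ S.reg j, ∃ e : Chart N, x ∈ e.source ∧
      Flattens S.leaf (Icc j n) e ∧ ContinuousAt (fun y => f (Ξ e j y)) (headCoords j (e x))) :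
    ContinuousOn f (S.reg j) := by
  intro x hx
  obtain ⟨e, hxe, he, hf⟩ := h x hx
  have hjI : j ∈ Icc j n := ⟨le_rfl, hj.2⟩
  have h1 : ContinuousAt (fun x => f (Ξ e j (headCLM N j (e x)))) x :=
    ContinuousAt.comp (f := fun x => headCLM N j (e x)) (g := fun y => f (Ξ e j y)) hf
      ((headCLM N j).continuous.continuousAt.comp (e.continuousAt hxe))
  refine h1.continuousWithinAt.congr_of_eventuallyEq_of_mem ?_ hx
  filter_upwards [mem_nhdsWithin_of_mem_nhds (e.open_source.mem_nhds hxe), self_mem_nhdsWithin] with z hz hz'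
  rw [coe_headCLM, he.planeParam_head hjI hz hz'.1]

/-- Functions are smooth only on regular sets, while `gradSq` differentiates within the whole leaf.
The regular set is a neighbourhood of its points in the leaf. -/
theorem differentiableWithinAt_leaf {j p : ℕ} (hj : k ≤ j) (hjp : j ≤ p) (hp : p ≤ n) {f : Amb N → ℝ}
    (hf : ContDiffOn ℝ ∞ f (S.reg p)) {x : Amb N} (hx : x ∈ S.reg j) :
    DifferentiableWithinAt ℝ f (S.leaf j) x := by
  obtain ⟨e, hxe, he⟩ := hS.exists_flattens hj (hjp.trans hp) hx
  exact ((hf.mono (hS.reg_mono hj hjp hp)).differentiableOn (by simp) x hx).mono_of_mem_nhdsWithin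
    (leaf_inter_subset_reg he hxe)

theorem gradSq_eq {j p i : ℕ} (hj : k ≤ j) {e : Chart N}
    (he : Flattens S.leaf (Icc j n) e) (hi : i ∈ Icc j n) (hip : i ≤ p) (hp : p ≤ n) {f : Amb N → ℝ}
    (hf : ContDiffOn ℝ ∞ f (S.reg p)) {y : Fin i → ℝ} (hy : y ∈ dom e i) :
    gradSq (S.leaf i) f (Ξ e i y) = gradInner (γ e i) (fun z => f (Ξ e i z)) (fun z => f (Ξ e i z)) y :=
  gradSq_planeParam he hi (hi.2.trans hS.dim_le) hy
    (hS.differentiableWithinAt_leaf (hj.trans hi.1) hip hp hf (planeParam_mem_reg he hi hy))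

theorem continuousOn_gradSq {j p : ℕ} (hj : k ≤ j) (hjp : j ≤ p) (hp : p ≤ n) {f : Amb N → ℝ}
    (hf : ContDiffOn ℝ ∞ f (S.reg p)) : ContinuousOn (gradSq (S.leaf j) f) (S.reg j) := by
  have hjI : j ∈ Icc j n := ⟨le_rfl, hjp.trans hp⟩
  refine hS.continuousOn_reg ⟨hj, hjp.trans hp⟩ fun x hx => ?_
  obtain ⟨e, hxe, he⟩ := hS.exists_flattens hj (hjp.trans hp) hx
  have hy := he.head_mem hjI hxe hx.1
  have hfs := hS.contDiffAt_comp_planeParam hj he hjI hjp hp hf hy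
  refine ⟨e, hxe, he, (continuousAt_gradInner (he.isMetricAt (hjI.2.trans hS.dim_le) hy) hfs hfs).congr ?_⟩
  filter_upwards [dom_mem_nhds hy] with z hz using (hS.gradSq_eq hj he hjI hjp hp hf hz).symm

theorem contDiffOn_log_u {p : ℕ} (hp : p ∈ Icc k n) : ContDiffOn ℝ ∞ (fun x => log (S.u p x)) (S.reg p) :=
  (hS.contDiffOn_u hp).log fun _ hx => (hS.u_pos hp hx).ne'

theorem continuousAt_elim {j m : ℕ} {f : ((Fin j ⊕ Finset.Ico m n) → ℝ) → ℝ} {y : Fin j → ℝ}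
    (h : ContinuousAt f (Sum.elim y 0)) : ContinuousAt (fun y => f (Sum.elim y 0)) y := by
  refine ContinuousAt.comp (f := fun y : Fin j → ℝ => Sum.elim y (0 : Finset.Ico m n → ℝ)) (g := f) h
    (continuousAt_pi.2 ?_)
  rintro (i | p)
  exacts [continuousAt_apply i y, continuousAt_const]

theorem isMetricAt_warpedMetric {j i m : ℕ} (hj : k ≤ j) {e : Chart N}
    (he : Flattens S.leaf (Icc j n) e) (hi : i ∈ Icc j n) (him : i ≤ m) {y : Fin i → ℝ}
    (hy : y ∈ dom e i) : IsMetricAt (S.warpedMetric e i m) (Sum.elim y 0) :=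
  isMetricAt_blockOf (he.isMetricAt (hi.2.trans hS.dim_le) hy) (hS.isWeightAt hj he hi him hy)

section

variable {j : ℕ} (hj : j ∈ Ico k n) {e : Chart N}
  (he : Flattens S.leaf (Icc j n) e) (hF : IsFermiChart (S.nu j) j e) {y : Fin j → ℝ}
  (hy : y ∈ dom e j)
include hj he hF hy

theorem continuousAt_tildeASq : ContinuousAt (fun y => S.tildeASq j (Ξ e j y)) y := by
  have hm := hS.isMetricAt_warpedMetric hj.1 he ⟨j.le_succ, hj.2⟩ le_rfl (incl_mem_dom.2 hy)
  rw [← incl_sumMap_elim hS] at hm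
  have h1 := (hm.secondFundNormSq_smooth (isHyperplane_sumMap (isHyperplane_castSucc j)).inj
    (single (inl (last j)) 1)).continuousAt
  have h2 := continuousAt_elim hS (ContinuousAt.comp (f := incl (Sum.map castSucc id)) h1
    (incl _).continuous.continuousAt)
  refine h2.congr ?_
  filter_upwards [dom_mem_nhds hy] with z hz using (hS.tildeASq_eq hj he hF hz).symm

theorem continuousAt_potential : ContinuousAt (fun y => S.potential j (Ξ e j y)) y := by
  have hjI : j ∈ Icc j n := ⟨le_rfl, hj.2.le⟩
  have hjI' : j + 1 ∈ Icc j n := ⟨j.le_succ, hj.2⟩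
  have hU := dom_mem_nhds hy
  have h1 := continuousAt_elim hS (hS.isMetricAt_warpedMetric hj.1 he hjI
    j.le_succ hy).scalarCurvature_smooth.continuousAt
  have h2 := ContinuousAt.comp (f := incl castSucc) (continuousAt_elim hS
    (hS.isMetricAt_warpedMetric hj.1 he hjI' le_rfl
    (incl_mem_dom.2 hy)).scalarCurvature_smooth.continuousAt)
    (incl (castSucc (n := j))).continuous.continuousAt
  refine ((h2.sub h1).add (hS.continuousAt_tildeASq hj he hF hy)).congr ?_
  filter_upwards [hU] with z hz
  have hzs := Flattens.planeParam_mem_source hz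
  have hzl := he.planeParam_mem hjI hz
  rw [potential, hS.scalHat_eq hj.1 he hjI' hzs (hS.nested j hj hzl),
      hS.scalMid_eq hj.1 hj.2.le he hzs hzl, hS.headCoords_succ_planeParam hj he hz,
      Flattens.headCoords_planeParam (hj.2.le.trans hS.dim_le) hz]
  rfl

theorem continuousAt_meanTrace : ContinuousAt (S.meanTrace e j) y :=
  continuousAt_elim hS (hS.isFermiAt_warpedMetric hj he hF (z := Sum.elim y 0) hy).continuousAt_trace

end

theorem continuousOn_tildeASq {j : ℕ} (hj : j ∈ Icc k n) : ContinuousOn (S.tildeASq j) (S.reg j) := by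
  rcases hj.2.eq_or_lt with rfl | h
  · exact continuousOn_const.congr fun x _ => if_neg (lt_irrefl _)
  · refine hS.continuousOn_reg hj fun x hx => ?_
    obtain ⟨e, hxe, he, hF⟩ := hS.exists_isFermiChart ⟨hj.1, h⟩ hx
    exact ⟨e, hxe, he, hS.continuousAt_tildeASq ⟨hj.1, h⟩ he hF (he.head_mem ⟨le_rfl, hj.2⟩ hxe hx.1)⟩

theorem continuousOn_potential {j : ℕ} (hj : j ∈ Ico k n) : ContinuousOn (S.potential j) (S.reg j) :=
  hS.continuousOn_reg ⟨hj.1, hj.2.le⟩ fun x hx => by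
    obtain ⟨e, hxe, he, hF⟩ := hS.exists_isFermiChart hj hx
    exact ⟨e, hxe, he, hS.continuousAt_potential hj he hF (he.head_mem ⟨le_rfl, hj.2.le⟩ hxe hx.1)⟩

end Slicing.IsMinimal

end Continuity

/-! ### Derivatives of volume along deformations, and stationarity. -/

section VolumeVariations

theorem timeD_const_mul {α : Type} [Fintype α] [DecidableEq α] {c : (α → ℝ) → ℝ}
    {f : ℝ × (α → ℝ) → ℝ} {y : α → ℝ} (hc : ∀ᶠ z in 𝓝 y, SmoothAt c z)
    (hf : ∀ᶠ w in 𝓝 ((0 : ℝ), y), SmoothAt f w) :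
    (∀ᶠ w in 𝓝 ((0 : ℝ), y), SmoothAt (fun w => c w.2 * f w) w) ∧
    timeD (fun w => c w.2 * f w) (0, y) = c y * timeD f (0, y) ∧
    timeD (timeD fun w => c w.2 * f w) (0, y) = c y * timeD (timeD f) (0, y) := by
  have h1 : ∀ᶠ w in 𝓝 ((0 : ℝ), y), SmoothAt (fun w => c w.2 * f w) w := by
    filter_upwards [(continuous_snd.tendsto ((0 : ℝ), y)).eventually hc, hf] with w h1 h2 using
      (h1.comp w contDiffAt_snd).mul h2
  refine ⟨h1, ?_, ?_⟩
  · exact (hasDerivAt_timeD (h1.self_of_nhds.diffAt)).unique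
      ((hasDerivAt_timeD (hf.self_of_nhds.diffAt)).const_mul (c y))
  · refine (Slicing.timeD_timeD_eq h1).2.unique (((Slicing.timeD_timeD_eq hf).2.const_mul (c y)).congr_of_eventuallyEq ?_)
    exact .of_forall fun s => deriv_const_mul_field (c y)

theorem ChartCover.integral_eq_sum {N j : ℕ} {L : ℕ → Set (Amb N)} {I : Set ℕ} {C : Set (Amb N)}
    {T : Type} [Fintype T] {e : T → Chart N} {χ : T → Amb N → ℝ}
    (h : ChartCover L I C e χ) (hj : j ∈ I) (hjN : j ≤ N) (hC : IsCompact C) (hCL : C ⊆ L j)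
    {r : Amb N → ℝ} (hr : ContinuousOn r C) :
    IntegrableOn r C μHE[j] ∧ ∫ x in C, r x ∂μHE[j] =
      ∑ t, ∫ y in paramPiece (e t) j (C ∩ tsupport (χ t)), χ t (Ξ (e t) j y) *
        (√(γ (e t) j y).det * r (Ξ (e t) j y)) := by
  have := h.integral_image_eq_sum hj hjN hC hCL contDiff_id Function.injective_id
    (fun x => by rw [fderiv_id]; exact Function.injective_id) (r := r) hr
  rw [image_id] at this
  exact this

variable {N n k : ℕ} {S : Slicing N n} {Ω : Set (Amb N)}

namespace Slicing.IsMinimal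

variable (hS : S.IsMinimal Ω k) {j : ℕ} (hj : j ∈ Ico k n)
include hS

/-- The regular set is relatively open in the leaf, being the part covered by flattening charts, and
the leaf is relatively closed in `Ω`. -/
theorem measurableSet_reg {j : ℕ} (hj : j ∈ Icc k n) : MeasurableSet (S.reg j) := by
  obtain ⟨C, hC, h⟩ := hS.leaf_closed j hj
  have : S.reg j = S.leaf j ∩ ⋃ (e : Chart N)
      (_ : Flattens S.leaf (Icc j n) e), e.source := by
    ext x
    refine ⟨fun hx => ?_, fun ⟨hx, hx'⟩ => ?_⟩
    · obtain ⟨e, hxe, he⟩ := hS.exists_flattens hj.1 hj.2 hx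
      exact ⟨hx.1, mem_iUnion₂.2 ⟨e, he, hxe⟩⟩
    · obtain ⟨e, he, hxe⟩ := mem_iUnion₂.1 hx'
      exact mem_reg_of_flattens he le_rfl hxe hx
  rw [this, h]
  exact (hS.isOpen.measurableSet.inter hC.measurableSet).inter
    (isOpen_iUnion fun e => isOpen_iUnion fun _ => e.open_source).measurableSet

/-- Integrals over the regular set of functions supported in a chart. -/
theorem integral_reg_eq {j : ℕ} (hj : j ∈ Icc k n) {e : Chart N}
    (he : Flattens S.leaf (Icc j n) e) {V : Set (Fin j → ℝ)} (hV : IsOpen V)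
    (hVe : V ⊆ dom e j) {f : Amb N → ℝ} (hf : ∀ x ∈ S.reg j \ Ξ e j '' V, f x = 0) :
    ∫ x in S.reg j, f x ∂μHE[j] = ∫ y in V, √(γ e j y).det * f (Ξ e j y) := by
  have hjN := hj.2.trans hS.dim_le
  rw [setIntegral_eq_of_subset_of_forall_sdiff_eq_zero (hS.measurableSet_reg hj) (image_subset_iff.2
    fun y hy => planeParam_mem_reg he ⟨le_rfl, hj.2⟩ (hVe hy)) hf]
  exact integral_image_eq_integral_gramOf (isOpen_dom e j)
    (he.contDiffOn_planeParam.of_le (by simp)) (Flattens.injOn_planeParam hjN)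
    (fun y hy => he.injective_fderiv_planeParam hjN hy) hV.measurableSet hVe f

include hj

section

variable {F : ℝ → Amb N → Amb N} {K : Set (Amb N)} (dF : S.IsDeformation Ω j F K)
include dF

theorem continuousOn_rho_flow (s : ℝ) : ContinuousOn (fun x => S.rho (j + 1) (F s x)) (S.leaf j ∩ K) := by
  refine (hS.contDiffOn_rho (hj.1.trans j.le_succ)).continuousOn.comp
    (dF.contDiff s).continuous.continuousOn fun x hx => dF.regular ⟨?_, (dF.mem_leaf s).2 (hS.nested j hj hx.1)⟩
  rw [← dF.image_eq s]
  exact ⟨x, hx.2, rfl⟩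

variable {T : Type} [Fintype T] {e : T → Chart N} {χ : T → Amb N → ℝ}
  (h : ChartCover S.leaf (Icc j n) (S.leaf j ∩ K) e χ)
include h

/-- The partition of unity writes the volume as a finite sum of integrals over parameter sets that
do not depend on `s`, and these are differentiated under the integral sign. -/
theorem hasDerivAt_volumeAlong : HasDerivAt (S.volumeAlong j F K)
      (∑ t, ∫ y in paramPiece (e t) j (S.leaf j ∩ K ∩ tsupport (χ t)), χ t (Ξ (e t) j y) *
        timeD (S.flowDensity (e t) j F) (0, y)) 0 ∧
    HasDerivAt (deriv (S.volumeAlong j F K))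
      (∑ t, ∫ y in paramPiece (e t) j (S.leaf j ∩ K ∩ tsupport (χ t)), χ t (Ξ (e t) j y) *
        timeD (timeD (S.flowDensity (e t) j F)) (0, y)) 0 := by
  have hjI : j ∈ Icc j n := ⟨le_rfl, hj.2.le⟩
  have hjN := hj.2.le.trans hS.dim_le
  have hC := hS.isCompact_leaf_inter ⟨hj.1, hj.2.le⟩ dF.compact dF.subset
  have hK : ∀ t, IsCompact (paramPiece (e t) j (S.leaf j ∩ K ∩ tsupport (χ t))) := fun t =>
    (h.flattens t).isCompact_paramPiece hjI hjN (ChartCover.isCompact_inter hC t)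
      (inter_subset_left.trans inter_subset_left) (inter_subset_right.trans (h.subset t))
  have h1 : S.volumeAlong j F K = fun s => ∑ t, ∫ y in paramPiece (e t) j (S.leaf j ∩ K ∩ tsupport (χ t)),
      (fun w : ℝ × (Fin j → ℝ) => χ t (Ξ (e t) j w.2) * S.flowDensity (e t) j F w) (s, y) :=
    funext fun s => (h.integral_image_eq_sum hjI hjN hC inter_subset_left (dF.contDiff s) (dF.bij s).1
      (dF.injective_fderiv s) (hS.continuousOn_rho_flow hj dF s)).2
  have key := fun t y (hy : y ∈ paramPiece (e t) j (S.leaf j ∩ K ∩ tsupport (χ t))) =>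
    timeD_const_mul (c := fun y => χ t (Ξ (e t) j y)) (by
      filter_upwards [(isOpen_dom (e t) j).mem_nhds hy.1] with z hz using
        (h.smooth t).contDiffAt.comp z ((h.flattens t).contDiffAt_planeParam hz))
      (hS.eventually_contDiffAt_flowDensity hj (h.flattens t) dF hy.1)
  obtain ⟨h2, h3⟩ := hasDerivAt_sum_setIntegral hK fun t y hy => (key t y hy).1
  rw [h1]
  refine ⟨h2.congr_deriv ?_, h3.congr_deriv ?_⟩ <;>
    refine sum_congr rfl fun t _ => setIntegral_congr_fun (hK t).measurableSet fun y hy => ?_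
  exacts [(key t y hy).2.1, (key t y hy).2.2]

end

theorem exists_fermiCover {K : Set (Amb N)} (hK : IsCompact K) (hKΩ : K ⊆ Ω) (hKr : K ∩ S.leaf j ⊆ S.reg j) :
    ∃ (T : Type) (_ : Fintype T) (e : T → Chart N) (χ : T → Amb N → ℝ),
      ChartCover S.leaf (Icc j n) (S.leaf j ∩ K) e χ ∧ ∀ t, IsFermiChart (S.nu j) j (e t) :=
  exists_chartCover (hS.isCompact_leaf_inter ⟨hj.1, hj.2.le⟩ hK hKΩ)
    fun _ hx => hS.exists_isFermiChart hj (hKr ⟨hx.2, hx.1⟩)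

/-- Minimizers are stationary. -/
theorem deriv_volumeAlong_eq_zero {F : ℝ → Amb N → Amb N} {K : Set (Amb N)}
    (dF : S.IsDeformation Ω j F K) (hKr : K ∩ S.leaf j ⊆ S.reg j) {v : ℝ}
    (hv : HasDerivAt (S.volumeAlong j F K) v 0) : v = 0 := by
  have hC := hS.isCompact_leaf_inter ⟨hj.1, hj.2.le⟩ dF.compact dF.subset
  obtain ⟨T, _, e, χ, h, -⟩ := hS.exists_fermiCover hj dF.compact dF.subset hKr
  -- Minimality compares `ℝ≥0∞`-valued integrals over `F s '' S.leaf j ∩ K`. Because `F s` permutes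
  -- `K`, this set is the image of `S.leaf j ∩ K`, where the real integral converges and is
  -- nonnegative.
  have key : ∀ s, ENNReal.ofReal (S.volumeAlong j F K s) =
      ∫⁻ x in F s '' S.leaf j ∩ K, ENNReal.ofReal (S.rho (j + 1) x) ∂μHE[j] ∧
      0 ≤ S.volumeAlong j F K s := by
    intro s
    have h1 : F s '' S.leaf j ∩ K = F s '' (S.leaf j ∩ K) := by
      rw [image_inter (dF.bij s).1, dF.image_eq]
    have hpos : ∀ x ∈ F s '' (S.leaf j ∩ K), 0 ≤ S.rho (j + 1) x := by
      rintro _ ⟨x, hx, rfl⟩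
      exact (hS.rho_pos (hj.1.trans j.le_succ) (dF.regular
        ⟨(dF.image_eq s).le ⟨x, hx.2, rfl⟩, (dF.mem_leaf s).2 (hS.nested j hj hx.1)⟩)).le
    have hm : MeasurableSet (F s '' (S.leaf j ∩ K)) :=
      (hC.image (dF.contDiff s).continuous).measurableSet
    rw [h1]
    exact ⟨ofReal_integral_eq_lintegral_ofReal (h.integral_image_eq_sum ⟨le_rfl, hj.2.le⟩
      (hj.2.le.trans hS.dim_le) hC inter_subset_left (dF.contDiff s) (dF.bij s).1
      (dF.injective_fderiv s) (hS.continuousOn_rho_flow hj dF s)).1 ((ae_restrict_iff' hm).2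
        (.of_forall hpos)), setIntegral_nonneg hm hpos⟩
  have hmin : ∀ τ, S.volumeAlong j F K 0 ≤ S.volumeAlong j F K τ := by
    intro τ
    -- Minimality speaks of time `1` only. The family with time scaled by `τ` reaches `F τ` at time
    -- `1`, so the volume has a minimum at `0` among all times.
    have Dτ : S.IsDeformation Ω j (fun s => F (τ * s)) K :=
      ⟨dF.compact, dF.subset, dF.regular, dF.smooth.comp ((contDiff_const.mul contDiff_fst).prodMk contDiff_snd),
        fun x => by rw [mul_zero, dF.zero], fun s => dF.bij _, fun s => dF.bij_fderiv _,
        fun s => dF.preserves _, fun s => dF.off _⟩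
    have := hS.minimizes j hj _ _ Dτ
    rw [mul_one, ← (key τ).1] at this
    refine (ENNReal.ofReal_le_ofReal_iff (key τ).2).1 ?_
    rw [(key 0).1, show F 0 = id from funext dF.zero, image_id]
    exact this
  exact (IsLocalMin.hasDerivAt_eq_zero (.of_forall hmin) hv)

variable {F : ℝ → Amb N → Amb N} {K : Set (Amb N)} {φ : Amb N → ℝ} (dF : S.IsNormalVariation Ω j φ F K)

include dF

/-- Off `K` the deformation is at rest, so `φ ν = 0`, and `ν` is a unit vector. -/
theorem eq_zero_off {x : Amb N} (hx : x ∈ S.reg j \ K) : φ x = 0 := by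
  have h1 := dF.2.2 x hx.1
  rw [show (fun s => F s x) = fun _ => x from funext fun s => dF.1.off s x hx.2, deriv_const] at h1
  refine (smul_eq_zero.1 h1.symm).resolve_right fun h => ?_
  have := hS.nu_unit j hj x hx.1
  rw [h, norm_zero] at this
  exact zero_ne_one this

/-- The first variation, for a deformation supported in a chart. -/
theorem integral_meanTrace_eq_zero {e : Chart N}
    (he : Flattens S.leaf (Icc j n) e) (hF : IsFermiChart (S.nu j) j e) (hKe : K ⊆ e.source)
    {V : Set (Fin j → ℝ)} (hV : IsOpen V) (hVe : V ⊆ dom e j)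
    (hφ : ContinuousOn φ (S.reg j)) (hφV : ∀ x ∈ S.reg j \ Ξ e j '' V, φ x = 0) :
    ∫ y in V, φ (Ξ e j y) * (√(γ e j y).det * (S.rho (j + 1) (Ξ e j y) * S.meanTrace e j y)) = 0 := by
  have hjI : j ∈ Icc j n := ⟨le_rfl, hj.2.le⟩
  have hjN := hj.2.le.trans hS.dim_le
  have hC := hS.isCompact_leaf_inter ⟨hj.1, hj.2.le⟩ dF.1.compact dF.1.subset
  -- Every chart of the cover is the given one, so the chart-dependent `meanTrace e j` is the same
  -- function in all summands.
  obtain ⟨T, _, e', χ, h, he'⟩ := exists_chartCover (L := S.leaf) (I := Icc j n) hC (p := (· = e))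
    fun x hx => ⟨e, hKe hx.2, he, rfl⟩
  obtain rfl : e' = fun _ => e := funext he'
  set r : Amb N → ℝ := fun x => 1 / 2 * (S.rho (j + 1) x * (φ x * S.meanTrace e j (headCoords j (e x)))) with hr
  have hCr : S.leaf j ∩ K ⊆ S.reg j := fun x hx => dF.2.1 ⟨hx.2, hx.1⟩
  have hrc : ContinuousOn r (S.leaf j ∩ K) := by
    refine continuousOn_const.mul (ContinuousOn.mul (((hS.contDiffOn_rho (hj.1.trans j.le_succ)).mono
      (hS.reg_mono hj.1 j.le_succ hj.2)).continuousOn.mono hCr) ((hφ.mono hCr).mul fun x hx => ?_))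
    refine ContinuousAt.continuousWithinAt (ContinuousAt.comp (f := fun x => headCLM N j (e x))
      (g := S.meanTrace e j) (hS.continuousAt_meanTrace hj he hF (he.head_mem hjI (hKe hx.2) hx.1))
      ((headCLM N j).continuous.continuousAt.comp (e.continuousAt (hKe hx.2))))
  have h0 := hS.deriv_volumeAlong_eq_zero hj dF.1 dF.2.1 (hS.hasDerivAt_volumeAlong hj dF.1 h).1
  have hrψ : ∀ y ∈ dom e j, r (Ξ e j y) = 1 / 2 * (S.rho (j + 1) (Ξ e j y) *
      (φ (Ξ e j y) * S.meanTrace e j y)) := fun y hy => by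
    simp only [hr, Flattens.headCoords_planeParam hjN hy]
  have h1 : ∫ x in S.leaf j ∩ K, r x ∂μHE[j] = 0 := by
    rw [← h0, (h.integral_eq_sum hjI hjN hC inter_subset_left hrc).2]
    refine sum_congr rfl fun t _ => setIntegral_congr_fun
      (he.isCompact_paramPiece hjI hjN (ChartCover.isCompact_inter hC t)
      (inter_subset_left.trans inter_subset_left) (inter_subset_right.trans (h.subset t))).measurableSet
      fun y hy => ?_
    rw [hS.timeD_flowDensity hj he hF dF.1 dF.2.2 hy.1, hrψ y hy.1]
    ring
  rw [← setIntegral_eq_of_subset_of_forall_sdiff_eq_zero (hS.measurableSet_reg ⟨hj.1, hj.2.le⟩) hCr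
    (fun x hx => by simp only [hr]; rw [hS.eq_zero_off hj dF ⟨hx.1, fun h => hx.2 ⟨hx.1.1, h⟩⟩]; ring),
    hS.integral_reg_eq ⟨hj.1, hj.2.le⟩ he hV hVe (fun x hx => by simp only [hr]; rw [hφV x hx]; ring)] at h1
  have h2 : ∫ y in V, φ (Ξ e j y) * (√(γ e j y).det * (S.rho (j + 1) (Ξ e j y) * S.meanTrace e j y)) =
      ∫ y in V, 2 * (√(γ e j y).det * r (Ξ e j y)) := by
    refine setIntegral_congr_fun hV.measurableSet fun y hy => ?_
    rw [hrψ y (hVe hy)]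
    ring
  rw [h2, integral_const_mul, h1, mul_zero]

end Slicing.IsMinimal

end VolumeVariations

/-! ### Test functions in charts, and the second variation formula. -/

section ChartTests

theorem exists_cutoff {E : Type*} [NormedAddCommGroup E] [NormedSpace ℝ E] [HasContDiffBump E]
    [FiniteDimensional ℝ E] {s : Set E} {x : E} (hs : s ∈ 𝓝 x) :
    ∃ f : E → ℝ, ContDiff ℝ ∞ f ∧ HasCompactSupport f ∧ tsupport f ⊆ s ∧ ∀ᶠ y in 𝓝 x, f y = 1 := by
  obtain ⟨d, hd, h⟩ := Metric.nhds_basis_closedBall.mem_iff.1 hs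
  let f : ContDiffBump x := { rIn := d / 2, rOut := d, rIn_pos := half_pos hd, rIn_lt_rOut := half_lt_self hd }
  exact ⟨f, f.contDiff, f.hasCompactSupport, f.tsupport_eq.le.trans h, f.eventuallyEq_one⟩

variable {N n k : ℕ} {S : Slicing N n} {Ω : Set (Amb N)}

theorem gradSq_eq_zero {L : Set (Amb N)} {f : Amb N → ℝ} {x : Amb N} (hx : x ∈ L)
    (h : f =ᶠ[𝓝[L] x] fun _ => (0 : ℝ)) : gradSq L f x = 0 := by
  have h2 : fderivWithin ℝ f L x = 0 := (h.fderivWithin_eq (h.eq_of_nhdsWithin hx)).trans (fderivWithin_const_apply 0)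
  rw [gradSq, h2]
  exact (congrArg (· ^ 2) ContinuousLinearMap.opNorm_zero).trans (zero_pow two_ne_zero)

/-- The function with the values `ζ` on the part of a submanifold in a chart, cut off by `η`. -/
def chartTest (e : Chart N) (j : ℕ) (η : Amb N → ℝ)
    (ζ : (Fin j → ℝ) → ℝ) : Amb N → ℝ := e.source.indicator fun x => ζ (headCoords j (e x)) * η (e x)

section

variable {e : Chart N} {j : ℕ} {η : Amb N → ℝ} {ζ ζ' : (Fin j → ℝ) → ℝ}

theorem chartTest_add : chartTest e j η (ζ + ζ') = chartTest e j η ζ + chartTest e j η ζ' := by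
  ext x
  by_cases hx : x ∈ e.source <;> simp [chartTest, hx, add_mul]

theorem chartTest_sub : chartTest e j η (ζ - ζ') = chartTest e j η ζ - chartTest e j η ζ' := by
  ext x
  by_cases hx : x ∈ e.source <;> simp [chartTest, hx, sub_mul]

theorem chartTest_planeParam (hjN : j ≤ N) {y : Fin j → ℝ} (hy : y ∈ dom e j) :
    chartTest e j η ζ (Ξ e j y) = ζ y * η (padCoords j y) := by
  rw [chartTest, indicator_of_mem (Flattens.planeParam_mem_source hy),
    Flattens.headCoords_planeParam hjN hy, Flattens.apply_planeParam hy]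

end

namespace Slicing.IsMinimal

variable (hS : S.IsMinimal Ω k) {j : ℕ} (hj : j ∈ Ico k n)
  {e : Chart N} (he : Flattens S.leaf (Icc j n) e)
  {η : Amb N → ℝ} (hη : ContDiff ℝ ∞ η) (hc : HasCompactSupport η) (hηt : tsupport η ⊆ e.target)
  (hηΩ : ∀ z ∈ tsupport η, e.symm z ∈ Ω) {ζ : (Fin j → ℝ) → ℝ} (hζ : ContDiff ℝ ∞ ζ)
include hS hj he hη hc hηt hηΩ hζ

theorem isNormalVariation_chartTest (hF : IsFermiChart (S.nu j) j e) : ∃ F K,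
    S.IsNormalVariation Ω j (chartTest e j η ζ) F K ∧ K ⊆ e.source := by
  have h1 : ContDiff ℝ ∞ fun z => ζ (headCLM N j z) := hζ.comp (headCLM N j).contDiff
  have h2 : tsupport (fun z => ζ (headCLM N j z) * η z) ⊆ tsupport η := tsupport_mul_subset_right
  obtain ⟨F, h⟩ := hS.exists_isNormalVariation hj he hF (h1.mul hη) (hc.mul_left (f := fun z => ζ (headCLM N j z)))
    (h2.trans hηt) fun z hz => hηΩ z (h2 hz)
  refine ⟨F, _, h, ?_⟩
  rintro _ ⟨z, hz, rfl⟩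
  exact e.map_target (hηt (h2 hz))

theorem isTest_chartTest : S.IsTest j (chartTest e j η ζ) := by
  have hK : IsCompact (e.symm '' tsupport η) := hc.isCompact.image_of_continuousOn (e.continuousOn_symm.mono hηt)
  have hKe : e.symm '' tsupport η ⊆ e.source := by
    rintro _ ⟨z, hz, rfl⟩; exact e.map_target (hηt hz)
  have hoff : ∀ x ∉ e.symm '' tsupport η, chartTest e j η ζ x = 0 := by
    intro x hx
    by_cases hxe : x ∈ e.source
    · rw [chartTest, indicator_of_mem hxe, image_eq_zero_of_notMem_tsupport fun h =>
        hx ⟨_, h, e.left_inv hxe⟩, mul_zero]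
    · exact indicator_of_notMem hxe _
  refine ⟨fun x _ => ContDiffAt.contDiffWithinAt ?_, S.leaf j ∩ e.symm '' tsupport η,
    hS.isCompact_leaf_inter ⟨hj.1, hj.2.le⟩ hK (by rintro _ ⟨z, hz, rfl⟩; exact hηΩ z hz),
    fun x hx => mem_reg_of_flattens he le_rfl (hKe hx.2) hx.1, fun x hx => hoff x fun h => hx.2 ⟨hx.1, h⟩⟩
  by_cases hxe : x ∈ e.source
  · have h1 : ContDiff ℝ ∞ fun z => ζ (headCLM N j z) * η z := (hζ.comp (headCLM N j).contDiff).mul hη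
    refine (h1.contDiffAt.comp x (he.contDiffAt hxe)).congr_of_eventuallyEq ?_
    filter_upwards [e.open_source.mem_nhds hxe] with z hz using indicator_of_mem hz _
  · refine (contDiffAt_const (c := (0 : ℝ))).congr_of_eventuallyEq ?_
    filter_upwards [hK.isClosed.isOpen_compl.mem_nhds fun h => hxe (hKe h)] with z hz using hoff z hz

omit hη hc hηt hηΩ hζ in
theorem chartTest_eq_zero {V : Set (Fin j → ℝ)} (h0 : ∀ y ∈ dom e j \ V, ζ y = 0) :
    ∀ x ∈ S.leaf j \ Ξ e j '' V, chartTest e j η ζ x = 0 := by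
  intro x hx
  by_cases hxe : x ∈ e.source
  · have hjI : j ∈ Icc j n := ⟨le_rfl, hj.2.le⟩
    have h1 := he.head_mem hjI hxe hx.1
    rw [chartTest, indicator_of_mem hxe, h0 _ ⟨h1, fun h => hx.2 ⟨_, h, he.planeParam_head hjI hxe hx.1⟩⟩, zero_mul]
  · exact indicator_of_notMem hxe _

omit hη hc hηt hηΩ hζ in
/-- A cutoff function at a point of a chart. -/
theorem exists_chartCutoff {y₀ : Fin j → ℝ} (hy : y₀ ∈ dom e j) : ∃ η : Amb N → ℝ,
    ContDiff ℝ ∞ η ∧ HasCompactSupport η ∧ tsupport η ⊆ e.target ∧ (∀ z ∈ tsupport η, e.symm z ∈ Ω) ∧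
    ∀ᶠ y in 𝓝 y₀, η (padCoords j y) = 1 := by
  have hΩ : Ξ e j y₀ ∈ Ω := by
    obtain ⟨C, -, h⟩ := hS.leaf_closed j ⟨hj.1, hj.2.le⟩
    exact (h.le (he.planeParam_mem ⟨le_rfl, hj.2.le⟩ hy)).1
  have hO : e.target ∩ e.symm ⁻¹' Ω ∈ 𝓝 (padCoords j y₀) :=
    (e.continuousOn_symm.isOpen_inter_preimage e.open_target hS.isOpen).mem_nhds ⟨hy, hΩ⟩
  obtain ⟨η, h1, h2, h3, h4⟩ := exists_cutoff hO
  exact ⟨η, h1, h2, fun z hz => (h3 hz).1, fun z hz => (h3 hz).2, ((padCLM N j).continuous.tendsto y₀).eventually h4⟩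

omit hη hc hηt hηΩ hζ in
-- Stationarity for all bump functions supported near `y₀` makes the mean curvature times a positive
-- density vanish, by the fundamental lemma.
theorem meanTrace_eq_zero (hF : IsFermiChart (S.nu j) j e) {y₀ : Fin j → ℝ} (hy₀ : y₀ ∈ dom e j) :
    S.meanTrace e j y₀ = 0 := by
  have hjN := hj.2.le.trans hS.dim_le
  obtain ⟨η, h1, h2, h3, h4, h5⟩ := hS.exists_chartCutoff hj he hy₀
  obtain ⟨V, hV', hV, hyV⟩ := mem_nhds_iff.1 (h5.and (dom_mem_nhds hy₀))
  have hVe : V ⊆ dom e j := fun y hy => (hV' hy).2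
  have hρ : ∀ y ∈ V, 0 < √(γ e j y).det * S.rho (j + 1) (Ξ e j y) :=
    fun y hy => mul_pos (Real.sqrt_pos.2 (he.isMetricAt hjN (hVe hy)).posDef.det_pos)
      (hS.rho_pos (hj.1.trans j.le_succ) (hS.reg_mono hj.1 j.le_succ hj.2
        (planeParam_mem_reg he ⟨le_rfl, hj.2.le⟩ (hVe hy))))
  have key := eq_zero_of_forall_integral_eq_zero hV (M := fun y => √(γ e j y).det *
      (S.rho (j + 1) (Ξ e j y) * S.meanTrace e j y)) ?_ ?_ hyV
  · rw [← mul_assoc] at key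
    exact (mul_eq_zero.1 key).resolve_left (hρ y₀ hyV).ne'
  · intro y hy
    refine ContinuousAt.continuousWithinAt (((contDiffAt_matrix_det fun a b =>
      (he.isMetricAt hjN (hVe hy)).smooth a b).continuousAt.sqrt).mul (ContinuousAt.mul ?_
      (hS.continuousAt_meanTrace hj he hF (hVe hy))))
    exact (hS.contDiffAt_comp_planeParam hj.1 he ⟨le_rfl, hj.2.le⟩ j.le_succ hj.2
      (hS.contDiffOn_rho (hj.1.trans j.le_succ)) (hVe hy)).continuousAt
  · intro ζ hζ hζc hζV
    obtain ⟨F, K, dF, hK⟩ := hS.isNormalVariation_chartTest hj he h1 h2 h3 h4 hζ hF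
    have h0 := hS.integral_meanTrace_eq_zero hj dF he hF hK hV hVe
      (hS.isTest_chartTest hj he h1 h2 h3 h4 hζ).1.continuousOn (fun x hx =>
        hS.chartTest_eq_zero hj he (fun y hy => image_eq_zero_of_notMem_tsupport fun h => hy.2 (hζV h)) x
          ⟨hx.1.1, hx.2⟩)
    rw [← h0]
    refine setIntegral_congr_fun hV.measurableSet fun y hy => ?_
    rw [chartTest_planeParam hjN (hVe hy), show η _ = 1 from (hV' hy).1, mul_one]

end Slicing.IsMinimal

namespace Slicing.IsMinimal

variable (hS : S.IsMinimal Ω k) {j : ℕ} (hj : j ∈ Ico k n) {F : ℝ → Amb N → Amb N} {K : Set (Amb N)}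
  {φ : Amb N → ℝ} (hφ : ContDiffOn ℝ ∞ φ (S.reg j))
include hS hj hφ

/-- The integrand of the second variation. -/
theorem continuousOn_secondVariation : ContinuousOn (fun x => S.rho (j + 1) x *
    (gradSq (S.leaf j) φ x - 1 / 2 * S.potential j x * φ x ^ 2)) (S.reg j) :=
  ((hS.contDiffOn_rho (hj.1.trans j.le_succ)).mono (hS.reg_mono hj.1 j.le_succ hj.2)).continuousOn.mul
    ((hS.continuousOn_gradSq hj.1 le_rfl hj.2.le hφ).sub ((continuousOn_const.mul
      (hS.continuousOn_potential hj)).mul (hφ.continuousOn.pow 2)))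

omit hφ in
theorem eventuallyEq_zero_off (dF : S.IsNormalVariation Ω j φ F K) {x : Amb N} (hx : x ∈ S.reg j \ K) :
    φ =ᶠ[𝓝[S.leaf j] x] fun _ => (0 : ℝ) := by
  obtain ⟨e, hxe, he⟩ := hS.exists_flattens hj.1 hj.2.le hx.1
  filter_upwards [leaf_inter_subset_reg he hxe, mem_nhdsWithin_of_mem_nhds
    (dF.1.compact.isClosed.isOpen_compl.mem_nhds hx.2)] with z hz hzK using hS.eq_zero_off hj dF ⟨hz, hzK⟩

/-- The local formula with vanishing mean curvature, summed over the partition of unity. What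
separates the sum from the stated integral is the divergence of the weighted tangential
acceleration, which integrates to zero. Hence the result is the same for every deformation with
velocity `φ ν`. -/
theorem hasDerivAt_deriv_volumeAlong (dF : S.IsNormalVariation Ω j φ F K) :
    HasDerivAt (deriv (S.volumeAlong j F K)) (∫ x in S.reg j, S.rho (j + 1) x *
      (gradSq (S.leaf j) φ x - 1 / 2 * S.potential j x * φ x ^ 2) ∂μHE[j]) 0 := by
  have hjI : j ∈ Icc j n := ⟨le_rfl, hj.2.le⟩
  have hjN := hj.2.le.trans hS.dim_le
  have hC := hS.isCompact_leaf_inter ⟨hj.1, hj.2.le⟩ dF.1.compact dF.1.subset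
  have hCr : S.leaf j ∩ K ⊆ S.reg j := fun x hx => dF.2.1 ⟨hx.2, hx.1⟩
  obtain ⟨T, _, e, χ, h, hF⟩ := hS.exists_fermiCover hj dF.1.compact dF.1.subset dF.2.1
  set r : Amb N → ℝ := fun x => S.rho (j + 1) x * (gradSq (S.leaf j) φ x - 1 / 2 * S.potential j x * φ x ^ 2) with hr
  have hrc : ContinuousOn r (S.reg j) := hS.continuousOn_secondVariation hj hφ
  have hoff : ∀ x ∈ S.reg j \ (S.leaf j ∩ K), r x = 0 := by
    intro x hx
    have hxK : x ∉ K := fun h => hx.2 ⟨hx.1.1, h⟩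
    simp only [hr]
    rw [hS.eq_zero_off hj dF ⟨hx.1, hxK⟩, gradSq_eq_zero hx.1.1 (hS.eventuallyEq_zero_off hj dF ⟨hx.1, hxK⟩)]
    ring
  refine (hS.hasDerivAt_volumeAlong hj dF.1 h).2.congr_deriv ?_
  have hK : ∀ t, IsCompact (paramPiece (e t) j (S.leaf j ∩ K ∩ tsupport (χ t))) := fun t =>
    (h.flattens t).isCompact_paramPiece hjI hjN (ChartCover.isCompact_inter hC t)
      (inter_subset_left.trans inter_subset_left) (inter_subset_right.trans (h.subset t))
  rw [setIntegral_eq_of_subset_of_forall_sdiff_eq_zero (hS.measurableSet_reg ⟨hj.1, hj.2.le⟩) hCr hoff,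
    (h.integral_eq_sum hjI hjN hC inter_subset_left (hrc.mono hCr)).2, ← sub_eq_zero,
    ← sum_sub_distrib]
  have hψ : ∀ t, ContinuousOn (Ξ (e t) j) (paramPiece (e t) j (S.leaf j ∩ K ∩ tsupport (χ t))) :=
    fun t => (h.flattens t).contDiffOn_planeParam.continuousOn.mono (paramPiece_subset _)
  have hχ : ∀ t, ContinuousOn (fun y => χ t (Ξ (e t) j y))
      (paramPiece (e t) j (S.leaf j ∩ K ∩ tsupport (χ t))) := fun t =>
    (h.smooth t).continuous.comp_continuousOn (hψ t)
  have hdet : ∀ t, ∀ y ∈ dom (e t) j, SmoothAt (fun y => √(γ (e t) j y).det) y :=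
    fun t y hy => (contDiffAt_matrix_det fun a b => ((h.flattens t).isMetricAt hjN hy).smooth a b).sqrt
      ((h.flattens t).isMetricAt hjN hy).posDef.det_pos.ne'
  have hdens := fun t y (hy : y ∈ dom (e t) j) =>
    (hS.eventually_contDiffAt_flowDensity hj (h.flattens t) dF.1 hy).self_of_nhds
  -- The divergence theorem is applied to the initial acceleration in space; `inner_accel`
  -- identifies its tangential part in every chart.
  refine Eq.trans (sum_congr rfl fun t _ => ?_) (h.sum_integral_divergence_eq_zero hjI hjN hC
    inter_subset_left (w := fun x => deriv (deriv fun s => F s x) 0) (r := S.rho (j + 1))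
    (Y := fun t => chartAccel (e t) j F) (fun x hx => ?_) (fun t y hy a => ?_)
    fun t y hy v => hS.inner_accel hj (h.flattens t) (hF t) dF.1 dF.2.2 hy v)
  · rw [← integral_sub]
    · refine setIntegral_congr_fun (hK t).measurableSet fun y hy => ?_
      simp only [hr]
      rw [hS.timeD_timeD_flowDensity hj (h.flattens t) (hF t) dF.1 dF.2.2 hy.1
        (hS.meanTrace_eq_zero hj (h.flattens t) (hF t) hy.1), hS.gradSq_eq hj.1 (h.flattens t) hjI le_rfl
        hj.2.le hφ hy.1]
      ring
    · refine ContinuousOn.integrableOn_compact (hK t) ((hχ t).mul fun y hy =>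
        ContinuousAt.continuousWithinAt ?_)
      exact ContinuousAt.comp (f := fun y : Fin j → ℝ => ((0 : ℝ), y))
        (g := timeD (timeD (S.flowDensity (e t) j F)))
        (contDiffAt_timeD (contDiffAt_timeD (hdens t y hy.1))).continuousAt
        (by fun_prop : Continuous fun y : Fin j → ℝ => ((0 : ℝ), y)).continuousAt
    · exact ContinuousOn.integrableOn_compact (hK t) ((hχ t).mul (ContinuousOn.mul (fun y hy =>
        (hdet t y hy.1).continuousAt.continuousWithinAt) (hrc.comp (hψ t) fun y hy => hCr hy.2.1)))
  · have h1 : (fun s => F s x) = fun _ => x := funext fun s => dF.1.off s x fun h => hx.2 ⟨hx.1, h⟩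
    simp only [h1, deriv_const']
  · refine ContDiffAt.of_le (n := ∞) (((hdet t y hy).mul (hS.contDiffAt_comp_planeParam hj.1 (h.flattens t) hjI
      j.le_succ hj.2 (hS.contDiffOn_rho (hj.1.trans j.le_succ)) hy)).mul ?_) (by simp)
    have h1 := contDiffAt_timeD (contDiffAt_timeD (dF.1.contDiffAt_chartFlow (h.flattens t)
      (dF.1.zero_mem_flowDomain hy)))
    exact (contDiffAt_pi.1 (h1.comp y (contDiffAt_const.prodMk contDiffAt_id))) _

/-- The second variation formula. -/
theorem secondVariation_eq (dF : S.IsNormalVariation Ω j φ F K) :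
    S.secondVariation Ω j φ = ∫ x in S.reg j, S.rho (j + 1) x *
      (gradSq (S.leaf j) φ x - 1 / 2 * S.potential j x * φ x ^ 2) ∂μHE[j] := by
  have h : ∃ d : (ℝ → Amb N → Amb N) × Set (Amb N), S.IsNormalVariation Ω j φ d.1 d.2 := ⟨(F, K), dF⟩
  rw [secondVariation, dif_pos h, iteratedDeriv_succ, iteratedDeriv_one]
  exact (hS.hasDerivAt_deriv_volumeAlong hj hφ h.choose_spec).deriv

end Slicing.IsMinimal

end ChartTests

/-! ### Gradients and weighted Laplacians. -/

section WeightedLaplacian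

variable {α : Type} [Fintype α] [DecidableEq α] {h : (α → ℝ) → Matrix α α ℝ} {y : α → ℝ}

theorem gradInner_comm (hm : IsMetricAt h y) (f f' : (α → ℝ) → ℝ) : gradInner h f f' y = gradInner h f' f y := by
  simp only [gradInner, gradOf, mul_sum]
  rw [sum_comm]
  refine sum_congr rfl fun a _ => sum_congr rfl fun b _ => ?_
  have : (h y)⁻¹ b a = (h y)⁻¹ a b := by simpa using hm.posDef.isHermitian.inv.apply a b
  rw [this]; ring

theorem gradInner_congr {f f₁ f' f₁' : (α → ℝ) → ℝ} (hf : f =ᶠ[𝓝 y] f₁) (hf' : f' =ᶠ[𝓝 y] f₁') :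
    gradInner h f f' y = gradInner h f₁ f₁' y := by
  simp only [gradInner, gradOf, partialD_congr hf, partialD_congr hf']

theorem gradInner_polarization (hm : IsMetricAt h y) {f f' : (α → ℝ) → ℝ} (hf : DiffAt f y)
    (hf' : DiffAt f' y) :
    gradInner h (fun x => f x + f' x) (fun x => f x + f' x) y -
      gradInner h (fun x => f x - f' x) (fun x => f x - f' x) y = 4 * gradInner h f' f y := by
  have h1 : gradInner h (fun x => f x + f' x) (fun x => f x + f' x) y -
      gradInner h (fun x => f x - f' x) (fun x => f x - f' x) y =
      2 * gradInner h f' f y + 2 * gradInner h f f' y := by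
    simp only [gradInner, gradOf, partialD_add hf hf', partialD_sub hf hf', mul_add, mul_sub,
      sum_add_distrib, sum_sub_distrib, add_mul, sub_mul]
    ring
  rw [h1, gradInner_comm hm f f']; ring

theorem gradInner_sum_left {κ : Type*} {s : Finset κ} {f : κ → (α → ℝ) → ℝ}
    (hf : ∀ p ∈ s, DiffAt (f p) y) (f' : (α → ℝ) → ℝ) :
    gradInner h (fun x => ∑ p ∈ s, f p x) f' y = ∑ p ∈ s, gradInner h (f p) f' y := by
  simp only [gradInner, partialD_sum hf, sum_mul]
  exact sum_comm

theorem laplaceOf_sum (hm : IsMetricAt h y) {κ : Type*} {s : Finset κ} {f : κ → (α → ℝ) → ℝ}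
    (hf : ∀ p ∈ s, SmoothAt (f p) y) :
    laplaceOf h (fun x => ∑ p ∈ s, f p x) y = ∑ p ∈ s, laplaceOf h (f p) y := by
  have h1 : ∀ c, gradOf h (fun x => ∑ p ∈ s, f p x) c =ᶠ[𝓝 y] fun x => ∑ p ∈ s, gradOf h (f p) c x := fun c => by
    have : ∀ᶠ x in 𝓝 y, ∀ p ∈ s, ContDiffAt ℝ 1 (f p) x := (Finset.eventually_all s).2 fun p hp =>
      ((hf p hp).of_le (by simp : (1 : WithTop ℕ∞) ≤ ∞)).eventually (by simp)
    filter_upwards [this] with x hx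
    simp only [gradOf, partialD_sum fun p hp => (hx p hp).diffAt, mul_sum]
    exact sum_comm
  simp only [laplaceOf, partialD_congr (h1 _), (h1 _).self_of_nhds,
    partialD_sum fun p hp => (contDiffAt_gradOf hm (hf p hp) _).diffAt, mul_sum]
  rw [sum_comm]
  refine sum_congr rfl fun c _ => ?_
  rw [sum_add_distrib, sum_comm]

/-- The divergence of a gradient with respect to a weighted volume. -/
theorem sum_partialD_weighted (hm : IsMetricAt h y) {W w : (α → ℝ) → ℝ} (hW : DiffAt W y)
    (hw : SmoothAt w y) :
    ∑ c, partialD c (fun x => √(h x).det * exp (W x) * gradOf h w c x) y =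
      √(h y).det * exp (W y) * (laplaceOf h w y + gradInner h W w y) := by
  have h1 : ∀ c, partialD c (fun x => √(h x).det * exp (W x) * gradOf h w c x) y =
      exp (W y) * partialD c (fun x => √(h x).det * gradOf h w c x) y +
      √(h y).det * exp (W y) * (partialD c W y * gradOf h w c y) := fun c => by
    have e1 : partialD c (fun x => exp (W x)) y = exp (W y) * partialD c W y := by
      rw [partialD, hW.hasFDerivAt.exp.fderiv]; rfl
    have e2 : DiffAt (fun x => √(h x).det * gradOf h w c x) y := by
      refine (((contDiffAt_matrix_det hm.smooth).sqrt hm.posDef.det_pos.ne').mul (contDiffAt_gradOf hm hw c)).diffAt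
    rw [partialD_congr (f' := fun x => exp (W x) * (√(h x).det * gradOf h w c x))
      (.of_forall fun x => by ring), partialD_mul hW.exp e2, e1]
    ring
  simp only [h1, sum_add_distrib, ← mul_sum]
  rw [← sqrt_det_mul_laplaceOf hm hw, gradInner]
  ring

end WeightedLaplacian

/-! ### The eigenfunction equation and the recursion for the scalar curvatures. -/

section Eigenfunctions

variable {N n k : ℕ} {S : Slicing N n} {Ω : Set (Amb N)}

namespace Slicing

/-- The potential of the quadratic form `Q_j`. -/
def formPotential (S : Slicing N n) (j : ℕ) (x : Amb N) : ℝ :=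
  3 / 8 * (S.tildeASq j x + 1 / (3 * (n : ℝ)) *
    ∑ p ∈ Finset.Ioc j n, (S.gradLogSq j p x + S.tildeASq p x)) - 1 / 2 * S.potential j x

/-- The integrand of the quadratic form `Q_j`. -/
def formDensity (S : Slicing N n) (j : ℕ) (φ : Amb N → ℝ) (x : Amb N) : ℝ :=
  S.rho (j + 1) x * (gradSq (S.leaf j) φ x + S.formPotential j x * φ x ^ 2)

/-- The function `log u_p`, in a chart. -/
def logU (S : Slicing N n) (e : Chart N) (i p : ℕ) (y : Fin i → ℝ) : ℝ :=
  log (S.u p (Ξ e i y))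

namespace IsMinimal

variable (hS : S.IsMinimal Ω k)
include hS

/-- A compact part of the regular set is covered by finitely many charts, in each of which the
integral is over a compact parameter set. -/
theorem integrableOn_reg {j : ℕ} (hj : j ∈ Icc k n) {f : Amb N → ℝ} (hf : ContinuousOn f (S.reg j))
    {K : Set (Amb N)} (hK : IsCompact K) (hKr : K ⊆ S.reg j) (h0 : ∀ x ∈ S.reg j \ K, f x = 0) :
    IntegrableOn f (S.reg j) μHE[j] := by
  obtain ⟨T, _, e, χ, h, -⟩ := exists_chartCover (L := S.leaf) (I := Icc j n) hK (p := fun _ => True) fun x hx => by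
      obtain ⟨e, h1, h2⟩ := hS.exists_flattens hj.1 hj.2 (hKr hx)
      exact ⟨e, h1, h2, trivial⟩
  exact (h.integral_eq_sum ⟨le_rfl, hj.2⟩ (hj.2.trans hS.dim_le) hK (fun x hx => (hKr hx).1)
    (hf.mono hKr)).1.of_forall_sdiff_eq_zero (hS.measurableSet_reg hj) h0

theorem contDiffAt_logU {j i p : ℕ} (hj : k ≤ j) {e : Chart N}
    (he : Flattens S.leaf (Icc j n) e) (hi : i ∈ Icc j n) (hp : p ∈ Icc i n) {y : Fin i → ℝ}
    (hy : y ∈ dom e i) : SmoothAt (S.logU e i p) y :=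
  hS.contDiffAt_comp_planeParam hj he hi hp.1 hp.2 (hS.contDiffOn_log_u ⟨hj.trans (hi.1.trans hp.1), hp.2⟩) hy

theorem scalarCurvature_warpedMetric {j i m : ℕ} (hj : k ≤ j) {e : Chart N}
    (he : Flattens S.leaf (Icc j n) e) (hi : i ∈ Icc j n) (him : i ≤ m) {y : Fin i → ℝ}
    (hy : y ∈ dom e i) : scalarCurvature (S.warpedMetric e i m) (Sum.elim y 0) = scalarCurvature (γ e i) y
      - 2 * ∑ p ∈ Finset.Ico m n, laplaceOf (γ e i) (S.logU e i p) y
      - ∑ p ∈ Finset.Ico m n, gradInner (γ e i) (S.logU e i p) (S.logU e i p) y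
      - ∑ p ∈ Finset.Ico m n, ∑ q ∈ Finset.Ico m n, gradInner (γ e i) (S.logU e i q) (S.logU e i p) y := by
  have hw := hS.isWeightAt hj he hi him hy
  have h1 := scalarCurvature_warpOf (z := Sum.elim y (0 : Finset.Ico m n → ℝ))
    (h := γ e i) (w := fun p : Finset.Ico m n => S.logU e i p)
    (he.isMetricAt (hi.2.trans hS.dim_le) hy) (by
      filter_upwards [dom_mem_nhds hy] with x hx p using hS.contDiffAt_logU hj he hi
        ⟨him.trans (Finset.mem_Ico.1 p.2).1, (Finset.mem_Ico.1 p.2).2.le⟩ hx)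
  have h2 := scalarCurvature_congr (blockOf_eventuallyEq_warpOf (h := γ e i)
    (z := Sum.elim y (0 : Finset.Ico m n → ℝ)) hw)
  rw [warpedMetric_eq_blockOf, h2]
  simp only [← Finset.sum_coe_sort (Finset.Ico m n)]
  exact h1

variable {j : ℕ} (hj : j ∈ Ico k n)
include hj

theorem continuousOn_formPotential : ContinuousOn (S.formPotential j) (S.reg j) := by
  have hji : j ∈ Icc k n := ⟨hj.1, hj.2.le⟩
  refine (continuousOn_const.mul ((hS.continuousOn_tildeASq hji).add (continuousOn_const.mul
    (continuousOn_finsetSum _ fun p hp => ?_)))).sub (continuousOn_const.mul (hS.continuousOn_potential hj))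
  have hp' := Finset.mem_Ioc.1 hp
  have hpi : p ∈ Icc k n := ⟨hj.1.trans hp'.1.le, hp'.2⟩
  exact (hS.continuousOn_gradSq hj.1 hp'.1.le hp'.2 (hS.contDiffOn_log_u hpi)).add
    ((hS.continuousOn_tildeASq hpi).mono (hS.reg_mono hj.1 hp'.1.le hp'.2))

/-- The deformation in the hypothesis is essential: without one, `secondVariation` takes its default
value `0`. With one, the second variation formula and the extra term of `Q_j` merge into a single
integral. -/
theorem Q_eq {F : ℝ → Amb N → Amb N} {K : Set (Amb N)} {φ : Amb N → ℝ} (hφ : ContDiffOn ℝ ∞ φ (S.reg j))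
    (dF : S.IsNormalVariation Ω j φ F K) : IntegrableOn (S.formDensity j φ) (S.reg j) μHE[j] ∧
      S.Q Ω j φ = ∫ x in S.reg j, S.formDensity j φ x ∂μHE[j] := by
  have hji : j ∈ Icc k n := ⟨hj.1, hj.2.le⟩
  have hC := hS.isCompact_leaf_inter hji dF.1.compact dF.1.subset
  have hCr : S.leaf j ∩ K ⊆ S.reg j := fun x hx => dF.2.1 ⟨hx.2, hx.1⟩
  have hρ := ((hS.contDiffOn_rho (hj.1.trans j.le_succ)).mono (hS.reg_mono hj.1 j.le_succ hj.2)).continuousOn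
  have h0 : ∀ x ∈ S.reg j \ (S.leaf j ∩ K), φ x = 0 ∧ gradSq (S.leaf j) φ x = 0 := fun x hx =>
    have hx' : x ∈ S.reg j \ K := ⟨hx.1, fun h => hx.2 ⟨hx.1.1, h⟩⟩
    ⟨hS.eq_zero_off hj dF hx', gradSq_eq_zero hx.1.1 (hS.eventuallyEq_zero_off hj dF hx')⟩
  have i1 : IntegrableOn (S.formDensity j φ) (S.reg j) μHE[j] := hS.integrableOn_reg hji (hρ.mul ((hS.continuousOn_gradSq hj.1 le_rfl hj.2.le hφ).add
    ((hS.continuousOn_formPotential hj).mul (hφ.continuousOn.pow 2)))) hC hCr fun x hx => by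
      simp [formDensity, (h0 x hx).1, (h0 x hx).2]
  have i2 := hS.integrableOn_reg hji (hS.continuousOn_secondVariation hj hφ) hC hCr fun x hx => by
      simp [(h0 x hx).1, (h0 x hx).2]
  refine ⟨i1, ?_⟩
  have e1 : ∫ x in S.reg j, (S.tildeASq j x + 1 / (3 * (n : ℝ)) *
      ∑ p ∈ Finset.Ioc j n, (S.gradLogSq j p x + S.tildeASq p x)) * φ x ^ 2 * S.rho (j + 1) x ∂μHE[j] =
      ∫ x in S.reg j, 8 / 3 * (S.formDensity j φ x - S.rho (j + 1) x *
        (gradSq (S.leaf j) φ x - 1 / 2 * S.potential j x * φ x ^ 2)) ∂μHE[j] := by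
    congr 1; ext x
    simp only [formDensity, formPotential]
    ring
  rw [Q, hS.secondVariation_eq hj hφ dF, e1, integral_const_mul, integral_sub i1 i2]
  ring

variable {e : Chart N} (he : Flattens S.leaf (Icc j n) e)
  (hF : IsFermiChart (S.nu j) j e) {y₀ : Fin j → ℝ} (hy₀ : y₀ ∈ dom e j)
include he hF hy₀

/-- The weak form of the eigenfunction equation, in a chart. -/
theorem exists_weak_equation : ∃ V : Set (Fin j → ℝ), IsOpen V ∧ y₀ ∈ V ∧ V ⊆ dom e j ∧
    ∀ ζ : (Fin j → ℝ) → ℝ, ContDiff ℝ ∞ ζ → HasCompactSupport ζ → tsupport ζ ⊆ V →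
      ∫ y in V, √(γ e j y).det * (S.rho (j + 1) (Ξ e j y) * (gradInner (γ e j) ζ (fun y => S.u j (Ξ e j y)) y +
          S.formPotential j (Ξ e j y) * (S.u j (Ξ e j y) * ζ y))) =
      S.lam j * ∫ y in V, √(γ e j y).det * (S.u j (Ξ e j y) * ζ y * S.rho (j + 1) (Ξ e j y)) := by
  have hji : j ∈ Icc k n := ⟨hj.1, hj.2.le⟩
  have hjI : j ∈ Icc j n := ⟨le_rfl, hj.2.le⟩
  have hjN := hj.2.le.trans hS.dim_le
  have hu : ∀ y ∈ dom e j, SmoothAt (fun y => S.u j (Ξ e j y)) y := fun y hy =>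
    hS.contDiffAt_comp_planeParam hj.1 he hjI le_rfl hj.2.le (hS.contDiffOn_u hji) hy
  obtain ⟨η, h1, h2, h3, h4, h5⟩ := hS.exists_chartCutoff hj he hy₀
  obtain ⟨η₀, g1, g2, g3, g4⟩ := exists_cutoff (dom_mem_nhds hy₀)
  obtain ⟨V, hV', hV, hyV⟩ := mem_nhds_iff.1 ((h5.and g4).and (dom_mem_nhds hy₀))
  have hVe : V ⊆ dom e j := fun y hy => (hV' hy).2
  refine ⟨V, hV, hyV, hVe, fun ζ hζ hζc hζV => ?_⟩
  -- The cutoff `η₀` makes the local expression of `u_j` smooth on the whole parameter space without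
  -- changing it near `y₀`.
  have hζ' : ContDiff ℝ ∞ fun y => η₀ y * S.u j (Ξ e j y) := contDiff_iff_contDiffAt.2 fun y => by
    by_cases hy : y ∈ dom e j
    · exact g1.contDiffAt.mul (hu y hy)
    · refine (contDiffAt_const (c := (0 : ℝ))).congr_of_eventuallyEq ?_
      filter_upwards [(isClosed_tsupport η₀).isOpen_compl.mem_nhds fun h => hy (g3 h)] with z hz
      rw [image_eq_zero_of_notMem_tsupport hz, zero_mul]
  set φ := chartTest e j η ζ with hφ
  set ψ := chartTest e j η (fun y => η₀ y * S.u j (Ξ e j y)) with hψ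
  have tφ : S.IsTest j φ := hS.isTest_chartTest hj he h1 h2 h3 h4 hζ
  have tψ : S.IsTest j ψ := hS.isTest_chartTest hj he h1 h2 h3 h4 hζ'
  have vφ : ∀ y ∈ V, φ (Ξ e j y) = ζ y := fun y hy => by
    rw [hφ, chartTest_planeParam hjN (hVe hy), (hV' hy).1.1, mul_one]
  have vψ : ∀ y ∈ V, ψ (Ξ e j y) = S.u j (Ξ e j y) := fun y hy => by
    rw [hψ, chartTest_planeParam hjN (hVe hy), (hV' hy).1.1, (hV' hy).1.2, one_mul, mul_one]
  have hK : IsCompact (Ξ e j '' tsupport ζ) := hζc.isCompact.image_of_continuousOn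
    (he.contDiffOn_planeParam.continuousOn.mono (hζV.trans hVe))
  have hK0 : ∀ x ∈ S.leaf j \ Ξ e j '' tsupport ζ, φ x = 0 :=
    hS.chartTest_eq_zero hj he fun y hy => image_eq_zero_of_notMem_tsupport hy.2
  have hV0 : ∀ x ∈ S.reg j \ Ξ e j '' V, x ∈ S.leaf j \ Ξ e j '' tsupport ζ :=
    fun x hx => ⟨hx.1.1, fun h => hx.2 (image_mono hζV h)⟩
  -- `Qbil` is defined by polarization, so deformations are needed for `ψ + φ` and `ψ - φ`. Both are
  -- chart functions, so both have one.
  obtain ⟨F₁, K₁, D₁, -⟩ := hS.isNormalVariation_chartTest hj he h1 h2 h3 h4 (hζ'.add hζ) hF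
  obtain ⟨F₂, K₂, D₂, -⟩ := hS.isNormalVariation_chartTest hj he h1 h2 h3 h4 (hζ'.sub hζ) hF
  have hadd : chartTest e j η (fun y => η₀ y * S.u j (Ξ e j y) + ζ y) = ψ + φ := chartTest_add
  have hsub : chartTest e j η (fun y => η₀ y * S.u j (Ξ e j y) - ζ y) = ψ - φ := chartTest_sub
  rw [hadd] at D₁
  rw [hsub] at D₂
  have t1 : ContDiffOn ℝ ∞ (ψ + φ) (S.reg j) := tψ.1.add tφ.1
  have t2 : ContDiffOn ℝ ∞ (ψ - φ) (S.reg j) := tψ.1.sub tφ.1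
  obtain ⟨i1, q1⟩ := hS.Q_eq hj t1 D₁
  obtain ⟨i2, q2⟩ := hS.Q_eq hj t2 D₂
  have hU : IsOpen (e.source ∩ e ⁻¹' (headCLM N j ⁻¹' V)) :=
    e.isOpen_inter_preimage (hV.preimage (headCLM N j).continuous)
  have key := (hS.eigenfunction j hj).equation φ ψ _ _ tφ tψ hK (image_subset_iff.2 fun y hy =>
    planeParam_mem_reg he hjI (hVe (hζV hy))) hK0 hU (image_subset_iff.2 fun y hy =>
      ⟨Flattens.planeParam_mem_source (hVe (hζV hy)), by
        change headCoords j (e (Ξ e j y)) ∈ V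
        rw [Flattens.headCoords_planeParam hjN (hVe (hζV hy))]; exact hζV hy⟩) fun x hx => by
      rw [← he.planeParam_head hjI hx.2.1 hx.1.1]
      exact vψ _ hx.2.2
  rw [Qbil, q1, q2, ← integral_sub i1 i2, ← integral_div, innerL2,
    hS.integral_reg_eq hji he hV hVe fun x hx => ?_, hS.integral_reg_eq hji he hV hVe fun x hx => ?_] at key
  · rw [(setIntegral_congr_fun hV.measurableSet fun y hy => by rw [vφ y hy] :
      ∫ y in V, √(γ e j y).det * (S.u j (Ξ e j y) * φ (Ξ e j y) * S.rho (j + 1) (Ξ e j y)) = _)] at key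
    rw [← key]
    refine setIntegral_congr_fun hV.measurableSet fun y hy => ?_
    have hVn := hV.mem_nhds hy
    have c1 := gradInner_congr (h := γ e j) (y := y)
      (f := fun y => (ψ + φ) (Ξ e j y)) (f' := fun y => (ψ + φ) (Ξ e j y))
      (f₁ := fun y => S.u j (Ξ e j y) + ζ y) (f₁' := fun y => S.u j (Ξ e j y) + ζ y)
      (by filter_upwards [hVn] with z hz using congrArg₂ _ (vψ z hz) (vφ z hz))
      (by filter_upwards [hVn] with z hz using congrArg₂ _ (vψ z hz) (vφ z hz))
    have c2 := gradInner_congr (h := γ e j) (y := y)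
      (f := fun y => (ψ - φ) (Ξ e j y)) (f' := fun y => (ψ - φ) (Ξ e j y))
      (f₁ := fun y => S.u j (Ξ e j y) - ζ y) (f₁' := fun y => S.u j (Ξ e j y) - ζ y)
      (by filter_upwards [hVn] with z hz using congrArg₂ (fun a b : ℝ => a - b) (vψ z hz) (vφ z hz))
      (by filter_upwards [hVn] with z hz using congrArg₂ (fun a b : ℝ => a - b) (vψ z hz) (vφ z hz))
    have c3 := gradInner_polarization (he.isMetricAt hjN (hVe hy)) ((hu y (hVe hy)).diffAt)
      (hζ.differentiable (by simp) y)
    simp only [formDensity]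
    rw [hS.gradSq_eq hj.1 he hjI le_rfl hj.2.le t1 (hVe hy),
      hS.gradSq_eq hj.1 he hjI le_rfl hj.2.le t2 (hVe hy), c1, c2, Pi.add_apply, Pi.sub_apply,
      vφ y hy, vψ y hy]
    linear_combination (-(√(γ e j y).det * S.rho (j + 1) (Ξ e j y) / 4)) * c3
  · rw [hK0 x (hV0 x hx)]; ring
  · have hx' := hV0 x hx
    -- Away from `V` the function `φ` vanishes near the point, so `ψ + φ` and `ψ - φ` have equal
    -- densities there and the difference is zero, although `ψ` need not vanish.
    have : φ =ᶠ[𝓝[S.leaf j] x] fun _ => (0 : ℝ) := by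
      filter_upwards [mem_nhdsWithin_of_mem_nhds (hK.isClosed.isOpen_compl.mem_nhds hx'.2),
        self_mem_nhdsWithin] with z hz hz' using hK0 z ⟨hz', hz⟩
    have h' : (ψ + φ) =ᶠ[𝓝[S.leaf j] x] (ψ - φ) := by
      filter_upwards [this] with z hz
      simp only [Pi.add_apply, Pi.sub_apply, hz, add_zero, sub_zero]
    have hg : gradSq (S.leaf j) (ψ + φ) x = gradSq (S.leaf j) (ψ - φ) x := by
      rw [gradSq, gradSq, h'.fderivWithin_eq (h'.eq_of_nhdsWithin hx'.1)]
    simp only [formDensity, hg, Pi.add_apply, Pi.sub_apply, hK0 x hx']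
    ring

omit hF hy₀ in
theorem exp_sum_logU {y : Fin j → ℝ} (hy : y ∈ dom e j) : exp (∑ p ∈ Finset.Ico j n, S.logU e j p y) =
      S.u j (Ξ e j y) * S.rho (j + 1) (Ξ e j y) := by
  have hr := planeParam_mem_reg he ⟨le_rfl, hj.2.le⟩ hy
  have h1 := hS.rho_eq_prod ⟨hj.1, hj.2.le⟩ hr
  rw [rho, ← Finset.mul_prod_Ioc_eq_prod_Icc hj.2.le, show Finset.Ioc j n = Finset.Icc (j + 1) n by ext; simp] at h1
  refine Eq.trans ?_ h1.symm
  rw [Real.exp_sum, Finset.prod_coe_sort (Finset.Ico j n) fun p => S.u p (Ξ e j y)]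
  refine Finset.prod_congr rfl fun p hp => Real.exp_log ?_
  have hp' := Finset.mem_Ico.1 hp
  exact hS.u_pos ⟨hj.1.trans hp'.1, hp'.2.le⟩ (hS.reg_mono hj.1 hp'.1 hp'.2.le hr)

/-- The eigenfunction equation, in a chart. -/
theorem laplace_logU_eq : laplaceOf (γ e j) (S.logU e j j) y₀ +
    ∑ q ∈ Finset.Ico j n, gradInner (γ e j) (S.logU e j q) (S.logU e j j) y₀ =
      S.formPotential j (Ξ e j y₀) - S.lam j := by
  have hji : j ∈ Icc k n := ⟨hj.1, hj.2.le⟩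
  have hjI : j ∈ Icc j n := ⟨le_rfl, hj.2.le⟩
  have hjN := hj.2.le.trans hS.dim_le
  obtain ⟨V, hV, hyV, hVe, key⟩ := hS.exists_weak_equation hj he hF hy₀
  set h := γ e j with hh
  set w := S.logU e j j with hw
  -- The exponential of `W` is `u_j ρ_{j+1}`, by `exp_sum_logU`.
  set W : (Fin j → ℝ) → ℝ := fun y => ∑ p ∈ Finset.Ico j n, S.logU e j p y with hW
  have hm := fun y (hy : y ∈ V) => he.isMetricAt hjN (hVe hy)
  have hws := fun y (hy : y ∈ V) => hS.contDiffAt_logU hj.1 he hjI ⟨le_rfl, hj.2.le⟩ (hVe hy)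
  have hls : ∀ y ∈ V, ∀ p ∈ Finset.Ico j n, SmoothAt (S.logU e j p) y := fun y hy p hp =>
    hS.contDiffAt_logU hj.1 he hjI ⟨(Finset.mem_Ico.1 hp).1, (Finset.mem_Ico.1 hp).2.le⟩ (hVe hy)
  have hWs : ∀ y ∈ V, SmoothAt W y := fun y hy => ContDiffAt.sum fun p hp => hls y hy p hp
  have hdet : ∀ y ∈ V, SmoothAt (fun y => √(h y).det) y := fun y hy =>
    (contDiffAt_matrix_det (hm y hy).smooth).sqrt (hm y hy).posDef.det_pos.ne'
  have hms : ∀ y ∈ V, SmoothAt (fun y => √(h y).det * exp (W y)) y := fun y hy =>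
    (hdet y hy).mul (hWs y hy).exp
  set Dv : Fin j → (Fin j → ℝ) → ℝ := fun a y => √(h y).det * exp (W y) * gradOf h w a y with hDv
  have hDs : ∀ a, ∀ y ∈ V, SmoothAt (Dv a) y := fun a y hy =>
    (hms y hy).mul (contDiffAt_gradOf (hm y hy) (hws y hy) a)
  have hpot : ContinuousOn (fun y => S.formPotential j (Ξ e j y)) V :=
    (hS.continuousOn_formPotential hj).comp (he.contDiffOn_planeParam.continuousOn.mono hVe)
      fun y hy => planeParam_mem_reg he hjI (hVe hy)
  have hDc := fun a => show ContinuousOn (partialD a (Dv a)) V from fun y hy =>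
    (contDiffAt_partialD (hDs a y hy) a).continuousAt.continuousWithinAt
  have hmc : ContinuousOn (fun y => √(h y).det * exp (W y)) V := fun y hy =>
    (hms y hy).continuousAt.continuousWithinAt
  -- As `ρ_{j+1} ∇u_j = exp(W) ∇log u_j`, the weak equation is in divergence form for `log u_j`. The
  -- fundamental lemma makes it pointwise.
  have h0 := eq_zero_of_forall_integral_eq_zero hV (M := fun y => √(h y).det * exp (W y) *
    (S.formPotential j (Ξ e j y) - S.lam j) - ∑ a, partialD a (Dv a) y)
    ((hmc.mul (hpot.sub continuousOn_const)).sub (continuousOn_finsetSum _ fun a _ => hDc a))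
    (fun ζ hζ hζc hζV => ?_) hyV
  · have h1 := sum_partialD_weighted (hm y₀ hyV) ((hWs y₀ hyV).diffAt) (hws y₀ hyV)
    rw [hW, gradInner_sum_left fun p hp => (hls y₀ hyV p hp).diffAt] at h1
    have h2 : 0 < √(h y₀).det * exp (W y₀) :=
      mul_pos (Real.sqrt_pos.2 (hm y₀ hyV).posDef.det_pos) (Real.exp_pos _)
    refine mul_left_cancel₀ h2.ne' (h1.symm.trans ?_)
    linarith
  · have hint : ∀ f : (Fin j → ℝ) → ℝ, ContinuousOn f V → (∀ y ∉ tsupport ζ, f y = 0) → IntegrableOn f V :=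
      fun f hf hf0 => ((hf.mono hζV).integrableOn_compact hζc.isCompact).of_forall_sdiff_eq_zero
        hV.measurableSet fun y hy => hf0 y hy.2
    have z0 : ∀ y ∉ tsupport ζ, ζ y = 0 := fun y hy => image_eq_zero_of_notMem_tsupport hy
    have z1 : ∀ a, ∀ y ∉ tsupport ζ, partialD a ζ y = 0 := fun a y hy => by
      rw [partialD_congr (f' := fun _ => 0) (by
        filter_upwards [(isClosed_tsupport ζ).isOpen_compl.mem_nhds hy] with z hz using z0 z hz),
        partialD_const]
    have hζn := fun y => hζ.contDiffAt (x := y)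
    have hζ1 := fun a => show ContinuousOn (partialD a ζ) V from fun y _ =>
      (contDiffAt_partialD (hζn y) a).continuousAt.continuousWithinAt
    have hDn := fun a => show ContinuousOn (Dv a) V from fun y hy => (hDs a y hy).continuousAt.continuousWithinAt
    have hζDv : ∀ a, ∀ y ∈ V, partialD a (fun y => ζ y * Dv a y) y =
        partialD a ζ y * Dv a y + ζ y * partialD a (Dv a) y := fun a y hy =>
      partialD_mul ((hζn y).diffAt) ((hDs a y hy).diffAt) a
    have e1 : ∀ a, ∫ y in V, (partialD a ζ y * Dv a y + ζ y * partialD a (Dv a) y) = 0 := fun a => by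
      rw [← setIntegral_congr_fun hV.measurableSet (hζDv a)]
      exact setIntegral_partialD_eq_zero hV hζc.isCompact hζV (fun y hy =>
        ((hζn y).mul (hDs a y hy)).of_le (by simp)) (fun y hy => by rw [z0 y hy.2, zero_mul]) a
    have i1 : IntegrableOn (fun y => ∑ a, partialD a ζ y * Dv a y + √(h y).det * exp (W y) *
        S.formPotential j (Ξ e j y) * ζ y) V := hint _
      ((continuousOn_finsetSum _ fun a _ => (hζ1 a).mul (hDn a)).add
        ((hmc.mul hpot).mul hζ.continuous.continuousOn)) fun y hy => by simp [z0 y hy, z1 _ y hy]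
    have i2 : IntegrableOn (fun y => S.lam j * (√(h y).det * exp (W y) * ζ y)) V := hint _
      (continuousOn_const.mul (hmc.mul hζ.continuous.continuousOn)) fun y hy => by simp [z0 y hy]
    have i3 : ∀ a, IntegrableOn (fun y => partialD a ζ y * Dv a y + ζ y * partialD a (Dv a) y) V := fun a =>
      hint _ (((hζ1 a).mul (hDn a)).add (hζ.continuous.continuousOn.mul (hDc a)))
        fun y hy => by simp [z0 y hy, z1 a y hy]
    have e2 := integral_sub (i1.sub i2) (integrable_finsetSum Finset.univ fun a _ => i3 a)
    rw [integral_finsetSum _ fun a _ => i3 a, sum_congr rfl fun a _ => e1 a, sum_const_zero, sub_zero] at e2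
    have e3 := integral_sub i1 i2
    rw [integral_const_mul] at e3
    have e4 : ∫ y in V, (∑ a, partialD a ζ y * Dv a y + √(h y).det * exp (W y) *
        S.formPotential j (Ξ e j y) * ζ y) = S.lam j * ∫ y in V, √(h y).det * exp (W y) * ζ y := by
      refine Eq.trans (setIntegral_congr_fun hV.measurableSet fun y hy => ?_) ((key ζ hζ hζc hζV).trans
        (congrArg _ (setIntegral_congr_fun hV.measurableSet fun y hy => ?_)))
      · have hupos := hS.u_pos hji (planeParam_mem_reg he hjI (hVe hy))
        have hu : DiffAt (fun y => S.u j (Ξ e j y)) y :=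
          (hS.contDiffAt_comp_planeParam hj.1 he hjI le_rfl hj.2.le (hS.contDiffOn_u hji) (hVe hy)).diffAt
        have hl : ∀ d, partialD d (fun y => S.u j (Ξ e j y)) y = S.u j (Ξ e j y) * partialD d w y := fun d => by
          have : D w y = _ := (hu.hasFDerivAt.log hupos.ne').fderiv
          rw [partialD, partialD, this, smul_apply, smul_eq_mul, mul_inv_cancel_left₀ hupos.ne']
        have hg : gradInner h ζ (fun y => S.u j (Ξ e j y)) y =
            S.u j (Ξ e j y) * ∑ a, partialD a ζ y * gradOf h w a y := by
          simp only [gradInner, gradOf, hl, mul_sum]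
          exact sum_congr rfl fun a _ => sum_congr rfl fun b _ => by ring
        have hs : ∑ a, partialD a ζ y * Dv a y = √(h y).det * exp (W y) * ∑ a, partialD a ζ y * gradOf h w a y := by
          rw [mul_sum]
          exact sum_congr rfl fun a _ => by simp only [hDv]; ring
        have hE : exp (W y) = _ := hS.exp_sum_logU hj he (hVe hy)
        rw [hs, hg, hE]
        ring
      · have hE : exp (W y) = _ := hS.exp_sum_logU hj he (hVe hy)
        rw [hE]
        ring
    rw [e4, sub_self] at e3
    rw [← e2.trans e3]
    refine setIntegral_congr_fun hV.measurableSet fun y hy => ?_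
    simp only [Pi.sub_apply, sum_add_distrib, mul_sub, mul_sum]
    ring

omit he hF hy₀ in
/-- The recursion for the scalar curvatures of the warped products. -/
theorem scalHat_eq_succ {x : Amb N} (hx : x ∈ S.reg j) : S.scalHat j x = S.scalHat (j + 1) x +
    2 * S.lam j + 1 / 4 * (S.tildeASq j x - 1 / (n : ℝ) *
      ∑ q ∈ Finset.Ioc j n, (S.gradLogSq j q x + S.tildeASq q x)) := by
  have hjI : j ∈ Icc j n := ⟨le_rfl, hj.2.le⟩
  obtain ⟨e, hxe, he, hF⟩ := hS.exists_isFermiChart hj hx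
  have hy := he.head_mem hjI hxe hx.1
  have hm := he.isMetricAt (hj.2.le.trans hS.dim_le) hy
  have h1 := hS.laplace_logU_eq hj he hF hy
  rw [he.planeParam_head hjI hxe hx.1, sum_eq_sum_Ico_succ_bot hj.2] at h1
  have h2 := hS.scalarCurvature_warpedMetric hj.1 he hjI le_rfl hy
  have h3 := hS.scalarCurvature_warpedMetric hj.1 he hjI j.le_succ hy
  rw [← hS.scalHat_eq hj.1 he hjI hxe hx.1] at h2
  rw [← hS.scalMid_eq hj.1 hj.2.le he hxe hx.1] at h3
  -- Splitting off `p = j` in the warped product formula shows that `R̂_j - R̃_j` is `-2` times the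
  -- left side of the eigenfunction equation.
  simp only [sum_eq_sum_Ico_succ_bot hj.2, sum_add_distrib] at h2
  have h4 : ∑ p ∈ Finset.Ico (j + 1) n, gradInner (γ e j) (S.logU e j j)
      (S.logU e j p) (headCoords j (e x)) = ∑ p ∈ Finset.Ico (j + 1) n,
      gradInner (γ e j) (S.logU e j p) (S.logU e j j) (headCoords j (e x)) :=
    sum_congr rfl fun p _ => gradInner_comm hm _ _
  have h5 : S.potential j x = S.scalHat (j + 1) x - S.scalMid j x + S.tildeASq j x := rfl
  have h6 : 1 / (3 * (n : ℝ)) = 1 / 3 * (1 / n) := by rw [one_div_mul_one_div]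
  -- In `-2` times the potential of `Q_j`, the scalar curvature `R̃_j` cancels, `|Ã_j|²` has
  -- coefficient `1 - 3/4`, and the remaining sum has coefficient `-(3/4) / (3n)`.
  rw [formPotential, h6] at h1
  linarith

end IsMinimal

end Slicing

end Eigenfunctions

/-! ### Fibre curvatures and the lower bound of the error term. -/

section FermiGradients

open scoped MatrixOrder

variable {κ ι P : Type} [Fintype κ] [DecidableEq κ] [Fintype ι] [DecidableEq ι] [Fintype P]
  [DecidableEq P] {h : (ι → ℝ) → Matrix ι ι ℝ} {U : P → (ι → ℝ) → ℝ} {emb : κ → ι} {s₀ : ι} {y : κ → ℝ}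

/-- The unit normal is orthogonal to the hypersurface, so the gradient splits by Pythagoras. -/
theorem IsFermiAt.gradInner_self (F : IsFermiAt h emb s₀ y) {f : (ι → ℝ) → ℝ}
    (hf : DiffAt f (incl emb y)) :
    gradInner h f f (incl emb y) = gradInner (restr h emb) (fun x => f (incl emb x))
      (fun x => f (incl emb x)) y + partialD s₀ f (incl emb y) ^ 2 := by
  simp only [gradInner, gradOf, F.hyper.sum_eq, F.inv_ab, F.inv_as, F.inv_sa, F.inv_ss,
    partialD_comp_incl F.hyper hf, zero_mul, zero_add, sum_const_zero, add_zero, one_mul]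
  ring

/-- For `M = Bᴴ B` the trace is that of `Xᴴ X` with `X = B k Bᴴ`, by cyclicity. -/
theorem Matrix.PosSemidef.trace_mul_mul_mul_nonneg {M k : Matrix κ κ ℝ} (hM : M.PosSemidef)
    (hk : k.conjTranspose = k) : 0 ≤ (M * k * (M * k)).trace := by
  obtain ⟨B, rfl⟩ := CStarAlgebra.nonneg_iff_eq_star_mul_self.mp hM.nonneg
  rw [Matrix.star_eq_conjTranspose]
  have h1 := (Matrix.posSemidef_conjTranspose_mul_self (B * k * B.conjTranspose)).trace_nonneg
  rw [Matrix.conjTranspose_mul, Matrix.conjTranspose_mul, Matrix.conjTranspose_conjTranspose, hk] at h1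
  have h2 : B * (k * B.conjTranspose) * (B * k * B.conjTranspose) =
      B * (k * B.conjTranspose * B * k * B.conjTranspose) := by simp only [Matrix.mul_assoc]
  rw [h2, trace_mul_comm] at h1
  have h3 : k * B.conjTranspose * B * k * B.conjTranspose * B =
      k * (B.conjTranspose * B * (k * (B.conjTranspose * B))) := by simp only [Matrix.mul_assoc]
  rw [h3, trace_mul_comm] at h1
  have h4 : B.conjTranspose * B * k * (B.conjTranspose * B * k) =
      B.conjTranspose * B * (k * (B.conjTranspose * B)) * k := by simp only [Matrix.mul_assoc]
  rwa [h4]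

/-- The part of the second fundamental form of a warped product in the direction of the fibres. -/
theorem IsFermiAt.sum_sq_le_secondFundNormSq (F : IsFermiAt h emb s₀ y) (hU : IsWeightAt U (incl emb y)) :
    ∑ p, partialD s₀ (fun x => log (U p x)) (incl emb y) ^ 2 ≤
      secondFundNormSq (blockOf h U) (Sum.map emb id) (single (inl s₀) 1)
        (incl (Sum.map emb id : κ ⊕ P → ι ⊕ P) (Sum.elim y 0)) := by
  set z : (κ ⊕ P) → ℝ := Sum.elim y 0
  have hb : base (incl (Sum.map emb id : κ ⊕ P → ι ⊕ P) z) = incl emb y :=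
    base_incl F.hyper z
  have F' : IsFermiAt (blockOf h U) (Sum.map emb id) (inl s₀) z := isFermiAt_blockOf F hU
  set w : P → (ι → ℝ) → ℝ := fun p x => log (U p x)
  have hw : ∀ p, DiffAt (w p) (incl emb y) := fun p =>
    (((hU.self_of_nhds p).1.log (hU.self_of_nhds p).2.ne').diffAt)
  -- The normal derivative of the warped metric is block diagonal, and its fibre entries are `∂_s
  -- U_p² = 2 U_p² ∂_s log U_p`.
  have hk : nDeriv (blockOf h U) (Sum.map emb id) (inl s₀) z = fromBlocks (nDeriv h emb s₀ y) 0 0 (diagonal fun p =>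
        2 * U p (incl emb y) ^ 2 * partialD s₀ (w p) (incl emb y)) := by
    have e : blockOf h U =ᶠ[𝓝 (incl (Sum.map emb id) z)] warpOf h w :=
      blockOf_eventuallyEq_warpOf (by rw [hb]; exact hU)
    ext a b
    rw [nDeriv, of_apply, partialD_congr (e.mono fun x hx => by rw [hx])]
    rcases a with a | p <;> rcases b with b | q
    · exact (partialD_warpOf_inl_inl _ _ _).trans (by rw [hb]; rfl)
    · exact partialD_warpOf_inl_inr _ _ _
    · exact partialD_warpOf_inr_inl _ _ _
    · refine (partialD_warpOf_inr_inr (by rw [hb]; exact hw) _ _ _).trans ?_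
      rw [hb, fromBlocks_apply₂₂, diagonal_apply]
      simp only [w, Real.exp_log (hU.self_of_nhds _).2]
      rfl
  have hH : (restr (blockOf h U) (Sum.map emb id) z)⁻¹ = fromBlocks (restr h emb y)⁻¹ 0 0
      (diagonal fun p => (U p (incl emb y) ^ 2)⁻¹) := by
    rw [restr_blockOf F.hyper]
    refine Matrix.inv_eq_right_inv ?_
    rw [blockOf, Matrix.fromBlocks_multiply]
    simp only [Matrix.mul_zero, Matrix.zero_mul, add_zero, zero_add, Matrix.diagonal_mul_diagonal]
    rw [← Matrix.fromBlocks_one]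
    congr 1
    · exact mul_nonsing_inv _ F.hyper_metric.isUnit_det
    · rw [← Matrix.diagonal_one]
      congr 1; ext p
      exact mul_inv_cancel₀ (pow_pos (hU.self_of_nhds p).2 2).ne'
  have h0 := F.hyper_metric.posDef.inv.posSemidef.trace_mul_mul_mul_nonneg (k := nDeriv h emb s₀ y)
    (by ext a b; exact F.nDeriv_comm b a)
  have h1 : ∀ p, (U p (incl emb y) ^ 2)⁻¹ * (2 * U p (incl emb y) ^ 2 *
      partialD s₀ (w p) (incl emb y)) = 2 * partialD s₀ (w p) (incl emb y) := fun p => by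
    have := (hU.self_of_nhds p).2.ne'
    field_simp
  have h2 : ∑ p, 2 * partialD s₀ (w p) (incl emb y) * (2 * partialD s₀ (w p) (incl emb y)) =
      4 * ∑ p, partialD s₀ (w p) (incl emb y) ^ 2 := by
    rw [mul_sum]
    exact sum_congr rfl fun p _ => by ring
  rw [F'.secondFundNormSq_eq, hk, hH, mul_assoc (_ * _)]
  simp only [Matrix.fromBlocks_multiply, Matrix.mul_zero, Matrix.zero_mul, add_zero, zero_add,
    Matrix.diagonal_mul_diagonal, h1]
  rw [trace, Fintype.sum_sum_type]
  simp only [diag_apply, fromBlocks_apply₁₁, fromBlocks_apply₂₂, Matrix.diagonal_apply_eq, h2]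
  -- The base block contributes a nonnegative trace, which is dropped; the fibre block gives exactly
  -- the sum of squares.
  exact (fun t ht => by linarith : ∀ t : ℝ, 0 ≤ t → ∑ p, partialD s₀ (w p) (incl emb y) ^ 2 ≤
    1 / 4 * (t + 4 * ∑ p, partialD s₀ (w p) (incl emb y) ^ 2)) _ h0

/-- The elementary inequality behind the lower bound of the scalar curvature. -/
theorem sum_sub_sum_div_ge {n k : ℕ} (hkn : k < n) {A : ℕ → ℝ} {G : ℕ → ℕ → ℝ}
    (hA : ∀ p ∈ Ico k n, 0 ≤ A p) (hAn : A n = 0) (hG : ∀ p ∈ Icc k n, ∀ q, 0 ≤ G p q)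
    (hAG : ∀ r ∈ Ico k n, ∑ q ∈ Finset.Ioc r n, (G (r + 1) q - G r q) ≤ A r) :
    -∑ q ∈ Finset.Ioc k n, G k q ≤ ∑ p ∈ Finset.Ico k n, (A p - 1 / (n : ℝ) * ∑ q ∈ Finset.Ioc p n, (G p q + A q)) := by
  set T := ∑ p ∈ Finset.Ico k n, A p with hT
  set B := ∑ q ∈ Finset.Ioc k n, G k q with hB
  have hT0 : 0 ≤ T := sum_nonneg fun p hp => hA p (Finset.mem_Ico.1 hp)
  have hB0 : 0 ≤ B := sum_nonneg fun q _ => hG k ⟨le_rfl, hkn.le⟩ q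
  -- Telescoping: each passage from one leaf to the next costs at most `A r`.
  have h1 : ∀ p, k ≤ p → p ≤ n → ∑ q ∈ Finset.Ioc p n, G p q ≤ B + ∑ r ∈ Finset.Ico k p, A r := by
    intro p hp
    induction p, hp using Nat.le_induction with
    | base => intro _; simp [hB]
    | succ p hp ih =>
      intro hpn
      have e1 := hAG p ⟨hp, hpn⟩
      have e2 : ∑ q ∈ Finset.Ioc (p + 1) n, G (p + 1) q ≤ ∑ q ∈ Finset.Ioc p n, G (p + 1) q :=
        Finset.sum_le_sum_of_subset_of_nonneg (Finset.Ioc_subset_Ioc_left p.le_succ)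
          fun q _ _ => hG _ ⟨hp.trans p.le_succ, hpn⟩ q
      rw [sum_sub_distrib] at e1
      rw [Finset.sum_Ico_succ_top hp]
      linarith [ih (by omega)]
  -- The terms `A r` with `r < p` come from telescoping and those with `q > p` from the sum itself.
  -- Together they are `T` without the nonnegative `A p`.
  have h2 : ∀ p ∈ Finset.Ico k n, ∑ q ∈ Finset.Ioc p n, (G p q + A q) ≤ B + T := by
    intro p hp
    have hp' := Finset.mem_Ico.1 hp
    have e1 : Finset.Ioc p n = insert n (Finset.Ico (p + 1) n) := by ext; simp; omega
    have e2 : ∑ q ∈ Finset.Ioc p n, A q = ∑ q ∈ Finset.Ico (p + 1) n, A q := by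
      rw [e1, sum_insert (by simp), hAn, zero_add]
    have e3 := Finset.sum_Ico_consecutive A hp'.1 hp'.2.le
    rw [sum_eq_sum_Ico_succ_bot hp'.2] at e3
    rw [sum_add_distrib, e2]
    linarith [h1 p hp'.1 hp'.2.le, hA p hp']
  have hn : (0 : ℝ) < n := by exact_mod_cast (Nat.zero_le k).trans_lt hkn
  have h3 : ∑ p ∈ Finset.Ico k n, (A p - 1 / (n : ℝ) * (B + T)) ≤
      ∑ p ∈ Finset.Ico k n, (A p - 1 / (n : ℝ) * ∑ q ∈ Finset.Ioc p n, (G p q + A q)) :=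
    Finset.sum_le_sum fun p hp => sub_le_sub_left (mul_le_mul_of_nonneg_left (h2 p hp) (by positivity)) _
  rw [sum_sub_distrib, Finset.sum_const, Nat.card_Ico, nsmul_eq_mul, Nat.cast_sub hkn.le] at h3
  -- There are `n - k` summands, each with the factor `1/n`.
  have h4 : ((n : ℝ) - k) * (1 / n * (B + T)) ≤ B + T := by
    rw [← mul_assoc, mul_one_div]
    refine mul_le_of_le_one_left (by positivity) ((div_le_one hn).2 ?_)
    linarith [(Nat.cast_nonneg k : (0 : ℝ) ≤ k)]
  linarith

end FermiGradients

/-! ### The scalar curvature formula and the lower bound. -/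

section ScalarCurvatureBounds

variable {N n k : ℕ} {S : Slicing N n} {Ω : Set (Amb N)}

namespace Slicing.IsMinimal

variable (hS : S.IsMinimal Ω k)
include hS

/-- The recursion is summed from the top, where there are no circles and `R̂_n = R_n`. -/
theorem scalHat_eq_sum {j : ℕ} (hj : j ∈ Icc k n) {x : Amb N} (hx : x ∈ S.reg j) :
    S.scalHat j x = S.scal n x + 2 * ∑ p ∈ Finset.Ico j n, S.lam p
      + (1 / 4) * ∑ p ∈ Finset.Ico j n, (S.tildeASq p x - (1 / (n : ℝ)) *
          ∑ q ∈ Finset.Ioc p n, (S.gradLogSq p q x + S.tildeASq q x)) := by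
  obtain ⟨d, hd⟩ : ∃ d, n = j + d := ⟨n - j, by have := hj.2; omega⟩
  induction d generalizing j with
  | zero =>
    obtain rfl : n = j := hd
    obtain ⟨e, hxe, he⟩ := hS.exists_flattens hj.1 le_rfl hx
    have h1 := hS.scalarCurvature_warpedMetric hj.1 he ⟨le_rfl, le_rfl⟩ le_rfl (he.head_mem ⟨le_rfl, le_rfl⟩ hxe hx.1)
    rw [hS.scalHat_eq hj.1 he ⟨le_rfl, le_rfl⟩ hxe hx.1, h1, hS.scal_eq hj.1 he ⟨le_rfl, le_rfl⟩ hxe hx.1]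
    simp
  | succ d ih =>
    have hjn : j < n := by omega
    rw [hS.scalHat_eq_succ ⟨hj.1, hjn⟩ hx, ih ⟨hj.1.trans j.le_succ, hjn⟩
      (hS.reg_mono hj.1 j.le_succ hjn hx) (by omega), sum_eq_sum_Ico_succ_bot hjn,
      sum_eq_sum_Ico_succ_bot hjn]
    ring

theorem gradLogSq_eq {j i q : ℕ} (hj : k ≤ j) {e : Chart N}
    (he : Flattens S.leaf (Icc j n) e) (hi : i ∈ Icc j n) (hq : q ∈ Icc i n) {y : Fin i → ℝ}
    (hy : y ∈ dom e i) : S.gradLogSq i q (Ξ e i y) = gradInner (γ e i) (S.logU e i q) (S.logU e i q) y :=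
  hS.gradSq_eq hj he hi hq.1 hq.2 (hS.contDiffOn_log_u ⟨hj.trans (hi.1.trans hq.1), hq.2⟩) hy

theorem gradLogSq_top {j : ℕ} (hj : j ∈ Icc k n) {x : Amb N} (hx : x ∈ S.leaf j) : S.gradLogSq j n x = 0 := by
  have hsub : ∀ p ≤ n, j ≤ p → S.leaf j ⊆ S.leaf p := fun p hp hjp => by
    induction p, hjp using Nat.le_induction with
    | base => exact subset_rfl
    | succ p hjp ih => exact (ih (by omega)).trans (hS.nested p ⟨hj.1.trans hjp, hp⟩)
  refine gradSq_eq_zero hx ?_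
  filter_upwards [self_mem_nhdsWithin] with z hz
  rw [hS.u_top z (hsub n le_rfl hj.2 hz), Real.log_one]

theorem sum_sq_le_tildeASq {r : ℕ} (hr : r ∈ Ico k n) {e : Chart N}
    (he : Flattens S.leaf (Icc r n) e) (hF : IsFermiChart (S.nu r) r e) {y : Fin r → ℝ}
    (hy : y ∈ dom e r) (hfer : IsFermiAt (γ e (r + 1)) castSucc (last r) y) :
    ∑ q ∈ Finset.Ico (r + 1) n, partialD (last r) (S.logU e (r + 1) q) (incl castSucc y) ^ 2 ≤
      S.tildeASq r (Ξ e r y) := by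
  have h1 := hfer.sum_sq_le_secondFundNormSq (hS.isWeightAt hr.1 he ⟨r.le_succ, hr.2⟩ le_rfl (incl_mem_dom.2 hy))
  rw [← warpedMetric_eq_blockOf, ← hS.tildeASq_eq hr he hF hy] at h1
  rw [← Finset.sum_coe_sort (Finset.Ico (r + 1) n)]
  exact h1

/-- The second fundamental form controls the change of `|∇ log u_q|²` between leaves. -/
theorem sum_gradLogSq_sub_le {r : ℕ} (hr : r ∈ Ico k n) {x : Amb N} (hx : x ∈ S.reg r) :
    ∑ q ∈ Finset.Ioc r n, (S.gradLogSq (r + 1) q x - S.gradLogSq r q x) ≤ S.tildeASq r x ∧ 0 ≤ S.tildeASq r x := by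
  have hrI : r ∈ Icc r n := ⟨le_rfl, hr.2.le⟩
  have hrI' : r + 1 ∈ Icc r n := ⟨r.le_succ, hr.2⟩
  obtain ⟨e, hxe, he, hF⟩ := hS.exists_isFermiChart hr hx
  obtain ⟨y, hy, rfl⟩ : ∃ y ∈ dom e r, Ξ e r y = x :=
    ⟨_, he.head_mem hrI hxe hx.1, he.planeParam_head hrI hxe hx.1⟩
  have hye := incl_mem_dom.2 hy
  have hfer := hF.isFermiAt he hrI (hrI'.2.trans hS.dim_le)
    (fun y hy => hS.nu_unit r hr _ (planeParam_mem_reg he hrI hy))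
    (fun y hy => hS.nu_normal r hr _ (planeParam_mem_reg he hrI hy)) hy
  have key := hS.sum_sq_le_tildeASq hr he hF hy hfer
  refine ⟨?_, (sum_nonneg fun _ _ => sq_nonneg _).trans key⟩
  -- The term `q = n` vanishes because `u_n = 1`; the other indices are those of the circles over
  -- `Σ_{r+1}`.
  rw [show Finset.Ioc r n = insert n (Finset.Ico (r + 1) n) by
      ext; have := hr.2; simp; omega, sum_insert (by simp), hS.gradLogSq_top ⟨hr.1, hr.2.le⟩ hx.1,
    hS.gradLogSq_top ⟨hr.1.trans r.le_succ, hr.2⟩ (hS.nested r hr hx.1), sub_zero, zero_add]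
  refine Eq.trans_le (sum_congr rfl fun q hq => ?_) key
  have hq := Finset.mem_Ico.1 hq
  have h1 := hS.gradLogSq_eq hr.1 he hrI' ⟨hq.1, hq.2.le⟩ hye
  rw [hfer.gradInner_self ((hS.contDiffAt_logU hr.1 he hrI' ⟨hq.1, hq.2.le⟩ hye).diffAt), planeParam_incl] at h1
  have h2 : (fun x => S.logU e (r + 1) q (incl castSucc x)) = S.logU e r q :=
    funext fun x => by simp only [logU, planeParam_incl]
  rw [h2] at h1
  rw [h1, hS.gradLogSq_eq hr.1 he hrI ⟨r.le_succ.trans hq.1, hq.2.le⟩ hy]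
  simp only [gradInner, gradOf, restr_inducedMetric he hy]
  ring

variable {κ : ℝ} (hκ : ∀ x ∈ S.leaf n, κ ≤ S.scal n x) (hkn : k < n)
include hκ hkn

/-- The eigenvalues are nonnegative, and the elementary inequality bounds the remaining sum by the
gradients on the bottom leaf. -/
theorem scalHat_ge {x : Amb N} (hx : x ∈ S.reg k) :
    κ - 1 / 4 * ∑ q ∈ Finset.Ioc k n, S.gradLogSq k q x ≤ S.scalHat k x := by
  have hr : ∀ r, k ≤ r → r ≤ n → x ∈ S.reg r := fun r h1 h2 => hS.reg_mono le_rfl h1 h2 hx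
  have h1 := sum_sub_sum_div_ge hkn (A := fun p => S.tildeASq p x) (G := fun p q => S.gradLogSq p q x)
    (fun p hp => (hS.sum_gradLogSq_sub_le hp (hr p hp.1 hp.2.le)).2) (if_neg (lt_irrefl _))
    (fun p _ q => sq_nonneg _) (fun r h => (hS.sum_gradLogSq_sub_le h (hr r h.1 h.2.le)).1)
  have h2 : 0 ≤ ∑ p ∈ Finset.Ico k n, S.lam p := sum_nonneg fun p hp =>
    (hS.eigenfunction p (Finset.mem_Ico.1 hp)).lam_nonneg
  rw [hS.scalHat_eq_sum ⟨le_rfl, hkn.le⟩ hx]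
  linarith [hκ x (hr n hkn.le le_rfl).1]

/-- The lower bound of the scalar curvature of the bottom leaf. -/
theorem scal_bound {e : Chart N} (he : Flattens S.leaf (Icc k n) e)
    {y : Fin k → ℝ} (hy : y ∈ dom e k) :
    κ + 3 / 4 * ∑ q ∈ Finset.Ioc k n, S.gradLogSq k q (Ξ e k y) - S.scal k (Ξ e k y) ≤
      -2 * laplaceOf (γ e k) (fun y => ∑ p ∈ Finset.Ico k n, S.logU e k p y) y -
      gradInner (γ e k) (fun y => ∑ p ∈ Finset.Ico k n, S.logU e k p y)
        (fun y => ∑ p ∈ Finset.Ico k n, S.logU e k p y) y := by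
  have hkI : k ∈ Icc k n := ⟨le_rfl, hkn.le⟩
  have hm := he.isMetricAt (hkn.le.trans hS.dim_le) hy
  have hx := planeParam_mem_reg he hkI hy
  have hs := Flattens.planeParam_mem_source hy
  have hls : ∀ p ∈ Finset.Ico k n, SmoothAt (S.logU e k p) y := fun p hp =>
    hS.contDiffAt_logU le_rfl he hkI ⟨(Finset.mem_Ico.1 hp).1, (Finset.mem_Ico.1 hp).2.le⟩ hy
  have hld := fun p hp => (hls p hp).differentiableAt (by simp : (∞ : WithTop ℕ∞) ≠ 0)
  have h1 := hS.scalHat_ge hκ hkn hx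
  have h2 := hS.scalarCurvature_warpedMetric le_rfl he hkI le_rfl hy
  have hh := Flattens.headCoords_planeParam (e := e) (hkn.le.trans hS.dim_le) hy
  have e1 := hS.scalHat_eq le_rfl he hkI hs hx.1
  have e2 := hS.scal_eq le_rfl he hkI hs hx.1
  rw [hh] at e1 e2
  rw [← e1, ← e2] at h2
  -- The warped product formula also contains `|∇ log u_k|²`, which has a favourable sign and is
  -- dropped; the term `q = n` is zero.
  have h3 : ∑ q ∈ Finset.Ioc k n, S.gradLogSq k q (Ξ e k y) ≤
      ∑ p ∈ Finset.Ico k n, gradInner (γ e k) (S.logU e k p) (S.logU e k p) y := by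
    have e3 : ∑ p ∈ Finset.Ico k n, gradInner (γ e k) (S.logU e k p) (S.logU e k p) y =
        ∑ p ∈ Finset.Ico k n, S.gradLogSq k p (Ξ e k y) := sum_congr rfl fun p hp =>
      (hS.gradLogSq_eq le_rfl he hkI ⟨(Finset.mem_Ico.1 hp).1, (Finset.mem_Ico.1 hp).2.le⟩ hy).symm
    have e4 : Finset.Ioc k n = insert n (Finset.Ico (k + 1) n) := by ext; simp; omega
    rw [e3, e4, sum_insert (by simp), hS.gradLogSq_top ⟨le_rfl, hkn.le⟩ hx.1, zero_add,
      sum_eq_sum_Ico_succ_bot hkn]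
    exact le_add_of_nonneg_left (sq_nonneg _)
  have h4 : gradInner (γ e k) (fun y => ∑ p ∈ Finset.Ico k n, S.logU e k p y)
      (fun y => ∑ p ∈ Finset.Ico k n, S.logU e k p y) y = ∑ p ∈ Finset.Ico k n, ∑ q ∈ Finset.Ico k n,
      gradInner (γ e k) (S.logU e k q) (S.logU e k p) y := by
    rw [gradInner_sum_left hld]
    exact sum_congr rfl fun p _ => by rw [gradInner_comm hm, gradInner_sum_left hld]
  have h5 : laplaceOf (γ e k) (fun y => ∑ p ∈ Finset.Ico k n, S.logU e k p y) y =
      ∑ p ∈ Finset.Ico k n, laplaceOf (γ e k) (S.logU e k p) y :=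
    laplaceOf_sum hm hls
  rw [h4, h5]
  linarith

end Slicing.IsMinimal

end ScalarCurvatureBounds

/-! ### The integral inequality. -/

section StabilityInequality

section

variable {α : Type} [Fintype α] [DecidableEq α] {h : (α → ℝ) → Matrix α α ℝ} {y : α → ℝ} (hm : IsMetricAt h y)
  {f W : (α → ℝ) → ℝ}
include hm

/-- The divergence of `f² ∇W`. The factor `1` occupies the place of the weight in the divergence
theorem. -/
theorem sum_partialD_sq_mul (hf : DiffAt f y) (hW : SmoothAt W y) :
    ∑ c, partialD c (fun x => √(h x).det * 1 * (f x ^ 2 * gradOf h W c x)) y =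
      √(h y).det * (f y ^ 2 * laplaceOf h W y + 2 * f y * gradInner h f W y) := by
  have h1 : ∀ c, partialD c (fun x => √(h x).det * 1 * (f x ^ 2 * gradOf h W c x)) y =
      f y ^ 2 * partialD c (fun x => √(h x).det * gradOf h W c x) y +
      √(h y).det * (2 * f y) * (partialD c f y * gradOf h W c y) := fun c => by
    have e2 : DiffAt (fun x => √(h x).det * gradOf h W c x) y :=
      (((contDiffAt_matrix_det hm.smooth).sqrt hm.posDef.det_pos.ne').mul (contDiffAt_gradOf hm hW c)).diffAt
    rw [show (fun x => √(h x).det * 1 * (f x ^ 2 * gradOf h W c x)) =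
      fun x => f x * (f x * (√(h x).det * gradOf h W c x)) from funext fun x => by ring,
      partialD_mul hf (hf.fun_mul e2), partialD_mul hf e2]
    ring
  rw [sum_congr rfl fun c _ => h1 c, sum_add_distrib, ← mul_sum, ← mul_sum, ← sqrt_det_mul_laplaceOf hm hW, gradInner]
  ring

theorem IsMetricAt.formOf_gradOf (v : α → ℝ) : formOf (h y) (fun a => gradOf h f a y) v = D f y v := by
  have h1 : (fun a => gradOf h f a y) = (h y)⁻¹.mulVec fun d => partialD d f y := rfl
  rw [formOf_comm hm.posDef, formOf_eq_dotProduct, h1, Matrix.mulVec_mulVec,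
    mul_nonsing_inv _ hm.isUnit_det, Matrix.one_mulVec]
  conv_rhs => rw [← univ_sum_single v, map_sum]
  refine sum_congr rfl fun a _ => ?_
  rw [← mul_one (v a), ← smul_eq_mul (v a) 1, Pi.single_smul, map_smul]
  simp [partialD]

/-- The expression is `|2∇f - f∇W|²`. -/
theorem gradInner_complete_square :
    0 ≤ 4 * gradInner h f f y - 4 * f y * gradInner h f W y + f y ^ 2 * gradInner h W W y := by
  have h1 : ∀ p q, gradInner h p q y = formOf (h y)⁻¹ (fun c => partialD c p y) (fun c => partialD c q y) :=
    fun p q => by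
      simp only [gradInner, gradOf, formOf_apply, mul_sum]
      exact sum_congr rfl fun _ _ => sum_congr rfl fun _ _ => by ring
  have h2 : 0 ≤ formOf (h y)⁻¹ ((2 : ℝ) • (fun c => partialD c f y) - f y • fun c => partialD c W y)
      ((2 : ℝ) • (fun c => partialD c f y) - f y • fun c => partialD c W y) := by
    rw [formOf_eq_dotProduct]
    simpa using hm.posDef.inv.posSemidef.dotProduct_mulVec_nonneg
      ((2 : ℝ) • (fun c => partialD c f y) - f y • fun c => partialD c W y)
  simp only [map_sub, map_smul, sub_apply, smul_apply, ← h1, smul_eq_mul, gradInner_comm hm W f] at h2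
  linarith

end

variable {N n k : ℕ} {S : Slicing N n} {Ω : Set (Amb N)}

namespace Slicing.IsMinimal

variable (hS : S.IsMinimal Ω k)
include hS

/-- The chart in the definition of `scal` changes with the point in an uncontrolled way; near each
point one fixed chart computes it. -/
theorem continuousOn_scal {j : ℕ} (hj : j ∈ Icc k n) : ContinuousOn (S.scal j) (S.reg j) := by
  refine hS.continuousOn_reg hj fun x hx => ?_
  have hjI : j ∈ Icc j n := ⟨le_rfl, hj.2⟩
  obtain ⟨e, hxe, he⟩ := hS.exists_flattens hj.1 hj.2 hx
  have hy := he.head_mem hjI hxe hx.1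
  refine ⟨e, hxe, he, (he.isMetricAt (hj.2.trans hS.dim_le) hy).scalarCurvature_smooth.continuousAt.congr ?_⟩
  filter_upwards [dom_mem_nhds hy] with z hz
  have h1 := hS.scal_eq hj.1 he hjI (Flattens.planeParam_mem_source hz) (he.planeParam_mem hjI hz)
  rwa [Flattens.headCoords_planeParam (hj.2.trans hS.dim_le) hz, eq_comm] at h1

theorem integrableOn_leaf {j : ℕ} (hj : j ∈ Icc k n) {f : Amb N → ℝ} (hf : ContinuousOn f (S.reg j))
    {K : Set (Amb N)} (hK : IsCompact K) (hKr : K ⊆ S.reg j) (h0 : ∀ x ∈ S.leaf j \ K, f x = 0) :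
    IntegrableOn f (S.leaf j) μHE[j] ∧ ∫ x in S.leaf j, f x ∂μHE[j] = ∫ x in K, f x ∂μHE[j] := by
  obtain ⟨C, hC, hL⟩ := hS.leaf_closed j hj
  have hm : MeasurableSet (S.leaf j) := hL ▸ hS.isOpen.measurableSet.inter hC.measurableSet
  exact ⟨((hS.integrableOn_reg hj hf hK hKr fun x hx => h0 x ⟨hx.1.1, hx.2⟩).mono_set hKr).of_forall_sdiff_eq_zero
    hm h0, setIntegral_eq_of_subset_of_forall_sdiff_eq_zero hm (fun x hx => (hKr hx).1) h0⟩

variable {κ : ℝ} (hκ : ∀ x ∈ S.leaf n, κ ≤ S.scal n x) (hkn : k < n)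
include hκ hkn

/-- Multiply the pointwise bound `-2ΔW - |∇W|²` by `φ²` and add the square `|2∇φ - φ∇W|²`. The
result is `4|∇φ|²` minus twice the divergence of `φ²∇W`, whose integral is zero. -/
theorem integral_scal_le {φ : Amb N → ℝ} (hφ : S.IsTest k φ) :
    IntegrableOn (fun x => (κ + (3 / 4) * ∑ j ∈ Finset.Ioc k n, S.gradLogSq k j x - S.scal k x) * φ x ^ 2)
      (S.leaf k) μHE[k] ∧
    IntegrableOn (fun x => gradSq (S.leaf k) φ x) (S.leaf k) μHE[k] ∧
    ∫ x in S.leaf k, (κ + (3 / 4) * ∑ j ∈ Finset.Ioc k n, S.gradLogSq k j x - S.scal k x) * φ x ^ 2 ∂μHE[k] ≤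
      4 * ∫ x in S.leaf k, gradSq (S.leaf k) φ x ∂μHE[k] := by
  obtain ⟨hs, K, hK, hKr, h0⟩ := hφ
  have hkI : k ∈ Icc k n := ⟨le_rfl, hkn.le⟩
  have hkN := hkn.le.trans hS.dim_le
  have hKL : K ⊆ S.leaf k := fun x hx => (hKr hx).1
  have c1 : ContinuousOn (fun x => (κ + (3 / 4) * ∑ j ∈ Finset.Ioc k n, S.gradLogSq k j x - S.scal k x) * φ x ^ 2)
      (S.reg k) := by
    refine ((continuousOn_const.add (continuousOn_const.mul (continuousOn_finsetSum _ fun q hq => ?_))).sub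
      (hS.continuousOn_scal hkI)).mul (hs.continuousOn.pow 2)
    have hq := Finset.mem_Ioc.1 hq
    exact hS.continuousOn_gradSq le_rfl hq.1.le hq.2 (hS.contDiffOn_log_u ⟨hq.1.le, hq.2⟩)
  have c2 := hS.continuousOn_gradSq le_rfl le_rfl hkn.le hs
  obtain ⟨i1, e1⟩ := hS.integrableOn_leaf hkI c1 hK hKr fun x hx => by simp [h0 x hx]
  obtain ⟨i2, e2⟩ := hS.integrableOn_leaf hkI c2 hK hKr fun x hx => gradSq_eq_zero hx.1 (by
    filter_upwards [self_mem_nhdsWithin, mem_nhdsWithin_of_mem_nhds (hK.isClosed.isOpen_compl.mem_nhds hx.2)]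
      with z hz hz' using h0 z ⟨hz, hz'⟩)
  refine ⟨i1, i2, ?_⟩
  obtain ⟨T, _, e, χ, h, -⟩ := exists_chartCover (L := S.leaf) (I := Icc k n) hK (p := fun _ => True) fun x hx => by
      obtain ⟨e, h1, h2⟩ := hS.exists_flattens le_rfl hkn.le (hKr hx)
      exact ⟨e, h1, h2, trivial⟩
  rw [e1, e2, (h.integral_eq_sum hkI hkN hK hKL (c1.mono hKr)).2, (h.integral_eq_sum hkI hkN hK hKL (c2.mono hKr)).2]
  set W : T → (Fin k → ℝ) → ℝ := fun t y => ∑ p ∈ Finset.Ico k n, S.logU (e t) k p y with hWdef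
  have hm := fun t y (hy : y ∈ dom (e t) k) => (h.flattens t).isMetricAt hkN hy
  have hφs := fun t y (hy : y ∈ dom (e t) k) =>
    hS.contDiffAt_comp_planeParam le_rfl (h.flattens t) hkI le_rfl hkn.le hs hy
  have hWs : ∀ t, ∀ y ∈ dom (e t) k, SmoothAt (W t) y := fun t y hy => ContDiffAt.sum fun p hp =>
    hS.contDiffAt_logU le_rfl (h.flattens t) hkI ⟨(Finset.mem_Ico.1 hp).1, (Finset.mem_Ico.1 hp).2.le⟩ hy
  have hdet : ∀ t, ∀ y ∈ dom (e t) k, SmoothAt (fun y => √(γ (e t) k y).det) y := fun t y hy =>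
    (contDiffAt_matrix_det (hm t y hy).smooth).sqrt (hm t y hy).posDef.det_pos.ne'
  have hY : ∀ t, ∀ y ∈ dom (e t) k, ∀ a, SmoothAt (fun y =>
      √(γ (e t) k y).det * 1 * (φ (Ξ (e t) k y) ^ 2 * gradOf (γ (e t) k) (W t) a y)) y := fun t y hy a =>
    ((hdet t y hy).mul contDiffAt_const).mul (((hφs t y hy).pow 2).mul (contDiffAt_gradOf (hm t y hy) (hWs t y hy) a))
  have hWd : ∀ p ∈ Finset.Ico k n, ∀ x ∈ S.reg k,
      DifferentiableWithinAt ℝ (fun x => log (S.u p x)) (S.leaf k) x := fun p hp x hx => by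
    have hp := Finset.mem_Ico.1 hp
    exact hS.differentiableWithinAt_leaf le_rfl hp.1 hp.2.le (hS.contDiffOn_log_u ⟨hp.1, hp.2.le⟩) hx
  -- The field in space is dual to the differential of `W` within the leaf, times `φ²`. Only its
  -- products with tangent vectors enter, so the ambiguity in normal directions is harmless.
  have hdiv := h.sum_integral_divergence_eq_zero hkI hkN hK hKL
    (w := fun x => φ x ^ 2 • (InnerProductSpace.toDual ℝ (Amb N)).symm (fderivWithin ℝ
      (fun x => ∑ p ∈ Finset.Ico k n, log (S.u p x)) (S.leaf k) x))
    (fun x hx => by simp [h0 x hx]) (r := fun _ => 1)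
    (Y := fun t y a => φ (Ξ (e t) k y) ^ 2 * gradOf (γ (e t) k) (W t) a y)
    (fun t y hy a => (hY t y hy a).of_le (by simp)) fun t y hy v => by
      rw [inner_smul_left, InnerProductSpace.toDual_symm_apply, ← ContinuousLinearMap.comp_apply,
        ← (h.flattens t).fderiv_comp_planeParam hkI hy (DifferentiableWithinAt.fun_sum fun p hp =>
          hWd p hp _ (planeParam_mem_reg (h.flattens t) hkI hy)),
        show (fun a => φ (Ξ (e t) k y) ^ 2 * gradOf (γ (e t) k) (W t) a y) =
          φ (Ξ (e t) k y) ^ 2 • fun a => gradOf (γ (e t) k) (W t) a y from rfl,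
        map_smul, smul_apply, (hm t y hy).formOf_gradOf]
      rfl
  have hc : ∀ t, IsCompact (paramPiece (e t) k (K ∩ tsupport (χ t))) := fun t =>
    (h.flattens t).isCompact_paramPiece hkI hkN (ChartCover.isCompact_inter hK t)
      (inter_subset_left.trans hKL) (inter_subset_right.trans (h.subset t))
  have hψ : ∀ t, ContinuousOn (Ξ (e t) k) (paramPiece (e t) k (K ∩ tsupport (χ t))) := fun t =>
    (h.flattens t).contDiffOn_planeParam.continuousOn.mono (paramPiece_subset _)
  have hχ : ∀ t, ContinuousOn (fun y => χ t (Ξ (e t) k y)) (paramPiece (e t) k (K ∩ tsupport (χ t))) :=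
    fun t => (h.smooth t).continuous.comp_continuousOn (hψ t)
  have hint : ∀ (f : Amb N → ℝ), ContinuousOn f (S.reg k) → ∀ t, IntegrableOn (fun y => χ t (Ξ (e t) k y) *
      (√(γ (e t) k y).det * f (Ξ (e t) k y)))
      (paramPiece (e t) k (K ∩ tsupport (χ t))) := fun f hf t =>
    ((hχ t).mul (ContinuousOn.mul (fun y hy => (hdet t y hy.1).continuousAt.continuousWithinAt)
      (hf.comp (hψ t) fun y hy => hKr hy.2.1))).integrableOn_compact (hc t)
  have hint' : ∀ t, IntegrableOn (fun y => χ t (Ξ (e t) k y) * ∑ a, partialD a (fun y =>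
      √(γ (e t) k y).det * 1 * (φ (Ξ (e t) k y) ^ 2 * gradOf (γ (e t) k) (W t) a y)) y)
      (paramPiece (e t) k (K ∩ tsupport (χ t))) := fun t =>
    ((hχ t).mul (continuousOn_finsetSum _ fun a _ y hy =>
      (contDiffAt_partialD (hY t y hy.1 a) a).continuousAt.continuousWithinAt)).integrableOn_compact (hc t)
  -- Subtracting twice the vanishing sum of divergences reduces the claim to a pointwise inequality
  -- in each chart.
  rw [← sub_zero (4 * _), ← mul_zero (2 : ℝ), ← hdiv, mul_sum, mul_sum, ← sum_sub_distrib]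
  refine Finset.sum_le_sum fun t _ => ?_
  rw [← integral_const_mul, ← integral_const_mul, ← integral_sub ((hint _ c2 t).const_mul 4) ((hint' t).const_mul 2)]
  refine setIntegral_mono_on (hint _ c1 t) (((hint _ c2 t).const_mul 4).sub ((hint' t).const_mul 2))
    (hc t).measurableSet fun y hy => ?_
  have hy := hy.1
  have s1 := hS.scal_bound hκ hkn (h.flattens t) hy
  have s2 := gradInner_complete_square (hm t y hy) (f := fun y => φ (Ξ (e t) k y)) (W := W t)
  rw [sum_partialD_sq_mul (hm t y hy) ((hφs t y hy).diffAt) (hWs t y hy),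
    hS.gradSq_eq le_rfl (h.flattens t) hkI le_rfl hkn.le hs hy]
  have s3 := mul_le_mul_of_nonneg_right s1 (sq_nonneg (φ (Ξ (e t) k y)))
  have s4 := mul_nonneg (h.nonneg t (Ξ (e t) k y)) (Real.sqrt_nonneg (γ (e t) k y).det)
  -- The cutoff and the volume density are nonnegative, so they may multiply the pointwise bound
  -- with the square added.
  have s5 := mul_le_mul_of_nonneg_left (s3.trans (le_add_of_nonneg_right s2)) s4
  refine le_of_eq_of_le ?_ (s5.trans_eq ?_) <;> ring

end Slicing.IsMinimal

end StabilityInequality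

end

theorem theorem2p6 {N n k : ℕ} (hk : 1 ≤ k) (hkn : k < n) (Ω : Set (Amb N)) (S : Slicing N n)
    (hS : S.IsMinimal Ω k) (κ : ℝ) (hκ : ∀ x ∈ S.leaf n, κ ≤ S.scal n x) :
    (∀ x ∈ S.reg k,
      S.scalHat k x = S.scal n x + 2 * ∑ p ∈ Finset.Ico k n, S.lam p
        + (1 / 4) * ∑ p ∈ Finset.Ico k n,
          (S.tildeASq p x - (1 / (n : ℝ)) *
            ∑ q ∈ Finset.Ioc p n, (S.gradLogSq p q x + S.tildeASq q x))) ∧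
    ∀ φ : Amb N → ℝ, S.IsTest k φ →
      IntegrableOn (fun x => (κ + (3 / 4) * ∑ j ∈ Finset.Ioc k n, S.gradLogSq k j x
        - S.scal k x) * φ x ^ 2) (S.leaf k) μHE[k] ∧
      IntegrableOn (fun x => gradSq (S.leaf k) φ x) (S.leaf k) μHE[k] ∧
      ∫ x in S.leaf k, (κ + (3 / 4) * ∑ j ∈ Finset.Ioc k n, S.gradLogSq k j x
        - S.scal k x) * φ x ^ 2 ∂μHE[k] ≤
      4 * ∫ x in S.leaf k, gradSq (S.leaf k) φ x ∂μHE[k] :=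
  ⟨fun _ hx => hS.scalHat_eq_sum ⟨le_rfl, hkn.le⟩ hx, fun _ hφ => hS.integral_scal_le hκ hkn hφ⟩
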